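/- **Setting.** Let $Q$ be a positive integer, $P$ an integer and $X_1\le X_2$ real numbers, neither of which is a rational number with denominator $\le Q$ (rationals $p/q$ are always in lowest terms with $q>0$). Write $S^1=\mathbb R/\mathbb Z$, with area form $dx\wedge dy$ on $[X_1,X_2]\times S^1$. Let $\phi$ be a perturbation of the twist $\phi_0(x,y)=(x,y-x)$ of $[X_1,X_2]\times S^1$: $\phi$ is the time-one map of $-x\,\partial_y+X_{K}$, where $X_K=K_y\partial_x-K_x\partial_y$ is the Hamiltonian vector field of a smooth function $K_t(x,y)$, 1-periodic in $t$ and $y$; $X_K$ is $C^1$-small (each of $|X_K|$ and $|DX_K|$ is less than $\varepsilon$), vanishes near the boundary, and vanishes wherever $x$ is not within distance $\varepsilon$ of a rational number of denominator $\le Q$. The flow identifies the mapping torus of $\phi$ with $Y=S^1\times[X_1,X_2]\times S^1$ (coordinates $t,x,y$), so that $\phi$ is the return map of $R=\partial_t-x\,\partial_y+X_K$. Assume that for each $p/q\in[X_1,X_2]$ with $q\le Q$ there are two irreducible periodic orbits $e_{p/q}$, $h_{p/q}$ of period $q$, along which $y$ changes by $-p$; that these are the only irreducible periodic orbits of period $\le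 Q$; that the linearized return map of $e_{p/q}$ has eigenvalues $e^{\pm2\pi i\theta}$ with $0<\theta<1/Q$ (elliptic), and that of $h_{p/q}$ has positive real eigenvalues $\ne 1$ (hyperbolic). A *generator* is a product $\alpha=\gamma_1\cdots\gamma_k$ of orbits $\gamma_i\in\{e_{p_i/q_i},h_{p_i/q_i}\}$, with no $h_{p/q}$ repeated, whose total homology class in $H_1(Y)$ is $Q[S^1\times pt\times pt]-P[pt\times pt\times S^1]$. Ordering the factors so that $p_1/q_1\ge\dots\ge p_k/q_k$, let $\mathcal P(\alpha)$ be the oriented polygonal path in the $(p,q)$-plane from $0$ to $(P,Q)$ with successive vertices $w_j=\sum_{i\le j}(p_i,q_i)$. For generators $\alpha,\beta$ and a relative class $Z\in H_2(Y;\alpha,\beta)$ of 2-chains with boundary $\alpha-\beta$, the *relative index* is $$I(\alpha,\beta;Z)=c_\tau(Z)+Q_\tau(Z)+\mu_\tau(\alpha,\beta).$$ Here $\tau$ is a trivialization, up to homotopy, of the vertical tangent bundle $V$ of $Y\to S^1$ over the orbits. The integer $c_\tau(Z)$ is the relative first Chern number: the algebraic number of zeros over $Z$ of a generic section of $V$ that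 is $\tau$-trivial over the boundary. The integer $Q_\tau(Z)$ is the relative self-intersection number: the algebraic intersection number in $[0,1]\times Y$ (oriented by $ds\,dt\,dx\,dy$) of two 2-chains representing $Z$, the first with boundary $\{1\}\times\alpha-\{0\}\times\beta$ and the second with boundary a small push-off of this along $\tau$. Finally, if $\alpha=\prod\alpha_i^{m_i}$ and $\beta=\prod\beta_j^{n_j}$ with distinct $\alpha_i$ and distinct $\beta_j$, then $\mu_\tau(\alpha,\beta)=\sum_i\sum_{k=1}^{m_i}\mu_\tau(\alpha_i^k)-\sum_j\sum_{k=1}^{n_j}\mu_\tau(\beta_j^k)$, with $\mu_\tau$ the Conley–Zehnder index. **Proposition 3.2 (Index formula).** For every $Q$ there is $\varepsilon>0$ such that the following holds for all $P,X_1,X_2$ and all $\phi$ as above. Let $\alpha,\beta$ be generators, and let $a$ and $b$ be the numbers of elliptic factors (counted with multiplicity) of $\alpha$ and $\beta$. Then $H_2(Y;\alpha,\beta)$ is nonempty, and for every $Z\in H_2(Y;\alpha,\beta)$ and every $\tau$ the relative index is well defined and $$I(\alpha,\beta;Z)=b-a+2\left(\int_{\mathcal P(\beta)}p\,dq-\int_{\mathcal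 P(\alpha)}p\,dq\right).$$ In particular it does not depend on $Z$ or $\tau$, and may be written $I(\alpha,\beta)$. -/

import Mathlib

open scoped ContDiff

noncomputable section

namespace PFH

section Chains

/-!
Smooth cubical singular chains in a space `X` that is smoothly covered by `ℝᵏ` through `π`
(below: `X = S¹ × ℝ × S¹` or `X = ℝ × S¹ × ℝ × S¹`, where `S¹ = ℝ/ℤ`).
-/

variable {k n : ℕ} {X X' : Type} {π : (Fin k → ℝ) → X}

/-- A smooth singular `n`-cube in `X`: a map from the unit cube that has a smooth lift along `π`. -/
@[ext]
structure SmoothCube (π : (Fin k → ℝ) → X) (n : ℕ) where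
  toFun : (Fin n → unitInterval) → X
  smooth : ∃ F : (Fin n → ℝ) → (Fin k → ℝ), ContDiff ℝ ∞ F ∧
    ∀ u, toFun u = π (F fun i => (u i : ℝ))

/-- The cube with a given smooth lift. -/
def SmoothCube.ofLift (π : (Fin k → ℝ) → X) (F : (Fin n → ℝ) → (Fin k → ℝ))
    (hF : ContDiff ℝ ∞ F) : SmoothCube π n :=
  ⟨fun u => π (F fun i => (u i : ℝ)), F, hF, fun _ => rfl⟩

/-- A smooth lift of a cube. (Its derivative on the unit cube does not depend on the choice when
`π` is the quotient map by a lattice.) -/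
def SmoothCube.lift (σ : SmoothCube π n) : (Fin n → ℝ) → (Fin k → ℝ) := σ.smooth.choose

/-- The partial derivative of (a lift of) a cube in its `i`-th variable. -/
def SmoothCube.partialDeriv (σ : SmoothCube π n) (i : Fin n) (u : Fin n → unitInterval) :
    Fin k → ℝ :=
  fderiv ℝ σ.lift (fun j => (u j : ℝ)) (Pi.single i 1)

theorem contDiff_insertNth (i : Fin (n + 1)) (e : ℝ) :
    ContDiff ℝ ∞ (fun u : Fin n → ℝ => (i.insertNth e u : Fin (n + 1) → ℝ)) := by
  rw [contDiff_pi]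
  intro j
  refine Fin.succAboveCases i ?_ (fun m => ?_) j
  · simpa using contDiff_const
  · simpa using contDiff_apply ℝ ℝ m

/-- The face `uᵢ = e` of a cube. -/
def SmoothCube.face (σ : SmoothCube π (n + 1)) (i : Fin (n + 1)) (e : unitInterval) :
    SmoothCube π n where
  toFun u := σ.toFun (i.insertNth e u)
  smooth := by
    obtain ⟨F, hF, h⟩ := σ.smooth
    refine ⟨fun u => F (i.insertNth (e : ℝ) u), hF.comp (contDiff_insertNth i e), fun u => ?_⟩
    rw [h]
    congr 2
    funext j
    refine Fin.succAboveCases i ?_ (fun m => ?_) j <;> simp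

/-- Integral singular chains. -/
abbrev Chain (π : (Fin k → ℝ) → X) (n : ℕ) := SmoothCube π n →₀ ℤ

/-- The chain given by one cube. -/
def SmoothCube.chain (σ : SmoothCube π n) : Chain π n := Finsupp.single σ 1

/-- The cubical boundary operator `∂σ = ∑ᵢ (-1)ⁱ (σ|_{uᵢ = 1} - σ|_{uᵢ = 0})`, `i = 0, …, n`. -/
def boundary : Chain π (n + 1) →+ Chain π n :=
  Finsupp.liftAddHom fun σ => zmultiplesHom (Chain π n)
    (∑ i : Fin (n + 1), (-1 : ℤ) ^ (i : ℕ) • ((σ.face i 1).chain - (σ.face i 0).chain))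

/-- A cube is degenerate if it does not depend on one of its variables. -/
def SmoothCube.IsDegenerate (σ : SmoothCube π n) : Prop :=
  ∃ i : Fin n, ∀ u v : Fin n → unitInterval, (∀ j, j ≠ i → u j = v j) → σ.toFun u = σ.toFun v

/-- The group of degenerate chains, which is divided out in cubical homology. -/
def degenerate (π : (Fin k → ℝ) → X) (n : ℕ) : AddSubgroup (Chain π n) :=
  AddSubgroup.closure {c | ∃ σ : SmoothCube π n, σ.IsDegenerate ∧ c = σ.chain}

/-- The chain `c` lies in the subspace `A`. -/
def Chain.In (A : Set X) (c : Chain π n) : Prop := ∀ σ ∈ c.support, ∀ u, σ.toFun u ∈ A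

/-- The two chains differ by a boundary in `A` (modulo degenerate chains). -/
def Homologous (A : Set X) (c c' : Chain π n) : Prop :=
  ∃ T : Chain π (n + 1), T.In A ∧ c - c' - boundary T ∈ degenerate π n

/-- The 2-chains `W` in `A` with `∂W = a - b` (modulo degenerate chains). -/
def RelCycle (A : Set X) (a b : Chain π 1) : Type :=
  {W : Chain π 2 // W.In A ∧ boundary W - (a - b) ∈ degenerate π 1}

theorem Chain.In.zero (A : Set X) : Chain.In A (0 : Chain π n) := by
  intro σ h; simp at h

theorem Chain.In.neg {A : Set X} {c : Chain π n} (h : c.In A) : (-c).In A := by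
  intro σ hσ; exact h σ (by simpa using hσ)

theorem Chain.In.add {A : Set X} {c d : Chain π n} (h : c.In A) (h' : d.In A) : (c + d).In A := by
  classical
  intro σ hσ
  rcases Finset.mem_union.1 (Finsupp.support_add hσ) with h1 | h1
  · exact h σ h1
  · exact h' σ h1

instance relSetoid (A : Set X) (a b : Chain π 1) : Setoid (RelCycle A a b) where
  r W W' := Homologous A W.1 W'.1
  iseqv :=
    { refl := fun W => ⟨0, Chain.In.zero A, by simp [zero_mem]⟩
      symm := by
        rintro W W' ⟨T, hT, h⟩
        refine ⟨-T, hT.neg, ?_⟩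
        have := neg_mem h
        rw [map_neg]
        convert this using 1
        abel
      trans := by
        rintro W W' W'' ⟨T, hT, h⟩ ⟨T', hT', h'⟩
        refine ⟨T + T', hT.add hT', ?_⟩
        have := add_mem h h'
        rw [map_add]
        convert this using 1
        abel }

/-- `H₂(A; a, b)`: relative homology classes of 2-chains `W` in `A` with `∂W = a - b`. -/
def RelClass (A : Set X) (a b : Chain π 1) : Type := Quotient (relSetoid A a b)

end Chains

section Spaces

/-- `S¹ × ℝ × S¹` with coordinates `(t, x, y)`. -/
abbrev YSpace := UnitAddCircle × ℝ × UnitAddCircle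

/-- `ℝ × S¹ × ℝ × S¹` with coordinates `(s, t, x, y)`. -/
abbrev MSpace := ℝ × YSpace

def projY (v : Fin 3 → ℝ) : YSpace := ((v 0 : UnitAddCircle), v 1, (v 2 : UnitAddCircle))

def projM (v : Fin 4 → ℝ) : MSpace := (v 0, (v 1 : UnitAddCircle), v 2, (v 3 : UnitAddCircle))

/-- The mapping torus `Y = S¹ × [X₁, X₂] × S¹`. -/
def torusY (X₁ X₂ : ℝ) : Set YSpace := {w | w.2.1 ∈ Set.Icc X₁ X₂}

/-- `[0,1] × Y`. -/
def slabM (X₁ X₂ : ℝ) : Set MSpace := Set.Icc 0 1 ×ˢ torusY X₁ X₂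

/-- The point `(t, x, y)` of `ℝ³`, for `z = x + iy`. -/
def pt3 (t : ℝ) (z : ℂ) : Fin 3 → ℝ := ![t, z.re, z.im]

theorem contDiff_pt3 {E : Type} [NormedAddCommGroup E] [NormedSpace ℝ E] {f : E → ℝ} {g : E → ℂ}
    (hf : ContDiff ℝ ∞ f) (hg : ContDiff ℝ ∞ g) : ContDiff ℝ ∞ fun u => pt3 (f u) (g u) := by
  rw [contDiff_pi]
  intro i
  fin_cases i
  · exact hf
  · exact Complex.reCLM.contDiff.comp hg
  · exact Complex.imCLM.contDiff.comp hg

/-- The projection of a cube in `[0,1] × Y` to `Y`. -/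
def cubeProj {n : ℕ} (σ : SmoothCube projM n) : SmoothCube projY n where
  toFun u := (σ.toFun u).2
  smooth := by
    obtain ⟨F, hF, h⟩ := σ.smooth
    refine ⟨fun u i => F u i.succ, contDiff_pi.2 fun i => contDiff_pi.1 hF i.succ, fun u => ?_⟩
    rw [h]; rfl

/-- The copy of a cube of `Y` in the slice `{s} × Y`. -/
def cubeIncl {n : ℕ} (s : ℝ) (σ : SmoothCube projY n) : SmoothCube projM n where
  toFun u := (s, σ.toFun u)
  smooth := by
    obtain ⟨F, hF, h⟩ := σ.smooth
    refine ⟨fun u => Fin.cons s (F u), contDiff_pi.2 fun i => ?_, fun u => ?_⟩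
    · refine Fin.cases ?_ (fun j => ?_) i
      · simpa using contDiff_const
      · simpa using contDiff_pi.1 hF j
    · rw [h]; rfl

/-- `π_Y` on chains. -/
def chainProj {n : ℕ} (c : Chain projM n) : Chain projY n := c.mapDomain cubeProj

/-- The chain `{s} × c`. -/
def chainIncl {n : ℕ} (s : ℝ) (c : Chain projY n) : Chain projM n := c.mapDomain (cubeIncl s)

/-- The circle `S¹ × {x} × {0}`. -/
def circleT (x : ℝ) : SmoothCube projY 1 :=
  SmoothCube.ofLift projY (fun u => pt3 (u 0) (x : ℂ))
    (contDiff_pt3 (contDiff_apply ℝ ℝ 0) contDiff_const)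

/-- The circle `{0} × {x} × S¹`. -/
def circleY (x : ℝ) : SmoothCube projY 1 :=
  SmoothCube.ofLift projY (fun u => pt3 0 (x + (u 0 : ℝ) * Complex.I))
    (contDiff_pt3 contDiff_const (contDiff_const.add
      ((Complex.ofRealCLM.contDiff.comp (contDiff_apply ℝ ℝ 0)).mul contDiff_const)))

end Spaces

section Counts

/-- Two 2-cubes in `[0,1] × Y`: the number of `(u, v)` with `σ u = σ' v + g`, each with the sign
of the orientation of `(∂₀σ, ∂₁σ, ∂₀σ', ∂₁σ')` with respect to `ds dt dx dy`.
Here `g` is a translation in the abelian group `ℝ × S¹ × ℝ × S¹`. -/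
def cubeIntersections (σ σ' : SmoothCube projM 2) (g : Fin 4 → ℝ) : ℤ :=
  ∑ᶠ (w : (Fin 2 → unitInterval) × (Fin 2 → unitInterval))
    (_ : σ.toFun w.1 = σ'.toFun w.2 + projM g),
    (SignType.sign (Matrix.det (Matrix.of
      ![σ.partialDeriv 0 w.1, σ.partialDeriv 1 w.1,
        σ'.partialDeriv 0 w.2, σ'.partialDeriv 1 w.2])) : ℤ)

/-- The signed number of intersections of the 2-chain `S` with the translate `S' + g`. -/
def chainIntersections (S S' : Chain projM 2) (g : Fin 4 → ℝ) : ℤ :=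
  S.sum fun σ m => S'.sum fun σ' m' => m * m' * cubeIntersections σ σ' g

/-- The algebraic intersection number `#(S ∩ S')` is `n`: after almost every sufficiently small
translation of `S'` (these put `S'` in general position to `S`) the signed count is `n`. -/
def HasIntersectionNumber (S S' : Chain projM 2) (n : ℤ) : Prop :=
  ∃ ρ > 0, ∀ᵐ g : Fin 4 → ℝ, ‖g‖ < ρ → chainIntersections S S' g = n

/-- The section `ψ` of the vertical tangent bundle `V = span(∂x, ∂y) ≅ ℂ`, at a point of the
universal cover of `Y`. -/
def sectionAt (ψ : ℝ → ℂ → ℂ) (v : Fin 3 → ℝ) : ℂ := ψ (v 0) ⟨v 1, v 2⟩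

/-- The number of solutions of `ψ = ζ` on a 2-cube of `Y`, each with the sign of the Jacobian
of `ψ` along the cube. -/
def cubeZeros (ψ : ℝ → ℂ → ℂ) (σ : SmoothCube projY 2) (ζ : ℂ) : ℤ :=
  ∑ᶠ (u : Fin 2 → unitInterval) (_ : sectionAt ψ (σ.lift fun j => (u j : ℝ)) = ζ),
    (SignType.sign (Matrix.det (Matrix.of fun i : Fin 2 =>
      let d := fderiv ℝ (fun w => sectionAt ψ (σ.lift w)) (fun j => (u j : ℝ)) (Pi.single i 1)
      ![d.re, d.im])) : ℤ)

/-- The algebraic number of zeros of the section `ψ` on the 2-chain `W` is `n`: almost every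
sufficiently small constant perturbation `ψ - ζ` has signed number of zeros `n`. -/
def HasZeroNumber (ψ : ℝ → ℂ → ℂ) (W : Chain projY 2) (n : ℤ) : Prop :=
  ∃ ρ > 0, ∀ᵐ ζ : ℂ, ‖ζ‖ < ρ → (W.sum fun σ m => m * cubeZeros ψ σ ζ) = n

end Counts

section Dynamics

/-!
A point of the cylinder `[X₁, X₂] × ℝ/ℤ` is written `z = x + iy`, `y` modulo `1`, with area form
`dx ∧ dy`.
-/

/-- The Hamiltonian vector field `(∂K/∂y, -∂K/∂x)` of a time-dependent function `K`. -/
def hamField (K : ℝ → ℂ → ℝ) (t : ℝ) (z : ℂ) : ℂ :=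
  ⟨fderiv ℝ (K t) z Complex.I, -(fderiv ℝ (K t) z 1)⟩

/-- The vector field `(0, -x) + X_K`. For `K = 0` its flow is `(x, y) ↦ (x, y - xt)`, and its
time-one map is the twist `φ₀ (x, y) = (x, y - x)`; in general its time-one map `φ` is a
Hamiltonian perturbation of `φ₀`. Following the flow identifies the mapping torus of `φ` with
`S¹ × [X₁, X₂] × S¹`, with flow `R = ∂_t + (0, -x) + X_K`. -/
def twistField (K : ℝ → ℂ → ℝ) (t : ℝ) (z : ℂ) : ℂ := -(z.re : ℂ) * Complex.I + hamField K t z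

variable {K : ℝ → ℂ → ℝ} {X₁ X₂ : ℝ}

/-- An irreducible periodic orbit `t ↦ (t, z t)` of `R` in `Y` (with a lift to the universal
cover). -/
structure Orbit (K : ℝ → ℂ → ℝ) (X₁ X₂ : ℝ) where
  z : ℝ → ℂ
  period : ℕ
  smooth : ContDiff ℝ ∞ z
  flow : ∀ t, HasDerivAt z (twistField K t (z t)) t
  mem : ∀ t, (z t).re ∈ Set.Icc X₁ X₂
  period_pos : 0 < period
  closed : ∃ w : ℤ, ∀ t, z (t + period) = z t + w * Complex.I
  irreducible : ∀ q : ℕ, 0 < q → q < period → ¬ ∃ w : ℤ, z q = z 0 + w * Complex.I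

/-- Solutions of the linearized flow along an orbit. -/
def Orbit.IsLinearized (γ : Orbit K X₁ X₂) (v : ℝ → ℂ) : Prop :=
  ∀ t, HasDerivAt v (fderiv ℝ (twistField K t) (γ.z t) (v t)) t

/-- `M` is the linearized return map of the orbit. -/
def Orbit.IsReturnMap (γ : Orbit K X₁ X₂) (M : ℂ →ₗ[ℝ] ℂ) : Prop :=
  ∀ w : ℂ, ∃ v : ℝ → ℂ, γ.IsLinearized v ∧ v 0 = w ∧ v γ.period = M w

/-- The linearized return map has eigenvalues `e^{±2πiθ}`. -/
def Orbit.HasRotationEigenvalues (γ : Orbit K X₁ X₂) (θ : ℝ) : Prop :=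
  ∃ M : ℂ →ₗ[ℝ] ℂ, γ.IsReturnMap M ∧
    M.charpoly.map (algebraMap ℝ ℂ) =
      (Polynomial.X - Polynomial.C (Complex.exp (2 * Real.pi * θ * Complex.I))) *
      (Polynomial.X - Polynomial.C (Complex.exp (-(2 * Real.pi * θ * Complex.I))))

/-- The orbit is nondegenerate and hyperbolic with positive eigenvalues. -/
def Orbit.IsPositiveHyperbolic (γ : Orbit K X₁ X₂) : Prop :=
  ∃ M : ℂ →ₗ[ℝ] ℂ, γ.IsReturnMap M ∧ ∃ l m : ℝ, 0 < l ∧ 0 < m ∧ l ≠ 1 ∧ m ≠ 1 ∧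
    M.charpoly = (Polynomial.X - Polynomial.C l) * (Polynomial.X - Polynomial.C m)

/-- A trivialization of `V` along an orbit, up to homotopy, is given by a nowhere zero section `ν`
(the trivialization sends `ν` to a positive multiple of `1 ∈ ℂ`). -/
structure Frame (γ : Orbit K X₁ X₂) where
  ν : ℝ → ℂ
  smooth : ContDiff ℝ ∞ ν
  ne_zero : ∀ t, ν t ≠ 0
  periodic : ∀ t, ν (t + γ.period) = ν t

/-- The total rotations, in full turns and with respect to the frame, of the nonzero solutions of
the linearized flow along the `k`-fold iterate of the orbit. -/
def rotationSet (γ : Orbit K X₁ X₂) (τ : Frame γ) (k : ℕ) : Set ℝ :=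
  {d | ∃ (v : ℝ → ℂ) (ρ ϑ : ℝ → ℝ), γ.IsLinearized v ∧ Continuous ϑ ∧ (∀ t, 0 < ρ t) ∧
    (∀ t, v t = ρ t * Complex.exp (2 * Real.pi * ϑ t * Complex.I) * τ.ν t) ∧
    d = ϑ ((k * γ.period : ℕ) : ℝ) - ϑ 0}

open Classical in
/-- The Conley–Zehnder index of the `k`-fold iterate, for a nondegenerate iterate: `2n` if
the rotation interval contains the integer `n`, and `2n + 1` if it lies in the open interval
`(n, n + 1)`. -/
def czIndex (γ : Orbit K X₁ X₂) (τ : Frame γ) (k : ℕ) : ℤ :=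
  if h : ∃ n : ℤ, (n : ℝ) ∈ rotationSet γ τ k then 2 * h.choose
  else 2 * ⌊sInf (rotationSet γ τ k)⌋ + 1

/-- The orbit as an oriented circle in `Y`. -/
def Orbit.loop (γ : Orbit K X₁ X₂) : SmoothCube projY 1 :=
  SmoothCube.ofLift projY (fun u => pt3 (γ.period * u 0) (γ.z (γ.period * u 0)))
    (contDiff_pt3 (contDiff_const.mul (contDiff_apply ℝ ℝ 0))
      (γ.smooth.comp (contDiff_const.mul (contDiff_apply ℝ ℝ 0))))

/-- The orbit as a subset of `Y`. -/
def Orbit.image (γ : Orbit K X₁ X₂) : Set YSpace := Set.range fun t : ℝ => projY (pt3 t (γ.z t))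

/-- The orbit pushed off by `r ν`. -/
def Orbit.pushLoop (γ : Orbit K X₁ X₂) (τ : Frame γ) (r : ℝ) : SmoothCube projY 1 :=
  SmoothCube.ofLift projY
    (fun u => pt3 (γ.period * u 0) (γ.z (γ.period * u 0) + r * τ.ν (γ.period * u 0)))
    (contDiff_pt3 (contDiff_const.mul (contDiff_apply ℝ ℝ 0))
      ((γ.smooth.comp (contDiff_const.mul (contDiff_apply ℝ ℝ 0))).add
        (contDiff_const.mul (τ.smooth.comp (contDiff_const.mul (contDiff_apply ℝ ℝ 0))))))

/-- The pushed off orbit as a subset of `S¹ × ℝ × S¹`. -/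
def Orbit.pushImage (γ : Orbit K X₁ X₂) (τ : Frame γ) (r : ℝ) : Set YSpace :=
  Set.range fun t : ℝ => projY (pt3 t (γ.z t + r * τ.ν t))

/-- The strip between an orbit and its push-off; its boundary is the push-off minus the orbit. -/
def Orbit.strip (γ : Orbit K X₁ X₂) (τ : Frame γ) (r : ℝ) : SmoothCube projY 2 :=
  SmoothCube.ofLift projY
    (fun u => pt3 (γ.period * u 1)
      (γ.z (γ.period * u 1) + ((u 0 * r : ℝ) : ℂ) * τ.ν (γ.period * u 1)))
    (contDiff_pt3 (contDiff_const.mul (contDiff_apply ℝ ℝ 1))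
      ((γ.smooth.comp (contDiff_const.mul (contDiff_apply ℝ ℝ 1))).add
        ((Complex.ofRealCLM.contDiff.comp ((contDiff_apply ℝ ℝ 0).mul contDiff_const)).mul
          (τ.smooth.comp (contDiff_const.mul (contDiff_apply ℝ ℝ 1))))))

end Dynamics

section Generators

/-- The two types of orbits: elliptic and hyperbolic. -/
inductive Kind
  | ell
  | hyp

/-- The rational numbers `p/q ∈ [X₁, X₂]` with `q ≤ Q`. -/
abbrev Slope (X₁ X₂ : ℝ) (Q : ℕ) := {r : ℚ // r.den ≤ Q ∧ (r : ℝ) ∈ Set.Icc X₁ X₂}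

/-- Labels of the orbits `e_{p/q}` and `h_{p/q}`. -/
abbrev Label (X₁ X₂ : ℝ) (Q : ℕ) := Slope X₁ X₂ Q × Kind

/-- An `ε`-small Hamiltonian perturbation of the twist `φ₀` of `[X₁, X₂] × S¹` for which each circle
`x = p/q`, `q ≤ Q`, of periodic orbits splits into an elliptic orbit and a hyperbolic orbit. -/
structure TwistPerturbation (X₁ X₂ : ℝ) (Q : ℕ) (ε : ℝ) where
  K : ℝ → ℂ → ℝ
  smooth : ContDiff ℝ ∞ fun w : ℝ × ℂ => K w.1 w.2
  periodic_t : ∀ t z, K (t + 1) z = K t z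
  periodic_y : ∀ t z, K t (z + Complex.I) = K t z
  /-- The perturbation is `C¹`-small. -/
  small : ∀ t z, ‖hamField K t z‖ < ε ∧ ‖fderiv ℝ (hamField K t) z‖ < ε
  /-- There is no perturbation where `x` is not close to a rational of denominator `≤ Q`. -/
  local_support : ∀ (t : ℝ) (z : ℂ), (∀ r : ℚ, r.den ≤ Q → ε ≤ |z.re - r|) → hamField K t z = 0
  /-- The perturbation takes place away from the boundary. -/
  boundary_support : ∃ d > 0, ∀ (t : ℝ) (z : ℂ), z.re < X₁ + d ∨ X₂ - d < z.re →
    hamField K t z = 0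
  /-- The orbits `e_{p/q}` and `h_{p/q}`. -/
  orbit : Label X₁ X₂ Q → Orbit K X₁ X₂
  /-- Both orbits are homotopic to those on the circle `x = p/q`, which have period `q` and along
  which `y` changes by `-p`. -/
  period_eq : ∀ l, (orbit l).period = l.1.1.den
  winding_eq : ∀ l t, (orbit l).z (t + l.1.1.den) = (orbit l).z t - (l.1.1.num : ℂ) * Complex.I
  elliptic : ∀ r, ∃ θ : ℝ, 0 < θ ∧ θ < 1 / Q ∧ (orbit (r, Kind.ell)).HasRotationEigenvalues θ
  hyperbolic : ∀ r, (orbit (r, Kind.hyp)).IsPositiveHyperbolic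
  /-- There are no other irreducible periodic orbits of period `≤ Q`. -/
  complete : ∀ γ : Orbit K X₁ X₂, γ.period ≤ Q → ∃ l, γ.image = (orbit l).image

variable {X₁ X₂ ε : ℝ} {Q : ℕ}

/-- An orbit set is given by the multiplicities of the orbits; this is its 1-cycle. -/
def TwistPerturbation.cycle (T : TwistPerturbation X₁ X₂ Q ε) (m : Label X₁ X₂ Q →₀ ℕ) :
    Chain projY 1 :=
  m.sum fun l j => (j : ℤ) • (T.orbit l).loop.chain

/-- The generators: admissible orbit sets in the class
`h = Q [S¹ × pt × pt] - P [pt × pt × S¹]` of `H₁(Y)`. -/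
structure Generator (T : TwistPerturbation X₁ X₂ Q ε) (P : ℤ) where
  mult : Label X₁ X₂ Q →₀ ℕ
  admissible : ∀ r, mult (r, Kind.hyp) ≤ 1
  sector : Homologous (torusY X₁ X₂) (T.cycle mult)
    ((Q : ℤ) • (circleT X₁).chain - P • (circleY X₁).chain)

variable {T : TwistPerturbation X₁ X₂ Q ε} {P : ℤ}

def Generator.cycle (α : Generator T P) : Chain projY 1 := T.cycle α.mult

/-- The union of the orbits of a generator. -/
def Generator.image (α : Generator T P) : Set YSpace := ⋃ l ∈ α.mult.support, (T.orbit l).image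

open Classical in
/-- The number of elliptic factors, counted with multiplicity. -/
def Generator.ellipticFactors (α : Generator T P) : ℕ :=
  α.mult.sum fun l j => if l.2 = Kind.ell then j else 0

/-- The numbers `p_i/q_i` for the factors of a generator, with multiplicity. -/
def Generator.slopes (α : Generator T P) : Multiset ℚ :=
  α.mult.sum fun l j => Multiset.replicate j l.1.1

/-- The vertices `w_0 = 0, w_1, …, w_k` of the polygonal path of a generator, in the
`(p, q)`-plane: the partial sums of the `(p_i, q_i)`, ordered by decreasing `p_i/q_i`. -/
def Generator.vertices (α : Generator T P) : List (ℝ × ℝ) :=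
  ((α.slopes.sort (· ≥ ·)).map fun r : ℚ => ((r.num : ℝ), (r.den : ℝ))).scanl (· + ·) 0

/-- `∫ p dq` along the straight segment from `v` to `w`. -/
def segmentIntegral (v w : ℝ × ℝ) : ℝ :=
  ∫ u in (0 : ℝ)..1, (v.1 + u * (w.1 - v.1)) * (w.2 - v.2)

/-- `∫ p dq` along the polygonal path of a generator. -/
def Generator.pathIntegral (α : Generator T P) : ℝ :=
  ((α.vertices.zip α.vertices.tail).map fun e => segmentIntegral e.1 e.2).sum

end Generators

section RelativeIndex

variable {X₁ X₂ ε : ℝ} {Q : ℕ} {T : TwistPerturbation X₁ X₂ Q ε} {P : ℤ}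

/-- A trivialization `τ` of `V` over the orbits (up to homotopy). -/
abbrev Trivialization (T : TwistPerturbation X₁ X₂ Q ε) := ∀ l, Frame (T.orbit l)

/-- `H₂(Y; α, β)`. -/
abbrev H2 (α β : Generator T P) : Type := RelClass (torusY X₁ X₂) α.cycle β.cycle

/-- The chain `W` represents the class `Z`. -/
def Represents {α β : Generator T P} (W : Chain projY 2) (Z : H2 α β) : Prop :=
  ∃ W' : RelCycle (torusY X₁ X₂) α.cycle β.cycle, W'.1 = W ∧ Quotient.mk _ W' = Z

/-- `ψ` is a smooth section of `V` over `Y` (written on the universal cover). -/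
def IsSection (ψ : ℝ → ℂ → ℂ) : Prop :=
  ContDiff ℝ ∞ (fun w : ℝ × ℂ => ψ w.1 w.2) ∧ (∀ t z, ψ (t + 1) z = ψ t z) ∧
    ∀ t z, ψ t (z + Complex.I) = ψ t z

/-- The section `ψ` is nowhere zero along the orbit and homotopic, through nowhere zero sections
there, to the frame. -/
def IsTrivialAlong {K : ℝ → ℂ → ℝ} (ψ : ℝ → ℂ → ℂ) (γ : Orbit K X₁ X₂) (τ : Frame γ) : Prop :=
  ∃ g : ℝ → ℂ, Continuous g ∧ (∀ t, g (t + γ.period) = g t) ∧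
    ∀ t, ψ t (γ.z t) = Complex.exp (g t) * τ.ν t

/-- The relative first Chern number `c_τ(Z)` is `n`: the algebraic number of zeros, over a chain
in the class `Z`, of a section of `V` that is `τ`-trivial over the boundary orbits. -/
def HasChernNumber (τ : Trivialization T) {α β : Generator T P} (Z : H2 α β) (n : ℤ) : Prop :=
  ∃ (W : Chain projY 2) (ψ : ℝ → ℂ → ℂ), Represents W Z ∧ IsSection ψ ∧
    (∀ l, α.mult l ≠ 0 ∨ β.mult l ≠ 0 → IsTrivialAlong ψ (T.orbit l) (τ l)) ∧
    HasZeroNumber ψ W n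

/-- The push-off of the 1-cycle of a generator by `r τ`. -/
def Generator.pushCycle (α : Generator T P) (τ : Trivialization T) (r : ℝ) : Chain projY 1 :=
  α.mult.sum fun l j => (j : ℤ) • ((T.orbit l).pushLoop (τ l) r).chain

def Generator.pushImage (α : Generator T P) (τ : Trivialization T) (r : ℝ) : Set YSpace :=
  ⋃ l ∈ α.mult.support, (T.orbit l).pushImage (τ l) r

/-- The strips between the orbits of a generator and their push-offs. -/
def Generator.strips (α : Generator T P) (τ : Trivialization T) (r : ℝ) : Chain projY 2 :=
  α.mult.sum fun l j => (j : ℤ) • ((T.orbit l).strip (τ l) r).chain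

/-- The size `r > 0` of the push-off is small enough: up to it, the push-offs of the orbits of `α`
stay in `Y` and do not meet the orbits of `α`. -/
def Generator.IsPushable (α : Generator T P) (τ : Trivialization T) (r : ℝ) : Prop :=
  ∀ ρ, 0 < ρ → ρ ≤ r → α.pushImage τ ρ ⊆ torusY X₁ X₂ ∧ Disjoint (α.pushImage τ ρ) α.image

/-- `S` is a 2-chain in `[0,1] × Y` with boundary `{1} × a - {0} × b`, which meets `{1} × Y` and
`{0} × Y` only in the supports `A` and `B` of `a` and `b`. -/
def IsFilling (X₁ X₂ : ℝ) (a b : Chain projY 1) (A B : Set YSpace) (S : Chain projM 2) : Prop :=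
  S.In (slabM X₁ X₂) ∧
  boundary S - (chainIncl 1 a - chainIncl 0 b) ∈ degenerate projM 1 ∧
  ∀ σ ∈ S.support, ∀ u, ((σ.toFun u).1 = 1 → (σ.toFun u).2 ∈ A) ∧
    ((σ.toFun u).1 = 0 → (σ.toFun u).2 ∈ B)

/-- The relative self-intersection number `Q_τ(Z) = Q_τ(Z, Z)` is `n`: the algebraic intersection
number in `[0,1] × Y` of two 2-chains `S`, `S'` that both represent `Z`, where `S` has boundary
`{1} × α - {0} × β`, and the boundary of `S'` is pushed off along `τ`. -/
def HasSelfIntersection (τ : Trivialization T) {α β : Generator T P} (Z : H2 α β) (n : ℤ) : Prop :=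
  ∃ (r : ℝ) (W : Chain projY 2) (S S' : Chain projM 2), 0 < r ∧
    α.IsPushable τ r ∧ β.IsPushable τ r ∧ Represents W Z ∧
    IsFilling X₁ X₂ α.cycle β.cycle α.image β.image S ∧
    Homologous (torusY X₁ X₂) (chainProj S) W ∧
    IsFilling X₁ X₂ (α.pushCycle τ r) (β.pushCycle τ r) (α.pushImage τ r) (β.pushImage τ r) S' ∧
    Homologous (torusY X₁ X₂) (chainProj S') (W + α.strips τ r - β.strips τ r) ∧
    HasIntersectionNumber S S' n

/-- `∑ᵢ ∑_{k=1}^{mᵢ} μ_τ(αᵢᵏ)`. -/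
def Generator.czSum (α : Generator T P) (τ : Trivialization T) : ℤ :=
  α.mult.sum fun l j => ∑ k ∈ Finset.Icc 1 j, czIndex (T.orbit l) (τ l) k

/-- The relative index, computed with the trivialization `τ`, has the value `n`:
`I(α, β; Z) = c_τ(Z) + Q_τ(Z) + μ_τ(α, β) = n`. -/
def HasRelativeIndex (τ : Trivialization T) {α β : Generator T P} (Z : H2 α β) (n : ℤ) : Prop :=
  ∃ c q : ℤ, HasChernNumber τ Z c ∧ HasSelfIntersection τ Z q ∧
    n = c + q + (α.czSum τ - β.czSum τ)

end RelativeIndex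

end PFH

end

/-! The fields ∂x, ∂y trivialize V over all of Y, so up to homotopy a trivialization along an orbit
is an integer n, the number of turns of its frame over one period (`Frame.turns`). Each of the three
terms of the index is a number attached to α minus the same number for β, whatever Z is. Write m for
the multiplicity of an orbit.

Chern number: by the argument principle the zeros of a τ-trivial section are counted by its turns
along the boundary, and an orbit contributes m n (`hasChernNumber_iff`).

Self-intersection: by Stokes it is the linking number of α with its push-off minus that of β
(`hasSelfIntersection_iff`). Orbits of different slopes are separated in the direction x; an orbit
of slope p/q links the push-off of one of slope p'/q' exactly q p' - q' p times if p/q > p'/q', and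
not at all if p/q < p'/q'. An orbit links its own push-off n times, and e and h of the same slope
are unlinked (`linkNumber`).

Conley–Zehnder index: the k-th iterate has index -1 - 2kn if elliptic and -2kn if hyperbolic
(`czIndex_elliptic`, `czIndex_hyperbolic`). Summed over k = 1, …, m this gives -m - m(m+1)n or
-m(m+1)n.

The dependence on τ cancels because m + m² = m(m+1) (`Generator.index_eq`). What remains is minus
the number of elliptic factors, minus the sum of p_i q_j - p_j q_i over pairs of factors in
decreasing order of slope. That last sum is 2∫p dq - PQ along the polygonal path
(`two_mul_pathSum`), and PQ is common to α and β.

The dynamical input is that linearized solutions, and differences of two strands of orbits, satisfy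
v' = (0, -Re v) up to an error ε|v| (`IsAlmostShear`). The angle of v then has velocity -cos² up to
ε, and a turn by -π takes a time of order ε^(-1/2). The choice of ε makes this time exceed Q, so
over total period at most Q rotations stay below half a turn, and distinct strands of equal slope do
not wind around each other.

Signed counts are handled by integrals. Composing a map with smooth steps, or staircases in the
circle directions, turns the count of regular preimages into the integral of a Jacobian determinant
(`integral_det_stairs`). The integrand is exact, so Stokes for cubes (`integral_det_gradMat`) moves
it to the boundary. Sard's theorem provides regularity for almost every translation. -/

open scoped ContDiff

noncomputable section

namespace PFH

/-! ### Stokes' theorem for smooth maps of a cube to a space of the same dimension. -/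

section CubeStokes

open MeasureTheory Set

/-- The matrix of partial derivatives of a map `ℝᵐ → ℝⁿ`; row `i` is the `i`-th partial
derivative. -/
def gradMat {m n : ℕ} (F : (Fin m → ℝ) → (Fin n → ℝ)) (x : Fin m → ℝ) :
    Matrix (Fin m) (Fin n) ℝ :=
  Matrix.of fun i j => fderiv ℝ F x (Pi.single i 1) j

/-- The integral of `y₀ dy₁ ∧ … ∧ dyₙ` over a singular `n`-cube in `ℝⁿ⁺¹`. -/
def leadInt {n : ℕ} (G : (Fin n → ℝ) → (Fin (n + 1) → ℝ)) : ℝ :=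
  ∫ y in Icc (0 : Fin n → ℝ) 1, G y 0 * ((gradMat G y).submatrix id Fin.succ).det

/-- The alternating form `dy₁ ∧ … ∧ dyₙ` on `ℝⁿ⁺¹`. -/
def tailForm (n : ℕ) : (Fin (n + 1) → ℝ) [⋀^Fin n]→L[ℝ] ℝ :=
  { (Matrix.detRowAlternating (R := ℝ) (n := Fin n)).compLinearMap
      (LinearMap.funLeft ℝ ℝ Fin.succ) with
    cont := by
      change Continuous fun v : Fin n → Fin (n + 1) → ℝ =>
        (Matrix.of fun k l : Fin n => v k l.succ).det
      refine Continuous.matrix_det ?_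
      refine continuous_matrix fun i j => ?_
      simp only [Matrix.of_apply]
      fun_prop }

theorem tailForm_apply {n : ℕ} (v : Fin n → Fin (n + 1) → ℝ) :
    tailForm n v = (Matrix.of fun k l : Fin n => v k l.succ).det := rfl

/-- The differential form `y₀ dy₁ ∧ … ∧ dyₙ`. -/
def leadForm (n : ℕ) (y : Fin (n + 1) → ℝ) : (Fin (n + 1) → ℝ) [⋀^Fin n]→L[ℝ] ℝ :=
  y 0 • tailForm n

theorem contDiff_leadForm (n : ℕ) : ContDiff ℝ ∞ (leadForm n) := by
  unfold leadForm
  exact (contDiff_apply ℝ ℝ (0 : Fin (n + 1))).smul contDiff_const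

/-- Only the factor y₀ is nonconstant, and its derivative in the direction v_i is v_i 0. The
alternating sum defining `extDeriv` is therefore the Laplace expansion of the determinant along
column zero. -/
theorem extDeriv_leadForm {n : ℕ} (y : Fin (n + 1) → ℝ) (v : Fin (n + 1) → Fin (n + 1) → ℝ) :
    extDeriv (leadForm n) y v = (Matrix.of v).det := by
  rw [extDeriv_apply ((contDiff_leadForm n).differentiable (by simp) y), Matrix.det_succ_column_zero]
  refine Finset.sum_congr rfl fun i _ => ?_
  have h : (fun y : Fin (n + 1) → ℝ => leadForm n y (i.removeNth v)) =
      fun y => y 0 * tailForm n (i.removeNth v) := by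
    funext y; simp [leadForm]
  rw [h, fderiv_mul_const (by fun_prop)]
  have h2 : fderiv ℝ (fun y : Fin (n + 1) → ℝ => y 0) y = ContinuousLinearMap.proj 0 :=
    (ContinuousLinearMap.proj (R := ℝ) (φ := fun _ : Fin (n + 1) => ℝ) 0).fderiv
  rw [h2]
  simp only [smul_apply, ContinuousLinearMap.proj_apply, smul_eq_mul,
    tailForm_apply, Matrix.of_apply, Int.reduceNeg, zsmul_eq_mul]
  have : (Matrix.of v).submatrix i.succAbove Fin.succ =
      Matrix.of fun k l : Fin n => (i.removeNth v) k l.succ := by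
    ext k l; simp [Fin.removeNth]
  rw [this]
  push_cast
  ring

theorem fderiv_insertNth {n : ℕ} (i : Fin (n + 1)) (e : ℝ) (x : Fin n → ℝ) :
    fderiv ℝ (fun y : Fin n → ℝ => (i.insertNth e y : Fin (n + 1) → ℝ)) x =
      ContinuousLinearMap.pi (i.insertNth (α := fun _ => (Fin n → ℝ) →L[ℝ] ℝ) 0
        (fun m => ContinuousLinearMap.proj m)) := by
  refine HasFDerivAt.fderiv ?_
  rw [hasFDerivAt_pi]
  intro j
  refine Fin.succAboveCases i ?_ (fun m => ?_) j
  · simpa using hasFDerivAt_const _ _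
  · simp only [Fin.insertNth_apply_succAbove]
    exact (ContinuousLinearMap.proj (R := ℝ) (φ := fun _ : Fin n => ℝ) m).hasFDerivAt

theorem fderiv_insertNth_single {n : ℕ} (i : Fin (n + 1)) (e : ℝ) (x : Fin n → ℝ) (k : Fin n) :
    fderiv ℝ (fun y : Fin n → ℝ => (i.insertNth e y : Fin (n + 1) → ℝ)) x (Pi.single k 1) =
      Pi.single (i.succAbove k) 1 := by
  rw [fderiv_insertNth]
  funext j
  refine Fin.succAboveCases i ?_ (fun m => ?_) j
  · simp [(Fin.succAbove_ne i k).symm]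
  · simp [Pi.single_apply]

theorem gradMat_face {m n : ℕ} {F : (Fin (n + 1) → ℝ) → (Fin m → ℝ)} (hF : Differentiable ℝ F)
    (i : Fin (n + 1)) (e : ℝ) (x : Fin n → ℝ) :
    gradMat (fun y => F (i.insertNth e y)) x =
      (gradMat F (i.insertNth e x)).submatrix i.succAbove id := by
  ext k l
  simp only [gradMat, Matrix.of_apply, Matrix.submatrix_apply, id]
  have := fderiv_comp x (hF (i.insertNth e x))
    ((contDiff_insertNth i e).differentiable (by simp) x)
  rw [Function.comp_def] at this
  rw [this, ContinuousLinearMap.comp_apply, fderiv_insertNth_single]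

/-- Stokes' theorem for the form `y₀ dy₁ ∧ … ∧ dyₙ` pulled back to the unit cube. -/
theorem integral_det_gradMat {n : ℕ} {F : (Fin (n + 1) → ℝ) → (Fin (n + 1) → ℝ)}
    (hF : ContDiff ℝ ∞ F) :
    ∫ x in Icc (0 : Fin (n + 1) → ℝ) 1, (gradMat F x).det =
      ∑ i : Fin (n + 1), (-1 : ℝ) ^ (i : ℕ) *
        (leadInt (fun y => F (i.insertNth 1 y)) - leadInt (fun y => F (i.insertNth 0 y))) := by
  let e : Fin (n + 1) → Fin (n + 1) → ℝ := fun i => Pi.single i 1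
  let pb : (Fin (n + 1) → ℝ) → (Fin (n + 1) → ℝ) [⋀^Fin n]→L[ℝ] ℝ := fun x =>
    (leadForm n (F x)).compContinuousLinearMap (fderiv ℝ F x)
  have hpb_apply : ∀ x v, pb x v = F x 0 * (Matrix.of fun k l : Fin n =>
      fderiv ℝ F x (v k) l.succ).det := by
    intro x v
    simp [pb, leadForm, tailForm_apply, Function.comp_def]
  have hdF : ContDiff ℝ ∞ (fderiv ℝ F) := hF.fderiv_right (by simp)
  have hterm : ∀ v : Fin n → Fin (n + 1) → ℝ, ContDiff ℝ ∞ fun x => pb x v := by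
    intro v
    simp_rw [hpb_apply, Matrix.det_apply']
    refine ContDiff.mul (contDiff_pi.1 hF 0) (ContDiff.sum fun σ _ => contDiff_const.mul
      (contDiff_prod fun j _ => ?_))
    exact contDiff_pi.1 (hdF.clm_apply contDiff_const) _
  have hpb : ∀ x, DifferentiableAt ℝ pb x := by
    intro x
    refine DifferentiableAt.continuousAlternatingMapCompContinuousLinearMap ?_ ?_
    · exact ((contDiff_leadForm n).comp hF).differentiable (by simp) x
    · exact hdF.differentiable (by simp) x
  -- Naturality of d under pullback: the determinant is the pullback of d(y₀ dy₁ ∧ …) on the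
  -- standard frame. Expanding d of the pulled-back form instead exhibits it as a divergence, to
  -- which the divergence theorem on the cube applies.
  have key : ∀ x, (gradMat F x).det =
      ∑ i : Fin (n + 1), ((-1 : ℝ) ^ (i : ℕ) • fderiv ℝ (fun y => pb y (i.removeNth e)) x) (e i) := by
    intro x
    have h1 := extDeriv_pullback (x := x)
      ((contDiff_leadForm n).differentiable (by simp) _) hF.contDiffAt
      (by simpa using (WithTop.coe_le_coe.2 le_top : ((2 : ℕ∞) : WithTop ℕ∞) ≤ ∞))
    have h2 := congrArg (fun w' => w' e) h1
    rw [extDeriv_apply (hpb x)] at h2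
    rw [ContinuousAlternatingMap.compContinuousLinearMap_apply, extDeriv_leadForm] at h2
    have h3 : gradMat F x = Matrix.of (⇑(fderiv ℝ F x) ∘ e) := rfl
    rw [h3, ← h2]
    refine Finset.sum_congr rfl fun i _ => ?_
    simp [pb]
  simp_rw [key]
  have hd := MeasureTheory.integral_divergence_of_hasFDerivAt_off_countable'
    (0 : Fin (n + 1) → ℝ) 1 zero_le_one
    (fun i x => (-1 : ℝ) ^ (i : ℕ) • pb x (i.removeNth e))
    (fun i x => (-1 : ℝ) ^ (i : ℕ) • fderiv ℝ (fun y => pb y (i.removeNth e)) x) ∅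
    Set.countable_empty
    (fun i => ((hterm (i.removeNth e)).continuous.fun_const_smul _).continuousOn)
    (fun x _ i => ((hterm (i.removeNth e)).differentiable (by simp) x).hasFDerivAt.fun_const_smul _)
    (by
      refine (Continuous.continuousOn ?_).integrableOn_compact isCompact_Icc
      refine continuous_finsetSum _ fun i _ => ?_
      have : ContDiff ℝ ∞ (fderiv ℝ fun y => pb y (i.removeNth e)) :=
        (hterm _).fderiv_right (by simp)
      exact (Continuous.clm_apply (f := fun x => (-1 : ℝ) ^ (i : ℕ) •
        fderiv ℝ (fun y => pb y (i.removeNth e)) x) (this.continuous.fun_const_smul _)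
        continuous_const))
  rw [hd]
  refine Finset.sum_congr rfl fun i _ => ?_
  rw [mul_sub]
  have hface : ∀ c : ℝ, (∫ x in Icc (0 : Fin n → ℝ) 1,
      (-1 : ℝ) ^ (i : ℕ) • pb (i.insertNth c x) (i.removeNth e)) =
      (-1 : ℝ) ^ (i : ℕ) * leadInt (fun y => F (i.insertNth c y)) := by
    intro c
    rw [leadInt, ← integral_const_mul]
    refine integral_congr_ae (ae_of_all _ fun x => ?_)
    simp only [smul_eq_mul]
    rw [hpb_apply, gradMat_face (hF.differentiable (by simp))]
    rfl
  have h0 : (0 : Fin (n + 1) → ℝ) ∘ i.succAbove = 0 := rfl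
  have h1 : (1 : Fin (n + 1) → ℝ) ∘ i.succAbove = 1 := rfl
  simp only [h0, h1, Pi.zero_apply, Pi.one_apply]
  rw [hface 1, hface 0]

end CubeStokes

/-! ### Signed counts of regular preimages as integrals. -/

section RegularValues

open MeasureTheory Set Metric

variable {n : ℕ} {F : (Fin n → ℝ) → (Fin n → ℝ)}

theorem det_fderiv_eq (F : (Fin n → ℝ) → (Fin n → ℝ)) (x : Fin n → ℝ) :
    (fderiv ℝ F x).det = (gradMat F x).det := by
  have : (fderiv ℝ F x).det = LinearMap.det (fderiv ℝ F x : (Fin n → ℝ) →ₗ[ℝ] (Fin n → ℝ)) := rfl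
  rw [this, ← LinearMap.det_toMatrix', ← Matrix.det_transpose]
  congr 1

theorem isClosed_of_separated {E : Type*} [MetricSpace E] {L : Set E}
    (hL : ∀ l ∈ L, ∀ l' ∈ L, l ≠ l' → 1 ≤ dist l l') : IsClosed L := by
  exact Metric.isClosed_of_pairwise_le_dist one_pos
    (fun l hl l' hl' h => hL l hl l' hl' h : L.Pairwise fun x y => 1 ≤ dist x y)

theorem continuous_det_gradMat (hF : ContDiff ℝ ∞ F) : Continuous fun x => (gradMat F x).det := by
  have h : ContDiff ℝ ∞ (fderiv ℝ F) := hF.fderiv_right (by simp)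
  refine Continuous.matrix_det (continuous_matrix fun i j => ?_)
  exact (continuous_apply j).comp (h.continuous.clm_apply continuous_const)

/-- A regular point has arbitrarily small open neighbourhoods on which the map is injective. -/
theorem exists_good_nhd (hF : ContDiff ℝ ∞ F) {x : Fin n → ℝ} (hx : (gradMat F x).det ≠ 0) :
    ∃ U, IsOpen U ∧ x ∈ U ∧ InjOn F U ∧
      (∀ y ∈ U, SignType.sign (gradMat F y).det = SignType.sign (gradMat F x).det) ∧
      ∀ V, IsOpen V → x ∈ V → F '' V ∈ nhds (F x) := by
  have hs : HasStrictFDerivAt F (fderiv ℝ F x) x := hF.contDiffAt.hasStrictFDerivAt (by simp)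
  have hdet : IsUnit (fderiv ℝ F x).det := by rw [det_fderiv_eq]; exact hx.isUnit
  let A : (Fin n → ℝ) ≃L[ℝ] (Fin n → ℝ) :=
    (fderiv ℝ F x).toContinuousLinearEquivOfDetNeZero hdet.ne_zero
  have hs' : HasStrictFDerivAt F (A : (Fin n → ℝ) →L[ℝ] (Fin n → ℝ)) x := by
    simpa only [A, ContinuousLinearMap.coe_toContinuousLinearEquivOfDetNeZero] using hs
  have hopen : IsOpen {y | SignType.sign (gradMat F y).det = SignType.sign (gradMat F x).det} := by
    rcases lt_or_gt_of_ne hx with h | h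
    · simp only [sign_neg h, sign_eq_neg_one_iff]
      exact isOpen_lt (continuous_det_gradMat hF) continuous_const
    · simp only [sign_pos h, sign_eq_one_iff]
      exact isOpen_lt continuous_const (continuous_det_gradMat hF)
  refine ⟨(hs'.toOpenPartialHomeomorph F).source ∩ _, (hs'.toOpenPartialHomeomorph F).open_source.inter
    hopen, ⟨hs'.mem_toOpenPartialHomeomorph_source, rfl⟩, ?_, fun y hy => hy.2, ?_⟩
  · exact (hs'.toOpenPartialHomeomorph F).injOn.mono inter_subset_left
  · intro V hV hxV
    rw [← hs'.map_nhds_eq_of_equiv]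
    exact Filter.image_mem_map (hV.mem_nhds hxV)

/-- Compactness: every point of the cube has a neighbourhood that contains no other solution. At a
solution this uses local injectivity of `F`, together with the fact that a ball of radius 1 about a
point of `L` contains no second point of `L`. -/
theorem finite_regular_preimage (hF : ContDiff ℝ ∞ F) {L : Set (Fin n → ℝ)}
    (hL : ∀ l ∈ L, ∀ l' ∈ L, l ≠ l' → 1 ≤ dist l l')
    (hreg : ∀ x ∈ Icc (0 : Fin n → ℝ) 1, F x ∈ L → (gradMat F x).det ≠ 0) :
    {x ∈ Icc (0 : Fin n → ℝ) 1 | F x ∈ L}.Finite := by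
  have hLc := isClosed_of_separated hL
  have : ∀ x ∈ Icc (0 : Fin n → ℝ) 1, ∃ U ∈ nhds x, ∀ y ∈ U, F y ∈ L → y = x := by
    intro x hx
    by_cases hxL : F x ∈ L
    · obtain ⟨U, hU, hxU, hinj, -, -⟩ := exists_good_nhd hF (hreg x hx hxL)
      refine ⟨U ∩ F ⁻¹' ball (F x) 1, Filter.inter_mem (hU.mem_nhds hxU)
        (hF.continuous.continuousAt.preimage_mem_nhds (ball_mem_nhds _ one_pos)), ?_⟩
      rintro y ⟨hyU, hyB⟩ hyL
      refine hinj hyU hxU ?_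
      by_contra hne
      exact absurd (hL _ hyL _ hxL hne) (not_le.2 hyB)
    · exact ⟨F ⁻¹' Lᶜ, hF.continuous.continuousAt.preimage_mem_nhds (hLc.isOpen_compl.mem_nhds hxL),
        fun y hy hyL => absurd hyL hy⟩
  choose! U hU hUL using this
  obtain ⟨t, ht, hcov⟩ := isCompact_Icc.elim_nhds_subcover U hU
  refine t.finite_toSet.subset ?_
  rintro y ⟨hy, hyL⟩
  obtain ⟨x, hxt, hyx⟩ := mem_iUnion₂.1 (hcov hy)
  rw [hUL x (ht x hxt) y hyx hyL]
  exact hxt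

/-- The integral of a bump function concentrated near a set of regular values, pulled back by a
map of the unit cube, is the signed number of preimages. -/
theorem integral_bump_eq_signed_count (hF : ContDiff ℝ ∞ F) {L : Set (Fin n → ℝ)}
    (hL : ∀ l ∈ L, ∀ l' ∈ L, l ≠ l' → 1 ≤ dist l l')
    (hreg : ∀ x ∈ Icc (0 : Fin n → ℝ) 1, F x ∈ L →
      (∀ i, x i ∈ Ioo (0 : ℝ) 1) ∧ (gradMat F x).det ≠ 0) :
    ∃ δ₀ > 0, ∀ δ, 0 < δ → δ < δ₀ → ∀ φ : (Fin n → ℝ) → ℝ,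
      Continuous φ → (∀ z, φ z ≠ 0 → ∃ l ∈ L, dist z l ≤ δ) →
      (∀ l ∈ L, ∫ z in closedBall l δ, φ z = 1) →
      ∫ x in Icc (0 : Fin n → ℝ) 1, φ (F x) * (gradMat F x).det =
        ∑ᶠ (x) (_ : x ∈ Icc (0 : Fin n → ℝ) 1 ∧ F x ∈ L),
          ((SignType.sign (gradMat F x).det : ℤ) : ℝ) := by
  classical
  have hLc := isClosed_of_separated hL
  have hfin := finite_regular_preimage hF hL fun x hx h => (hreg x hx h).2
  set P := {x ∈ Icc (0 : Fin n → ℝ) 1 | F x ∈ L} with hP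
  obtain ⟨D, hD, hDdisj⟩ := hfin.t2_separation
  -- Each preimage gets a neighbourhood in the interior of the cube on which `F` is injective with
  -- Jacobian of constant sign. Its image stays within 1/2 of `F x`, so that by separation no other
  -- point of `L` can contribute there.
  have hgood : ∀ x ∈ P, ∃ V, IsOpen V ∧ x ∈ V ∧ V ⊆ Icc 0 1 ∧ V ⊆ D x ∧ InjOn F V ∧
      F '' V ⊆ ball (F x) (1 / 2) ∧ (∃ r > 0, closedBall (F x) r ⊆ F '' V) ∧
      ∀ y ∈ V, SignType.sign (gradMat F y).det = SignType.sign (gradMat F x).det := by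
    rintro x ⟨hx, hxL⟩
    obtain ⟨hxi, hdet⟩ := hreg x hx hxL
    obtain ⟨U, hU, hxU, hinj, hsgn, himg⟩ := exists_good_nhd hF hdet
    have hIo : IsOpen (univ.pi fun _ : Fin n => Ioo (0 : ℝ) 1) :=
      isOpen_set_pi finite_univ fun _ _ => isOpen_Ioo
    have hB : IsOpen (F ⁻¹' ball (F x) (1 / 2)) := isOpen_ball.preimage hF.continuous
    have hV : IsOpen (((U ∩ D x) ∩ univ.pi fun _ : Fin n => Ioo (0 : ℝ) 1) ∩
        F ⁻¹' ball (F x) (1 / 2)) := ((hU.inter (hD x).2).inter hIo).inter hB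
    have hxV : x ∈ (((U ∩ D x) ∩ univ.pi fun _ : Fin n => Ioo (0 : ℝ) 1) ∩
        F ⁻¹' ball (F x) (1 / 2)) :=
      ⟨⟨⟨hxU, (hD x).1⟩, fun i _ => hxi i⟩, mem_ball_self (by norm_num)⟩
    refine ⟨_, hV, hxV, ?_, fun y hy => hy.1.1.2, hinj.mono fun y hy => hy.1.1.1, ?_, ?_,
      fun y hy => hsgn y hy.1.1.1⟩
    · exact fun y hy => ⟨fun i => (hy.1.2 i trivial).1.le, fun i => (hy.1.2 i trivial).2.le⟩
    · rintro _ ⟨y, hy, rfl⟩; exact hy.2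
    · obtain ⟨r, hr, hrs⟩ := Metric.nhds_basis_closedBall.mem_iff.1 (himg _ hV hxV)
      exact ⟨r, hr, hrs⟩
  choose! V hVo hxV hVI hVD hVinj hVball hVr hVs using hgood
  choose! r hr hrV using hVr
  -- away from the neighbourhoods the map stays at a positive distance from `L`
  have hKc : IsCompact (F '' (Icc 0 1 \ ⋃ x ∈ P, V x)) :=
    (isCompact_Icc.diff (isOpen_biUnion fun x hx => hVo x hx)).image hF.continuous
  have hKd : Disjoint (F '' (Icc 0 1 \ ⋃ x ∈ P, V x)) L := by
    rw [Set.disjoint_left]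
    rintro _ ⟨y, ⟨hyI, hyV⟩, rfl⟩ hyL
    exact hyV (mem_biUnion (show y ∈ P from ⟨hyI, hyL⟩) (hxV y ⟨hyI, hyL⟩))
  obtain ⟨η, hη, hηd⟩ := Metric.exists_pos_forall_lt_edist hKc hLc hKd
  obtain ⟨ρ, hρ, hρr⟩ : ∃ ρ > 0, ∀ x ∈ P, ρ ≤ r x := by
    have : ∀ x ∈ P, 0 < r x := hr
    rcases P.eq_empty_or_nonempty with h | h
    · exact ⟨1, one_pos, by simp [h]⟩
    · obtain ⟨x, hx, hmin⟩ := hfin.exists_minimalFor r P h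
      refine ⟨r x, hr x hx, fun y hy => ?_⟩
      rcases le_total (r x) (r y) with h' | h'
      · exact h'
      · exact hmin hy h'
  -- δ < ρ puts the δ-ball about `F x` inside the image of its neighbourhood; δ < η makes the bump
  -- vanish off the neighbourhoods; δ < 1/2 keeps the bumps at other points of `L` away from these
  -- images.
  refine ⟨min (min ρ η) (1 / 2), by positivity, fun δ hδ hδ0 φ hφc hφ hφ1 => ?_⟩
  have hδρ : δ < ρ := hδ0.trans_le ((min_le_left _ _).trans (min_le_left _ _))
  have hδη : δ < η := hδ0.trans_le ((min_le_left _ _).trans (min_le_right _ _))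
  have hδ2 : δ < 1 / 2 := hδ0.trans_le (min_le_right _ _)
  have hdetc := continuous_det_gradMat hF
  -- Change of variables on `V x`: the sign of the determinant is constant and comes out, and what
  -- is left is the total mass 1 of the bump at `F x`.
  have hVint : ∀ x ∈ P, (∫ y in V x, φ (F y) * (gradMat F y).det) =
      ((SignType.sign (gradMat F x).det : ℤ) : ℝ) := by
    intro x hx
    have h1 : (∫ y in V x, φ (F y) * (gradMat F y).det) =
        ((SignType.sign (gradMat F x).det : ℤ) : ℝ) * ∫ y in V x, |(fderiv ℝ F y).det| • φ (F y) := by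
      rw [← integral_const_mul]
      refine setIntegral_congr_fun (hVo x hx).measurableSet fun y hy => ?_
      simp only [smul_eq_mul]
      rw [det_fderiv_eq, ← hVs x hx y hy]
      have := sign_mul_abs (gradMat F y).det
      rw [← mul_assoc]
      have h3 : (((SignType.sign (gradMat F y).det : ℤ) : ℝ)) * |(gradMat F y).det| =
          (gradMat F y).det := by
        rw [← this]; push_cast; simp
      rw [h3, mul_comm]
    rw [h1, ← integral_image_eq_integral_abs_det_fderiv_smul volume (hVo x hx).measurableSet
      (fun y _ => ((hF.differentiable (by simp) y).hasFDerivAt).hasFDerivWithinAt) (hVinj x hx) φ]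
    have hsub : closedBall (F x) δ ⊆ F '' V x :=
      (closedBall_subset_closedBall (hδρ.le.trans (hρr x hx))).trans (hrV x hx)
    rw [setIntegral_eq_of_subset_of_forall_sdiff_eq_zero
      (measurable_image_of_fderivWithin (hVo x hx).measurableSet
        (fun y _ => ((hF.differentiable (by simp) y).hasFDerivAt).hasFDerivWithinAt) (hVinj x hx))
      hsub, hφ1 _ hx.2, mul_one]
    rintro z ⟨hz1, hz2⟩
    by_contra hz
    obtain ⟨l, hl, hzl⟩ := hφ z hz
    have hlx : l ≠ F x := by rintro rfl; exact hz2 hzl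
    have h4 := hL l hl (F x) hx.2 hlx
    have h5 : dist z (F x) < 1 / 2 := hVball x hx hz1
    have h6 := dist_triangle_left l (F x) z
    linarith
  have hmeas : MeasurableSet (⋃ x ∈ P, V x) :=
    (isOpen_biUnion fun x hx => hVo x hx).measurableSet
  rw [setIntegral_eq_of_subset_of_forall_sdiff_eq_zero (s := ⋃ x ∈ P, V x) measurableSet_Icc
    (iUnion₂_subset hVI)]
  · have hPf : (⋃ x ∈ P, V x) = ⋃ x ∈ hfin.toFinset, V x := by simp
    rw [hPf, integral_biUnion_finset]
    · change _ = ∑ᶠ (x) (_ : x ∈ P), ((SignType.sign (gradMat F x).det : ℤ) : ℝ)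
      rw [finsum_mem_eq_finite_toFinset_sum _ hfin]
      exact Finset.sum_congr rfl fun x hx => hVint x (by simpa using hx)
    · exact fun x hx => (hVo x (by simpa using hx)).measurableSet
    · intro x hx y hy hxy
      have hx' : x ∈ P := by simpa using hx
      have hy' : y ∈ P := by simpa using hy
      exact (hDdisj hx' hy' hxy).mono (hVD x hx') (hVD y hy')
    · intro x hx
      exact (((hφc.comp hF.continuous).mul hdetc).continuousOn.integrableOn_compact
        isCompact_Icc).mono_set (hVI x (by simpa using hx))
  · rintro y ⟨hyI, hyV⟩
    by_contra hne
    obtain ⟨l, hl, hzl⟩ := hφ _ (left_ne_zero_of_mul hne)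
    have h1 := hηd (F y) ⟨y, ⟨hyI, hyV⟩, rfl⟩ l hl
    rw [edist_dist, ← ENNReal.ofReal_coe_nnreal] at h1
    have := (ENNReal.ofReal_lt_ofReal_iff_of_nonneg η.coe_nonneg).1 h1
    linarith

/-- A smooth function that increases by `1` across each point of `L` and is locally constant at
distance more than `δ` from `L`. -/
structure Stair (L : Set ℝ) (δ : ℝ) (H : ℝ → ℝ) : Prop where
  smooth : ContDiff ℝ ∞ H
  supp : ∀ x, deriv H x ≠ 0 → ∃ l ∈ L, |x - l| ≤ δ
  jump : ∀ l ∈ L, H (l + δ) - H (l - δ) = 1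

theorem Stair.contDiff_deriv {L : Set ℝ} {δ : ℝ} {H : ℝ → ℝ} (h : Stair L δ H) :
    ContDiff ℝ ∞ (deriv H) :=
  ((contDiff_succ_iff_deriv (n := ∞)).1 (by simpa using h.smooth)).2.2

theorem fderiv_comp_pi {m : ℕ} {H : Fin m → ℝ → ℝ} (hH : ∀ j, Differentiable ℝ (H j))
    {G : (Fin n → ℝ) → (Fin m → ℝ)} (hG : Differentiable ℝ G) (x v : Fin n → ℝ) (j : Fin m) :
    fderiv ℝ (fun y j => H j (G y j)) x v j = deriv (H j) (G x j) * fderiv ℝ G x v j := by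
  have h1 : HasFDerivAt (fun y j => H j (G y j))
      (ContinuousLinearMap.pi fun j => deriv (H j) (G x j) •
        (ContinuousLinearMap.proj j).comp (fderiv ℝ G x)) x := by
    rw [hasFDerivAt_pi]
    intro j
    exact ((hH j (G x j)).hasDerivAt).comp_hasFDerivAt x
      ((hasFDerivAt_pi'.1 (hG x).hasFDerivAt) j)
  rw [h1.fderiv]
  simp

theorem det_gradMat_comp {H : Fin n → ℝ → ℝ} (hH : ∀ j, Differentiable ℝ (H j))
    (hF : Differentiable ℝ F) (x : Fin n → ℝ) :
    (gradMat (fun y j => H j (F y j)) x).det =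
      (∏ j, deriv (H j) (F x j)) * (gradMat F x).det := by
  rw [← Matrix.det_mul_row]
  congr 1
  ext i j
  simp only [gradMat, Matrix.of_apply]
  exact fderiv_comp_pi hH hF _ _ _

/-- A ball for the sup norm is a box, so the integral is a product of one-dimensional ones, each
equal to the jump of `H j` across a single point. -/
theorem setIntegral_closedBall_prod {L : Fin n → Set ℝ} {δ : ℝ} (hδ : 0 < δ) {H : Fin n → ℝ → ℝ}
    (hH : ∀ j, Stair (L j) δ (H j)) {l : Fin n → ℝ} (hl : ∀ j, l j ∈ L j) :
    ∫ z in closedBall l δ, ∏ j, deriv (H j) (z j) = 1 := by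
  have h1 : closedBall l δ = univ.pi fun j => Icc (l j - δ) (l j + δ) := by
    rw [closedBall_pi _ hδ.le]
    simp_rw [Real.closedBall_eq_Icc]
  rw [h1, volume_pi, Measure.restrict_pi_pi, integral_fintype_prod_eq_prod]
  refine Finset.prod_eq_one fun j _ => ?_
  rw [integral_Icc_eq_integral_Ioc, ← intervalIntegral.integral_of_le (by linarith),
    intervalIntegral.integral_deriv_eq_sub
      (fun x _ => (hH j).smooth.differentiable (by simp) x)
      ((hH j).contDiff_deriv.continuous.intervalIntegrable _ _), (hH j).jump _ (hl j)]

/-- Signed count of regular preimages as the integral of a determinant. -/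
theorem integral_det_stairs (hF : ContDiff ℝ ∞ F) {L : Fin n → Set ℝ}
    (hL : ∀ j, ∀ l ∈ L j, ∀ l' ∈ L j, l ≠ l' → 1 ≤ |l - l'|)
    (hreg : ∀ x ∈ Icc (0 : Fin n → ℝ) 1, (∀ j, F x j ∈ L j) →
      (∀ i, x i ∈ Ioo (0 : ℝ) 1) ∧ (gradMat F x).det ≠ 0) :
    ∃ δ₀ > 0, ∀ δ, 0 < δ → δ < δ₀ → ∀ H : Fin n → ℝ → ℝ, (∀ j, Stair (L j) δ (H j)) →
      ∫ x in Icc (0 : Fin n → ℝ) 1, (gradMat (fun y j => H j (F y j)) x).det =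
        ∑ᶠ (x) (_ : x ∈ Icc (0 : Fin n → ℝ) 1 ∧ ∀ j, F x j ∈ L j),
          ((SignType.sign (gradMat F x).det : ℤ) : ℝ) := by
  obtain ⟨δ₀, hδ₀, h⟩ := integral_bump_eq_signed_count hF (L := {z | ∀ j, z j ∈ L j}) (by
    intro l hl l' hl' hne
    obtain ⟨j, hj⟩ := Function.ne_iff.1 hne
    exact (hL j _ (hl j) _ (hl' j) hj).trans (dist_le_pi_dist l l' j)) hreg
  refine ⟨δ₀, hδ₀, fun δ hδ hδ' H hH => ?_⟩
  -- By the chain rule the determinant acquires the factor ∏ H_j', a bump of mass 1 around each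
  -- point of the product set.
  refine Eq.trans ?_ (h δ hδ hδ' (fun z => ∏ j, deriv (H j) (z j)) ?_ ?_ ?_)
  · exact integral_congr_ae (ae_of_all _ fun x =>
      det_gradMat_comp (fun j => (hH j).smooth.differentiable (by simp))
        (hF.differentiable (by simp)) x)
  · exact continuous_finsetProd _ fun j _ =>
      (hH j).contDiff_deriv.continuous.comp (continuous_apply j)
  · intro z hz
    have := fun j => (hH j).supp (z j) (Finset.prod_ne_zero_iff.1 hz j (Finset.mem_univ j))
    choose l hl hd using this
    exact ⟨l, hl, (dist_pi_le_iff hδ.le).2 hd⟩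
  · exact fun l hl => setIntegral_closedBall_prod hδ hH hl

/-- Almost every translate of the lattice `Λ` consists of regular values. -/
theorem ae_regular (hF : ContDiff ℝ ∞ F) {Λ : Set (Fin n → ℝ)} (hΛ : Λ.Countable) :
    ∀ᵐ c : Fin n → ℝ, ∀ x ∈ Icc (0 : Fin n → ℝ) 1, F x - c ∈ Λ →
      (∀ i, x i ∈ Ioo (0 : ℝ) 1) ∧ (gradMat F x).det ≠ 0 := by
  -- Sard's theorem in equal dimensions. The boundary of the cube is null, hence so is its image; a
  -- bad `c` lies in one of countably many translates of these two null sets.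
  have hcrit : volume (F '' {x | (gradMat F x).det = 0}) = 0 :=
    addHaar_image_eq_zero_of_det_fderivWithin_eq_zero volume
      (fun x _ => ((hF.differentiable (by simp) x).hasFDerivAt).hasFDerivWithinAt)
      fun x hx => by rw [det_fderiv_eq]; exact hx
  have hbd : volume (F '' (Icc (0 : Fin n → ℝ) 1 \ univ.pi fun _ => Ioo (0 : ℝ) 1)) = 0 := by
    refine addHaar_image_eq_zero_of_differentiableOn_of_addHaar_eq_zero volume
      (hF.differentiable (by simp)).differentiableOn ?_
    have := (Measure.univ_pi_Ioo_ae_eq_Icc (μ := fun _ : Fin n => (volume : Measure ℝ))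
      (f := fun _ => 0) (g := fun _ => 1)).symm.le
    exact ae_le_set.1 this
  have hnull : volume (⋃ k ∈ Λ, (fun z => z - k) '' (F '' {x | (gradMat F x).det = 0} ∪
      F '' (Icc (0 : Fin n → ℝ) 1 \ univ.pi fun _ => Ioo (0 : ℝ) 1))) = 0 := by
    rw [measure_biUnion_null_iff hΛ]
    intro k _
    simp only [sub_eq_add_neg, image_add_right, neg_neg]
    rw [measure_preimage_add_right]
    exact measure_union_null hcrit hbd
  filter_upwards [compl_mem_ae_iff.2 hnull] with c hc x hx hxc
  have hc' : ∀ k ∈ Λ, ∀ z ∈ F '' {x | (gradMat F x).det = 0} ∪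
      F '' (Icc (0 : Fin n → ℝ) 1 \ univ.pi fun _ => Ioo (0 : ℝ) 1), z - k ≠ c :=
    fun k hk z hz h => hc (mem_biUnion hk ⟨z, hz, h⟩)
  refine ⟨fun i => ?_, fun h => hc' _ hxc (F x) (Or.inl ⟨x, h, rfl⟩) (by simp)⟩
  by_contra hi
  refine hc' _ hxc (F x) (Or.inr ⟨x, ⟨hx, fun h => hi (h i trivial)⟩, rfl⟩) (by simp)

end RegularValues

/-! ### Smooth steps and staircases. -/

section Stairs

/-- A smooth step from `0` to `1` between `c` and `c + δ`. -/
def stepFn (c δ x : ℝ) : ℝ := Real.smoothTransition ((x - c) / δ)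

/-- A smooth staircase with steps at `c + ℤ`. -/
def stairFn (c δ x : ℝ) : ℝ := ⌊x - c⌋ + Real.smoothTransition (Int.fract (x - c) / δ)

variable {c δ x : ℝ}

theorem contDiff_stepFn (c δ : ℝ) : ContDiff ℝ ∞ (stepFn c δ) :=
  Real.smoothTransition.contDiff.comp ((contDiff_id.sub contDiff_const).div_const δ)

theorem stepFn_of_le (hδ : 0 < δ) (h : x ≤ c) : stepFn c δ x = 0 :=
  Real.smoothTransition.zero_of_nonpos (div_nonpos_of_nonpos_of_nonneg (by linarith) hδ.le)

theorem stepFn_of_ge (hδ : 0 < δ) (h : c + δ ≤ x) : stepFn c δ x = 1 :=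
  Real.smoothTransition.one_of_one_le ((one_le_div hδ).2 (by linarith))

theorem deriv_stepFn_ne_zero (hδ : 0 < δ) (h : deriv (stepFn c δ) x ≠ 0) :
    c ≤ x ∧ x ≤ c + δ := by
  constructor
  · by_contra! hx
    refine h ?_
    have : stepFn c δ =ᶠ[nhds x] fun _ => 0 := by
      filter_upwards [gt_mem_nhds hx] with y hy using stepFn_of_le hδ hy.le
    rw [this.deriv_eq, deriv_const]
  · by_contra! hx
    refine h ?_
    have : stepFn c δ =ᶠ[nhds x] fun _ => 1 := by
      filter_upwards [lt_mem_nhds hx] with y hy using stepFn_of_ge hδ hy.le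
    rw [this.deriv_eq, deriv_const]

theorem stair_stepFn (hδ : 0 < δ) : Stair {c} δ (stepFn c δ) where
  smooth := contDiff_stepFn c δ
  supp x h := by
    have := deriv_stepFn_ne_zero hδ h
    exact ⟨c, rfl, abs_le.2 ⟨by linarith, by linarith⟩⟩
  jump l hl := by
    rw [Set.mem_singleton_iff.1 hl, stepFn_of_ge hδ le_rfl, stepFn_of_le hδ (by linarith), sub_zero]

/-- The step at c + k - 1 is complete after a length δ, so the jump of the floor function at c + k
is already compensated. On this window, which crosses that jump, the staircase is one shifted smooth
step; such windows cover the line, which yields smoothness and the derivative. -/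
theorem stairFn_eq (hδ : 0 < δ) (hδ1 : δ < 1) (k : ℤ) (h1 : c + k - 1 + δ ≤ x) (h2 : x < c + k + 1) :
    stairFn c δ x = k + stepFn (c + k) δ x := by
  unfold stairFn
  rcases le_or_gt (c + k) x with h | h
  · have hf : ⌊x - c⌋ = k := by rw [Int.floor_eq_iff]; constructor <;> linarith
    rw [Int.fract, hf, stepFn]
    congr 3
    ring
  · have hf : ⌊x - c⌋ = k - 1 := by
      rw [Int.floor_eq_iff]; push_cast; constructor <;> linarith
    rw [Int.fract, hf, stepFn_of_le hδ h.le, Real.smoothTransition.one_of_one_le]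
    · push_cast; ring
    · rw [one_le_div hδ]; push_cast; linarith

theorem stairFn_eventuallyEq (hδ : 0 < δ) (hδ1 : δ < 1) (k : ℤ) (h1 : c + k - 1 + δ < x)
    (h2 : x < c + k + 1) : stairFn c δ =ᶠ[nhds x] fun y => k + stepFn (c + k) δ y := by
  filter_upwards [Ioo_mem_nhds h1 h2] with y hy using stairFn_eq hδ hδ1 k hy.1.le hy.2

theorem exists_stair_branch (_ : δ < 1) (c x : ℝ) :
    ∃ k : ℤ, c + k - 1 + δ < x ∧ x < c + k + 1 :=
  ⟨⌊x - c⌋, by linarith [Int.floor_le (x - c)], by linarith [Int.lt_floor_add_one (x - c)]⟩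

theorem contDiff_stairFn (hδ : 0 < δ) (hδ1 : δ < 1) : ContDiff ℝ ∞ (stairFn c δ) := by
  rw [contDiff_iff_contDiffAt]
  intro x
  obtain ⟨k, h1, h2⟩ := exists_stair_branch hδ1 c x
  exact (contDiffAt_const.add (contDiff_stepFn _ _).contDiffAt).congr_of_eventuallyEq
    (stairFn_eventuallyEq hδ hδ1 k h1 h2)

theorem deriv_stairFn_eq (hδ : 0 < δ) (hδ1 : δ < 1) (k : ℤ) (h1 : c + k - 1 + δ < x)
    (h2 : x < c + k + 1) : deriv (stairFn c δ) x = deriv (stepFn (c + k) δ) x := by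
  rw [(stairFn_eventuallyEq hδ hδ1 k h1 h2).deriv_eq, deriv_const_add]

theorem deriv_stairFn_ne_zero (hδ : 0 < δ) (hδ1 : δ < 1) (h : deriv (stairFn c δ) x ≠ 0) :
    ∃ k : ℤ, c + k ≤ x ∧ x ≤ c + k + δ := by
  obtain ⟨k, h1, h2⟩ := exists_stair_branch hδ1 c x
  rw [deriv_stairFn_eq hδ hδ1 k h1 h2] at h
  exact ⟨k, deriv_stepFn_ne_zero hδ h⟩

/-- This equivariance makes the differential of the staircase a form on ℝ/ℤ and the later integrals
independent of the lifts of cubes. -/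
theorem stairFn_add_int (c δ x : ℝ) (k : ℤ) : stairFn c δ (x + k) = stairFn c δ x + k := by
  unfold stairFn
  rw [show x + k - c = x - c + k by ring, Int.floor_add_intCast, Int.fract_add_intCast]
  push_cast; ring

theorem deriv_stairFn_add_int (c δ x : ℝ) (k : ℤ) :
    deriv (stairFn c δ) (x + k) = deriv (stairFn c δ) x := by
  rw [← deriv_comp_add_const]
  simp_rw [stairFn_add_int]
  rw [deriv_add_const]

theorem stair_stairFn (hδ : 0 < δ) (hδ2 : δ < 1 / 2) :
    Stair (Set.range fun k : ℤ => c + k) δ (stairFn c δ) where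
  smooth := contDiff_stairFn hδ (by linarith)
  supp x h := by
    obtain ⟨k, h1, h2⟩ := deriv_stairFn_ne_zero hδ (by linarith) h
    exact ⟨c + k, ⟨k, rfl⟩, abs_le.2 ⟨by linarith, by linarith⟩⟩
  jump := by
    rintro _ ⟨k, rfl⟩
    simp only
    rw [stairFn_eq hδ (by linarith) k (by linarith) (by linarith), stepFn_of_ge hδ le_rfl,
      stairFn_eq hδ (by linarith) k (by linarith) (by linarith), stepFn_of_le hδ (by linarith)]
    ring

end Stairs

/-! ### Additive functions on cubical chains. -/

section ChainEvaluation

variable {k n : ℕ} {X : Type} {π : (Fin k → ℝ) → X}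

/-- The additive extension to chains of a real function of cubes. -/
def evalC (f : SmoothCube π n → ℝ) : Chain π n →+ ℝ :=
  Finsupp.liftAddHom fun σ => zmultiplesHom ℝ (f σ)

theorem evalC_apply (f : SmoothCube π n → ℝ) (c : Chain π n) :
    evalC f c = c.sum fun σ m => (m : ℝ) * f σ := by
  rw [evalC, Finsupp.liftAddHom_apply]
  exact Finsupp.sum_congr fun σ _ => by simp

@[simp] theorem evalC_chain (f : SmoothCube π n → ℝ) (σ : SmoothCube π n) :
    evalC f σ.chain = f σ := by
  simp [evalC, SmoothCube.chain]

theorem evalC_congr {f g : SmoothCube π n → ℝ} {c : Chain π n} (h : ∀ σ ∈ c.support, f σ = g σ) :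
    evalC f c = evalC g c := by
  rw [evalC_apply, evalC_apply]
  exact Finsupp.sum_congr fun σ hσ => by rw [h σ hσ]

theorem evalC_add_fun (f g : SmoothCube π n → ℝ) (c : Chain π n) :
    evalC (fun σ => f σ + g σ) c = evalC f c + evalC g c := by
  simp only [evalC_apply, mul_add, Finsupp.sum_add]

theorem evalC_neg_fun (f : SmoothCube π n → ℝ) (c : Chain π n) :
    evalC (fun σ => -f σ) c = -evalC f c := by
  simp only [evalC_apply, mul_neg, Finsupp.sum, Finset.sum_neg_distrib]

theorem evalC_sub_fun (f g : SmoothCube π n → ℝ) (c : Chain π n) :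
    evalC (fun σ => f σ - g σ) c = evalC f c - evalC g c := by
  simp only [sub_eq_add_neg, evalC_add_fun, evalC_neg_fun]

@[simp] theorem evalC_zero_fun (c : Chain π n) : evalC (fun _ : SmoothCube π n => (0 : ℝ)) c = 0 := by
  simp [evalC_apply]

theorem evalC_eq_zero {f : SmoothCube π n → ℝ} {c : Chain π n} (h : ∀ σ ∈ c.support, f σ = 0) :
    evalC f c = 0 := by
  rw [evalC_congr (g := fun _ => 0) h, evalC_zero_fun]

theorem evalC_boundary (f : SmoothCube π n → ℝ) (c : Chain π (n + 1)) :
    evalC f (boundary c) = evalC (fun σ => ∑ i : Fin (n + 1), (-1 : ℝ) ^ (i : ℕ) *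
      (f (σ.face i 1) - f (σ.face i 0))) c := by
  have : (evalC f).comp boundary = evalC (fun σ => ∑ i : Fin (n + 1), (-1 : ℝ) ^ (i : ℕ) *
      (f (σ.face i 1) - f (σ.face i 0))) := by
    refine Finsupp.addHom_ext' fun σ => ?_
    ext
    have h : boundary (Finsupp.single σ (1 : ℤ)) =
        ∑ i : Fin (n + 1), (-1 : ℤ) ^ (i : ℕ) • ((σ.face i 1).chain - (σ.face i 0).chain) := by
      simp [boundary]
    simp only [AddMonoidHom.comp_apply, Finsupp.singleAddHom_apply, h, map_sum, map_zsmul, map_sub,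
      evalC_chain]
    rw [show Finsupp.single σ (1 : ℤ) = σ.chain from rfl, evalC_chain]
    exact Finset.sum_congr rfl fun i _ => by simp
  exact DFunLike.congr_fun this c

theorem evalC_degenerate {f : SmoothCube π n → ℝ} (hf : ∀ σ, σ.IsDegenerate → f σ = 0)
    {c : Chain π n} (hc : c ∈ degenerate π n) : evalC f c = 0 := by
  induction hc using AddSubgroup.closure_induction with
  | mem x hx => obtain ⟨σ, hσ, rfl⟩ := hx; simp [hf σ hσ]
  | zero => simp
  | add x y _ _ hx hy => rw [map_add, hx, hy, add_zero]
  | neg x _ hx => rw [map_neg, hx, neg_zero]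

theorem evalC_eq_of_sub_mem {f : SmoothCube π n → ℝ} (hf : ∀ σ, σ.IsDegenerate → f σ = 0)
    {c c' : Chain π n} (hc : c - c' ∈ degenerate π n) : evalC f c = evalC f c' := by
  have := evalC_degenerate hf hc
  rwa [map_sub, sub_eq_zero] at this

theorem evalC_mapDomain {l k' : ℕ} {X' : Type} {π' : (Fin k' → ℝ) → X'}
    (g : SmoothCube π n → SmoothCube π' l) (f : SmoothCube π' l → ℝ) (c : Chain π n) :
    evalC f (Finsupp.mapDomain g c) = evalC (fun σ => f (g σ)) c := by
  rw [evalC_apply, evalC_apply, Finsupp.sum_mapDomain_index] <;> intros <;> push_cast <;> ring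

theorem evalC_swap {k' n' : ℕ} {X' : Type} {π' : (Fin k' → ℝ) → X'}
    (f : SmoothCube π n → SmoothCube π' n' → ℝ) (c : Chain π n) (c' : Chain π' n') :
    evalC (fun σ => evalC (f σ) c') c = evalC (fun σ' => evalC (fun σ => f σ σ') c) c' := by
  simp only [evalC_apply, Finsupp.sum, Finset.mul_sum]
  rw [Finset.sum_comm]
  refine Finset.sum_congr rfl fun _ _ => Finset.sum_congr rfl fun _ _ => by ring

end ChainEvaluation

/-! ### Lifts of cubes and their ambiguity by lattice vectors. -/

section Lattices

open Set

variable {k n : ℕ} {X : Type} {π : (Fin k → ℝ) → X}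

/-- The fibres of `π` are the orbits of the translations by integers in the coordinates in `per`. -/
def IsLatticeProj (π : (Fin k → ℝ) → X) (per : Fin k → Prop) : Prop :=
  ∀ v v', π v = π v' ↔ ∃ m : Fin k → ℤ, (∀ j, ¬ per j → m j = 0) ∧ ∀ j, v j = v' j + m j

def perY : Fin 3 → Prop := fun j => j ≠ 1

def perM : Fin 4 → Prop := fun j => j = 1 ∨ j = 3

theorem circle_coe_eq_iff (x y : ℝ) :
    (x : UnitAddCircle) = (y : UnitAddCircle) ↔ ∃ m : ℤ, x = y + m := by
  rw [← sub_eq_zero, ← AddCircle.coe_sub, AddCircle.coe_eq_zero_iff]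
  constructor
  · rintro ⟨n, h⟩; exact ⟨n, by simp at h; linarith⟩
  · rintro ⟨n, h⟩; exact ⟨n, by simp; linarith⟩

theorem isLatticeProj_projY : IsLatticeProj projY perY := by
  intro v v'
  simp only [projY, Prod.mk.injEq, circle_coe_eq_iff, perY]
  constructor
  · rintro ⟨⟨a, ha⟩, hx, ⟨b, hb⟩⟩
    refine ⟨![a, 0, b], fun j hj => ?_, fun j => ?_⟩
    · rw [not_not.1 hj]; rfl
    · fin_cases j <;> simp [*]
  · rintro ⟨m, hm, h⟩
    exact ⟨⟨m 0, h 0⟩, by simp [h 1, hm 1], ⟨m 2, h 2⟩⟩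

theorem isLatticeProj_projM : IsLatticeProj projM perM := by
  intro v v'
  simp only [projM, Prod.mk.injEq, circle_coe_eq_iff, perM]
  constructor
  · rintro ⟨hs, ⟨a, ha⟩, hx, ⟨b, hb⟩⟩
    refine ⟨![0, a, 0, b], fun j hj => ?_, fun j => ?_⟩
    · fin_cases j <;> simp at hj ⊢
    · fin_cases j <;> simp [*]
  · rintro ⟨m, hm, h⟩
    exact ⟨by simp [h 0, hm 0 (by decide)], ⟨m 1, h 1⟩, by simp [h 2, hm 2 (by decide)], ⟨m 3, h 3⟩⟩

/-- Two lifts of a cube differ by a lattice vector. -/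
def LiftEq (per : Fin k → Prop) (A A' : (Fin n → ℝ) → (Fin k → ℝ)) : Prop :=
  ∃ m : Fin k → ℤ, (∀ j, ¬ per j → m j = 0) ∧ ∀ u ∈ Icc (0 : Fin n → ℝ) 1, ∀ j, A u j = A' u j + m j

theorem LiftEq.refl (per : Fin k → Prop) (A : (Fin n → ℝ) → (Fin k → ℝ)) : LiftEq per A A :=
  ⟨0, by simp, by simp⟩

/-- The difference of the two lifts is continuous on the cube, which is connected, and its
components are integer valued; so it is constant. -/
theorem liftEq_of_proj_eq {per : Fin k → Prop} (hπ : IsLatticeProj π per)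
    {A A' : (Fin n → ℝ) → (Fin k → ℝ)} (hA : Continuous A) (hA' : Continuous A')
    (h : ∀ u ∈ Icc (0 : Fin n → ℝ) 1, π (A u) = π (A' u)) : LiftEq per A A' := by
  have hd : ∀ u ∈ Icc (0 : Fin n → ℝ) 1, ∃ m : Fin k → ℤ, (∀ j, ¬ per j → m j = 0) ∧
      ∀ j, A u j = A' u j + m j := fun u hu => (hπ _ _).1 (h u hu)
  obtain ⟨m, hm0, hm⟩ := hd 0 ⟨le_rfl, zero_le_one⟩
  refine ⟨m, hm0, fun u hu j => ?_⟩
  have hconn : IsPreconnected (Icc (0 : Fin n → ℝ) 1) := (convex_Icc _ _).isPreconnected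
  have hcont : ContinuousOn (fun u => A u j - A' u j) (Icc 0 1) :=
    (((continuous_apply j).comp hA).sub ((continuous_apply j).comp hA')).continuousOn
  have := hconn.image _ hcont
  have hsub : (fun u => A u j - A' u j) '' Icc 0 1 ⊆ range ((↑) : ℤ → ℝ) := by
    rintro _ ⟨v, hv, rfl⟩
    obtain ⟨m', -, hm'⟩ := hd v hv
    exact ⟨m' j, by simp [hm' j]⟩
  have hss : ((fun u => A u j - A' u j) '' Icc 0 1).Subsingleton :=
    (countable_range _).isTotallyDisconnected _ hsub this
  have h1 := hss ⟨u, hu, rfl⟩ ⟨0, ⟨le_rfl, zero_le_one⟩, rfl⟩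
  simp only [hm j] at h1
  linarith

theorem SmoothCube.lift_smooth (σ : SmoothCube π n) : ContDiff ℝ ∞ σ.lift := σ.smooth.choose_spec.1

theorem SmoothCube.lift_spec (σ : SmoothCube π n) (u : Fin n → unitInterval) :
    σ.toFun u = π (σ.lift fun i => (u i : ℝ)) := σ.smooth.choose_spec.2 u

/-- A point of the unit cube of `ℝⁿ`, as a function to the unit interval. -/
def toCube (u : Fin n → ℝ) (hu : u ∈ Icc (0 : Fin n → ℝ) 1) : Fin n → unitInterval :=
  fun i => ⟨u i, hu.1 i, hu.2 i⟩

theorem SmoothCube.proj_lift (σ : SmoothCube π n) {u : Fin n → ℝ} (hu : u ∈ Icc (0 : Fin n → ℝ) 1) :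
    π (σ.lift u) = σ.toFun (toCube u hu) := (σ.lift_spec (toCube u hu)).symm

theorem SmoothCube.liftEq {per : Fin k → Prop} (hπ : IsLatticeProj π per) (σ : SmoothCube π n)
    {A : (Fin n → ℝ) → (Fin k → ℝ)} (hA : Continuous A)
    (h : ∀ u : Fin n → unitInterval, σ.toFun u = π (A fun i => (u i : ℝ))) :
    LiftEq per σ.lift A :=
  liftEq_of_proj_eq hπ σ.lift_smooth.continuous hA fun u hu => by
    rw [σ.proj_lift hu, h]; rfl

theorem SmoothCube.liftEq_ofLift {per : Fin k → Prop} (hπ : IsLatticeProj π per)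
    {A : (Fin n → ℝ) → (Fin k → ℝ)} (hA : ContDiff ℝ ∞ A) :
    LiftEq per (SmoothCube.ofLift π A hA).lift A :=
  SmoothCube.liftEq hπ _ hA.continuous fun _ => rfl

theorem SmoothCube.liftEq_face {per : Fin k → Prop} (hπ : IsLatticeProj π per)
    (σ : SmoothCube π (n + 1)) (i : Fin (n + 1)) (e : unitInterval) :
    LiftEq per (σ.face i e).lift fun u => σ.lift (i.insertNth (e : ℝ) u) := by
  refine SmoothCube.liftEq hπ _ (σ.lift_smooth.continuous.comp (contDiff_insertNth i e).continuous)
    fun u => ?_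
  have : (fun j => ((i.insertNth e u : Fin (n + 1) → unitInterval) j : ℝ)) =
      i.insertNth (e : ℝ) fun j => (u j : ℝ) := by
    funext j
    refine Fin.succAboveCases i ?_ (fun m => ?_) j <;> simp
  rw [← this, ← σ.lift_spec]
  rfl

/-- The lifts are related on the closed cube only, so derivatives are compared at interior points.
For integrals this is enough, the boundary being a null set. -/
theorem LiftEq.fderiv_eq {per : Fin k → Prop} {A A' : (Fin n → ℝ) → (Fin k → ℝ)}
    (h : LiftEq per A A') {u : Fin n → ℝ} (hu : ∀ i, u i ∈ Ioo (0 : ℝ) 1) :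
    fderiv ℝ A u = fderiv ℝ A' u := by
  obtain ⟨m, -, hm⟩ := h
  have hn : (univ.pi fun _ : Fin n => Ioo (0 : ℝ) 1) ∈ nhds u :=
    (isOpen_set_pi finite_univ fun _ _ => isOpen_Ioo).mem_nhds fun i _ => hu i
  have : A =ᶠ[nhds u] fun v => A' v + fun j => (m j : ℝ) := by
    filter_upwards [hn] with v hv
    funext j
    exact hm v ⟨fun i => (hv i trivial).1.le, fun i => (hv i trivial).2.le⟩ j
  rw [this.fderiv_eq, fderiv_add_const]

/-- A degenerate cube has a vanishing partial derivative. -/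
theorem SmoothCube.IsDegenerate.exists_fderiv_eq_zero {per : Fin k → Prop}
    (hπ : IsLatticeProj π per) {σ : SmoothCube π n} (hσ : σ.IsDegenerate) :
    ∃ i, ∀ u : Fin n → ℝ, (∀ i, u i ∈ Ioo (0 : ℝ) 1) → fderiv ℝ σ.lift u (Pi.single i 1) = 0 := by
  classical
  obtain ⟨i, hi⟩ := hσ
  refine ⟨i, fun u hu => ?_⟩
  have hup : ContDiff ℝ ∞ fun u : Fin n → ℝ => Function.update u i 0 := by
    rw [contDiff_pi]
    intro j
    rcases eq_or_ne j i with rfl | hj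
    · simpa using contDiff_const
    · simpa [hj] using contDiff_apply ℝ ℝ j
  -- Freezing the i-th variable at 0 gives another lift of the same degenerate cube, and this lift
  -- has no derivative in that variable.
  have hl : LiftEq per σ.lift fun u => σ.lift (Function.update u i 0) := by
    refine SmoothCube.liftEq hπ σ (σ.lift_smooth.continuous.comp hup.continuous) fun u => ?_
    rw [hi u (Function.update u i 0) fun j hj => by simp [hj], σ.lift_spec]
    congr 2
    funext j
    rcases eq_or_ne j i with rfl | hj <;> simp [*]
  rw [hl.fderiv_eq hu]
  have h1 : HasFDerivAt (fun u : Fin n → ℝ => Function.update u i 0)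
      (fderiv ℝ (fun u : Fin n → ℝ => Function.update u i 0) u) u :=
    (hup.differentiable (by simp) u).hasFDerivAt
  have h2 : fderiv ℝ (fun u : Fin n → ℝ => Function.update u i 0) u (Pi.single i 1) = 0 := by
    have hline : HasDerivAt (fun s : ℝ => u + s • (Pi.single i (1 : ℝ) : Fin n → ℝ))
        (Pi.single i 1) 0 := by
      simpa using ((hasDerivAt_id (0 : ℝ)).smul_const (Pi.single i (1 : ℝ) : Fin n → ℝ)).const_add u
    have h3 : HasDerivAt (fun s : ℝ => Function.update (u + s • (Pi.single i (1 : ℝ) : Fin n → ℝ)) i 0)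
        (fderiv ℝ (fun u : Fin n → ℝ => Function.update u i 0) u (Pi.single i 1)) 0 := by
      have h1' : HasFDerivAt (fun u : Fin n → ℝ => Function.update u i 0)
          (fderiv ℝ (fun u : Fin n → ℝ => Function.update u i 0) u)
          (u + (0 : ℝ) • (Pi.single i (1 : ℝ) : Fin n → ℝ)) := by
        rw [zero_smul, add_zero]; exact h1
      exact h1'.comp_hasDerivAt (0 : ℝ) hline
    have h4 : (fun s : ℝ => Function.update (u + s • (Pi.single i (1 : ℝ) : Fin n → ℝ)) i 0) =
        fun _ => Function.update u i 0 := by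
      funext s j
      rcases eq_or_ne j i with rfl | hj <;> simp [*]
    rw [h4] at h3
    exact h3.unique (hasDerivAt_const _ _)
  have h5 := fderiv_comp u (σ.lift_smooth.differentiable (by simp) _) h1.differentiableAt
  rw [Function.comp_def] at h5
  rw [h5, ContinuousLinearMap.comp_apply, h2, map_zero]

end Lattices

/-! ### Integrals over products of two cubes, and Stokes for them. -/

section Pairings

open MeasureTheory Set

variable {k n p q : ℕ} {X : Type} {π : (Fin k → ℝ) → X} {per : Fin k → Prop}

theorem setIntegral_cube_congr {f g : (Fin n → ℝ) → ℝ}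
    (h : ∀ y, (∀ i, y i ∈ Ioo (0 : ℝ) 1) → f y = g y) :
    ∫ y in Icc (0 : Fin n → ℝ) 1, f y = ∫ y in Icc (0 : Fin n → ℝ) 1, g y := by
  have hae := (Measure.univ_pi_Ioo_ae_eq_Icc (μ := fun _ : Fin n => (volume : Measure ℝ))
    (f := fun _ => 0) (g := fun _ => 1))
  have h1 : (univ.pi fun _ : Fin n => Ioo (0 : ℝ) 1) =ᵐ[volume] Icc (0 : Fin n → ℝ) 1 := hae
  rw [← setIntegral_congr_set h1, ← setIntegral_congr_set h1]
  refine setIntegral_congr_fun (MeasurableSet.univ_pi fun _ => measurableSet_Ioo) fun y hy => ?_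
  exact h y fun i => hy i trivial

theorem interior_mem_cube {y : Fin n → ℝ} (hy : ∀ i, y i ∈ Ioo (0 : ℝ) 1) :
    y ∈ Icc (0 : Fin n → ℝ) 1 := ⟨fun i => (hy i).1.le, fun i => (hy i).2.le⟩

/-- The system of functions `H` respects the translations by integers in the coordinates in
`per`. -/
structure StairSys (per : Fin k → Prop) (ι : Fin n → Fin k) (H : Fin n → ℝ → ℝ) : Prop where
  smooth : ∀ j, ContDiff ℝ ∞ (H j)
  add_int : ∀ j, per (ι j) → ∀ (x : ℝ) (m : ℤ), H j (x + m) = H j x + m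

/-- The map with components `H_j (G_{ι j})`. -/
def stairMap (H : Fin n → ℝ → ℝ) (ι : Fin n → Fin k) {m : ℕ} (G : (Fin m → ℝ) → (Fin k → ℝ)) :
    (Fin m → ℝ) → (Fin n → ℝ) := fun y j => H j (G y (ι j))

/-- The map `(u, v) ↦ A u - B v`. -/
def diffLift (A : (Fin p → ℝ) → (Fin k → ℝ)) (B : (Fin q → ℝ) → (Fin k → ℝ)) :
    (Fin (p + q) → ℝ) → (Fin k → ℝ) :=
  fun y => A (fun i => y (Fin.castAdd q i)) - B (fun i => y (Fin.natAdd p i))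

theorem contDiff_diffLift {A : (Fin p → ℝ) → (Fin k → ℝ)} {B : (Fin q → ℝ) → (Fin k → ℝ)}
    (hA : ContDiff ℝ ∞ A) (hB : ContDiff ℝ ∞ B) : ContDiff ℝ ∞ (diffLift A B) :=
  (hA.comp (contDiff_pi.2 fun _ => contDiff_apply ℝ ℝ _)).sub
    (hB.comp (contDiff_pi.2 fun _ => contDiff_apply ℝ ℝ _))

theorem contDiff_stairMap {H : Fin n → ℝ → ℝ} (hH : ∀ j, ContDiff ℝ ∞ (H j)) {ι : Fin n → Fin k}
    {m : ℕ} {G : (Fin m → ℝ) → (Fin k → ℝ)} (hG : ContDiff ℝ ∞ G) :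
    ContDiff ℝ ∞ (stairMap H ι G) :=
  contDiff_pi.2 fun j => (hH j).comp (contDiff_pi.1 hG _)

theorem LiftEq.diffLift {A A' : (Fin p → ℝ) → (Fin k → ℝ)} {B B' : (Fin q → ℝ) → (Fin k → ℝ)}
    (hA : LiftEq per A A') (hB : LiftEq per B B') :
    LiftEq per (diffLift A B) (diffLift A' B') := by
  obtain ⟨m, h1, h2⟩ := hA
  obtain ⟨m', h1', h2'⟩ := hB
  refine ⟨m - m', fun j hj => by simp [h1 j hj, h1' j hj], fun u hu j => ?_⟩
  simp only [PFH.diffLift, Pi.sub_apply]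
  rw [h2 _ ⟨fun i => hu.1 _, fun i => hu.2 _⟩, h2' _ ⟨fun i => hu.1 _, fun i => hu.2 _⟩]
  push_cast; ring

theorem LiftEq.stairMap {H : Fin n → ℝ → ℝ} {ι : Fin n → Fin k} (hH : StairSys per ι H) {m : ℕ}
    {G G' : (Fin m → ℝ) → (Fin k → ℝ)} (h : LiftEq per G G') :
    LiftEq (fun j => per (ι j)) (stairMap H ι G) (stairMap H ι G') := by
  obtain ⟨a, h1, h2⟩ := h
  refine ⟨fun j => a (ι j), fun j hj => h1 _ hj, fun u hu j => ?_⟩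
  simp only [PFH.stairMap]
  rw [h2 u hu]
  by_cases hj : per (ι j)
  · exact hH.add_int j hj _ _
  · simp [h1 _ hj]

theorem LiftEq.gradMat_eq {A A' : (Fin n → ℝ) → (Fin k → ℝ)}
    (h : LiftEq per A A') {u : Fin n → ℝ} (hu : ∀ i, u i ∈ Ioo (0 : ℝ) 1) :
    gradMat A u = gradMat A' u := by
  simp only [gradMat, h.fderiv_eq hu]

/-- The coordinate 0 enters undifferentiated, so it must not be one of the periodic ones; all other
coordinates enter through derivatives, which do not see integer shifts. -/
theorem LiftEq.leadInt_eq {per : Fin (n + 1) → Prop} {A A' : (Fin n → ℝ) → (Fin (n + 1) → ℝ)}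
    (h : LiftEq per A A') (h0 : ¬ per 0) : leadInt A = leadInt A' := by
  refine setIntegral_cube_congr fun y hy => ?_
  rw [h.gradMat_eq hy]
  obtain ⟨m, h1, h2⟩ := h
  rw [h2 y (interior_mem_cube hy) 0, h1 0 h0]
  simp

theorem LiftEq.integral_det_eq {per : Fin n → Prop} {A A' : (Fin n → ℝ) → (Fin n → ℝ)}
    (h : LiftEq per A A') : ∫ y in Icc (0 : Fin n → ℝ) 1, (gradMat A y).det =
      ∫ y in Icc (0 : Fin n → ℝ) 1, (gradMat A' y).det :=
  setIntegral_cube_congr fun y hy => by rw [h.gradMat_eq hy]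

theorem fderiv_diffLift {A : (Fin p → ℝ) → (Fin k → ℝ)} {B : (Fin q → ℝ) → (Fin k → ℝ)}
    (hA : Differentiable ℝ A) (hB : Differentiable ℝ B) (y v : Fin (p + q) → ℝ) :
    fderiv ℝ (diffLift A B) y v =
      fderiv ℝ A (fun i => y (Fin.castAdd q i)) (fun i => v (Fin.castAdd q i)) -
        fderiv ℝ B (fun i => y (Fin.natAdd p i)) (fun i => v (Fin.natAdd p i)) := by
  have hl : HasFDerivAt (fun (y : Fin (p + q) → ℝ) (i : Fin p) => y (Fin.castAdd q i))
      (ContinuousLinearMap.pi fun i => ContinuousLinearMap.proj (Fin.castAdd q i)) y :=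
    hasFDerivAt_pi.2 fun i =>
      (ContinuousLinearMap.proj (R := ℝ) (φ := fun _ : Fin (p + q) => ℝ) _).hasFDerivAt
  have hr : HasFDerivAt (fun (y : Fin (p + q) → ℝ) (i : Fin q) => y (Fin.natAdd p i))
      (ContinuousLinearMap.pi fun i => ContinuousLinearMap.proj (Fin.natAdd p i)) y :=
    hasFDerivAt_pi.2 fun i =>
      (ContinuousLinearMap.proj (R := ℝ) (φ := fun _ : Fin (p + q) => ℝ) _).hasFDerivAt
  have h := ((hA fun i => y (Fin.castAdd q i)).hasFDerivAt.comp y hl).sub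
    ((hB fun i => y (Fin.natAdd p i)).hasFDerivAt.comp y hr)
  have h' : HasFDerivAt (diffLift A B) _ y := h
  rw [h'.fderiv]
  rfl

theorem fderiv_diffLift_left {A : (Fin p → ℝ) → (Fin k → ℝ)} {B : (Fin q → ℝ) → (Fin k → ℝ)}
    (hA : Differentiable ℝ A) (hB : Differentiable ℝ B) (y : Fin (p + q) → ℝ) (i : Fin p) :
    fderiv ℝ (diffLift A B) y (Pi.single (Fin.castAdd q i) 1) =
      fderiv ℝ A (fun i => y (Fin.castAdd q i)) (Pi.single i 1) := by
  rw [fderiv_diffLift hA hB]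
  have h1 : (fun j => (Pi.single (Fin.castAdd q i) (1 : ℝ) : Fin (p + q) → ℝ) (Fin.castAdd q j)) =
      Pi.single i 1 := by
    funext j; simp [Pi.single_apply]
  have h2 : (fun j => (Pi.single (Fin.castAdd q i) (1 : ℝ) : Fin (p + q) → ℝ) (Fin.natAdd p j)) =
      0 := by
    funext j
    have : Fin.natAdd p j ≠ Fin.castAdd q i := by
      intro h; have := congrArg Fin.val h; simp at this; omega
    simp [this]
  rw [h1, h2, map_zero, sub_zero]

theorem fderiv_diffLift_right {A : (Fin p → ℝ) → (Fin k → ℝ)} {B : (Fin q → ℝ) → (Fin k → ℝ)}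
    (hA : Differentiable ℝ A) (hB : Differentiable ℝ B) (y : Fin (p + q) → ℝ) (i : Fin q) :
    fderiv ℝ (diffLift A B) y (Pi.single (Fin.natAdd p i) 1) =
      -fderiv ℝ B (fun i => y (Fin.natAdd p i)) (Pi.single i 1) := by
  rw [fderiv_diffLift hA hB]
  have h1 : (fun j => (Pi.single (Fin.natAdd p i) (1 : ℝ) : Fin (p + q) → ℝ) (Fin.natAdd p j)) =
      Pi.single i 1 := by
    funext j; simp [Pi.single_apply]
  have h2 : (fun j => (Pi.single (Fin.natAdd p i) (1 : ℝ) : Fin (p + q) → ℝ) (Fin.castAdd q j)) =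
      0 := by
    funext j
    have : Fin.castAdd q j ≠ Fin.natAdd p i := by
      intro h; have := congrArg Fin.val h; simp at this; omega
    simp [this]
  rw [h1, h2, map_zero, zero_sub]

theorem gradMat_stairMap {H : Fin n → ℝ → ℝ} (hH : ∀ j, ContDiff ℝ ∞ (H j)) {ι : Fin n → Fin k}
    {m : ℕ} {G : (Fin m → ℝ) → (Fin k → ℝ)} (hG : ContDiff ℝ ∞ G) (y : Fin m → ℝ) :
    gradMat (stairMap H ι G) y =
      Matrix.of fun i j => deriv (H j) (G y (ι j)) * fderiv ℝ G y (Pi.single i 1) (ι j) := by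
  ext i j
  have hG' : ContDiff ℝ ∞ fun y j => G y (ι j) := contDiff_pi.2 fun j => contDiff_pi.1 hG _
  have h1 := fderiv_comp_pi (fun j => (hH j).differentiable (by simp))
    (hG'.differentiable (by simp)) y (Pi.single i 1) j
  simp only [gradMat, Matrix.of_apply]
  refine h1.trans ?_
  congr 1
  have h2 : HasFDerivAt (fun y j => G y (ι j))
      (ContinuousLinearMap.pi fun j => (ContinuousLinearMap.proj (ι j)).comp (fderiv ℝ G y)) y :=
    hasFDerivAt_pi.2 fun j =>
      hasFDerivAt_pi'.1 (hG.differentiable (by simp) y).hasFDerivAt (ι j)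
  rw [h2.fderiv]
  rfl

/-- The integral of `d(H₀ G₀) ∧ … ` over the product of two cubes, `G = σ - σ'`. -/
def detPair (H : Fin (p + q) → ℝ → ℝ) (ι : Fin (p + q) → Fin k) (σ : SmoothCube π p)
    (σ' : SmoothCube π q) : ℝ :=
  ∫ y in Icc (0 : Fin (p + q) → ℝ) 1, (gradMat (stairMap H ι (diffLift σ.lift σ'.lift)) y).det

/-- The integral of `(H₀ G₀) d(H₁ G₁) ∧ …` over the product of two cubes, `G = σ - σ'`. -/
def leadPair (H : Fin (p + q + 1) → ℝ → ℝ) (ι : Fin (p + q + 1) → Fin k) (σ : SmoothCube π p)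
    (σ' : SmoothCube π q) : ℝ :=
  leadInt (stairMap H ι (diffLift σ.lift σ'.lift))

theorem detPair_eq {H : Fin (p + q) → ℝ → ℝ} {ι : Fin (p + q) → Fin k} (hH : StairSys per ι H)
    {σ : SmoothCube π p} {σ' : SmoothCube π q} {A : (Fin p → ℝ) → (Fin k → ℝ)}
    {B : (Fin q → ℝ) → (Fin k → ℝ)} (hA : LiftEq per σ.lift A) (hB : LiftEq per σ'.lift B) :
    detPair H ι σ σ' =
      ∫ y in Icc (0 : Fin (p + q) → ℝ) 1, (gradMat (stairMap H ι (diffLift A B)) y).det :=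
  ((hA.diffLift hB).stairMap hH).integral_det_eq

theorem leadPair_eq {H : Fin (p + q + 1) → ℝ → ℝ} {ι : Fin (p + q + 1) → Fin k}
    (hH : StairSys per ι H) (h0 : ¬ per (ι 0))
    {σ : SmoothCube π p} {σ' : SmoothCube π q} {A : (Fin p → ℝ) → (Fin k → ℝ)}
    {B : (Fin q → ℝ) → (Fin k → ℝ)} (hA : LiftEq per σ.lift A) (hB : LiftEq per σ'.lift B) :
    leadPair H ι σ σ' = leadInt (stairMap H ι (diffLift A B)) :=
  ((hA.diffLift hB).stairMap hH).leadInt_eq h0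

theorem leadInt_eq_zero_of_row {G : (Fin n → ℝ) → (Fin (n + 1) → ℝ)} (i : Fin n)
    (h : ∀ y, (∀ i, y i ∈ Ioo (0 : ℝ) 1) → ∀ j, gradMat G y i j = 0) : leadInt G = 0 := by
  have : leadInt G = ∫ y in Icc (0 : Fin n → ℝ) 1, (0 : ℝ) :=
    setIntegral_cube_congr fun y hy => by
      rw [Matrix.det_eq_zero_of_row_eq_zero i fun j => h y hy j.succ, mul_zero]
  rw [this, integral_zero]

/-- A variable on which a cube does not depend gives a zero row of the gradient matrix. Hence these
pairings descend to chains modulo degenerate ones. -/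
theorem leadPair_degenerate_left (hπ : IsLatticeProj π per) {H : Fin (p + q + 1) → ℝ → ℝ}
    {ι : Fin (p + q + 1) → Fin k} (hH : ∀ j, ContDiff ℝ ∞ (H j)) {σ : SmoothCube π p}
    (hσ : σ.IsDegenerate) (σ' : SmoothCube π q) : leadPair H ι σ σ' = 0 := by
  obtain ⟨i, hi⟩ := hσ.exists_fderiv_eq_zero hπ
  refine leadInt_eq_zero_of_row (Fin.castAdd q i) fun y hy j => ?_
  rw [gradMat_stairMap hH (contDiff_diffLift σ.lift_smooth σ'.lift_smooth), Matrix.of_apply,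
    fderiv_diffLift_left (σ.lift_smooth.differentiable (by simp))
      (σ'.lift_smooth.differentiable (by simp)), hi _ fun i => hy _]
  simp

theorem leadPair_degenerate_right (hπ : IsLatticeProj π per) {H : Fin (p + q + 1) → ℝ → ℝ}
    {ι : Fin (p + q + 1) → Fin k} (hH : ∀ j, ContDiff ℝ ∞ (H j)) (σ : SmoothCube π p)
    {σ' : SmoothCube π q} (hσ : σ'.IsDegenerate) : leadPair H ι σ σ' = 0 := by
  obtain ⟨i, hi⟩ := hσ.exists_fderiv_eq_zero hπ
  refine leadInt_eq_zero_of_row (Fin.natAdd p i) fun y hy j => ?_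
  rw [gradMat_stairMap hH (contDiff_diffLift σ.lift_smooth σ'.lift_smooth), Matrix.of_apply,
    fderiv_diffLift_right (σ.lift_smooth.differentiable (by simp))
      (σ'.lift_smooth.differentiable (by simp)), hi _ fun i => hy _]
  simp

/-- Stokes on the product cube. Faces of a product are products of a face of one factor with the
other factor, and the faces of the second factor carry the extra sign (-1)^p with p the dimension of
the first. The sign is trivial for p = 2 and produces the minus in `detPair_one_two`. -/
theorem detPair_two_two (hπ : IsLatticeProj π per) {H : Fin 4 → ℝ → ℝ} {ι : Fin 4 → Fin k}
    (hH : StairSys per ι H) (h0 : ¬ per (ι 0)) (σ σ' : SmoothCube π 2) :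
    detPair (p := 2) (q := 2) H ι σ σ' =
      (∑ i : Fin 2, (-1 : ℝ) ^ (i : ℕ) * (leadPair (p := 1) (q := 2) H ι (σ.face i 1) σ' -
        leadPair (p := 1) (q := 2) H ι (σ.face i 0) σ')) +
      ∑ i : Fin 2, (-1 : ℝ) ^ (i : ℕ) * (leadPair (p := 2) (q := 1) H ι σ (σ'.face i 1) -
        leadPair (p := 2) (q := 1) H ι σ (σ'.face i 0)) := by
  have hS := integral_det_gradMat (contDiff_stairMap hH.smooth (ι := ι)
    (contDiff_diffLift (p := 2) (q := 2) σ.lift_smooth σ'.lift_smooth))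
  have hl : ∀ (i : Fin 2) (e : unitInterval), leadPair (p := 1) (q := 2) H ι (σ.face i e) σ' =
      leadInt (n := 3) fun y => stairMap H ι (diffLift (p := 2) (q := 2) σ.lift σ'.lift)
        ((Fin.castAdd 2 i : Fin 4).insertNth (e : ℝ) y) := by
    intro i e
    rw [leadPair_eq hH h0 (σ.liftEq_face hπ i e) (LiftEq.refl per _)]
    congr 1
    funext y j
    refine congrArg (H j) (congrArg₂ (· - ·) (congrFun (congrArg σ.lift ?_) _)
      (congrFun (congrArg σ'.lift ?_) _)) <;>
    · funext l; fin_cases i <;> fin_cases l <;> rfl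
  have hr : ∀ (i : Fin 2) (e : unitInterval), leadPair (p := 2) (q := 1) H ι σ (σ'.face i e) =
      leadInt (n := 3) fun y => stairMap H ι (diffLift (p := 2) (q := 2) σ.lift σ'.lift)
        ((Fin.natAdd 2 i : Fin 4).insertNth (e : ℝ) y) := by
    intro i e
    rw [leadPair_eq hH h0 (LiftEq.refl per _) (σ'.liftEq_face hπ i e)]
    congr 1
    funext y j
    refine congrArg (H j) (congrArg₂ (· - ·) (congrFun (congrArg σ.lift ?_) _)
      (congrFun (congrArg σ'.lift ?_) _)) <;>
    · funext l; fin_cases i <;> fin_cases l <;> rfl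
  refine hS.trans ?_
  rw [Fin.sum_univ_four]
  simp only [Fin.sum_univ_two, hl, hr]
  simp
  ring

theorem detPair_one_two (hπ : IsLatticeProj π per) {H : Fin 3 → ℝ → ℝ} {ι : Fin 3 → Fin k}
    (hH : StairSys per ι H) (h0 : ¬ per (ι 0)) (σ : SmoothCube π 1) (σ' : SmoothCube π 2) :
    detPair (p := 1) (q := 2) H ι σ σ' =
      (∑ i : Fin 1, (-1 : ℝ) ^ (i : ℕ) * (leadPair (p := 0) (q := 2) H ι (σ.face i 1) σ' -
        leadPair (p := 0) (q := 2) H ι (σ.face i 0) σ')) -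
      ∑ i : Fin 2, (-1 : ℝ) ^ (i : ℕ) * (leadPair (p := 1) (q := 1) H ι σ (σ'.face i 1) -
        leadPair (p := 1) (q := 1) H ι σ (σ'.face i 0)) := by
  have hS := integral_det_gradMat (contDiff_stairMap hH.smooth (ι := ι)
    (contDiff_diffLift (p := 1) (q := 2) σ.lift_smooth σ'.lift_smooth))
  have hl : ∀ (i : Fin 1) (e : unitInterval), leadPair (p := 0) (q := 2) H ι (σ.face i e) σ' =
      leadInt (n := 2) fun y => stairMap H ι (diffLift (p := 1) (q := 2) σ.lift σ'.lift)
        ((Fin.castAdd 2 i : Fin 3).insertNth (e : ℝ) y) := by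
    intro i e
    rw [leadPair_eq hH h0 (σ.liftEq_face hπ i e) (LiftEq.refl per _)]
    congr 1
    funext y j
    refine congrArg (H j) (congrArg₂ (· - ·) (congrFun (congrArg σ.lift ?_) _)
      (congrFun (congrArg σ'.lift ?_) _)) <;>
    · funext l; fin_cases i <;> fin_cases l <;> rfl
  have hr : ∀ (i : Fin 2) (e : unitInterval), leadPair (p := 1) (q := 1) H ι σ (σ'.face i e) =
      leadInt (n := 2) fun y => stairMap H ι (diffLift (p := 1) (q := 2) σ.lift σ'.lift)
        ((Fin.natAdd 1 i : Fin 3).insertNth (e : ℝ) y) := by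
    intro i e
    rw [leadPair_eq hH h0 (LiftEq.refl per _) (σ'.liftEq_face hπ i e)]
    congr 1
    funext y j
    refine congrArg (H j) (congrArg₂ (· - ·) (congrFun (congrArg σ.lift ?_) _)
      (congrFun (congrArg σ'.lift ?_) _)) <;>
    · funext l; fin_cases i <;> fin_cases l <;> rfl
  refine hS.trans ?_
  rw [Fin.sum_univ_three]
  simp only [Fin.sum_univ_two, Fin.sum_univ_one, hl, hr]
  simp
  ring

theorem detPair_two_one (hπ : IsLatticeProj π per) {H : Fin 3 → ℝ → ℝ} {ι : Fin 3 → Fin k}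
    (hH : StairSys per ι H) (h0 : ¬ per (ι 0)) (σ : SmoothCube π 2) (σ' : SmoothCube π 1) :
    detPair (p := 2) (q := 1) H ι σ σ' =
      (∑ i : Fin 2, (-1 : ℝ) ^ (i : ℕ) * (leadPair (p := 1) (q := 1) H ι (σ.face i 1) σ' -
        leadPair (p := 1) (q := 1) H ι (σ.face i 0) σ')) +
      ∑ i : Fin 1, (-1 : ℝ) ^ (i : ℕ) * (leadPair (p := 2) (q := 0) H ι σ (σ'.face i 1) -
        leadPair (p := 2) (q := 0) H ι σ (σ'.face i 0)) := by
  have hS := integral_det_gradMat (contDiff_stairMap hH.smooth (ι := ι)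
    (contDiff_diffLift (p := 2) (q := 1) σ.lift_smooth σ'.lift_smooth))
  have hl : ∀ (i : Fin 2) (e : unitInterval), leadPair (p := 1) (q := 1) H ι (σ.face i e) σ' =
      leadInt (n := 2) fun y => stairMap H ι (diffLift (p := 2) (q := 1) σ.lift σ'.lift)
        ((Fin.castAdd 1 i : Fin 3).insertNth (e : ℝ) y) := by
    intro i e
    rw [leadPair_eq hH h0 (σ.liftEq_face hπ i e) (LiftEq.refl per _)]
    congr 1
    funext y j
    refine congrArg (H j) (congrArg₂ (· - ·) (congrFun (congrArg σ.lift ?_) _)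
      (congrFun (congrArg σ'.lift ?_) _)) <;>
    · funext l; fin_cases i <;> fin_cases l <;> rfl
  have hr : ∀ (i : Fin 1) (e : unitInterval), leadPair (p := 2) (q := 0) H ι σ (σ'.face i e) =
      leadInt (n := 2) fun y => stairMap H ι (diffLift (p := 2) (q := 1) σ.lift σ'.lift)
        ((Fin.natAdd 2 i : Fin 3).insertNth (e : ℝ) y) := by
    intro i e
    rw [leadPair_eq hH h0 (LiftEq.refl per _) (σ'.liftEq_face hπ i e)]
    congr 1
    funext y j
    refine congrArg (H j) (congrArg₂ (· - ·) (congrFun (congrArg σ.lift ?_) _)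
      (congrFun (congrArg σ'.lift ?_) _)) <;>
    · funext l; fin_cases i <;> fin_cases l <;> rfl
  refine hS.trans ?_
  rw [Fin.sum_univ_three]
  simp only [Fin.sum_univ_two, Fin.sum_univ_one, hl, hr]
  simp

end Pairings

/-! ### From intersections of fillings to linking integrals of their boundaries. -/

section Linking

open MeasureTheory Set

variable {c : Fin 4 → ℝ} {δ : ℝ}

/-- The functions of the coordinates `(s, t, x, y)`. -/
def stairM (c : Fin 4 → ℝ) (δ : ℝ) : Fin 4 → ℝ → ℝ :=
  ![stepFn (c 0) δ, stairFn (c 1) δ, stepFn (c 2) δ, stairFn (c 3) δ]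

/-- The functions of the coordinates `(x, t, y)`. -/
def stairY (c : Fin 4 → ℝ) (δ : ℝ) : Fin 3 → ℝ → ℝ :=
  ![stepFn (c 2) δ, stairFn (c 1) δ, stairFn (c 3) δ]

/-- The coordinates `(t, x, y)` in the order `(x, t, y)`. -/
def ordY : Fin 3 → Fin 3 := ![1, 0, 2]

theorem stairSys_stairM (hδ : 0 < δ) (hδ1 : δ < 1) : StairSys perM (id : Fin 4 → Fin 4) (stairM c δ) where
  smooth j := by
    fin_cases j
    exacts [contDiff_stepFn _ _, contDiff_stairFn hδ hδ1, contDiff_stepFn _ _,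
      contDiff_stairFn hδ hδ1]
  add_int j hj x m := by
    rcases hj with rfl | rfl
    exacts [stairFn_add_int _ _ _ _, stairFn_add_int _ _ _ _]

theorem stairSys_stairY (hδ : 0 < δ) (hδ1 : δ < 1) : StairSys perY ordY (stairY c δ) where
  smooth j := by
    fin_cases j
    exacts [contDiff_stepFn _ _, contDiff_stairFn hδ hδ1, contDiff_stairFn hδ hδ1]
  add_int j hj x m := by
    fin_cases j
    · exact absurd rfl hj
    exacts [stairFn_add_int _ _ _ _, stairFn_add_int _ _ _ _]

theorem not_perM_zero : ¬ perM (id (0 : Fin 4)) := by simp [perM]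

theorem not_perY_ordY_zero : ¬ perY (ordY 0) := by simp [perY, ordY]

/-- Putting x before t is a transposition. The coordinate x has to come first on Y because the
undifferentiated coordinate must not be periodic; the sign reappears in `leadInt_stairM_eq`. -/
theorem det_fin_three_of_ord (f : Fin 3 → Fin 3 → ℝ) :
    (Matrix.of f).det = -(Matrix.of fun i j => f i (ordY j)).det := by
  rw [Matrix.det_fin_three, Matrix.det_fin_three]
  simp [ordY]
  ring

/-- The integrand lives where the bumps in t, x and y are all nonzero. If the step in s is
constantly κ there, it factors out and leaves the determinant in the three coordinates of Y. -/
theorem leadInt_stairM_eq (hδ : 0 < δ) (hδ1 : δ < 1) {D : (Fin 3 → ℝ) → (Fin 4 → ℝ)}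
    (hD : ContDiff ℝ ∞ D) (κ : ℝ)
    (h : ∀ y ∈ Icc (0 : Fin 3 → ℝ) 1, (∀ j : Fin 3, deriv (stairM c δ j.succ) (D y j.succ) ≠ 0) →
      stepFn (c 0) δ (D y 0) = κ) :
    leadInt (stairMap (stairM c δ) id D) =
      -(κ * ∫ y in Icc (0 : Fin 3 → ℝ) 1,
        (gradMat (stairMap (stairY c δ) ordY fun y j => D y j.succ) y).det) := by
  have hM := stairSys_stairM (c := c) hδ hδ1
  have hY := stairSys_stairY (c := c) hδ hδ1
  have hD' : ContDiff ℝ ∞ fun y j => D y (Fin.succ j) := contDiff_pi.2 fun j => contDiff_pi.1 hD _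
  rw [leadInt, ← neg_mul, ← integral_const_mul]
  refine setIntegral_cube_congr fun y hy => ?_
  rw [gradMat_stairMap hM.smooth hD, gradMat_stairMap hY.smooth hD']
  have hd : ∀ (i j : Fin 3), fderiv ℝ (fun y j => D y (Fin.succ j)) y (Pi.single i 1) j =
      fderiv ℝ D y (Pi.single i 1) j.succ := by
    intro i j
    have h2 : HasFDerivAt (fun y j => D y (Fin.succ j))
        (ContinuousLinearMap.pi fun j : Fin 3 =>
          (ContinuousLinearMap.proj j.succ).comp (fderiv ℝ D y)) y :=
      hasFDerivAt_pi.2 fun j =>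
        hasFDerivAt_pi'.1 (hD.differentiable (by simp) y).hasFDerivAt j.succ
    rw [h2.fderiv]
    rfl
  have hdet : ((Matrix.of fun i j => deriv (stairM c δ j) (D y (id j)) *
        fderiv ℝ D y (Pi.single i 1) (id j)).submatrix id Fin.succ).det =
      -(Matrix.of fun i j => deriv (stairY c δ j) (D y (ordY j).succ) *
        fderiv ℝ (fun y j => D y (Fin.succ j)) y (Pi.single i 1) (ordY j)).det := by
    refine (det_fin_three_of_ord _).trans ?_
    congr 2
    ext i j
    simp only [Matrix.of_apply, hd]
    fin_cases j <;> rfl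
  rw [hdet]
  have h0 : stairMap (stairM c δ) id D y 0 = stepFn (c 0) δ (D y 0) := rfl
  rw [h0]
  by_cases hz : ∀ j : Fin 3, deriv (stairM c δ j.succ) (D y j.succ) ≠ 0
  · rw [h y (interior_mem_cube hy) hz]; ring
  · push Not at hz
    obtain ⟨j, hj⟩ := hz
    have : (Matrix.of fun i j => deriv (stairY c δ j) (D y (ordY j).succ) *
        fderiv ℝ (fun y j => D y (Fin.succ j)) y (Pi.single i 1) (ordY j)).det = 0 := by
      refine Matrix.det_eq_zero_of_column_eq_zero (ordY j) fun i => ?_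
      have e : deriv (stairY c δ (ordY j)) (D y (ordY (ordY j)).succ) =
          deriv (stairM c δ j.succ) (D y j.succ) := by
        fin_cases j <;> rfl
      rw [Matrix.of_apply, e, hj, zero_mul]
    rw [this]; ring

theorem dist_circle_le (a b : ℝ) (k : ℤ) :
    dist (a : UnitAddCircle) (b : UnitAddCircle) ≤ |a - b - k| := by
  rw [dist_eq_norm, ← AddCircle.coe_sub, UnitAddCircle.norm_eq]
  exact round_le _ _

/-- If the derivatives do not vanish then the points are close to each other. -/
theorem dist_projY_le (hδ : 0 < δ) (hδ1 : δ < 1) {r : ℝ} (hc : ∀ j, |c j| ≤ r) (hr : δ ≤ r)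
    {v w : Fin 3 → ℝ}
    (h : ∀ j : Fin 3, deriv (stairM c δ j.succ) (v j - w j) ≠ 0) :
    dist (projY v) (projY w) ≤ 2 * r := by
  have h0 : deriv (stairFn (c 1) δ) (v 0 - w 0) ≠ 0 := h 0
  have h1 : deriv (stepFn (c 2) δ) (v 1 - w 1) ≠ 0 := h 1
  have h2 : deriv (stairFn (c 3) δ) (v 2 - w 2) ≠ 0 := h 2
  have c1 := abs_le.1 (hc 1)
  have c2 := abs_le.1 (hc 2)
  have c3 := abs_le.1 (hc 3)
  obtain ⟨k, hk1, hk2⟩ := deriv_stairFn_ne_zero hδ hδ1 h0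
  obtain ⟨l, hl1, hl2⟩ := deriv_stairFn_ne_zero hδ hδ1 h2
  obtain ⟨hx1, hx2⟩ := deriv_stepFn_ne_zero hδ h1
  refine max_le ((dist_circle_le _ _ k).trans ?_) (max_le ?_ ((dist_circle_le _ _ l).trans ?_))
  · exact abs_le.2 ⟨by linarith, by linarith⟩
  · change |v 1 - w 1| ≤ _
    exact abs_le.2 ⟨by linarith, by linarith⟩
  · exact abs_le.2 ⟨by linarith, by linarith⟩

theorem projM_snd (v : Fin 4 → ℝ) : (projM v).2 = projY fun j => v j.succ := rfl

theorem liftEq_cubeProj {n : ℕ} (σ : SmoothCube projM n) :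
    LiftEq perY (cubeProj σ).lift fun u j => σ.lift u j.succ := by
  refine SmoothCube.liftEq isLatticeProj_projY _ ?_ fun u => ?_
  · exact continuous_pi fun j => (continuous_apply j.succ).comp σ.lift_smooth.continuous
  · change (σ.toFun u).2 = _
    rw [σ.lift_spec, projM_snd]

theorem liftEq_cubeIncl {n : ℕ} (e : ℝ) (σ : SmoothCube projY n) :
    LiftEq perM (cubeIncl e σ).lift fun u => Fin.cons e (σ.lift u) := by
  refine SmoothCube.liftEq isLatticeProj_projM _ ?_ fun u => ?_
  · refine continuous_pi fun j => Fin.cases ?_ (fun j => ?_) j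
    · simpa using continuous_const
    · simp only [Fin.cons_succ]
      exact (continuous_apply j).comp σ.lift_smooth.continuous
  · change (e, σ.toFun u) = _
    rw [σ.lift_spec]
    rfl

theorem contDiff_cons {n : ℕ} (e : ℝ) (σ : SmoothCube projY n) :
    ContDiff ℝ ∞ fun u => (Fin.cons e (σ.lift u) : Fin 4 → ℝ) := by
  refine contDiff_pi.2 fun j => Fin.cases ?_ (fun j => ?_) j
  · simpa using contDiff_const
  · simpa using contDiff_pi.1 σ.lift_smooth j

theorem SmoothCube.lift_zero_eq {n : ℕ} (σ : SmoothCube projM n) {u : Fin n → ℝ}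
    (hu : u ∈ Icc (0 : Fin n → ℝ) 1) : σ.lift u 0 = (σ.toFun (toCube u hu)).1 := by
  rw [← σ.proj_lift hu]; rfl

/-- Nonvanishing bumps force the projections to Y to be 2r-close, by `dist_projY_le`; so the height
of the step needs to be known only where the two cubes nearly meet over Y. -/
theorem leadPair_cubeIncl_left (hδ : 0 < δ) (hδ1 : δ < 1) {r : ℝ} (hc : ∀ j, |c j| ≤ r)
    (hr : δ ≤ r) (e κ : ℝ) (a : SmoothCube projY 1) (σ : SmoothCube projM 2)
    (h : ∀ u v, dist (a.toFun u) (σ.toFun v).2 ≤ 2 * r →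
      stepFn (c 0) δ (e - (σ.toFun v).1) = κ) :
    leadPair (p := 1) (q := 2) (stairM c δ) id (cubeIncl e a) σ =
      -(κ * detPair (p := 1) (q := 2) (stairY c δ) ordY a (cubeProj σ)) := by
  rw [leadPair_eq (stairSys_stairM hδ hδ1) not_perM_zero (liftEq_cubeIncl e a) (LiftEq.refl _ _),
    detPair_eq (p := 1) (q := 2) (H := stairY c δ) (ι := ordY) (stairSys_stairY hδ hδ1)
      (LiftEq.refl _ _) (liftEq_cubeProj σ)]
  refine leadInt_stairM_eq hδ hδ1 (contDiff_diffLift (p := 1) (q := 2) (contDiff_cons e a)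
    σ.lift_smooth) κ fun y hy hj => ?_
  have hu : (fun i : Fin 1 => y (Fin.castAdd 2 i)) ∈ Icc (0 : Fin 1 → ℝ) 1 :=
    ⟨fun i => hy.1 _, fun i => hy.2 _⟩
  have hv : (fun i : Fin 2 => y (Fin.natAdd 1 i)) ∈ Icc (0 : Fin 2 → ℝ) 1 :=
    ⟨fun i => hy.1 _, fun i => hy.2 _⟩
  have := h (toCube _ hu) (toCube _ hv) (by
    rw [← a.proj_lift, ← σ.proj_lift, projM_snd]
    exact dist_projY_le hδ hδ1 hc hr hj)
  rw [← this, ← σ.lift_zero_eq]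
  rfl

theorem leadPair_cubeIncl_right (hδ : 0 < δ) (hδ1 : δ < 1) {r : ℝ} (hc : ∀ j, |c j| ≤ r)
    (hr : δ ≤ r) (e κ : ℝ) (σ : SmoothCube projM 2) (a : SmoothCube projY 1)
    (h : ∀ u v, dist (σ.toFun u).2 (a.toFun v) ≤ 2 * r →
      stepFn (c 0) δ ((σ.toFun u).1 - e) = κ) :
    leadPair (p := 2) (q := 1) (stairM c δ) id σ (cubeIncl e a) =
      -(κ * detPair (p := 2) (q := 1) (stairY c δ) ordY (cubeProj σ) a) := by
  rw [leadPair_eq (stairSys_stairM hδ hδ1) not_perM_zero (LiftEq.refl _ _) (liftEq_cubeIncl e a),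
    detPair_eq (p := 2) (q := 1) (H := stairY c δ) (ι := ordY) (stairSys_stairY hδ hδ1)
      (liftEq_cubeProj σ) (LiftEq.refl _ _)]
  refine leadInt_stairM_eq hδ hδ1 (contDiff_diffLift (p := 2) (q := 1) σ.lift_smooth
    (contDiff_cons e a)) κ fun y hy hj => ?_
  have hu : (fun i : Fin 2 => y (Fin.castAdd 1 i)) ∈ Icc (0 : Fin 2 → ℝ) 1 :=
    ⟨fun i => hy.1 _, fun i => hy.2 _⟩
  have hv : (fun i : Fin 1 => y (Fin.natAdd 2 i)) ∈ Icc (0 : Fin 1 → ℝ) 1 :=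
    ⟨fun i => hy.1 _, fun i => hy.2 _⟩
  have := h (toCube _ hu) (toCube _ hv) (by
    rw [← a.proj_lift, ← σ.proj_lift, projM_snd]
    exact dist_projY_le hδ hδ1 hc hr hj)
  rw [← this, ← σ.lift_zero_eq]
  rfl

/-- The integral computing the linking number of two 1-cycles. -/
def linkInt (c : Fin 4 → ℝ) (δ : ℝ) (a b : Chain projY 1) : ℝ :=
  evalC (fun σ => evalC (leadPair (p := 1) (q := 1) (stairY c δ) ordY σ) b) a

/-- The integral computing the intersection number of a 1-cycle and a 2-chain. -/
def crossInt (c : Fin 4 → ℝ) (δ : ℝ) (a : Chain projY 1) (W : Chain projY 2) : ℝ :=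
  evalC (fun σ => evalC (detPair (p := 1) (q := 2) (stairY c δ) ordY σ) W) a

def crossInt' (c : Fin 4 → ℝ) (δ : ℝ) (W : Chain projY 2) (a : Chain projY 1) : ℝ :=
  evalC (fun σ => evalC (detPair (p := 2) (q := 1) (stairY c δ) ordY σ) a) W

/-- The integral computing the intersection number of two 2-chains. -/
def interInt (c : Fin 4 → ℝ) (δ : ℝ) (S S' : Chain projM 2) : ℝ :=
  evalC (fun σ => evalC (detPair (p := 2) (q := 2) (stairM c δ) id σ) S') S

theorem evalC_fun_boundary_left {k p n : ℕ} {X : Type} {π : (Fin k → ℝ) → X}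
    (f : SmoothCube π n → SmoothCube π p → ℝ) (S : Chain π (n + 1)) (S' : Chain π p) :
    evalC (fun σ => evalC (fun σ' => ∑ i : Fin (n + 1), (-1 : ℝ) ^ (i : ℕ) *
      (f (σ.face i 1) σ' - f (σ.face i 0) σ')) S') S =
      evalC (fun σ => evalC (f σ) S') (boundary S) := by
  rw [evalC_swap, evalC_swap f (boundary S)]
  refine evalC_congr fun σ' _ => ?_
  rw [evalC_boundary]

theorem evalC_fun_boundary_right {k p n : ℕ} {X : Type} {π : (Fin k → ℝ) → X}
    (f : SmoothCube π p → SmoothCube π n → ℝ) (S : Chain π p) (S' : Chain π (n + 1)) :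
    evalC (fun σ => evalC (fun σ' => ∑ i : Fin (n + 1), (-1 : ℝ) ^ (i : ℕ) *
      (f σ (σ'.face i 1) - f σ (σ'.face i 0))) S') S =
      evalC (fun σ => evalC (f σ) (boundary S')) S := by
  refine evalC_congr fun σ _ => ?_
  rw [evalC_boundary]

theorem interInt_eq (hδ : 0 < δ) (hδ1 : δ < 1) (S S' : Chain projM 2) :
    interInt c δ S S' =
      evalC (fun σ => evalC (leadPair (p := 1) (q := 2) (stairM c δ) id σ) S') (boundary S) +
      evalC (fun σ => evalC (leadPair (p := 2) (q := 1) (stairM c δ) id σ) (boundary S')) S := by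
  rw [← evalC_fun_boundary_left, ← evalC_fun_boundary_right, ← evalC_add_fun]
  refine evalC_congr fun σ _ => ?_
  rw [← evalC_add_fun]
  refine evalC_congr fun σ' _ => ?_
  exact detPair_two_two isLatticeProj_projM (stairSys_stairM hδ hδ1) not_perM_zero σ σ'

/-- The term of Stokes' formula with the boundary of `a` drops out, since `a` is a cycle. The same
happens in `crossInt'_eq`. -/
theorem crossInt_eq (hδ : 0 < δ) (hδ1 : δ < 1) {a : Chain projY 1} (ha : boundary a = 0)
    (W : Chain projY 2) : crossInt c δ a W = -linkInt c δ a (boundary W) := by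
  have h : crossInt c δ a W =
      evalC (fun σ => evalC (leadPair (p := 0) (q := 2) (stairY c δ) ordY σ) W) (boundary a) -
      evalC (fun σ => evalC (leadPair (p := 1) (q := 1) (stairY c δ) ordY σ) (boundary W)) a := by
    rw [← evalC_fun_boundary_left, ← evalC_fun_boundary_right, ← evalC_sub_fun]
    refine evalC_congr fun σ _ => ?_
    rw [← evalC_sub_fun]
    refine evalC_congr fun σ' _ => ?_
    exact detPair_one_two isLatticeProj_projY (stairSys_stairY hδ hδ1) not_perY_ordY_zero σ σ'
  rw [h, ha, map_zero, zero_sub]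
  rfl

theorem crossInt'_eq (hδ : 0 < δ) (hδ1 : δ < 1) {a : Chain projY 1} (ha : boundary a = 0)
    (W : Chain projY 2) : crossInt' c δ W a = linkInt c δ (boundary W) a := by
  have h : crossInt' c δ W a =
      evalC (fun σ => evalC (leadPair (p := 1) (q := 1) (stairY c δ) ordY σ) a) (boundary W) +
      evalC (fun σ => evalC (leadPair (p := 2) (q := 0) (stairY c δ) ordY σ) (boundary a)) W := by
    rw [← evalC_fun_boundary_left, ← evalC_fun_boundary_right, ← evalC_add_fun]
    refine evalC_congr fun σ _ => ?_
    rw [← evalC_add_fun]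
    refine evalC_congr fun σ' _ => ?_
    exact detPair_two_one isLatticeProj_projY (stairSys_stairY hδ hδ1) not_perY_ordY_zero σ σ'
  rw [h, ha]
  simp only [map_zero, evalC_zero_fun, add_zero]
  rfl

theorem linkInt_degenerate_right (hδ : 0 < δ) (hδ1 : δ < 1) (a : Chain projY 1)
    {b b' : Chain projY 1} (h : b - b' ∈ degenerate projY 1) :
    linkInt c δ a b = linkInt c δ a b' :=
  evalC_congr fun σ _ => evalC_eq_of_sub_mem (fun _ hσ' =>
    leadPair_degenerate_right isLatticeProj_projY (stairSys_stairY hδ hδ1).smooth σ hσ') h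

theorem linkInt_degenerate_left (hδ : 0 < δ) (hδ1 : δ < 1) {a a' : Chain projY 1}
    (b : Chain projY 1) (h : a - a' ∈ degenerate projY 1) :
    linkInt c δ a b = linkInt c δ a' b :=
  evalC_eq_of_sub_mem (fun _ hσ => evalC_eq_zero fun σ' _ =>
    leadPair_degenerate_left isLatticeProj_projY (stairSys_stairY hδ hδ1).smooth hσ σ') h

theorem linkInt_sub_right (a b b' : Chain projY 1) :
    linkInt c δ a (b - b') = linkInt c δ a b - linkInt c δ a b' := by
  simp only [linkInt, map_sub, evalC_sub_fun]

theorem linkInt_sub_left (a a' b : Chain projY 1) :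
    linkInt c δ (a - a') b = linkInt c δ a b - linkInt c δ a' b := by
  simp only [linkInt, map_sub]

theorem SmoothCube.continuous_toFun {k n : ℕ} {X : Type} [TopologicalSpace X]
    {π : (Fin k → ℝ) → X} (hπ : Continuous π) (σ : SmoothCube π n) : Continuous σ.toFun := by
  have : σ.toFun = fun u => π (σ.lift fun i => (u i : ℝ)) := funext σ.lift_spec
  rw [this]
  exact hπ.comp (σ.lift_smooth.continuous.comp
    (continuous_pi fun i => continuous_subtype_val.comp (continuous_apply i)))

theorem continuous_projY : Continuous projY := by
  refine Continuous.prodMk ?_ (Continuous.prodMk (continuous_apply 1) ?_)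
  · exact (AddCircle.continuous_mk' 1).comp (continuous_apply 0)
  · exact (AddCircle.continuous_mk' 1).comp (continuous_apply 2)

theorem continuous_projM : Continuous projM := by
  refine Continuous.prodMk (continuous_apply 0) (Continuous.prodMk ?_
    (Continuous.prodMk (continuous_apply 2) ?_))
  · exact (AddCircle.continuous_mk' 1).comp (continuous_apply 1)
  · exact (AddCircle.continuous_mk' 1).comp (continuous_apply 3)

theorem exists_pos_le_of_cubes {p q : ℕ} {f : (Fin p → unitInterval) × (Fin q → unitInterval) → ℝ}
    (hf : Continuous f) (h : ∀ w, 0 < f w) : ∃ η > 0, ∀ w, η ≤ f w := by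
  obtain ⟨w, -, hw⟩ := isCompact_univ.exists_isMinOn univ_nonempty hf.continuousOn
  exact ⟨f w, h w, fun w' => hw (mem_univ w')⟩

/-- A finite family of properties that hold for small positive numbers. -/
theorem exists_pos_forall_finset {ι : Type*} (s : Finset ι) {P : ι → ℝ → Prop}
    (hP : ∀ i ∈ s, ∃ η > 0, ∀ r, 0 < r → r < η → P i r) :
    ∃ η > 0, ∀ r, 0 < r → r < η → ∀ i ∈ s, P i r := by
  classical
  induction s using Finset.induction_on with
  | empty => exact ⟨1, one_pos, by simp⟩
  | insert a s _ ih =>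
    obtain ⟨η, hη, h⟩ := ih fun i hi => hP i (Finset.mem_insert_of_mem hi)
    obtain ⟨η', hη', h'⟩ := hP a (Finset.mem_insert_self _ _)
    refine ⟨min η η', lt_min hη hη', fun r hr hr' i hi => ?_⟩
    rcases Finset.mem_insert.1 hi with rfl | hi
    · exact h' r hr (hr'.trans_le (min_le_right _ _))
    · exact h r hr (hr'.trans_le (min_le_left _ _)) i hi

theorem boundary_chainProj (S : Chain projM 2) :
    boundary (chainProj S) = chainProj (boundary S) := by
  have : (boundary.comp (Finsupp.mapDomain.addMonoidHom cubeProj) :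
      Chain projM 2 →+ Chain projY 1) =
      (Finsupp.mapDomain.addMonoidHom cubeProj).comp boundary := by
    refine Finsupp.addHom_ext' fun σ => ?_
    ext1
    simp only [AddMonoidHom.comp_apply, Finsupp.singleAddHom_apply, boundary,
      Finsupp.mapDomain.addMonoidHom_apply, Finsupp.mapDomain_single, Finsupp.liftAddHom_apply_single,
      zmultiplesHom_apply, one_smul]
    rw [← Finsupp.mapDomain.addMonoidHom_apply, map_sum]
    refine Finset.sum_congr rfl fun i _ => ?_
    rw [map_zsmul, map_sub]
    simp only [Finsupp.mapDomain.addMonoidHom_apply, SmoothCube.chain, Finsupp.mapDomain_single]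
    rfl
  exact DFunLike.congr_fun this S

theorem chainProj_degenerate {n : ℕ} {c : Chain projM n} (h : c ∈ degenerate projM n) :
    chainProj c ∈ degenerate projY n := by
  have : degenerate projM n ≤
      (degenerate projY n).comap (Finsupp.mapDomain.addMonoidHom cubeProj) := by
    refine (AddSubgroup.closure_le _).2 ?_
    rintro _ ⟨σ, ⟨i, hi⟩, rfl⟩
    refine AddSubgroup.subset_closure ⟨cubeProj σ, ⟨i, fun u v huv => ?_⟩, ?_⟩
    · exact congrArg Prod.snd (hi u v huv)
    · simp [SmoothCube.chain]
  exact this h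

theorem chainProj_chainIncl {n : ℕ} (e : ℝ) (a : Chain projY n) :
    chainProj (chainIncl e a) = a := by
  rw [chainProj, chainIncl, ← Finsupp.mapDomain_comp]
  exact Finsupp.mapDomain_id

theorem chainProj_sub {n : ℕ} (a b : Chain projM n) :
    chainProj (a - b) = chainProj a - chainProj b :=
  map_sub (Finsupp.mapDomain.addMonoidHom cubeProj) a b

theorem IsFilling.boundary_chainProj {X₁ X₂ : ℝ} {a b : Chain projY 1} {A B : Set YSpace}
    {S : Chain projM 2} (h : IsFilling X₁ X₂ a b A B S) :
    boundary (chainProj S) - (a - b) ∈ degenerate projY 1 := by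
  have := chainProj_degenerate h.2.1
  rwa [chainProj_sub, chainProj_sub, chainProj_chainIncl, chainProj_chainIncl,
    ← PFH.boundary_chainProj] at this

theorem evalC_eq_neg_mul {k n : ℕ} {X : Type} {π : (Fin k → ℝ) → X} {f g : SmoothCube π n → ℝ}
    {c : Chain π n} (κ : ℝ) (h : ∀ σ ∈ c.support, f σ = -(κ * g σ)) :
    evalC f c = -(κ * evalC g c) := by
  rw [evalC_congr h, evalC_neg_fun]
  congr 1
  simp only [evalC_apply, Finsupp.mul_sum]
  exact Finsupp.sum_congr fun σ _ => by ring

/-- The number of intersections of two fillings, as a difference of linking numbers of their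
boundaries. -/
theorem interInt_fillings {X₁ X₂ : ℝ} {a b a' b' : Chain projY 1} {A B A' B' : Set YSpace}
    {S S' : Chain projM 2} (hS : IsFilling X₁ X₂ a b A B S)
    (hS' : IsFilling X₁ X₂ a' b' A' B' S') (ha : a.In A) (hb : b.In B) (ha' : a'.In A')
    (hb' : b'.In B') (hA : Disjoint A A') (hB : Disjoint B B') (hda : boundary a = 0)
    (hdb' : boundary b' = 0) :
    ∃ ρ > 0, ∀ r, 0 < r → r < ρ → ∀ c : Fin 4 → ℝ, (∀ j, |c j| ≤ r) → ∀ δ, 0 < δ → δ ≤ r →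
      interInt c δ S S' = linkInt c δ a a' - linkInt c δ b b' := by
  have hcY := SmoothCube.continuous_toFun (n := 1) continuous_projY
  have hcM := SmoothCube.continuous_toFun (n := 2) continuous_projM
  have hs : ∀ σ ∈ S.support, ∀ u, 0 ≤ (σ.toFun u).1 ∧ (σ.toFun u).1 ≤ 1 :=
    fun σ hσ u => (hS.1 σ hσ u).1
  have hs' : ∀ σ ∈ S'.support, ∀ u, 0 ≤ (σ.toFun u).1 ∧ (σ.toFun u).1 ≤ 1 :=
    fun σ hσ u => (hS'.1 σ hσ u).1
  -- separation of the ends of the two fillings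
  have sep : ∀ (x : Chain projY 1) (Y : Chain projM 2) (f : ℝ → ℝ), Continuous f →
      (∀ τ ∈ x.support, ∀ σ ∈ Y.support, ∀ u v, 0 ≤ f (σ.toFun v).1 ∧
        (f (σ.toFun v).1 = 0 → τ.toFun u ≠ (σ.toFun v).2)) →
      ∃ η > 0, ∀ r, 0 < r → r < η → ∀ w ∈ x.support ×ˢ Y.support, ∀ u v,
        dist (w.1.toFun u) (w.2.toFun v).2 ≤ 2 * r → 2 * r ≤ f (w.2.toFun v).1 := by
    intro x Y f hf h
    refine exists_pos_forall_finset _ fun w hw => ?_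
    obtain ⟨hτ, hσ⟩ := Finset.mem_product.1 hw
    obtain ⟨η, hη, hη'⟩ := exists_pos_le_of_cubes (p := 1) (q := 2)
      (f := fun z => max (dist (w.1.toFun z.1) (w.2.toFun z.2).2) (f (w.2.toFun z.2).1))
      (((hcY w.1).comp continuous_fst).dist (continuous_snd.comp ((hcM w.2).comp continuous_snd))
        |>.max (hf.comp (continuous_fst.comp ((hcM w.2).comp continuous_snd)))) (by
        rintro ⟨u, v⟩
        obtain ⟨h1, h2⟩ := h _ hτ _ hσ u v
        rcases h1.eq_or_lt with h0 | h0
        · exact lt_max_of_lt_left (dist_pos.2 (h2 h0.symm))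
        · exact lt_max_of_lt_right h0)
    refine ⟨η / 2, by positivity, fun r hr hrη u v hd => ?_⟩
    rcases le_max_iff.1 (hη' (u, v)) with h1 | h1
    · simp only at h1; linarith
    · simp only at h1; linarith
  have hf1 : Continuous fun s : ℝ => 1 - s := continuous_const.sub continuous_id
  obtain ⟨η₁, h₁, sep₁⟩ := sep a S' (fun s => 1 - s) hf1 fun τ hτ σ hσ u v =>
    ⟨by linarith [(hs' σ hσ v).2], fun h0 => (disjoint_left.1 hA (ha τ hτ u)).elim ∘ by
      intro he; rw [he]; exact (hS'.2.2 σ hσ v).1 (by linarith)⟩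
  obtain ⟨η₂, h₂, sep₂⟩ := sep b S' (fun s => s) continuous_id fun τ hτ σ hσ u v =>
    ⟨(hs' σ hσ v).1, fun h0 => (disjoint_left.1 hB (hb τ hτ u)).elim ∘ by
      intro he; rw [he]; exact (hS'.2.2 σ hσ v).2 h0⟩
  obtain ⟨η₃, h₃, sep₃⟩ := sep a' S (fun s => 1 - s) hf1 fun τ hτ σ hσ u v =>
    ⟨by linarith [(hs σ hσ v).2], fun h0 => (disjoint_right.1 hA (ha' τ hτ u)).elim ∘ by
      intro he; rw [he]; exact (hS.2.2 σ hσ v).1 (by linarith)⟩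
  obtain ⟨η₄, h₄, sep₄⟩ := sep b' S (fun s => s) continuous_id fun τ hτ σ hσ u v =>
    ⟨(hs σ hσ v).1, fun h0 => (disjoint_right.1 hB (hb' τ hτ u)).elim ∘ by
      intro he; rw [he]; exact (hS.2.2 σ hσ v).2 h0⟩
  refine ⟨min (min (min η₁ η₂) (min η₃ η₄)) 1, by positivity, fun r hr hrρ c hc δ hδ hδr => ?_⟩
  have hr1 : r < 1 := hrρ.trans_le (min_le_right _ _)
  have hr' := hrρ.trans_le (min_le_left _ _)
  have hr₁ : r < η₁ := hr'.trans_le ((min_le_left _ _).trans (min_le_left _ _))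
  have hr₂ : r < η₂ := hr'.trans_le ((min_le_left _ _).trans (min_le_right _ _))
  have hr₃ : r < η₃ := hr'.trans_le ((min_le_right _ _).trans (min_le_left _ _))
  have hr₄ : r < η₄ := hr'.trans_le ((min_le_right _ _).trans (min_le_right _ _))
  have hδ1 : δ < 1 := hδr.trans_lt hr1
  have hc0 := abs_le.1 (hc 0)
  have hM := (stairSys_stairM (c := c) hδ hδ1).smooth
  rw [interInt_eq hδ hδ1]
  -- Close to `a` the chain `S'` stays at height at most 1 - 2r, so on the top boundary of `S` the
  -- step in s has the value 1. Close to `b` it stays above 2r, and on the bottom boundary the step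
  -- is 0.
  have e1 : evalC (fun σ => evalC (leadPair (p := 1) (q := 2) (stairM c δ) id σ) S')
      (boundary S) = -crossInt c δ a (chainProj S') := by
    rw [evalC_eq_of_sub_mem (fun _ hσ => evalC_eq_zero fun σ' _ =>
      leadPair_degenerate_left isLatticeProj_projM hM hσ σ') hS.2.1, map_sub, chainIncl, chainIncl,
      evalC_mapDomain, evalC_mapDomain]
    have t1 : evalC (fun τ => evalC (leadPair (p := 1) (q := 2) (stairM c δ) id (cubeIncl 1 τ)) S')
        a = -(1 * crossInt c δ a (chainProj S')) := by
      refine evalC_eq_neg_mul 1 fun τ hτ => ?_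
      rw [chainProj, evalC_mapDomain]
      refine evalC_eq_neg_mul 1 fun σ hσ => ?_
      refine leadPair_cubeIncl_left hδ hδ1 hc hδr 1 1 τ σ fun u v hd => ?_
      have := sep₁ r hr hr₁ (τ, σ) (Finset.mem_product.2 ⟨hτ, hσ⟩) u v hd
      exact stepFn_of_ge hδ (by simp only at this; linarith)
    have t2 : evalC (fun τ => evalC (leadPair (p := 1) (q := 2) (stairM c δ) id (cubeIncl 0 τ)) S')
        b = 0 := by
      refine evalC_eq_zero fun τ hτ => evalC_eq_zero fun σ hσ => ?_
      rw [leadPair_cubeIncl_left hδ hδ1 hc hδr 0 0 τ σ fun u v hd => ?_]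
      · simp
      have := sep₂ r hr hr₂ (τ, σ) (Finset.mem_product.2 ⟨hτ, hσ⟩) u v hd
      exact stepFn_of_le hδ (by simp only at this; linarith)
    rw [t1, t2]; ring
  -- With the boundary in the second slot the height difference changes sign: it is negative at the
  -- top of `S'` and positive at the bottom, so only `{0} × b'` contributes.
  have e2 : evalC (fun σ => evalC (leadPair (p := 2) (q := 1) (stairM c δ) id σ)
      (boundary S')) S = crossInt' c δ (chainProj S) b' := by
    have hdeg : evalC (fun σ => evalC (leadPair (p := 2) (q := 1) (stairM c δ) id σ)
        (boundary S')) S = evalC (fun σ => evalC (leadPair (p := 2) (q := 1) (stairM c δ) id σ)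
        (chainIncl 1 a' - chainIncl 0 b')) S :=
      evalC_congr fun σ _ => evalC_eq_of_sub_mem (fun _ hσ' =>
        leadPair_degenerate_right isLatticeProj_projM hM σ hσ') hS'.2.1
    rw [hdeg]
    simp only [map_sub, evalC_sub_fun]
    rw [chainIncl, chainIncl]
    simp only [evalC_mapDomain]
    have t1 : evalC (fun σ => evalC (fun τ =>
        leadPair (p := 2) (q := 1) (stairM c δ) id σ (cubeIncl 1 τ)) a') S = 0 := by
      refine evalC_eq_zero fun σ hσ => evalC_eq_zero fun τ hτ => ?_
      rw [leadPair_cubeIncl_right hδ hδ1 hc hδr 1 0 σ τ fun u v hd => ?_]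
      · simp
      have := sep₃ r hr hr₃ (τ, σ) (Finset.mem_product.2 ⟨hτ, hσ⟩) v u (by rwa [dist_comm])
      exact stepFn_of_le hδ (by simp only at this; linarith)
    have t2 : evalC (fun σ => evalC (fun τ =>
        leadPair (p := 2) (q := 1) (stairM c δ) id σ (cubeIncl 0 τ)) b') S =
        -(1 * crossInt' c δ (chainProj S) b') := by
      rw [crossInt', chainProj, evalC_mapDomain]
      refine evalC_eq_neg_mul 1 fun σ hσ => evalC_eq_neg_mul 1 fun τ hτ => ?_
      refine leadPair_cubeIncl_right hδ hδ1 hc hδr 0 1 σ τ fun u v hd => ?_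
      have := sep₄ r hr hr₄ (τ, σ) (Finset.mem_product.2 ⟨hτ, hσ⟩) v u (by rwa [dist_comm])
      exact stepFn_of_ge hδ (by simp only at this; linarith)
    rw [t1, t2]; ring
  -- Inserting the projected boundaries a' - b' and a - b, the mixed linking integral of `a` with
  -- `b'` appears twice with opposite signs and cancels.
  rw [e1, e2, crossInt_eq hδ hδ1 hda, crossInt'_eq hδ hδ1 hdb',
    linkInt_degenerate_right hδ hδ1 a hS'.boundary_chainProj,
    linkInt_degenerate_left hδ hδ1 b' hS.boundary_chainProj, linkInt_sub_right, linkInt_sub_left]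
  ring

end Linking

/-! ### Intersection numbers of chains as integrals. -/

section Counting

open MeasureTheory Set

/-- The values of the coordinates `(s, t, x, y)` modulo the lattice. -/
def latM (c : Fin 4 → ℝ) : Fin 4 → Set ℝ :=
  ![{c 0}, range fun k : ℤ => c 1 + k, {c 2}, range fun k : ℤ => c 3 + k]

theorem projM_add (v w : Fin 4 → ℝ) : projM (v + w) = projM v + projM w := by
  simp [projM]

theorem mem_latM_iff (c v w : Fin 4 → ℝ) :
    (∀ j, (v - w) j ∈ latM c j) ↔ projM v = projM w + projM c := by
  rw [← projM_add, isLatticeProj_projM]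
  constructor
  · intro h
    have h0 : v 0 - w 0 = c 0 := h 0
    obtain ⟨k, h1 : c 1 + k = v 1 - w 1⟩ := h 1
    have h2 : v 2 - w 2 = c 2 := h 2
    obtain ⟨l, h3 : c 3 + l = v 3 - w 3⟩ := h 3
    refine ⟨![0, k, 0, l], fun j hj => ?_, fun j => ?_⟩
    · fin_cases j <;> simp [perM] at hj ⊢
    · fin_cases j <;> simp <;> linarith
  · rintro ⟨m, hm, h⟩ j
    have e := h j
    simp only [Pi.add_apply] at e
    fin_cases j
    · change v 0 - w 0 = c 0
      have := hm 0 (by simp [perM])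
      simp_all
    · exact ⟨m 1, by simp at e ⊢; linarith⟩
    · change v 2 - w 2 = c 2
      have := hm 2 (by simp [perM])
      simp_all
    · exact ⟨m 3, by simp at e ⊢; linarith⟩

theorem stair_stairM {c : Fin 4 → ℝ} {δ : ℝ} (hδ : 0 < δ) (hδ1 : δ < 1 / 2) (j : Fin 4) :
    Stair (latM c j) δ (stairM c δ j) := by
  fin_cases j
  exacts [stair_stepFn hδ, stair_stairFn hδ hδ1, stair_stepFn hδ, stair_stairFn hδ hδ1]

theorem range_separated (a : ℝ) : ∀ l ∈ range (fun k : ℤ => a + k),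
    ∀ l' ∈ range (fun k : ℤ => a + k), l ≠ l' → 1 ≤ |l - l'| := by
  rintro _ ⟨k, rfl⟩ _ ⟨l, rfl⟩ h
  have hkl : k ≠ l := fun e => h (by rw [e])
  have : (1 : ℤ) ≤ |k - l| := Int.one_le_abs (sub_ne_zero.2 hkl)
  have h2 : ((1 : ℤ) : ℝ) ≤ ((|k - l| : ℤ) : ℝ) := by exact_mod_cast this
  push_cast at h2
  simpa using h2

theorem latM_separated (c : Fin 4 → ℝ) (j : Fin 4) :
    ∀ l ∈ latM c j, ∀ l' ∈ latM c j, l ≠ l' → 1 ≤ |l - l'| := by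
  have hs : ∀ a : ℝ, ∀ l ∈ ({a} : Set ℝ), ∀ l' ∈ ({a} : Set ℝ), l ≠ l' → 1 ≤ |l - l'| := by
    rintro a _ rfl _ rfl h; exact absurd rfl h
  fin_cases j
  exacts [hs _, range_separated _, hs _, range_separated _]

/-- A pair of points of the unit square as a point of `ℝ⁴`. -/
def pairPt (w : (Fin 2 → unitInterval) × (Fin 2 → unitInterval)) : Fin 4 → ℝ :=
  Fin.append (fun i => (w.1 i : ℝ)) (fun i => (w.2 i : ℝ))

theorem pairPt_castAdd (w : (Fin 2 → unitInterval) × (Fin 2 → unitInterval)) :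
    (fun i : Fin 2 => pairPt w (Fin.castAdd 2 i)) = fun i => (w.1 i : ℝ) := by
  funext i; exact Fin.append_left _ _ i

theorem pairPt_natAdd (w : (Fin 2 → unitInterval) × (Fin 2 → unitInterval)) :
    (fun i : Fin 2 => pairPt w (Fin.natAdd 2 i)) = fun i => (w.2 i : ℝ) := by
  funext i; exact Fin.append_right _ _ i

theorem pairPt_injective : Function.Injective pairPt := by
  intro w w' h
  have h1 := pairPt_castAdd w
  have h2 := pairPt_natAdd w
  rw [h, pairPt_castAdd] at h1
  rw [h, pairPt_natAdd] at h2
  exact Prod.ext (funext fun i => Subtype.ext (congrFun h1 i).symm)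
    (funext fun i => Subtype.ext (congrFun h2 i).symm)

theorem range_pairPt : range pairPt = Icc (0 : Fin 4 → ℝ) 1 := by
  ext x
  constructor
  · rintro ⟨w, rfl⟩
    constructor <;> intro i <;> fin_cases i
    exacts [(w.1 0).2.1, (w.1 1).2.1, (w.2 0).2.1, (w.2 1).2.1, (w.1 0).2.2, (w.1 1).2.2,
      (w.2 0).2.2, (w.2 1).2.2]
  · intro hx
    refine ⟨(fun i => ⟨x (Fin.castAdd 2 i), hx.1 _, hx.2 _⟩,
      fun i => ⟨x (Fin.natAdd 2 i), hx.1 _, hx.2 _⟩), ?_⟩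
    funext i
    fin_cases i <;> rfl

theorem finsum_cast_real {α : Type*} (p : α → Prop) (f : α → ℤ) :
    ((∑ᶠ (w : α) (_ : p w), f w : ℤ) : ℝ) = ∑ᶠ (w : α) (_ : p w), (f w : ℝ) := by
  have hinj : Function.Injective (Int.castAddHom ℝ) := Int.cast_injective
  have := AddMonoidHom.map_finsum_of_injective (Int.castAddHom ℝ) hinj
    fun w => ∑ᶠ (_ : p w), f w
  refine this.trans (finsum_congr fun w => ?_)
  exact AddMonoidHom.map_finsum_of_injective (Int.castAddHom ℝ) hinj fun _ : p w => f w

/-- In the difference map the two rows of σ' change sign, which leaves the determinant unchanged. -/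
theorem det_gradMat_diffLift (σ σ' : SmoothCube projM 2)
    (w : (Fin 2 → unitInterval) × (Fin 2 → unitInterval)) :
    (gradMat (diffLift (p := 2) (q := 2) σ.lift σ'.lift) (pairPt w)).det =
      (Matrix.of ![σ.partialDeriv 0 w.1, σ.partialDeriv 1 w.1,
        σ'.partialDeriv 0 w.2, σ'.partialDeriv 1 w.2]).det := by
  have hσ := σ.lift_smooth.differentiable (by simp)
  have hσ' := σ'.lift_smooth.differentiable (by simp)
  have e : gradMat (diffLift (p := 2) (q := 2) σ.lift σ'.lift) (pairPt w) =
      Matrix.of ![σ.partialDeriv 0 w.1, σ.partialDeriv 1 w.1,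
        -σ'.partialDeriv 0 w.2, -σ'.partialDeriv 1 w.2] := by
    have hl := fderiv_diffLift_left (p := 2) (q := 2) hσ hσ' (pairPt w)
    have hr := fderiv_diffLift_right (p := 2) (q := 2) hσ hσ' (pairPt w)
    rw [pairPt_castAdd] at hl
    rw [pairPt_natAdd] at hr
    ext i j
    fin_cases i
    · exact congrFun (hl 0) j
    · exact congrFun (hl 1) j
    · exact congrFun (hr 0) j
    · exact congrFun (hr 1) j
  rw [e, Matrix.det_succ_row_zero, Matrix.det_succ_row_zero]
  simp only [Matrix.det_fin_three, Fin.sum_univ_four]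
  simp [Matrix.of_apply, Matrix.submatrix_apply, Fin.succAbove]

/-- Intersections of σ with the translate of σ' are the points of the product cube where the
difference of the lifts lies in the lattice translate by `c`, so `integral_det_stairs` applies to
the difference map. -/
theorem cubeIntersections_eq (σ σ' : SmoothCube projM 2) (c : Fin 4 → ℝ)
    (hreg : ∀ x ∈ Icc (0 : Fin 4 → ℝ) 1,
      (∀ j, diffLift (p := 2) (q := 2) σ.lift σ'.lift x j ∈ latM c j) →
      (∀ i, x i ∈ Ioo (0 : ℝ) 1) ∧
        (gradMat (diffLift (p := 2) (q := 2) σ.lift σ'.lift) x).det ≠ 0) :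
    ∃ δ₀ > 0, ∀ δ, 0 < δ → δ < δ₀ →
      detPair (p := 2) (q := 2) (stairM c δ) id σ σ' = cubeIntersections σ σ' c := by
  obtain ⟨δ₀, hδ₀, h⟩ := integral_det_stairs
    (contDiff_diffLift (p := 2) (q := 2) σ.lift_smooth σ'.lift_smooth) (latM_separated c) hreg
  refine ⟨min δ₀ (1 / 2), by positivity, fun δ hδ hδ' => ?_⟩
  refine (h δ hδ (hδ'.trans_le (min_le_left _ _)) (stairM c δ)
    (stair_stairM hδ (hδ'.trans_le (min_le_right _ _)))).trans ?_
  rw [cubeIntersections, finsum_cast_real]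
  have himg : {x | x ∈ Icc (0 : Fin 4 → ℝ) 1 ∧
      ∀ j, diffLift (p := 2) (q := 2) σ.lift σ'.lift x j ∈ latM c j} =
      pairPt '' {w | σ.toFun w.1 = σ'.toFun w.2 + projM c} := by
    have key : ∀ w, (∀ j, diffLift (p := 2) (q := 2) σ.lift σ'.lift (pairPt w) j ∈ latM c j) ↔
        σ.toFun w.1 = σ'.toFun w.2 + projM c := by
      intro w
      rw [σ.lift_spec, σ'.lift_spec, ← mem_latM_iff, diffLift, pairPt_castAdd, pairPt_natAdd]
    ext x
    constructor
    · rintro ⟨hx, hx'⟩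
      rw [← range_pairPt] at hx
      obtain ⟨w, rfl⟩ := hx
      exact ⟨w, (key w).1 hx', rfl⟩
    · rintro ⟨w, hw, rfl⟩
      exact ⟨range_pairPt ▸ mem_range_self w, (key w).2 hw⟩
  change ∑ᶠ (x) (_ : x ∈ {x | x ∈ Icc (0 : Fin 4 → ℝ) 1 ∧
      ∀ j, diffLift (p := 2) (q := 2) σ.lift σ'.lift x j ∈ latM c j}), _ = _
  rw [himg, finsum_mem_image pairPt_injective.injOn]
  refine finsum_congr fun w => finsum_congr fun _ => ?_
  rw [det_gradMat_diffLift]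

theorem chainIntersections_cast (S S' : Chain projM 2) (c : Fin 4 → ℝ) :
    (chainIntersections S S' c : ℝ) =
      evalC (fun σ => evalC (fun σ' => (cubeIntersections σ σ' c : ℝ)) S') S := by
  simp only [chainIntersections, evalC_apply, Finsupp.sum, Finset.mul_sum]
  push_cast
  refine Finset.sum_congr rfl fun _ _ => Finset.sum_congr rfl fun _ _ => by ring

theorem countable_lattice : {z : Fin 4 → ℝ | ∃ m : Fin 4 → ℤ, ∀ j, z j = m j}.Countable := by
  refine (countable_range fun (m : Fin 4 → ℤ) (j : Fin 4) => (m j : ℝ)).mono ?_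
  rintro z ⟨m, hm⟩
  exact ⟨m, funext fun j => (hm j).symm⟩

/-- For almost every translation, the signed number of intersections is given by an integral. -/
theorem ae_chainIntersections_eq (S S' : Chain projM 2) :
    ∀ᵐ c : Fin 4 → ℝ, ∃ δ₀ > 0, ∀ δ, 0 < δ → δ < δ₀ →
      interInt c δ S S' = chainIntersections S S' c := by
  have hae : ∀ᵐ c : Fin 4 → ℝ, ∀ w ∈ S.support ×ˢ S'.support, ∃ δ₀ > 0, ∀ δ, 0 < δ → δ < δ₀ →
      detPair (p := 2) (q := 2) (stairM c δ) id w.1 w.2 = cubeIntersections w.1 w.2 c := by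
    rw [Finset.eventually_all]
    intro w _
    filter_upwards [ae_regular (contDiff_diffLift (p := 2) (q := 2) w.1.lift_smooth
      w.2.lift_smooth) countable_lattice] with c hc
    refine cubeIntersections_eq w.1 w.2 c fun x hx hL => hc x hx ?_
    have : ∀ j, ∃ k : ℤ, diffLift (p := 2) (q := 2) w.1.lift w.2.lift x j - c j = k := by
      intro j
      have hj := hL j
      fin_cases j
      · exact ⟨0, by rw [mem_singleton_iff.1 hj]; simp⟩
      · obtain ⟨k, hk⟩ := hj; exact ⟨k, by rw [← hk]; simp⟩
      · exact ⟨0, by rw [mem_singleton_iff.1 hj]; simp⟩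
      · obtain ⟨k, hk⟩ := hj; exact ⟨k, by rw [← hk]; simp⟩
    choose m hm using this
    exact ⟨m, hm⟩
  filter_upwards [hae] with c hc
  obtain ⟨η, hη, h⟩ := exists_pos_forall_finset (S.support ×ˢ S'.support)
    (P := fun w δ => detPair (p := 2) (q := 2) (stairM c δ) id w.1 w.2 =
      cubeIntersections w.1 w.2 c) hc
  refine ⟨η, hη, fun δ hδ hδη => ?_⟩
  rw [chainIntersections_cast, interInt]
  exact evalC_congr fun σ hσ => evalC_congr fun σ' hσ' =>
    h δ hδ hδη (σ, σ') (Finset.mem_product.2 ⟨hσ, hσ'⟩)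

/-- The intersection number of two fillings is determined by the linking integrals of their
boundaries. -/
theorem hasIntersectionNumber_iff {X₁ X₂ : ℝ} {a b a' b' : Chain projY 1} {A B A' B' : Set YSpace}
    {S S' : Chain projM 2} (hS : IsFilling X₁ X₂ a b A B S)
    (hS' : IsFilling X₁ X₂ a' b' A' B' S') (ha : a.In A) (hb : b.In B) (ha' : a'.In A')
    (hb' : b'.In B') (hA : Disjoint A A') (hB : Disjoint B B') (hda : boundary a = 0)
    (hdb' : boundary b' = 0) (N : ℤ)
    (hN : ∃ ρ > 0, ∀ c : Fin 4 → ℝ, (∀ j, |c j| ≤ ρ) → ∀ δ, 0 < δ → δ ≤ ρ →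
      linkInt c δ a a' - linkInt c δ b b' = N) (n : ℤ) :
    HasIntersectionNumber S S' n ↔ n = N := by
  have hcount : ∃ ρ > 0, ∀ᵐ c : Fin 4 → ℝ, ‖c‖ < ρ → chainIntersections S S' c = N := by
    obtain ⟨ρ, hρ, h⟩ := hN
    obtain ⟨ρ', hρ', h'⟩ := interInt_fillings hS hS' ha hb ha' hb' hA hB hda hdb'
    refine ⟨min ρ ρ' / 2, by positivity, ?_⟩
    filter_upwards [ae_chainIntersections_eq S S'] with c hc hcn
    obtain ⟨δ₀, hδ₀, hc⟩ := hc
    have hm : 0 < min ρ ρ' := lt_min hρ hρ'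
    have hmin1 := min_le_left ρ ρ'
    have hmin2 := min_le_right ρ ρ'
    have hcj : ∀ j, |c j| ≤ min ρ ρ' / 2 := fun j => (norm_le_pi_norm c j).trans hcn.le
    set δ := min (δ₀ / 2) (min ρ ρ' / 2) with hδdef
    have hδ : 0 < δ := by positivity
    have hδ1 : δ ≤ δ₀ / 2 := min_le_left _ _
    have hδ2 : δ ≤ min ρ ρ' / 2 := min_le_right _ _
    have e1 := hc δ hδ (by linarith)
    have e2 := h' (min ρ ρ' / 2) (by positivity) (by linarith) c hcj δ hδ hδ2
    have e3 := h c (fun j => (hcj j).trans (by linarith)) δ hδ (by linarith)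
    rw [e1, e3] at e2
    exact_mod_cast e2
  constructor
  · rintro ⟨ρ, hρ, h⟩
    obtain ⟨ρ', hρ', h'⟩ := hcount
    -- Uniqueness: both almost-everywhere statements hold on a common small ball, which has positive
    -- measure, so some translation satisfies both.
    have hpos : (volume : Measure (Fin 4 → ℝ)) (Metric.ball 0 (min ρ ρ')) ≠ 0 :=
      (Metric.measure_ball_pos _ _ (lt_min hρ hρ')).ne'
    have hfreq : ∃ᶠ c in ae (volume : Measure (Fin 4 → ℝ)), c ∈ Metric.ball (0 : Fin 4 → ℝ) (min ρ ρ') :=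
      frequently_ae_mem_iff.2 hpos
    obtain ⟨c, hc, hc1, hc2⟩ := (hfreq.and_eventually (h.and h')).exists
    have hc' : ‖c‖ < min ρ ρ' := by simpa using hc
    rw [← hc1 (hc'.trans_le (min_le_left _ _)), hc2 (hc'.trans_le (min_le_right _ _))]
  · rintro rfl
    exact hcount

end Counting

/-! ### Winding numbers of plane curves as crossing integrals. -/

section Winding

open MeasureTheory Set Complex

/-- A step from `0` to `1` inside `[-ρ, ρ]`. -/
structure IsStep (ρ : ℝ) (B : ℝ → ℝ) : Prop where
  smooth : ContDiff ℝ ∞ B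
  zero : ∀ x ≤ -ρ, B x = 0
  one : ∀ x, ρ ≤ x → B x = 1

theorem IsStep.deriv_ne_zero {ρ : ℝ} {B : ℝ → ℝ} (h : IsStep ρ B) {x : ℝ} (hx : deriv B x ≠ 0) :
    |x| ≤ ρ := by
  by_contra! hlt
  refine hx ?_
  rcases lt_abs.1 hlt with h1 | h1
  · have : B =ᶠ[nhds x] fun _ => 1 := by
      filter_upwards [lt_mem_nhds h1] with y hy using h.one y hy.le
    rw [this.deriv_eq, deriv_const]
  · have : B =ᶠ[nhds x] fun _ => 0 := by
      filter_upwards [gt_mem_nhds (show x < -ρ by linarith)] with y hy using h.zero y hy.le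
    rw [this.deriv_eq, deriv_const]

theorem isStep_stepFn {c δ ρ : ℝ} (hδ : 0 < δ) (h1 : -ρ ≤ c) (h2 : c + δ ≤ ρ) :
    IsStep ρ (stepFn c δ) :=
  ⟨contDiff_stepFn c δ, fun _ hx => stepFn_of_le hδ (hx.trans h1),
    fun _ hx => stepFn_of_ge hδ (h2.trans hx)⟩

/-- Integrate the logarithmic derivative to get G; then exp(-G) f has zero derivative and the value
1 at time 0. -/
theorem exists_smooth_log {f : ℝ → ℂ} (hf : ContDiff ℝ ∞ f) (h0 : ∀ t, f t ≠ 0) :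
    ∃ G : ℝ → ℂ, ContDiff ℝ ∞ G ∧ ∀ t, exp (G t) = f t := by
  have hdf : ContDiff ℝ ∞ (deriv f) := ((contDiff_succ_iff_deriv (n := ∞)).1 (by simpa using hf)).2.2
  have hq : ContDiff ℝ ∞ fun t => deriv f t / f t := by
    simp only [div_eq_mul_inv]
    exact hdf.mul (hf.inv h0)
  let G : ℝ → ℂ := fun t => log (f 0) + ∫ s in (0 : ℝ)..t, deriv f s / f s
  have hG : ∀ t, HasDerivAt G (deriv f t / f t) t := fun t =>
    (intervalIntegral.integral_hasDerivAt_right (hq.continuous.intervalIntegrable _ _)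
      (hq.continuous.stronglyMeasurableAtFilter _ _) hq.continuous.continuousAt).const_add _
  have hGs : ContDiff ℝ ∞ G := by
    rw [contDiff_infty_iff_deriv]
    refine ⟨fun t => (hG t).differentiableAt, ?_⟩
    have : deriv G = fun t => deriv f t / f t := funext fun t => (hG t).deriv
    rw [this]; exact hq
  refine ⟨G, hGs, fun t => ?_⟩
  have hd : ∀ t, HasDerivAt (fun t => exp (-G t) * f t) 0 t := by
    intro t
    have h1 := ((hG t).neg.cexp).mul (hf.differentiable (by simp) t).hasDerivAt
    refine h1.congr_deriv ?_
    rw [mul_assoc, neg_mul, div_mul_cancel₀ _ (h0 t)]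
    ring
  have hc : exp (-G t) * f t = exp (-G 0) * f 0 :=
    is_const_of_deriv_eq_zero (fun t => (hd t).differentiableAt) (fun t => (hd t).deriv) t 0
  have hG0 : exp (-G 0) * f 0 = 1 := by
    simp only [G, intervalIntegral.integral_same, add_zero]
    rw [exp_neg, exp_log (h0 0), inv_mul_cancel₀ (h0 0)]
  rw [hG0, exp_neg] at hc
  have := exp_ne_zero (G t)
  field_simp at hc
  exact hc.symm

/-- Two continuous logarithms of the same function have the same increments. -/
theorem log_increment_eq {G G' : ℝ → ℂ} (hG : Continuous G) (hG' : Continuous G')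
    (h : ∀ t, exp (G t) = exp (G' t)) (s t : ℝ) : G t - G s = G' t - G' s := by
  have hd : ∀ t, ∃ n : ℤ, G t = G' t + n * (2 * Real.pi * I) := fun t => exp_eq_exp_iff_exists_int.1 (h t)
  have hsub : range (fun t => ((G t - G' t) / (2 * Real.pi * I)).re) ⊆ range ((↑) : ℤ → ℝ) := by
    rintro _ ⟨t, rfl⟩
    obtain ⟨n, hn⟩ := hd t
    refine ⟨n, ?_⟩
    have : (G t - G' t) / (2 * Real.pi * I) = n := by
      rw [hn]; field_simp [Real.pi_ne_zero, I_ne_zero]; ring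
    simp only [this]
    simp
  have hcont : Continuous fun t => ((G t - G' t) / (2 * Real.pi * I)).re :=
    continuous_re.comp ((hG.sub hG').div_const _)
  have hss := (countable_range ((↑) : ℤ → ℝ)).isTotallyDisconnected _ hsub
    (isPreconnected_range hcont)
  have e : ((G t - G' t) / (2 * Real.pi * I)).re = ((G s - G' s) / (2 * Real.pi * I)).re :=
    hss ⟨t, rfl⟩ ⟨s, rfl⟩
  obtain ⟨n, hn⟩ := hd t
  obtain ⟨m, hm⟩ := hd s
  have hn' : (G t - G' t) / (2 * Real.pi * I) = n := by
    rw [hn]; field_simp [Real.pi_ne_zero, I_ne_zero]; ring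
  have hm' : (G s - G' s) / (2 * Real.pi * I) = m := by
    rw [hm]; field_simp [Real.pi_ne_zero, I_ne_zero]; ring
  rw [hn', hm'] at e
  have hnm : n = m := by simpa using e
  rw [hn, hm, hnm]; ring

/-- The nowhere zero function `f` makes `n` turns on `[0, T]`. -/
def HasTurns (f : ℝ → ℂ) (T : ℝ) (n : ℤ) : Prop :=
  ∃ G : ℝ → ℂ, ContDiff ℝ ∞ G ∧ (∀ t, exp (G t) = f t) ∧ G T = G 0 + 2 * Real.pi * I * n

theorem exists_hasTurns {f : ℝ → ℂ} (hf : ContDiff ℝ ∞ f) (h0 : ∀ t, f t ≠ 0) {T : ℝ}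
    (hT : f T = f 0) : ∃ n : ℤ, HasTurns f T n := by
  obtain ⟨G, hG, hGf⟩ := exists_smooth_log hf h0
  have : exp (G T) = exp (G 0) := by rw [hGf, hGf, hT]
  obtain ⟨n, hn⟩ := exp_eq_exp_iff_exists_int.1 this
  exact ⟨n, G, hG, hGf, by rw [hn]; ring⟩

theorem leadInt_curve {G : ℝ → Fin 2 → ℝ} (hG : ContDiff ℝ ∞ G) :
    leadInt (fun y : Fin 1 → ℝ => G (y 0)) = ∫ t in (0 : ℝ)..1, G t 0 * deriv (fun s => G s 1) t := by
  have e : (MeasurableEquiv.funUnique (Fin 1) ℝ) ⁻¹' Icc (0 : ℝ) 1 = Icc (0 : Fin 1 → ℝ) 1 := by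
    ext y
    simp only [mem_preimage, mem_Icc, Pi.le_def, Fin.forall_fin_one]
    rfl
  rw [intervalIntegral.integral_of_le zero_le_one, ← integral_Icc_eq_integral_Ioc,
    ← (volume_preserving_funUnique (Fin 1) ℝ).setIntegral_preimage_emb
      (MeasurableEquiv.measurableEmbedding _), e]
  refine setIntegral_congr_fun measurableSet_Icc fun y _ => ?_
  have h1 : MeasurableEquiv.funUnique (Fin 1) ℝ y = y 0 := rfl
  simp only [h1]
  congr 1
  rw [Matrix.det_fin_one]
  simp only [Matrix.submatrix_apply, gradMat, Matrix.of_apply, id]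
  have h2 : HasFDerivAt (fun y : Fin 1 → ℝ => G (y 0))
      ((fderiv ℝ G (y 0)).comp (ContinuousLinearMap.proj 0)) y :=
    (hG.differentiable (by simp) (y 0)).hasFDerivAt.comp y
      (ContinuousLinearMap.proj (R := ℝ) (φ := fun _ : Fin 1 => ℝ) 0).hasFDerivAt
  have h3 : HasDerivAt (fun s => G s 1) (fderiv ℝ G (y 0) 1 1) (y 0) :=
    (hasDerivAt_pi.1 (hG.differentiable (by simp) (y 0)).hasFDerivAt.hasDerivAt) 1
  rw [h2.fderiv, h3.deriv]
  simp

/-- The curve `f` in the plane, with the functions `B`, `V` applied to the coordinates. -/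
def planeCurve (B V : ℝ → ℝ) (f : ℝ → ℂ) : ℝ → Fin 2 → ℝ := fun t => ![B (f t).re, V (f t).im]

theorem contDiff_planeCurve {B V : ℝ → ℝ} (hB : ContDiff ℝ ∞ B) (hV : ContDiff ℝ ∞ V) {f : ℝ → ℂ}
    (hf : ContDiff ℝ ∞ f) : ContDiff ℝ ∞ (planeCurve B V f) := by
  refine contDiff_pi.2 fun j => ?_
  fin_cases j
  · exact hB.comp (reCLM.contDiff.comp hf)
  · exact hV.comp (imCLM.contDiff.comp hf)

variable {ρ : ℝ} {B V : ℝ → ℝ}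

/-- The integral over a full circle. -/
theorem integral_circle (hρ : 0 < ρ) (hB : IsStep ρ B) (hV : IsStep ρ V) {R : ℝ} (hR : 2 * ρ ≤ R) :
    ∫ θ in (0 : ℝ)..2 * Real.pi,
      B (R * Real.cos θ) * (deriv V (R * Real.sin θ) * (R * Real.cos θ)) = 1 := by
  set g : ℝ → ℝ := fun θ => B (R * Real.cos θ) * (deriv V (R * Real.sin θ) * (R * Real.cos θ))
  have hVd : Continuous (deriv V) :=
    (((contDiff_succ_iff_deriv (n := ∞)).1 (by simpa using hV.smooth)).2.2).continuous
  have hg : Continuous g := by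
    have := hB.smooth.continuous
    fun_prop
  have hper : Function.Periodic g (2 * Real.pi) := fun θ => by
    simp only [g, Real.cos_add_two_pi, Real.sin_add_two_pi]
  -- Starting the period at -π/2 makes cos nonnegative on the first half and nonpositive on the
  -- second. Where the bump V' is nonzero, |R cos θ| ≥ ρ, so B is 1 on the right half and 0 on the
  -- left half; the integral is V(R) - V(-R) = 1.
  have hp := hper.intervalIntegral_add_eq 0 (-(Real.pi / 2))
  rw [zero_add] at hp
  rw [hp]
  have hbig : ∀ θ : ℝ, deriv V (R * Real.sin θ) ≠ 0 → ρ ≤ |R * Real.cos θ| := by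
    intro θ h
    have h1 := hV.deriv_ne_zero h
    by_contra! h2
    have h3 := sq_lt_sq' (by linarith [abs_nonneg (R * Real.cos θ)]) h2
    have h4 := sq_le_sq' (by linarith [abs_nonneg (R * Real.sin θ)]) h1
    rw [sq_abs] at h3 h4
    have h5 : (R * Real.cos θ) ^ 2 + (R * Real.sin θ) ^ 2 = R ^ 2 := by
      linear_combination R ^ 2 * Real.sin_sq_add_cos_sq θ
    have h6 : (2 * ρ) ^ 2 ≤ R ^ 2 := pow_le_pow_left₀ (by positivity) hR 2
    nlinarith [sq_nonneg ρ, mul_pos hρ hρ]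
  have hsplit : ∫ θ in (-(Real.pi / 2))..(-(Real.pi / 2) + 2 * Real.pi), g θ =
      (∫ θ in (-(Real.pi / 2))..(Real.pi / 2), g θ) +
        ∫ θ in (Real.pi / 2)..(-(Real.pi / 2) + 2 * Real.pi), g θ :=
    (intervalIntegral.integral_add_adjacent_intervals (hg.intervalIntegrable _ _)
      (hg.intervalIntegrable _ _)).symm
  rw [hsplit]
  have h1 : ∫ θ in (-(Real.pi / 2))..(Real.pi / 2), g θ =
      ∫ θ in (-(Real.pi / 2))..(Real.pi / 2), deriv V (R * Real.sin θ) * (R * Real.cos θ) := by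
    refine intervalIntegral.integral_congr fun θ hθ => ?_
    rw [uIcc_of_le (by linarith [Real.pi_pos])] at hθ
    have hcos : 0 ≤ Real.cos θ := Real.cos_nonneg_of_mem_Icc hθ
    simp only [g]
    by_cases hz : deriv V (R * Real.sin θ) = 0
    · simp [hz]
    · have := hbig θ hz
      rw [abs_of_nonneg (mul_nonneg (by linarith) hcos)] at this
      rw [hB.one _ this, one_mul]
  have h2 : ∫ θ in (Real.pi / 2)..(-(Real.pi / 2) + 2 * Real.pi), g θ = 0 := by
    refine intervalIntegral.integral_zero_ae (ae_of_all _ fun θ hθ => ?_)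
    rw [uIoc_of_le (by linarith [Real.pi_pos])] at hθ
    have hcos : Real.cos θ ≤ 0 :=
      Real.cos_nonpos_of_pi_div_two_le_of_le hθ.1.le (by linarith [hθ.2])
    simp only [g]
    by_cases hz : deriv V (R * Real.sin θ) = 0
    · simp [hz]
    · have := hbig θ hz
      rw [abs_of_nonpos (mul_nonpos_of_nonneg_of_nonpos (by linarith) hcos)] at this
      rw [hB.zero _ (by linarith), zero_mul]
  have h3 : ∫ θ in (-(Real.pi / 2))..(Real.pi / 2), deriv V (R * Real.sin θ) * (R * Real.cos θ) =
      V (R * Real.sin (Real.pi / 2)) - V (R * Real.sin (-(Real.pi / 2))) := by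
    refine intervalIntegral.integral_eq_sub_of_hasDerivAt (f := fun θ => V (R * Real.sin θ))
      (fun θ _ => ?_) ((Continuous.intervalIntegrable (by fun_prop) _ _))
    exact ((hV.smooth.differentiable (by simp) _).hasDerivAt).comp θ
      ((Real.hasDerivAt_sin θ).const_mul R)
  rw [h1, h2, h3, Real.sin_neg, Real.sin_pi_div_two, hV.one _ (by linarith), hV.zero _ (by linarith)]
  ring

/-- The number of turns of a curve as a crossing integral. -/
theorem leadInt_planeCurve (hρ : 0 < ρ) (hB : IsStep ρ B) (hV : IsStep ρ V) {f : ℝ → ℂ} {n : ℤ}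
    (hf : HasTurns f 1 n) (hfar : ∀ t ∈ Icc (0 : ℝ) 1, 2 * ρ < ‖f t‖) :
    leadInt (fun y : Fin 1 → ℝ => planeCurve B V f (y 0)) = n := by
  obtain ⟨g, hg, hgf, hgn⟩ := hf
  obtain rfl : f = fun t => exp (g t) := funext fun t => (hgf t).symm
  -- Any L above log 2ρ serves: interpolating log |f| with L keeps the modulus larger than 2ρ during
  -- the whole homotopy.
  set L : ℝ := Real.log (2 * ρ) + 1 with hL
  have hlog : ∀ t ∈ Icc (0 : ℝ) 1, Real.log (2 * ρ) < (g t).re := by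
    intro t ht
    have := hfar t ht
    rw [norm_exp] at this
    rwa [← Real.log_lt_iff_lt_exp (by positivity)] at this
  -- the homotopy to a multiple of a round circle
  let D : (Fin 2 → ℝ) → ℂ := fun y => exp (((1 - y 0) * (g (y 1)).re + y 0 * L : ℝ) + (g (y 1)).im * I)
  have hc0 : ContDiff ℝ ∞ fun y : Fin 2 → ℝ => y 0 := contDiff_apply ℝ ℝ 0
  have hc1 : ContDiff ℝ ∞ fun y : Fin 2 → ℝ => y 1 := contDiff_apply ℝ ℝ 1
  have hgre : ContDiff ℝ ∞ fun y : Fin 2 → ℝ => (g (y 1)).re :=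
    reCLM.contDiff.comp (hg.comp hc1)
  have hgim : ContDiff ℝ ∞ fun y : Fin 2 → ℝ => (g (y 1)).im :=
    imCLM.contDiff.comp (hg.comp hc1)
  have hD : ContDiff ℝ ∞ D := by
    refine contDiff_exp.comp ?_
    refine (ofRealCLM.contDiff.comp (((contDiff_const.sub hc0).mul hgre).add
      (hc0.mul contDiff_const))).add ((ofRealCLM.contDiff.comp hgim).mul contDiff_const)
  let Dv : (Fin 2 → ℝ) → (Fin 2 → ℝ) := fun y => ![(D y).re, (D y).im]
  have hDv : ContDiff ℝ ∞ Dv := by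
    refine contDiff_pi.2 fun j => ?_
    fin_cases j
    · exact reCLM.contDiff.comp hD
    · exact imCLM.contDiff.comp hD
  let H : Fin 2 → ℝ → ℝ := ![B, V]
  have hH : ∀ j, ContDiff ℝ ∞ (H j) := by
    intro j
    fin_cases j
    exacts [hB.smooth, hV.smooth]
  have hst := integral_det_gradMat (contDiff_stairMap hH (ι := id) hDv)
  -- Both derivatives B' and V' are nonzero only in the square with half side ρ, which lies in the
  -- disc of radius 2ρ that the homotopy avoids.
  have hzero : ∫ x in Icc (0 : Fin 2 → ℝ) 1, (gradMat (stairMap H id Dv) x).det = 0 := by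
    refine (setIntegral_congr_fun (g := fun _ => (0 : ℝ)) measurableSet_Icc fun x hx => ?_).trans
      (by simp)
    change (gradMat (fun y j => H j (Dv y j)) x).det = 0
    rw [det_gradMat_comp (fun j => (hH j).differentiable (by simp)) (hDv.differentiable (by simp)),
      Fin.prod_univ_two]
    by_contra hne
    have h1 := hB.deriv_ne_zero (left_ne_zero_of_mul (left_ne_zero_of_mul hne))
    have h2 := hV.deriv_ne_zero (right_ne_zero_of_mul (left_ne_zero_of_mul hne))
    have h3 : ‖D x‖ ≤ 2 * ρ := by
      refine (norm_le_abs_re_add_abs_im _).trans ?_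
      have e1 : |(D x).re| ≤ ρ := h1
      have e2 : |(D x).im| ≤ ρ := h2
      linarith
    have h4 : 2 * ρ < ‖D x‖ := by
      simp only [D]
      rw [norm_exp, ← Real.log_lt_iff_lt_exp (by positivity)]
      have hx0 : 0 ≤ x 0 := hx.1 0
      have hx1 : x 0 ≤ 1 := hx.2 0
      have := hlog (x 1) ⟨hx.1 1, hx.2 1⟩
      simp
      rcases hx0.eq_or_lt with h | h
      · rw [← h]; simpa using this
      · nlinarith
    linarith
  rw [hzero, Fin.sum_univ_two] at hst
  -- The logarithm changes by 2πi n over the interval, with n an integer, so all curves of the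
  -- homotopy are closed and the two lateral faces cancel.
  have hperiod : (fun y : Fin 1 → ℝ => stairMap H id Dv ((1 : Fin 2).insertNth 1 y)) =
      fun y => stairMap H id Dv ((1 : Fin 2).insertNth 0 y) := by
    have hDp : ∀ a : ℝ, D ![a, 1] = D ![a, 0] := by
      intro a
      have e1 : (g 1).re = (g 0).re := by rw [hgn]; simp
      have e2 : (g 1).im = (g 0).im + 2 * Real.pi * n := by rw [hgn]; simp
      simp only [D]
      rw [exp_eq_exp_iff_exists_int]
      refine ⟨n, ?_⟩
      simp [e1, e2]
      ring
    funext y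
    have e1 : ((1 : Fin 2).insertNth (1 : ℝ) y : Fin 2 → ℝ) = ![y 0, 1] := by
      funext j; fin_cases j <;> rfl
    have e0 : ((1 : Fin 2).insertNth (0 : ℝ) y : Fin 2 → ℝ) = ![y 0, 0] := by
      funext j; fin_cases j <;> rfl
    rw [e1, e0]
    funext j
    change H j (Dv ![y 0, 1] (id j)) = H j (Dv ![y 0, 0] (id j))
    rw [show Dv ![y 0, 1] = Dv ![y 0, 0] by simp only [Dv, hDp]]
  have hface : ∀ e : ℝ, (fun y : Fin 1 → ℝ => stairMap H id Dv ((0 : Fin 2).insertNth e y)) =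
      fun y => planeCurve B V (fun t => D ![e, t]) (y 0) := by
    intro e
    funext y
    have e1 : ((0 : Fin 2).insertNth e y : Fin 2 → ℝ) = ![e, y 0] := by
      funext j; fin_cases j <;> rfl
    rw [e1]
    funext j
    fin_cases j <;> rfl
  rw [hperiod, hface 1, hface 0, sub_self] at hst
  have hst' : leadInt (fun y : Fin 1 → ℝ => planeCurve B V (fun t => D ![0, t]) (y 0)) =
      leadInt (fun y : Fin 1 → ℝ => planeCurve B V (fun t => D ![1, t]) (y 0)) := by
    simp at hst; linarith
  have hD0 : (fun t => D ![0, t]) = fun t => exp (g t) := by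
    funext t
    simp only [D]
    congr 1
    simp
  rw [hD0] at hst'
  rw [hst']
  set R := Real.exp L with hRdef
  have hR : 2 * ρ ≤ R := by
    rw [← Real.exp_log (show 0 < 2 * ρ by positivity)]
    exact Real.exp_le_exp.2 (by linarith)
  have hD1 : (fun t => D ![1, t]) = fun t => (R : ℂ) * exp ((g t).im * I) := by
    funext t
    simp only [D]
    rw [exp_add, hRdef, ofReal_exp]
    simp
  have hθ : ContDiff ℝ ∞ fun t => (g t).im := imCLM.contDiff.comp hg
  have hsm : ContDiff ℝ ∞ fun t => (R : ℂ) * exp ((g t).im * I) :=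
    contDiff_const.mul (contDiff_exp.comp ((ofRealCLM.contDiff.comp hθ).mul contDiff_const))
  rw [hD1, leadInt_curve (contDiff_planeCurve hB.smooth hV.smooth hsm)]
  have hVd : Continuous (deriv V) :=
    (((contDiff_succ_iff_deriv (n := ∞)).1 (by simpa using hV.smooth)).2.2).continuous
  set k : ℝ → ℝ := fun θ => B (R * Real.cos θ) * (deriv V (R * Real.sin θ) * (R * Real.cos θ))
    with hk
  have hkc : Continuous k := by
    have := hB.smooth.continuous
    fun_prop
  have hcurve : ∀ t, planeCurve B V (fun t => (R : ℂ) * exp ((g t).im * I)) t =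
      ![B (R * Real.cos (g t).im), V (R * Real.sin (g t).im)] := by
    intro t
    simp only [planeCurve]
    rw [re_ofReal_mul, im_ofReal_mul, exp_ofReal_mul_I_re, exp_ofReal_mul_I_im]
  have hint : ∀ t, planeCurve B V (fun t => (R : ℂ) * exp ((g t).im * I)) t 0 *
      deriv (fun s => planeCurve B V (fun t => (R : ℂ) * exp ((g t).im * I)) s 1) t =
      (k ∘ fun t => (g t).im) t * deriv (fun t => (g t).im) t := by
    intro t
    simp only [hcurve, Matrix.cons_val_zero, Matrix.cons_val_one, Function.comp, hk]
    have h1 : HasDerivAt (fun s => V (R * Real.sin (g s).im))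
        (deriv V (R * Real.sin (g t).im) *
          (R * (Real.cos (g t).im * deriv (fun t => (g t).im) t))) t :=
      ((hV.smooth.differentiable (by simp) _).hasDerivAt).comp t
        ((((Real.hasDerivAt_sin _).comp t
          (hθ.differentiable (by simp) t).hasDerivAt)).const_mul R)
    rw [h1.deriv]
    ring
  simp_rw [hint]
  have hθd : Continuous (deriv fun t => (g t).im) :=
    (((contDiff_succ_iff_deriv (n := ∞)).1 (by simpa using hθ)).2.2).continuous
  -- With the angle as variable, this is the integral of a 2π-periodic function over n periods, each
  -- worth 1 by `integral_circle`.
  rw [intervalIntegral.integral_comp_mul_deriv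
    (fun t _ => (hθ.differentiable (by simp) t).hasDerivAt) hθd.continuousOn hkc]
  have hper : Function.Periodic k (2 * Real.pi) := fun θ => by
    simp only [hk, Real.cos_add_two_pi, Real.sin_add_two_pi]
  have e2 : (g 1).im = (g 0).im + n • (2 * Real.pi) := by rw [hgn]; simp; ring
  have e3 := hper.intervalIntegral_add_eq (g 0).im 0
  rw [zero_add] at e3
  rw [e2, hper.intervalIntegral_add_zsmul_eq n, e3, integral_circle hρ hB hV hR]
  · simp
  · exact fun _ _ => hkc.intervalIntegrable _ _

end Winding

/-! ### Zeros of a section over a chain: the argument principle. -/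

section Zeros

open MeasureTheory Set

/-- The section `ψ` along the map `G`, as a map to the plane. -/
def secMap (ψ : ℝ → ℂ → ℂ) {n : ℕ} (G : (Fin n → ℝ) → (Fin 3 → ℝ)) : (Fin n → ℝ) → (Fin 2 → ℝ) :=
  fun y => ![(sectionAt ψ (G y)).re, (sectionAt ψ (G y)).im]

/-- The steps at the coordinates of `ζ`. -/
def stepsAt (ζ : ℂ) (δ : ℝ) : Fin 2 → ℝ → ℝ := ![stepFn ζ.re δ, stepFn ζ.im δ]

/-- The integral that counts the zeros of `ψ - ζ` on a 2-cube. -/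
def zeroInt (ψ : ℝ → ℂ → ℂ) (ζ : ℂ) (δ : ℝ) (σ : SmoothCube projY 2) : ℝ :=
  ∫ y in Icc (0 : Fin 2 → ℝ) 1, (gradMat (fun y j => stepsAt ζ δ j (secMap ψ σ.lift y j)) y).det

/-- The integral that gives the number of turns of `ψ - ζ` along a loop. -/
def turnInt (ψ : ℝ → ℂ → ℂ) (ζ : ℂ) (δ : ℝ) (σ : SmoothCube projY 1) : ℝ :=
  leadInt fun y j => stepsAt ζ δ j (secMap ψ σ.lift y j)

variable {ψ : ℝ → ℂ → ℂ} {n : ℕ}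

theorem contDiff_stepsAt (ζ : ℂ) (δ : ℝ) (j : Fin 2) : ContDiff ℝ ∞ (stepsAt ζ δ j) := by
  fin_cases j
  exacts [contDiff_stepFn _ _, contDiff_stepFn _ _]

theorem stair_stepsAt (ζ : ℂ) {δ : ℝ} (hδ : 0 < δ) (j : Fin 2) :
    Stair ((![{ζ.re}, {ζ.im}] : Fin 2 → Set ℝ) j) δ (stepsAt ζ δ j) := by
  fin_cases j
  exacts [stair_stepFn hδ, stair_stepFn hδ]

theorem IsSection.contDiff_sectionAt (hψ : IsSection ψ) : ContDiff ℝ ∞ (sectionAt ψ) := by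
  have h2 : ContDiff ℝ ∞ fun v : Fin 3 → ℝ => (⟨v 1, v 2⟩ : ℂ) :=
    Complex.equivRealProdCLM.symm.contDiff.comp
      ((contDiff_apply ℝ ℝ (1 : Fin 3)).prodMk (contDiff_apply ℝ ℝ (2 : Fin 3)))
  exact hψ.1.comp ((contDiff_apply ℝ ℝ (0 : Fin 3)).prodMk h2)

theorem IsSection.contDiff_secMap (hψ : IsSection ψ) {G : (Fin n → ℝ) → (Fin 3 → ℝ)}
    (hG : ContDiff ℝ ∞ G) : ContDiff ℝ ∞ (secMap ψ G) := by
  refine contDiff_pi.2 fun j => ?_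
  fin_cases j
  · exact Complex.reCLM.contDiff.comp (hψ.contDiff_sectionAt.comp hG)
  · exact Complex.imCLM.contDiff.comp (hψ.contDiff_sectionAt.comp hG)

theorem IsSection.add_int_t (hψ : IsSection ψ) (t : ℝ) (z : ℂ) (m : ℤ) : ψ (t + m) z = ψ t z := by
  have hp : Function.Periodic (fun t => ψ t z) 1 := fun t => hψ.2.1 t z
  simpa using hp.int_mul m t

theorem IsSection.add_int_y (hψ : IsSection ψ) (t : ℝ) (z : ℂ) (m : ℤ) :
    ψ t (z + m * Complex.I) = ψ t z := by
  have hp : Function.Periodic (ψ t) Complex.I := fun z => hψ.2.2 t z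
  simpa using hp.int_mul m z

theorem IsSection.sectionAt_eq (hψ : IsSection ψ) {v w : Fin 3 → ℝ} {m : Fin 3 → ℤ} (hm : m 1 = 0)
    (h : ∀ j, v j = w j + m j) : sectionAt ψ v = sectionAt ψ w := by
  have e : (⟨v 1, v 2⟩ : ℂ) = (⟨w 1, w 2⟩ : ℂ) + m 2 * Complex.I := by
    apply Complex.ext <;> simp [h 1, h 2, hm]
  rw [sectionAt, sectionAt, e, hψ.add_int_y, h 0, hψ.add_int_t]

theorem IsSection.liftEq_secMap (hψ : IsSection ψ) {A A' : (Fin n → ℝ) → (Fin 3 → ℝ)}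
    (h : LiftEq perY A A') (ζ : ℂ) (δ : ℝ) :
    LiftEq (fun _ : Fin 2 => False) (fun y j => stepsAt ζ δ j (secMap ψ A y j))
      fun y j => stepsAt ζ δ j (secMap ψ A' y j) := by
  obtain ⟨m, hm, h⟩ := h
  refine ⟨0, fun _ _ => rfl, fun u hu j => ?_⟩
  have e : secMap ψ A u = secMap ψ A' u := by
    simp only [secMap, hψ.sectionAt_eq (hm 1 (by simp [perY])) (h u hu)]
  simp [e]

theorem contDiff_stepsAt_secMap (hψ : IsSection ψ) {G : (Fin n → ℝ) → (Fin 3 → ℝ)}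
    (hG : ContDiff ℝ ∞ G) (ζ : ℂ) (δ : ℝ) :
    ContDiff ℝ ∞ fun y j => stepsAt ζ δ j (secMap ψ G y j) :=
  contDiff_pi.2 fun j => (contDiff_stepsAt ζ δ j).comp (contDiff_pi.1 (hψ.contDiff_secMap hG) j)

theorem turnInt_eq (hψ : IsSection ψ) {σ : SmoothCube projY 1} {A : (Fin 1 → ℝ) → (Fin 3 → ℝ)}
    (h : LiftEq perY σ.lift A) (ζ : ℂ) (δ : ℝ) :
    turnInt ψ ζ δ σ = leadInt fun y j => stepsAt ζ δ j (secMap ψ A y j) :=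
  (hψ.liftEq_secMap h ζ δ).leadInt_eq not_false

theorem turnInt_degenerate (hψ : IsSection ψ) (ζ : ℂ) (δ : ℝ) (σ : SmoothCube projY 1)
    (hσ : σ.IsDegenerate) : turnInt ψ ζ δ σ = 0 := by
  obtain ⟨i, hi⟩ := hσ.exists_fderiv_eq_zero isLatticeProj_projY
  refine leadInt_eq_zero_of_row i fun y hy j => ?_
  have hs : Differentiable ℝ fun v : Fin 3 → ℝ =>
      fun j => stepsAt ζ δ j ((![(sectionAt ψ v).re, (sectionAt ψ v).im] : Fin 2 → ℝ) j) := by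
    refine ContDiff.differentiable (n := ∞) (contDiff_pi.2 fun j => (contDiff_stepsAt ζ δ j).comp ?_)
      (by simp)
    fin_cases j
    · exact Complex.reCLM.contDiff.comp hψ.contDiff_sectionAt
    · exact Complex.imCLM.contDiff.comp hψ.contDiff_sectionAt
  have hc := fderiv_comp y (hs (σ.lift y)) (σ.lift_smooth.differentiable (by simp) y)
  simp only [gradMat, Matrix.of_apply]
  have e : (fun y j => stepsAt ζ δ j (secMap ψ σ.lift y j)) =
    (fun v : Fin 3 → ℝ => fun j => stepsAt ζ δ j
      ((![(sectionAt ψ v).re, (sectionAt ψ v).im] : Fin 2 → ℝ) j)) ∘ σ.lift := rfl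
  rw [e, hc, ContinuousLinearMap.comp_apply, hi y hy, map_zero]
  rfl

theorem zeroInt_eq (hψ : IsSection ψ) (ζ : ℂ) (δ : ℝ) (σ : SmoothCube projY 2) :
    zeroInt ψ ζ δ σ = ∑ i : Fin 2, (-1 : ℝ) ^ (i : ℕ) *
      (turnInt ψ ζ δ (σ.face i 1) - turnInt ψ ζ δ (σ.face i 0)) := by
  have hS := integral_det_gradMat (contDiff_stepsAt_secMap hψ σ.lift_smooth ζ δ)
  refine hS.trans (Finset.sum_congr rfl fun i _ => ?_)
  rw [turnInt_eq hψ (σ.liftEq_face isLatticeProj_projY i 1),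
    turnInt_eq hψ (σ.liftEq_face isLatticeProj_projY i 0)]
  rfl

/-- The form that counts zeros is exact, so its integral over a chain is the integral of turns over
the boundary, and degenerate cubes contribute nothing. -/
theorem evalC_zeroInt (hψ : IsSection ψ) (ζ : ℂ) (δ : ℝ) {W : Chain projY 2} {a : Chain projY 1}
    (hW : boundary W - a ∈ degenerate projY 1) :
    evalC (zeroInt ψ ζ δ) W = evalC (turnInt ψ ζ δ) a := by
  rw [← evalC_eq_of_sub_mem (turnInt_degenerate hψ ζ δ) hW, evalC_boundary]
  exact evalC_congr fun σ _ => zeroInt_eq hψ ζ δ σ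

def valPt (u : Fin 2 → unitInterval) : Fin 2 → ℝ := fun j => u j

theorem valPt_injective : Function.Injective valPt := fun u v h => by
  funext j
  exact Subtype.ext (congrFun h j)

theorem gradMat_secMap (hψ : IsSection ψ) (σ : SmoothCube projY 2) (x : Fin 2 → ℝ) :
    gradMat (secMap ψ σ.lift) x = Matrix.of fun i : Fin 2 =>
      let d := fderiv ℝ (fun w => sectionAt ψ (σ.lift w)) x (Pi.single i 1)
      ![d.re, d.im] := by
  have hd : HasFDerivAt (fun w => sectionAt ψ (σ.lift w))
      (fderiv ℝ (fun w => sectionAt ψ (σ.lift w)) x) x :=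
    ((hψ.contDiff_sectionAt.comp σ.lift_smooth).differentiable (by simp) x).hasFDerivAt
  have h1 : HasFDerivAt (secMap ψ σ.lift) (ContinuousLinearMap.pi
      ![Complex.reCLM.comp (fderiv ℝ (fun w => sectionAt ψ (σ.lift w)) x),
        Complex.imCLM.comp (fderiv ℝ (fun w => sectionAt ψ (σ.lift w)) x)]) x := by
    rw [hasFDerivAt_pi]
    intro j
    fin_cases j
    · exact Complex.reCLM.hasFDerivAt.comp x hd
    · exact Complex.imCLM.hasFDerivAt.comp x hd
  ext i j
  simp only [gradMat, Matrix.of_apply]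
  rw [h1.fderiv]
  fin_cases j <;> rfl

theorem cubeZeros_eq (hψ : IsSection ψ) (σ : SmoothCube projY 2) (ζ : ℂ)
    (hreg : ∀ x ∈ Icc (0 : Fin 2 → ℝ) 1,
      (∀ j, secMap ψ σ.lift x j ∈ (![{ζ.re}, {ζ.im}] : Fin 2 → Set ℝ) j) →
      (∀ i, x i ∈ Ioo (0 : ℝ) 1) ∧ (gradMat (secMap ψ σ.lift) x).det ≠ 0) :
    ∃ δ₀ > 0, ∀ δ, 0 < δ → δ < δ₀ → zeroInt ψ ζ δ σ = cubeZeros ψ σ ζ := by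
  obtain ⟨δ₀, hδ₀, h⟩ := integral_det_stairs (hψ.contDiff_secMap σ.lift_smooth)
    (L := ![{ζ.re}, {ζ.im}]) (by
      intro j l hl l' hl' hne
      fin_cases j <;> exact absurd (hl.trans hl'.symm) hne) hreg
  refine ⟨δ₀, hδ₀, fun δ hδ hδ' => ?_⟩
  refine (h δ hδ hδ' (stepsAt ζ δ) (stair_stepsAt ζ hδ)).trans ?_
  rw [cubeZeros, finsum_cast_real]
  have himg : {x | x ∈ Icc (0 : Fin 2 → ℝ) 1 ∧
      ∀ j, secMap ψ σ.lift x j ∈ (![{ζ.re}, {ζ.im}] : Fin 2 → Set ℝ) j} =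
      valPt '' {u | sectionAt ψ (σ.lift fun j => (u j : ℝ)) = ζ} := by
    have key : ∀ x, (∀ j, secMap ψ σ.lift x j ∈ (![{ζ.re}, {ζ.im}] : Fin 2 → Set ℝ) j) ↔
        sectionAt ψ (σ.lift x) = ζ := by
      intro x
      rw [Fin.forall_fin_two, Complex.ext_iff]
      rfl
    ext x
    constructor
    · rintro ⟨hx, hx'⟩
      exact ⟨toCube x hx, (key x).1 hx', rfl⟩
    · rintro ⟨u, hu, rfl⟩
      exact ⟨⟨fun j => (u j).2.1, fun j => (u j).2.2⟩, (key _).2 hu⟩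
  change ∑ᶠ (x) (_ : x ∈ {x | x ∈ Icc (0 : Fin 2 → ℝ) 1 ∧
      ∀ j, secMap ψ σ.lift x j ∈ (![{ζ.re}, {ζ.im}] : Fin 2 → Set ℝ) j}), _ = _
  rw [himg, finsum_mem_image valPt_injective.injOn]
  refine finsum_congr fun u => finsum_congr fun _ => ?_
  rw [gradMat_secMap hψ]
  rfl

theorem ae_zeroInt_eq (hψ : IsSection ψ) (W : Chain projY 2) :
    ∀ᵐ ζ : ℂ, ∃ δ₀ > 0, ∀ δ, 0 < δ → δ < δ₀ →
      evalC (zeroInt ψ ζ δ) W = (W.sum fun σ m => m * cubeZeros ψ σ ζ : ℤ) := by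
  have hae : ∀ᵐ ζ : ℂ, ∀ σ ∈ W.support, ∃ δ₀ > 0, ∀ δ, 0 < δ → δ < δ₀ →
      zeroInt ψ ζ δ σ = cubeZeros ψ σ ζ := by
    rw [Finset.eventually_all]
    intro σ _
    have h1 := ae_regular (hψ.contDiff_secMap σ.lift_smooth)
      (Λ := {0}) (countable_singleton _)
    have h2 := Complex.volume_preserving_equiv_pi.quasiMeasurePreserving.ae h1
    filter_upwards [h2] with ζ hζ
    refine cubeZeros_eq hψ σ ζ fun x hx hL => hζ x hx ?_
    rw [mem_singleton_iff, sub_eq_zero]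
    funext j
    have := hL j
    fin_cases j <;> exact this
  filter_upwards [hae] with ζ hζ
  obtain ⟨η, hη, h⟩ := exists_pos_forall_finset W.support
    (P := fun σ δ => zeroInt ψ ζ δ σ = cubeZeros ψ σ ζ) hζ
  refine ⟨η, hη, fun δ hδ hδη => ?_⟩
  rw [evalC_congr fun σ hσ => h δ hδ hδη σ hσ, evalC_apply]
  simp [Finsupp.sum]

/-- The number of zeros of a section over a chain is determined by its turns along the boundary. -/
theorem hasZeroNumber_iff (hψ : IsSection ψ) {W : Chain projY 2} {a : Chain projY 1}
    (hW : boundary W - a ∈ degenerate projY 1) {N : ℤ}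
    (hN : ∃ ρ > 0, ∀ ζ : ℂ, ‖ζ‖ ≤ ρ → ∀ δ, 0 < δ → δ ≤ ρ → evalC (turnInt ψ ζ δ) a = N) (n : ℤ) :
    HasZeroNumber ψ W n ↔ n = N := by
  have hcount : ∃ ρ > 0, ∀ᵐ ζ : ℂ, ‖ζ‖ < ρ → (W.sum fun σ m => m * cubeZeros ψ σ ζ) = N := by
    obtain ⟨ρ, hρ, h⟩ := hN
    refine ⟨ρ, hρ, ?_⟩
    filter_upwards [ae_zeroInt_eq hψ W] with ζ hζ hζρ
    obtain ⟨δ₀, hδ₀, hδ⟩ := hζ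
    set δ := min (δ₀ / 2) ρ
    have h0 : 0 < δ := by positivity
    have h1 : δ ≤ δ₀ / 2 := min_le_left _ _
    have e1 := hδ δ h0 (by linarith)
    rw [evalC_zeroInt hψ ζ δ hW, h ζ hζρ.le δ h0 (min_le_right _ _)] at e1
    exact_mod_cast e1.symm
  constructor
  · rintro ⟨ρ, hρ, h⟩
    obtain ⟨ρ', hρ', h'⟩ := hcount
    have hpos : (volume : Measure ℂ) (Metric.ball 0 (min ρ ρ')) ≠ 0 :=
      (Metric.measure_ball_pos _ _ (lt_min hρ hρ')).ne'
    have hfreq : ∃ᶠ c in ae (volume : Measure ℂ), c ∈ Metric.ball (0 : ℂ) (min ρ ρ') :=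
      frequently_ae_mem_iff.2 hpos
    obtain ⟨c, hc, hc1, hc2⟩ := (hfreq.and_eventually (h.and h')).exists
    have hc' : ‖c‖ < min ρ ρ' := by simpa using hc
    rw [← hc1 (hc'.trans_le (min_le_left _ _)), hc2 (hc'.trans_le (min_le_right _ _))]
  · rintro rfl
    exact hcount

/-- The turns of a section along a loop on which it does not vanish. -/
theorem exists_turnInt_eq (hψ : IsSection ψ) {A : (Fin 1 → ℝ) → (Fin 3 → ℝ)} (hA : ContDiff ℝ ∞ A)
    {f : ℝ → ℂ} {n : ℤ} (hf : HasTurns f 1 n) (hAf : ∀ y, sectionAt ψ (A y) = f (y 0)) :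
    ∃ ρ > 0, ∀ ζ : ℂ, ‖ζ‖ ≤ ρ → ∀ δ, 0 < δ → δ ≤ ρ →
      turnInt ψ ζ δ (SmoothCube.ofLift projY A hA) = n := by
  have hfc : Continuous f := by
    obtain ⟨G, hG, hGf, -⟩ := hf
    obtain rfl : f = fun t => Complex.exp (G t) := funext fun t => (hGf t).symm
    exact Complex.continuous_exp.comp hG.continuous
  have hf0 : ∀ t, f t ≠ 0 := by
    obtain ⟨G, hG, hGf, -⟩ := hf
    exact fun t => hGf t ▸ Complex.exp_ne_zero _
  obtain ⟨t₀, -, ht₀⟩ := isCompact_Icc.exists_isMinOn (nonempty_Icc.2 zero_le_one)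
    (hfc.norm.continuousOn (s := Icc (0 : ℝ) 1))
  have hpos : 0 < ‖f t₀‖ := norm_pos_iff.2 (hf0 t₀)
  -- With m the minimum of |f| and |ζ|, δ ≤ m/8, both steps take place inside [-m/4, m/4]; the curve
  -- avoids the disc of radius 2 · m/4 as `leadInt_planeCurve` demands.
  refine ⟨‖f t₀‖ / 8, by positivity, fun ζ hζ δ hδ hδρ => ?_⟩
  rw [turnInt_eq hψ (SmoothCube.liftEq_ofLift isLatticeProj_projY hA)]
  have hre := abs_le.1 ((Complex.abs_re_le_norm ζ).trans hζ)
  have him := abs_le.1 ((Complex.abs_im_le_norm ζ).trans hζ)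
  have hB : IsStep (‖f t₀‖ / 4) (stepFn ζ.re δ) := isStep_stepFn hδ (by linarith) (by linarith)
  have hV : IsStep (‖f t₀‖ / 4) (stepFn ζ.im δ) := isStep_stepFn hδ (by linarith) (by linarith)
  rw [← leadInt_planeCurve (by positivity) hB hV hf fun t ht => by
    have : ‖f t₀‖ ≤ ‖f t‖ := ht₀ ht
    linarith]
  congr 1
  funext y j
  simp only [secMap, hAf, planeCurve]
  fin_cases j <;> rfl

end Zeros

/-! ### The angle of solutions of an almost sheared linear equation. -/

section AlmostShear

open MeasureTheory Set Complex

variable {ε : ℝ} {v : ℝ → ℂ}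

/-- The construction of `exists_smooth_log` for C¹ functions, with the derivative recorded because
it carries the angular velocity. -/
theorem exists_log_hasDerivAt {v v' : ℝ → ℂ} (hv : ∀ t, HasDerivAt v (v' t) t) (hc : Continuous v')
    (h0 : ∀ t, v t ≠ 0) :
    ∃ G : ℝ → ℂ, (∀ t, HasDerivAt G (v' t / v t) t) ∧ ∀ t, exp (G t) = v t := by
  have hvc : Continuous v := continuous_iff_continuousAt.2 fun t => (hv t).continuousAt
  have hq : Continuous fun t => v' t / v t := hc.div hvc h0
  let G : ℝ → ℂ := fun t => log (v 0) + ∫ s in (0 : ℝ)..t, v' s / v s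
  have hG : ∀ t, HasDerivAt G (v' t / v t) t := fun t =>
    (intervalIntegral.integral_hasDerivAt_right (hq.intervalIntegrable _ _)
      (hq.stronglyMeasurableAtFilter _ _) hq.continuousAt).const_add _
  refine ⟨G, hG, fun t => ?_⟩
  have hd : ∀ t, HasDerivAt (fun t => exp (-G t) * v t) 0 t := by
    intro t
    have h1 := ((hG t).neg.cexp).mul (hv t)
    refine h1.congr_deriv ?_
    rw [mul_assoc, neg_mul, div_mul_cancel₀ _ (h0 t)]
    ring
  have hc : exp (-G t) * v t = exp (-G 0) * v 0 :=
    is_const_of_deriv_eq_zero (fun t => (hd t).differentiableAt) (fun t => (hd t).deriv) t 0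
  have hG0 : exp (-G 0) * v 0 = 1 := by
    simp only [G, intervalIntegral.integral_same, add_zero]
    rw [exp_neg, exp_log (h0 0), inv_mul_cancel₀ (h0 0)]
  rw [hG0, exp_neg] at hc
  have := exp_ne_zero (G t)
  field_simp at hc
  exact hc.symm

/-- The vector function `v` satisfies, up to a small error, the linear equation `v' = (0, -Re v)` of
the shear flow. -/
def IsAlmostShear (ε : ℝ) (v : ℝ → ℂ) : Prop :=
  ∃ v' : ℝ → ℂ, Continuous v' ∧ (∀ t, HasDerivAt v (v' t) t) ∧
    ∀ t, ‖v' t + (v t).re * I‖ ≤ ε * ‖v t‖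

theorem IsAlmostShear.continuous (h : IsAlmostShear ε v) : Continuous v := by
  obtain ⟨v', -, hv, -⟩ := h
  exact continuous_iff_continuousAt.2 fun t => (hv t).continuousAt

/-- The angle of an almost sheared vector. -/
theorem IsAlmostShear.exists_angle (h : IsAlmostShear ε v) (h0 : ∀ t, v t ≠ 0) :
    ∃ (G : ℝ → ℂ) (ω' : ℝ → ℝ), Continuous G ∧ (∀ t, exp (G t) = v t) ∧
      (∀ t, HasDerivAt (fun t => (G t).im) (ω' t) t) ∧ Continuous ω' ∧
      ∀ t, |ω' t + Real.cos (G t).im ^ 2| ≤ ε := by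
  obtain ⟨v', hc, hv, hb⟩ := h
  have hvc : Continuous v := continuous_iff_continuousAt.2 fun t => (hv t).continuousAt
  obtain ⟨G, hG, hGv⟩ := exists_log_hasDerivAt hv hc h0
  refine ⟨G, fun t => (v' t / v t).im, continuous_iff_continuousAt.2 fun t => (hG t).continuousAt,
    hGv, fun t => ?_, continuous_im.comp (hc.div hvc h0), fun t => ?_⟩
  · exact imCLM.hasFDerivAt.comp_hasDerivAt t (hG t)
  -- For v = |v| e^{iω} this is the angular contribution of the shear: the unperturbed equation
  -- turns v with velocity -cos² ω.
  · have hre : ((v t).re * I / v t).im = Real.cos (G t).im ^ 2 := by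
      rw [← hGv t]
      have e1 : ((exp (G t)).re : ℂ) * I / exp (G t) = ((exp (G t)).re : ℂ) * I * exp (-G t) := by
        rw [exp_neg]; rfl
      rw [e1, mul_assoc, im_ofReal_mul, I_mul_im, exp_re, exp_re, neg_re, neg_im, Real.cos_neg, Real.exp_neg]
      have := (Real.exp_pos (G t).re).ne'
      field_simp
    have e2 : (v' t / v t).im + Real.cos (G t).im ^ 2 = ((v' t + (v t).re * I) / v t).im := by
      rw [add_div, add_im, hre]
    rw [e2]
    refine (abs_im_le_norm _).trans ?_
    rw [norm_div, div_le_iff₀ (norm_pos_iff.2 (h0 t))]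
    exact hb t

/-- The time that the angle of a slightly perturbed shear flow needs for half a turn. -/
def halfTurnTime (ε : ℝ) : ℝ := ∫ s in (0 : ℝ)..Real.pi, (Real.cos s ^ 2 + ε)⁻¹

theorem continuous_speed_inv (hε : 0 < ε) : Continuous fun s => (Real.cos s ^ 2 + ε)⁻¹ :=
  Continuous.inv₀ (by fun_prop) fun s => by positivity

/-- Slow motion happens near π/2: within distance s of it |cos| ≤ s, and with ε ≤ s² the integrand
is at least 1/(2s²) on an interval of length 2s. -/
theorem inv_le_halfTurnTime (hε : 0 < ε) {s : ℝ} (hs : 0 < s) (hs1 : s ≤ 1) (hεs : ε ≤ s ^ 2) :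
    s⁻¹ ≤ halfTurnTime ε := by
  have hc := continuous_speed_inv hε
  have hpi := Real.pi_gt_three
  have h1 : ∫ u in (Real.pi / 2 - s)..(Real.pi / 2 + s), (Real.cos u ^ 2 + ε)⁻¹ ≤ halfTurnTime ε := by
    refine intervalIntegral.integral_mono_interval (by linarith) (by linarith) (by linarith)
      (ae_of_all _ fun u => ?_) (hc.intervalIntegrable _ _)
    have : 0 < Real.cos u ^ 2 + ε := by positivity
    exact (inv_pos.2 this).le
  have h2 : ∫ _u in (Real.pi / 2 - s)..(Real.pi / 2 + s), (2 * s ^ 2)⁻¹ ≤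
      ∫ u in (Real.pi / 2 - s)..(Real.pi / 2 + s), (Real.cos u ^ 2 + ε)⁻¹ := by
    refine intervalIntegral.integral_mono_on (by linarith) (by simp) (hc.intervalIntegrable _ _)
      fun u hu => ?_
    have : |Real.cos u| ≤ s := by
      rw [← Real.sin_pi_div_two_sub]
      refine (Real.abs_sin_le_abs).trans (abs_le.2 ⟨by linarith [hu.2], by linarith [hu.1]⟩)
    have h3 : Real.cos u ^ 2 ≤ s ^ 2 := by
      rw [← sq_abs]; exact pow_le_pow_left₀ (abs_nonneg _) this 2
    exact inv_anti₀ (by positivity) (by linarith)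
  refine le_trans (le_of_eq ?_) (h2.trans h1)
  rw [intervalIntegral.integral_const, smul_eq_mul]
  field_simp
  ring

/-- In a time shorter than `halfTurnTime ε` an almost sheared vector makes less than half a turn. -/
theorem IsAlmostShear.angle_bounds (hε : 0 < ε) (h : IsAlmostShear ε v) (h0 : ∀ t, v t ≠ 0)
    {G : ℝ → ℂ} (hG : Continuous G) (hGv : ∀ t, exp (G t) = v t) {t T : ℝ} (hT : 0 ≤ T)
    (hT' : T < halfTurnTime ε) :
    -Real.pi < (G (t + T)).im - (G t).im ∧ (G (t + T)).im - (G t).im ≤ ε * T := by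
  obtain ⟨G', ω', hG', hGv', hω, hωc, hb⟩ := h.exists_angle h0
  have hinc : (G (t + T)).im - (G t).im = (G' (t + T)).im - (G' t).im := by
    have := log_increment_eq hG hG' (fun s => (hGv s).trans (hGv' s).symm) t (t + T)
    simpa using congrArg Complex.im this
  rw [hinc]
  set θ : ℝ → ℝ := fun t => (G' t).im
  have hd : Differentiable ℝ θ := fun t => (hω t).differentiableAt
  have hc := continuous_speed_inv hε
  constructor
  · by_contra! hlt
    -- The function k measures the angle by the time a rotation with velocity -(cos² + ε) would
    -- need. The true velocity is not below this, so k(θ(s)) + s is nondecreasing, while a turn by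
    -- -π lowers k by the full `halfTurnTime ε`.
    let k : ℝ → ℝ := fun x => ∫ s in (0 : ℝ)..x, (Real.cos s ^ 2 + ε)⁻¹
    have hk : ∀ x, HasDerivAt k ((Real.cos x ^ 2 + ε)⁻¹) x := fun x =>
      intervalIntegral.integral_hasDerivAt_right (hc.intervalIntegrable _ _)
        (hc.stronglyMeasurableAtFilter _ _) hc.continuousAt
    have hkmono : Monotone k := monotone_of_deriv_nonneg (fun x => (hk x).differentiableAt) fun x => by
      rw [(hk x).deriv]
      have : 0 < Real.cos x ^ 2 + ε := by positivity
      exact (inv_pos.2 this).le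
    have hper : Function.Periodic (fun s => (Real.cos s ^ 2 + ε)⁻¹) Real.pi := fun s => by
      simp [Real.cos_add_pi]
    have hkpi : ∀ x, k (x - Real.pi) = k x - halfTurnTime ε := by
      intro x
      have h1 : k x - k (x - Real.pi) =
          ∫ s in (x - Real.pi)..(x - Real.pi + Real.pi), (Real.cos s ^ 2 + ε)⁻¹ := by
        rw [sub_add_cancel]
        exact intervalIntegral.integral_interval_sub_left (hc.intervalIntegrable _ _)
          (hc.intervalIntegrable _ _)
      rw [hper.intervalIntegral_add_eq _ 0, zero_add] at h1
      rw [halfTurnTime]; linarith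
    have hmono : Monotone fun s => k (θ s) + s := by
      refine monotone_of_deriv_nonneg
        (fun s => ((hk (θ s)).comp s (hω s)).differentiableAt.add differentiableAt_id) fun s => ?_
      have hds : HasDerivAt (fun s => k (θ s) + s) ((Real.cos (θ s) ^ 2 + ε)⁻¹ * ω' s + 1) s :=
        ((hk (θ s)).comp s (hω s)).add (hasDerivAt_id s)
      rw [hds.deriv]
      have h1 := (abs_le.1 (hb s)).1
      have hpos : 0 < Real.cos (θ s) ^ 2 + ε := by positivity
      have : -1 ≤ (Real.cos (θ s) ^ 2 + ε)⁻¹ * ω' s := by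
        rw [inv_mul_eq_div, le_div_iff₀ hpos]
        change -ε ≤ ω' s + Real.cos (θ s) ^ 2 at h1
        linarith
      linarith
    have h1 := hmono (show t ≤ t + T by linarith)
    have h2 : k (θ (t + T)) ≤ k (θ t - Real.pi) := hkmono (by change θ (t + T) - θ t ≤ _ at hlt; linarith)
    rw [hkpi] at h2
    simp only at h1
    linarith
  -- The velocity is at most ε - cos², hence at most ε.
  · have hmono : Antitone fun s => θ s - ε * s := by
      refine antitone_of_deriv_nonpos (hd.sub (differentiable_id.const_mul ε)) fun s => ?_
      have hds : HasDerivAt (fun s => θ s - ε * s) (ω' s - ε * 1) s :=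
        (hω s).sub ((hasDerivAt_id s).const_mul ε)
      rw [hds.deriv]
      have h1 := (abs_le.1 (hb s)).2
      nlinarith [sq_nonneg (Real.cos (G' s).im)]
    have := hmono (show t ≤ t + T by linarith)
    simp only at this
    change θ (t + T) - θ t ≤ _
    linarith

/-- An almost sheared vector that starts in the direction of the shear does not turn in the positive
direction. -/
theorem IsAlmostShear.angle_nonpos (hε1 : ε < 1) (h : IsAlmostShear ε v) (h0 : ∀ t, v t ≠ 0)
    {G : ℝ → ℂ} (hG : Continuous G) (hGv : ∀ t, exp (G t) = v t) (hv : v 0 = 1) {T : ℝ}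
    (hT : 0 ≤ T) : (G T).im - (G 0).im ≤ 0 := by
  obtain ⟨G', ω', hG', hGv', hω, hωc, hb⟩ := h.exists_angle h0
  have hinc : (G T).im - (G 0).im = (G' T).im - (G' 0).im := by
    have := log_increment_eq hG hG' (fun s => (hGv s).trans (hGv' s).symm) 0 T
    simpa using congrArg Complex.im this
  rw [hinc, sub_nonpos]
  have hcos : Real.cos (G' 0).im ^ 2 = 1 := by
    have h1 : exp (G' 0) = 1 := (hGv' 0).trans hv
    obtain ⟨n, hn⟩ := exp_eq_one_iff.1 h1
    have h2 : (G' 0).im = n * (2 * Real.pi) := by rw [hn]; simp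
    rw [h2, Real.cos_int_mul_two_pi]; norm_num
  -- The initial angle is a barrier: whenever it is attained cos² = 1, so the velocity is at most ε
  -- - 1 < 0.
  have := image_le_of_deriv_right_lt_deriv_boundary (f := fun t => (G' t).im)
    (f' := ω') (a := 0) (b := T) (B := fun _ => (G' 0).im) (B' := fun _ => 0)
    ((continuous_im.comp hG').continuousOn) (fun x _ => (hω x).hasDerivWithinAt) le_rfl
    (fun x => hasDerivAt_const _ _) (fun x _ hx => by
      have h1 := (abs_le.1 (hb x)).2
      rw [hx, hcos] at h1
      linarith)
  exact this ⟨hT, le_rfl⟩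

end AlmostShear

/-! ### The perturbed twist flow and its linearization. -/

section Flow

open Set Complex

variable {X₁ X₂ ε : ℝ} {Q : ℕ} (T : TwistPerturbation X₁ X₂ Q ε)

namespace TwistPerturbation

theorem eps_pos (T : TwistPerturbation X₁ X₂ Q ε) : 0 < ε := (norm_nonneg _).trans_lt (T.small 0 0).1

theorem contDiff_hamField : ContDiff ℝ ∞ fun w : ℝ × ℂ => hamField T.K w.1 w.2 := by
  have h1 : ContDiff ℝ ∞ fun w : ℝ × ℂ => fderiv ℝ (T.K w.1) w.2 :=
    ContDiff.fderiv (f := fun (w : ℝ × ℂ) z => T.K w.1 z) (n := ∞)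
      (T.smooth.comp ((contDiff_fst.comp contDiff_fst).prodMk contDiff_snd)) contDiff_snd le_rfl
  exact Complex.equivRealProdCLM.symm.contDiff.comp
    ((h1.clm_apply contDiff_const).prodMk (h1.clm_apply contDiff_const).neg)

theorem differentiable_hamField (t : ℝ) : Differentiable ℝ (hamField T.K t) :=
  (T.contDiff_hamField.comp (contDiff_const.prodMk contDiff_id)).differentiable (by simp)

theorem hasFDerivAt_twistField (t : ℝ) (z : ℂ) :
    HasFDerivAt (twistField T.K t)
      (-(ofRealCLM.comp reCLM).smulRight I + fderiv ℝ (hamField T.K t) z) z := by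
  have h1 : HasFDerivAt (fun z : ℂ => -(z.re : ℂ) * I) (-(ofRealCLM.comp reCLM).smulRight I) z := by
    have h2 := ((-(ofRealCLM.comp reCLM).smulRight I : ℂ →L[ℝ] ℂ)).hasFDerivAt (x := z)
    refine h2.congr_of_eventuallyEq (Filter.Eventually.of_forall fun w => ?_)
    simp
  exact h1.add (T.differentiable_hamField t z).hasFDerivAt

theorem fderiv_twistField_apply (t : ℝ) (z v : ℂ) :
    fderiv ℝ (twistField T.K t) z v + (v.re : ℂ) * I = fderiv ℝ (hamField T.K t) z v := by
  rw [(T.hasFDerivAt_twistField t z).fderiv]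
  simp

theorem norm_fderiv_add_le (t : ℝ) (z v : ℂ) :
    ‖fderiv ℝ (twistField T.K t) z v + (v.re : ℂ) * I‖ ≤ ε * ‖v‖ := by
  rw [fderiv_twistField_apply]
  exact (ContinuousLinearMap.le_opNorm _ _).trans
    (mul_le_mul_of_nonneg_right (T.small t z).2.le (norm_nonneg _))

theorem norm_hamField_sub_le (t : ℝ) (z w : ℂ) :
    ‖hamField T.K t z - hamField T.K t w‖ ≤ ε * ‖z - w‖ :=
  convex_univ.norm_image_sub_le_of_norm_fderiv_le (fun x _ => T.differentiable_hamField t x)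
    (fun x _ => (T.small t x).2.le) (mem_univ w) (mem_univ z)

/-- The twist part is linear in z, so the difference of its values is exactly the shear of z - w;
the remainder is the Lipschitz bound for `hamField`. -/
theorem norm_twistField_sub_add_le (t : ℝ) (z w : ℂ) :
    ‖twistField T.K t z - twistField T.K t w + ((z - w).re : ℂ) * I‖ ≤ ε * ‖z - w‖ := by
  have : twistField T.K t z - twistField T.K t w + ((z - w).re : ℂ) * I =
      hamField T.K t z - hamField T.K t w := by
    simp only [twistField, sub_re, ofReal_sub]; ring
  rw [this]
  exact T.norm_hamField_sub_le t z w

theorem norm_le_of_add {a b : ℂ} (h : ‖a + (b.re : ℂ) * I‖ ≤ ε * ‖b‖) : ‖a‖ ≤ (1 + ε) * ‖b‖ := by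
  have h1 : ‖(b.re : ℂ) * I‖ ≤ ‖b‖ := by
    rw [norm_mul, norm_I, mul_one, Complex.norm_real]; exact abs_re_le_norm b
  have h2 := norm_sub_le (a + (b.re : ℂ) * I) ((b.re : ℂ) * I)
  rw [add_sub_cancel_right] at h2
  linarith

theorem hamField_add_one (t : ℝ) (z : ℂ) : hamField T.K (t + 1) z = hamField T.K t z := by
  have : T.K (t + 1) = T.K t := funext (T.periodic_t t)
  rw [hamField, hamField, this]

theorem hamField_add_I (t : ℝ) (z : ℂ) : hamField T.K t (z + I) = hamField T.K t z := by
  have h : fderiv ℝ (T.K t) (z + I) = fderiv ℝ (T.K t) z := by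
    rw [← fderiv_comp_add_right]
    congr 1
    exact funext (T.periodic_y t)
  rw [hamField, hamField, h]

theorem twistField_add_int (t : ℝ) (z : ℂ) (k m : ℤ) :
    twistField T.K (t + k) (z + m * I) = twistField T.K t z := by
  have h1 : Function.Periodic (fun t => hamField T.K t (z + m * I)) 1 := fun t =>
    T.hamField_add_one t _
  have h2 : Function.Periodic (hamField T.K t) I := fun z => T.hamField_add_I t z
  have h3 := h1.int_mul k t
  have h4 := h2.int_mul m z
  simp only [mul_one] at h3
  rw [twistField, twistField, h3, h4]
  simp

theorem flow_unique {f g : ℝ → ℂ} {t₀ : ℝ} (hf : ∀ t, HasDerivAt f (twistField T.K t (f t)) t)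
    (hg : ∀ t, HasDerivAt g (twistField T.K t (g t)) t) (h : f t₀ = g t₀) : f = g :=
  ODE_solution_unique_univ (K := ⟨1 + ε, by linarith [T.eps_pos]⟩) (s := fun _ => univ)
    (fun t => (LipschitzWith.of_dist_le_mul fun z w => by
      rw [dist_eq_norm, dist_eq_norm]
      exact norm_le_of_add (T.norm_twistField_sub_add_le t z w)).lipschitzOnWith)
    (fun t => ⟨hf t, mem_univ _⟩) (fun t => ⟨hg t, mem_univ _⟩) h

theorem linearized_unique (γ : Orbit T.K X₁ X₂) {f g : ℝ → ℂ} {t₀ : ℝ} (hf : γ.IsLinearized f)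
    (hg : γ.IsLinearized g) (h : f t₀ = g t₀) : f = g :=
  ODE_solution_unique_univ (K := ⟨1 + ε, by linarith [T.eps_pos]⟩) (s := fun _ => univ)
    (v := fun t => fderiv ℝ (twistField T.K t) (γ.z t))
    (fun t => (LipschitzWith.of_dist_le_mul fun z w => by
      rw [dist_eq_norm, dist_eq_norm, ← map_sub]
      exact norm_le_of_add (T.norm_fderiv_add_le t _ _)).lipschitzOnWith)
    (fun t => ⟨hf t, mem_univ _⟩) (fun t => ⟨hg t, mem_univ _⟩) h

/-- Translates of orbits are orbits. -/
theorem flow_translate (γ : Orbit T.K X₁ X₂) (k m : ℤ) (t : ℝ) :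
    HasDerivAt (fun t => γ.z (t + k) + m * I) (twistField T.K t (γ.z (t + k) + m * I)) t := by
  have h := ((γ.flow (t + k)).comp_add_const t (k : ℝ)).add_const (m * I)
  have e : twistField T.K t (γ.z (t + k) + m * I) = twistField T.K (t + k) (γ.z (t + k)) := by
    have h1 := T.twistField_add_int t (γ.z (t + k)) 0 m
    have h2 := T.twistField_add_int t (γ.z (t + k)) k 0
    simp only [Int.cast_zero, zero_mul, add_zero] at h1 h2
    rw [h1, h2]
  rw [e]
  exact h

/-- Integer translates of orbits in t and y are flow lines again, so uniqueness for the differential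
equation spreads one coincidence to all times. -/
theorem orbit_eq_of_eq_at {γ γ' : Orbit T.K X₁ X₂} {k m : ℤ} {t₀ : ℝ}
    (h : γ.z (t₀ + k) = γ'.z t₀ + m * I) (t : ℝ) : γ.z (t + k) = γ'.z t + m * I := by
  have h1 := T.flow_translate γ k 0
  have h2 := T.flow_translate γ' 0 m
  simp only [Int.cast_zero, zero_mul, add_zero] at h1 h2
  exact congrFun (T.flow_unique h1 h2 h) t

theorem continuous_twistField_comp {z : ℝ → ℂ} (hz : Continuous z) :
    Continuous fun t => twistField T.K t (z t) := by
  have := T.contDiff_hamField.continuous.comp (continuous_id.prodMk hz)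
  have h2 : Continuous fun t => -((z t).re : ℂ) * I := by fun_prop
  exact h2.add this

/-- The difference of two strands. -/
theorem isAlmostShear_sub (γ γ' : Orbit T.K X₁ X₂) (k m : ℤ) :
    IsAlmostShear ε fun t => γ.z (t + k) - γ'.z t - m * I := by
  have h1 := T.flow_translate γ k (-m)
  have hc : Continuous fun t => γ.z (t + k) + ((-m : ℤ) : ℂ) * I :=
    continuous_iff_continuousAt.2 fun t => (h1 t).continuousAt
  have hc' : Continuous γ'.z := γ'.smooth.continuous
  refine ⟨fun t => twistField T.K t (γ.z (t + k) + ((-m : ℤ) : ℂ) * I) - twistField T.K t (γ'.z t),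
    (T.continuous_twistField_comp hc).sub (T.continuous_twistField_comp hc'), fun t => ?_, fun t => ?_⟩
  · refine ((h1 t).sub (γ'.flow t)).congr_of_eventuallyEq (Filter.Eventually.of_forall fun s => ?_)
    simp; ring
  · have := T.norm_twistField_sub_add_le t (γ.z (t + k) + ((-m : ℤ) : ℂ) * I) (γ'.z t)
    have e : γ.z (t + k) + ((-m : ℤ) : ℂ) * I - γ'.z t = γ.z (t + k) - γ'.z t - m * I := by
      push_cast; ring
    rwa [e] at this

theorem contDiff_twistField : ContDiff ℝ ∞ fun w : ℝ × ℂ => twistField T.K w.1 w.2 := by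
  have h2 : ContDiff ℝ ∞ fun w : ℝ × ℂ => -(w.2.re : ℂ) * I :=
    (ofRealCLM.contDiff.comp (reCLM.contDiff.comp contDiff_snd)).neg.mul contDiff_const
  exact h2.add T.contDiff_hamField

theorem isAlmostShear_linearized (γ : Orbit T.K X₁ X₂) {v : ℝ → ℂ} (hv : γ.IsLinearized v) :
    IsAlmostShear ε v := by
  have hvc : Continuous v := continuous_iff_continuousAt.2 fun t => (hv t).continuousAt
  have h1 : ContDiff ℝ ∞ fun w : ℝ × ℂ => fderiv ℝ (twistField T.K w.1) w.2 :=
    ContDiff.fderiv (f := fun (w : ℝ × ℂ) z => twistField T.K w.1 z) (n := ∞)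
      (T.contDiff_twistField.comp ((contDiff_fst.comp contDiff_fst).prodMk contDiff_snd))
      contDiff_snd le_rfl
  refine ⟨fun t => fderiv ℝ (twistField T.K t) (γ.z t) (v t), ?_, hv, fun t =>
    T.norm_fderiv_add_le t _ _⟩
  exact (h1.continuous.comp (continuous_id.prodMk γ.smooth.continuous)).clm_apply hvc

theorem linearized_ne_zero {γ : Orbit T.K X₁ X₂} {v : ℝ → ℂ} (hv : γ.IsLinearized v) {t₀ : ℝ}
    (h0 : v t₀ ≠ 0) (t : ℝ) : v t ≠ 0 := by
  intro h
  refine h0 ?_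
  have hz : γ.IsLinearized fun _ => 0 := fun t => by
    simpa using hasDerivAt_const t (0 : ℂ)
  rw [T.linearized_unique γ hv hz h]

end TwistPerturbation

end Flow

/-! ### Turns of frames, location of the orbits, and return maps. -/

section Labels

open Set Complex

variable {X₁ X₂ ε : ℝ} {Q : ℕ}

/-- `HasTurns` records the increment of one logarithm on [0, S]. Periodicity of f and the comparison
of logarithms carry it to every interval of length S and to every continuous logarithm. -/
theorem HasTurns.log_add {f : ℝ → ℂ} {S : ℝ} {n : ℤ} (h : HasTurns f S n) (hS : ∀ t, f (t + S) = f t)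
    {G : ℝ → ℂ} (hG : Continuous G) (hGf : ∀ t, exp (G t) = f t) (t : ℝ) :
    G (t + S) = G t + 2 * Real.pi * I * n := by
  obtain ⟨G', hG', hGf', e⟩ := h
  have h1 := log_increment_eq hG hG'.continuous (fun s => (hGf s).trans (hGf' s).symm) 0 S
  have h2 := log_increment_eq (G := fun t => G (t + S)) (by fun_prop) hG
    (fun s => by rw [hGf, hGf, hS]) 0 t
  simp only [zero_add] at h2
  linear_combination h2 + h1 + e

theorem HasTurns.log_add_nat {f : ℝ → ℂ} {S : ℝ} {n : ℤ} (h : HasTurns f S n)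
    (hS : ∀ t, f (t + S) = f t) {G : ℝ → ℂ} (hG : Continuous G) (hGf : ∀ t, exp (G t) = f t) (k : ℕ)
    (t : ℝ) : G (t + k * S) = G t + 2 * Real.pi * I * (k * n : ℤ) := by
  induction k with
  | zero => simp
  | succ k ih =>
    have := h.log_add hS hG hGf (t + k * S)
    push_cast at *
    rw [show t + (k + 1) * S = t + k * S + S by ring, this, ih]
    ring

/-- The number of turns of a frame with respect to the coordinates, over the period. -/
def Frame.turns {K : ℝ → ℂ → ℝ} {γ : Orbit K X₁ X₂} (τ : Frame γ) : ℤ :=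
  (exists_hasTurns (T := γ.period) τ.smooth τ.ne_zero (by simpa using τ.periodic 0)).choose

theorem Frame.hasTurns {K : ℝ → ℂ → ℝ} {γ : Orbit K X₁ X₂} (τ : Frame γ) :
    HasTurns τ.ν γ.period τ.turns :=
  (exists_hasTurns (T := γ.period) τ.smooth τ.ne_zero (by simpa using τ.periodic 0)).choose_spec

/-- Rotation relative to the frame is traded for the increment of a logarithm in the fixed
coordinates of ℂ, where the shear estimates apply; the frame accounts for k · `τ.turns` full turns.
-/
theorem mem_rotationSet_iff {K : ℝ → ℂ → ℝ} {γ : Orbit K X₁ X₂}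
    (hcont : ∀ v, γ.IsLinearized v → Continuous v) (τ : Frame γ) (k : ℕ) (d : ℝ) :
    d ∈ rotationSet γ τ k ↔ ∃ v G : ℝ → ℂ, γ.IsLinearized v ∧ Continuous G ∧
      (∀ t, exp (G t) = v t) ∧
      2 * Real.pi * (d + k * τ.turns) = (G ((k * γ.period : ℕ) : ℝ)).im - (G 0).im := by
  obtain ⟨N, hN, hNν, -⟩ := τ.hasTurns
  have hpi := Real.pi_ne_zero
  have hNk : (N ((k * γ.period : ℕ) : ℝ)).im = (N 0).im + 2 * Real.pi * (k * τ.turns) := by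
    have := τ.hasTurns.log_add_nat τ.periodic hN.continuous hNν k 0
    rw [zero_add] at this
    push_cast
    rw [this]
    simp
  constructor
  · rintro ⟨v, ρ, ϑ, hv, hϑ, hρ, hvρ, rfl⟩
    have hρc : Continuous ρ := by
      have : ρ = fun t => ‖v t‖ / ‖τ.ν t‖ := by
        funext t
        rw [eq_div_iff (norm_ne_zero_iff.2 (τ.ne_zero t)), hvρ, norm_mul, norm_mul]
        have : (2 * Real.pi * ϑ t * I : ℂ) = ((2 * Real.pi * ϑ t : ℝ) : ℂ) * I := by push_cast; ring
        rw [this, norm_exp_ofReal_mul_I, mul_one, Complex.norm_real, Real.norm_of_nonneg (hρ t).le]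
      rw [this]
      exact (hcont v hv).norm.div τ.smooth.continuous.norm fun t => norm_ne_zero_iff.2 (τ.ne_zero t)
    refine ⟨v, fun t => (Real.log (ρ t) : ℂ) + 2 * Real.pi * ϑ t * I + N t, hv, ?_, fun t => ?_, ?_⟩
    · have h1 : Continuous fun t => Real.log (ρ t) := hρc.log fun t => (hρ t).ne'
      have h2 := hN.continuous
      fun_prop
    · rw [exp_add, exp_add, hNν, ← ofReal_exp, Real.exp_log (hρ t), hvρ]
    · have e : ∀ t, ((Real.log (ρ t) : ℂ) + 2 * Real.pi * ϑ t * I + N t).im =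
          2 * Real.pi * ϑ t + (N t).im := by
        intro t
        have : (2 * Real.pi * ϑ t * I : ℂ) = ((2 * Real.pi * ϑ t : ℝ) : ℂ) * I := by push_cast; ring
        rw [this, add_im, add_im, ofReal_im, im_ofReal_mul, I_im]
        ring
      simp only [e, hNk]
      ring
  · rintro ⟨v, G, hv, hG, hGv, hd⟩
    refine ⟨v, fun t => Real.exp ((G t).re - (N t).re), fun t => ((G t).im - (N t).im) / (2 * Real.pi),
      hv, ?_, fun t => Real.exp_pos _, fun t => ?_, ?_⟩
    · have h2 := hN.continuous
      fun_prop
    · rw [← hNν, ofReal_exp, ← exp_add, ← exp_add, ← hGv]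
      have e : (2 * Real.pi * ((((G t).im - (N t).im) / (2 * Real.pi) : ℝ) : ℂ) * I : ℂ) =
          (((G t).im - (N t).im : ℝ) : ℂ) * I := by
        have : (Real.pi : ℂ) ≠ 0 := by exact_mod_cast hpi
        push_cast
        field_simp
      rw [e]
      congr 1
      apply Complex.ext <;> simp
    · simp only [hNk]
      field_simp
      linarith

namespace TwistPerturbation

variable (T : TwistPerturbation X₁ X₂ Q ε)

theorem orbit_add_period (l : Label X₁ X₂ Q) (t : ℝ) :
    (T.orbit l).z (t + (T.orbit l).period) = (T.orbit l).z t - (l.1.1.num : ℂ) * I := by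
  rw [T.period_eq, T.winding_eq]

theorem hasDerivAt_re (γ : Orbit T.K X₁ X₂) (t : ℝ) :
    HasDerivAt (fun t => (γ.z t).re) ((hamField T.K t (γ.z t)).re) t := by
  have : HasDerivAt (fun t => (γ.z t).re) (twistField T.K t (γ.z t)).re t :=
    reCLM.hasFDerivAt.comp_hasDerivAt t (γ.flow t)
  simpa [twistField] using this

theorem hasDerivAt_im (γ : Orbit T.K X₁ X₂) (t : ℝ) :
    HasDerivAt (fun t => (γ.z t).im) (-(γ.z t).re + (hamField T.K t (γ.z t)).im) t := by
  have : HasDerivAt (fun t => (γ.z t).im) (twistField T.K t (γ.z t)).im t :=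
    imCLM.hasFDerivAt.comp_hasDerivAt t (γ.flow t)
  simpa [twistField] using this

/-- The orbits stay close to the circle `x = p/q`. -/
theorem abs_re_sub_le (l : Label X₁ X₂ Q) (t : ℝ) :
    |((T.orbit l).z t).re - l.1.1| ≤ ε * (Q + 1) := by
  set γ := T.orbit l
  set q : ℕ := l.1.1.den with hq
  have hε := T.eps_pos
  have hqQ : (q : ℝ) ≤ Q := by exact_mod_cast l.1.2.1
  have hq0 : (0 : ℝ) < q := by exact_mod_cast l.1.1.pos
  have h1 : ∀ s ∈ Icc t (t + q), ‖(γ.z s).re - (γ.z t).re‖ ≤ ε * (s - t) :=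
    norm_image_sub_le_of_norm_deriv_le_segment' (fun s _ => (T.hasDerivAt_re γ s).hasDerivWithinAt)
      fun s _ => ((abs_re_le_norm _).trans (T.small s _).1.le)
  -- During one period x moves by at most εq, so y + x(t)s moves with speed at most ε(q + 1). Its
  -- change over the period is q(x(t) - p/q), because y changes by -p.
  have h2 := norm_image_sub_le_of_norm_deriv_le_segment' (C := ε * (q + 1)) (a := t) (b := t + q)
    (f := fun s => (γ.z s).im + (γ.z t).re * s)
    (fun s _ => ((T.hasDerivAt_im γ s).add ((hasDerivAt_id s).const_mul (γ.z t).re)).hasDerivWithinAt)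
    (fun s hs => by
      have h3 := h1 s ⟨hs.1, hs.2.le⟩
      have h4 := (abs_im_le_norm _).trans (T.small s (γ.z s)).1.le
      have h5 : ε * (s - t) ≤ ε * q := mul_le_mul_of_nonneg_left (by linarith [hs.2]) hε.le
      rw [Real.norm_eq_abs, abs_le] at h3
      rw [abs_le] at h4
      rw [Real.norm_eq_abs, abs_le]
      constructor <;> linarith [h3.1, h3.2, h4.1, h4.2]) (t + q) ⟨by linarith, le_rfl⟩
  have h3 : (γ.z (t + q)).im = (γ.z t).im - l.1.1.num := by
    rw [T.winding_eq]; simp [γ]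
  simp only [h3] at h2
  have e : (γ.z t).im - (l.1.1.num : ℝ) + (γ.z t).re * (t + q) - ((γ.z t).im + (γ.z t).re * t) =
      q * ((γ.z t).re - l.1.1) := by
    have : (l.1.1 : ℝ) * q = l.1.1.num := by exact_mod_cast Rat.mul_den_eq_num l.1.1
    rw [← this]; ring
  rw [e, norm_mul, Real.norm_of_nonneg hq0.le, add_sub_cancel_left, mul_comm] at h2
  have h4 := le_of_mul_le_mul_right h2 hq0
  rw [Real.norm_eq_abs] at h4
  refine h4.trans ?_
  gcongr

/-- The orbits do not meet the boundary. -/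
theorem re_mem_Ioo (hX : ∀ r : ℚ, r.den ≤ Q → (r : ℝ) ≠ X₁ ∧ (r : ℝ) ≠ X₂) (l : Label X₁ X₂ Q)
    (t : ℝ) : ((T.orbit l).z t).re ∈ Ioo X₁ X₂ := by
  obtain ⟨d, hd, hb⟩ := T.boundary_support
  -- Near the boundary the field is the unperturbed twist, so an orbit that gets there keeps x
  -- constant and y changes by -xq over a period. This forces x = p/q, which is impossible at X₁ and
  -- X₂.
  have key : ∀ x : ℝ, (x < X₁ + d ∨ X₂ - d < x) → ((T.orbit l).z t).re = x → (l.1.1 : ℝ) = x := by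
    intro x hx htx
    have hflow : ∀ s : ℝ, HasDerivAt (fun s : ℝ => (T.orbit l).z t - ((x * (s - t) : ℝ) : ℂ) * I)
        (twistField T.K s ((T.orbit l).z t - ((x * (s - t) : ℝ) : ℂ) * I)) s := by
      intro s
      have hre : ((T.orbit l).z t - ((x * (s - t) : ℝ) : ℂ) * I).re = x := by simp [htx]
      have e : twistField T.K s ((T.orbit l).z t - ((x * (s - t) : ℝ) : ℂ) * I) = -((x : ℂ) * I) := by
        rw [twistField, hre, hb s _ (by rw [hre]; exact hx)]; simp
      rw [e]
      have h1 : HasDerivAt (fun s : ℝ => x * (s - t)) (x * 1) s :=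
        ((hasDerivAt_id s).sub_const t).const_mul x
      have := (h1.ofReal_comp.mul_const I).const_sub ((T.orbit l).z t)
      simpa using this
    have h := congrFun (T.flow_unique (t₀ := t) (T.orbit l).flow hflow (by simp)) (t + l.1.1.den)
    rw [T.winding_eq] at h
    have h2 := congrArg Complex.im h
    simp at h2
    have hq0 : (l.1.1.den : ℝ) ≠ 0 := by exact_mod_cast l.1.1.pos.ne'
    have : (l.1.1 : ℝ) * l.1.1.den = l.1.1.num := by exact_mod_cast Rat.mul_den_eq_num l.1.1
    rw [← this] at h2
    exact mul_right_cancel₀ hq0 h2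
  have hm := (T.orbit l).mem t
  refine ⟨hm.1.lt_of_ne fun h => (hX l.1.1 l.1.2.1).1 (key X₁ (Or.inl (by linarith)) h.symm),
    hm.2.lt_of_ne fun h => (hX l.1.1 l.1.2.1).2 (key X₂ (Or.inr (by linarith)) h)⟩

/-- Linearized solutions along translated orbits. -/
theorem linearized_translate {γ γ' : Orbit T.K X₁ X₂} {k m : ℤ}
    (h : ∀ t, γ.z (t + k) = γ'.z t + m * I) {v : ℝ → ℂ} (hv : γ.IsLinearized v) :
    γ'.IsLinearized fun t => v (t + k) := by
  intro t
  have h1 := (hv (t + k)).comp_add_const t (k : ℝ)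
  have e : fderiv ℝ (twistField T.K (t + k)) (γ.z (t + k)) =
      fderiv ℝ (twistField T.K t) (γ'.z t) := by
    rw [h, ← fderiv_comp_add_right]
    congr 1
    funext z
    exact T.twistField_add_int t z k m
  rwa [e] at h1

theorem linearized_smul {γ : Orbit T.K X₁ X₂} (c : ℝ) {v : ℝ → ℂ} (hv : γ.IsLinearized v) :
    γ.IsLinearized fun t => c • v t := fun t => by
  rw [map_smul]
  exact (hv t).const_smul c

theorem orbit_add_period' (l : Label X₁ X₂ Q) (t : ℝ) :
    (T.orbit l).z (t + ((T.orbit l).period : ℤ)) = (T.orbit l).z t + ((-l.1.1.num : ℤ) : ℂ) * I := by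
  push_cast
  rw [T.orbit_add_period l]; ring

/-- Induction on k: shifting a solution by one period gives a solution along the same orbit, by
invariance of the field under integer translations. -/
theorem returnMap_iterate {l : Label X₁ X₂ Q} {M : ℂ →ₗ[ℝ] ℂ} (hM : (T.orbit l).IsReturnMap M)
    {v : ℝ → ℂ} (hv : (T.orbit l).IsLinearized v) (k : ℕ) :
    v ((k * (T.orbit l).period : ℕ) : ℝ) = (M ^ k) (v 0) := by
  have hone : ∀ w : ℝ → ℂ, (T.orbit l).IsLinearized w → w (T.orbit l).period = M (w 0) := by
    intro w hw
    obtain ⟨u, hu, hu0, hu1⟩ := hM (w 0)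
    rw [← hu1, T.linearized_unique _ hu hw hu0]
  induction k generalizing v with
  | zero => simp
  | succ k ih =>
    have h1 := ih (T.linearized_translate (T.orbit_add_period' l) hv)
    simp only [zero_add, Int.cast_natCast] at h1
    rw [hone v hv, ← Module.End.mul_apply, ← pow_succ] at h1
    rw [← h1]
    congr 1
    push_cast
    ring

/-- The iterates of an elliptic return map have no positive eigenvalues. -/
theorem pow_apply_ne_smul {θ : ℝ} (hθ : 0 < θ) {k : ℕ} (hk : 0 < k) (hkθ : k * θ < 1)
    {M : ℂ →ₗ[ℝ] ℂ} (hM : M.charpoly.map (algebraMap ℝ ℂ) =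
      (Polynomial.X - Polynomial.C (exp (2 * Real.pi * θ * I))) *
      (Polynomial.X - Polynomial.C (exp (-(2 * Real.pi * θ * I))))) {c : ℝ} (hc : 0 < c) {u : ℂ}
    (hu : u ≠ 0) : (M ^ k) u ≠ c • u := by
  intro h
  have hk0 : (0 : ℝ) < k := by exact_mod_cast hk
  -- If a k-th power of an eigenvalue were a positive real, it would be 1 and kθ would be an
  -- integer, contrary to 0 < kθ < 1.
  have hne : ∀ s : ℝ, s = θ ∨ s = -θ → exp (2 * Real.pi * s * I) ^ k ≠ (c : ℂ) := by
    intro s hs he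
    rw [← exp_nat_mul] at he
    have hn := congrArg norm he
    have e1 : (k : ℂ) * (2 * Real.pi * s * I) = ((k * (2 * Real.pi * s) : ℝ) : ℂ) * I := by
      push_cast; ring
    rw [e1, norm_exp_ofReal_mul_I, Complex.norm_real, Real.norm_of_nonneg hc.le] at hn
    rw [← hn, ofReal_one, exp_eq_one_iff] at he
    obtain ⟨n, he⟩ := he
    have e2 : (k : ℝ) * s = n := by
      have h3 : ((k * s : ℝ) : ℂ) * (2 * Real.pi * I) = (n : ℂ) * (2 * Real.pi * I) := by
        rw [← he]; push_cast; ring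
      have h4 := mul_right_cancel₀ (by simp [Real.pi_ne_zero]) h3
      exact_mod_cast h4
    have hpos : 0 < k * θ := by positivity
    rcases hs with rfl | rfl
    · rw [e2] at hpos hkθ
      have a : 0 < n := by exact_mod_cast hpos
      have b : n < 1 := by exact_mod_cast hkθ
      omega
    · have e3 : (k : ℝ) * θ = ((-n : ℤ) : ℝ) := by push_cast; linarith
      rw [e3] at hpos hkθ
      have a : 0 < -n := by exact_mod_cast hpos
      have b : -n < 1 := by exact_mod_cast hkθ
      omega
  -- The characteristic polynomial has no common root with X^k - c. A Bézout relation evaluated at M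
  -- on u, with Cayley–Hamilton and M^k u = c u, gives u = 0.
  have hcop : IsCoprime M.charpoly (Polynomial.X ^ k - Polynomial.C c) := by
    rw [← Polynomial.isCoprime_map (algebraMap ℝ ℂ), hM]
    have hfac : ∀ s : ℝ, s = θ ∨ s = -θ → IsCoprime
        (Polynomial.X - Polynomial.C (exp (2 * Real.pi * s * I)))
        ((Polynomial.X ^ k - Polynomial.C c : Polynomial ℝ).map (algebraMap ℝ ℂ)) := by
      intro s hs
      refine ((Polynomial.irreducible_X_sub_C _).coprime_iff_not_dvd).2 fun hd => hne s hs ?_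
      rw [Polynomial.dvd_iff_isRoot] at hd
      simpa [sub_eq_zero] using hd
    refine IsCoprime.mul_left (hfac θ (Or.inl rfl)) ?_
    have := hfac (-θ) (Or.inr rfl)
    rwa [show (2 * Real.pi * ((-θ : ℝ) : ℂ) * I) = -(2 * Real.pi * θ * I) by push_cast; ring] at this
  obtain ⟨a, b, hab⟩ := hcop
  have h1 := congrArg (fun P => Polynomial.aeval M P u) hab
  simp only [map_add, map_mul, LinearMap.aeval_self_charpoly, mul_zero, zero_add, map_sub, map_pow,
    Polynomial.aeval_X, Polynomial.aeval_C, map_one, Module.End.mul_apply, Module.End.one_apply,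
    LinearMap.sub_apply, Module.algebraMap_end_apply, h, sub_self, map_zero] at h1
  exact hu h1.symm

/-- Along the hyperbolic orbits there is a linearized solution that is multiplied by a positive
number in each period. -/
theorem exists_positive_solution (r : Slope X₁ X₂ Q) :
    ∃ (v : ℝ → ℂ) (c : ℝ), 0 < c ∧ (T.orbit (r, Kind.hyp)).IsLinearized v ∧ v 0 ≠ 0 ∧
      ∀ t, v (t + (T.orbit (r, Kind.hyp)).period) = c • v t := by
  obtain ⟨M, hM, c, m, hc, -, -, -, hp⟩ := T.hyperbolic r
  have hev : Module.End.HasEigenvalue M c := by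
    rw [Module.End.hasEigenvalue_iff_isRoot_charpoly, hp]
    simp
  obtain ⟨u, hu⟩ := hev.exists_hasEigenvector
  obtain ⟨v, hv, hv0, hv1⟩ := hM u
  refine ⟨v, c, hc, hv, hv0 ▸ hu.2, fun t => ?_⟩
  have h1 := T.linearized_translate (T.orbit_add_period' (r, Kind.hyp)) hv
  have h2 := T.linearized_smul c hv
  have := congrFun (T.linearized_unique _ (t₀ := 0) h1 h2 (by
    simp only [zero_add, Int.cast_natCast]
    rw [hv1, hv0, hu.apply_eq_smul])) t
  simpa using this

end TwistPerturbation

end Labels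

/-! ### The size of ε, separation of the orbits, and Conley–Zehnder indices. -/

section Index

open Set Complex

variable {X₁ X₂ ε : ℝ} {Q : ℕ}

/-- The bound for the size of the perturbation. -/
def epsBound (Q : ℕ) : ℝ := 1 / (100 * ((Q : ℝ) + 1) ^ 4)

theorem epsBound_pos (Q : ℕ) : 0 < epsBound Q := by unfold epsBound; positivity

theorem epsBound_mul_pow_four (Q : ℕ) : epsBound Q * ((Q : ℝ) + 1) ^ 4 = 1 / 100 := by
  unfold epsBound; field_simp

/-- The square controls the half-turn time and the drift in y; the cube controls the distance
between orbits of different slopes. -/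
theorem epsBound_mul_pow_le (Q : ℕ) {j : ℕ} (hj : j ≤ 4) :
    epsBound Q * ((Q : ℝ) + 1) ^ j ≤ 1 / 100 := by
  rw [← epsBound_mul_pow_four Q]
  exact mul_le_mul_of_nonneg_left (pow_le_pow_right₀ (by linarith [Q.cast_nonneg (α := ℝ)]) hj)
    (epsBound_pos Q).le

/-- Apply `inv_le_halfTurnTime` with s = 1/(Q + 1), which gives a half-turn time of at least Q + 1.
-/
theorem lt_halfTurnTime (hε0 : 0 < ε) (hε : ε ≤ epsBound Q) : (Q : ℝ) < halfTurnTime ε := by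
  have hQ : (0 : ℝ) ≤ Q := Q.cast_nonneg
  have h1 := inv_le_halfTurnTime hε0 (s := ((Q : ℝ) + 1)⁻¹) (by positivity)
    (inv_le_one_of_one_le₀ (by linarith)) (by
      rw [inv_pow, ← one_div, le_div_iff₀ (by positivity)]
      have := epsBound_mul_pow_le Q (j := 2) (by norm_num)
      have h2 : ε * ((Q : ℝ) + 1) ^ 2 ≤ epsBound Q * ((Q : ℝ) + 1) ^ 2 :=
        mul_le_mul_of_nonneg_right hε (by positivity)
      linarith)
  rw [inv_inv] at h1
  linarith

/-- The difference is a positive integer divided by the product of the denominators, and that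
product is at most Q². -/
theorem slope_gap {r r' : ℚ} (h : r' < r) (hr : r.den ≤ Q) (hr' : r'.den ≤ Q) :
    (1 : ℝ) / Q ^ 2 ≤ (r : ℝ) - r' := by
  have hd : (0 : ℝ) < r.den := by exact_mod_cast r.pos
  have hd' : (0 : ℝ) < r'.den := by exact_mod_cast r'.pos
  have hQ : (r.den : ℝ) ≤ Q := by exact_mod_cast hr
  have hQ' : (r'.den : ℝ) ≤ Q := by exact_mod_cast hr'
  have e : (r : ℝ) * r.den = r.num := by exact_mod_cast Rat.mul_den_eq_num r
  have e' : (r' : ℝ) * r'.den = r'.num := by exact_mod_cast Rat.mul_den_eq_num r'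
  have hlt : (r' : ℝ) < r := by exact_mod_cast h
  have h1 : (0 : ℝ) < ((r.num * r'.den - r'.num * r.den : ℤ) : ℝ) := by
    push_cast
    rw [← e, ← e']
    nlinarith [mul_pos (mul_pos hd hd') (sub_pos.2 hlt)]
  have h2 : (1 : ℝ) ≤ ((r.num * r'.den - r'.num * r.den : ℤ) : ℝ) := by
    exact_mod_cast (by exact_mod_cast h1 : (0 : ℤ) < _)
  push_cast at h2
  rw [← e, ← e'] at h2
  have hQ0 : (0 : ℝ) < Q := hd.trans_le hQ
  rw [div_le_iff₀ (by positivity)]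
  have h3 : (r.den : ℝ) * r'.den ≤ Q ^ 2 := by nlinarith
  nlinarith [mul_le_mul_of_nonneg_left h3 (sub_pos.2 hlt).le]

namespace TwistPerturbation

variable (T : TwistPerturbation X₁ X₂ Q ε)

theorem one_le_Q (l : Label X₁ X₂ Q) : (1 : ℝ) ≤ Q := by
  exact_mod_cast (l.1.1.pos).trans_le l.1.2.1

/-- The circles x = p/q are at least 1/Q² apart, and each orbit stays within ε(Q + 1) ≤ 1/(4Q²) of
its circle. -/
theorem re_gap (hε : ε ≤ epsBound Q) {l l' : Label X₁ X₂ Q} (h : l'.1.1 < l.1.1) (s t : ℝ) :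
    1 / (2 * (Q : ℝ) ^ 2) ≤ ((T.orbit l).z s).re - ((T.orbit l').z t).re := by
  have h1 := (abs_le.1 (T.abs_re_sub_le l s)).1
  have h2 := (abs_le.1 (T.abs_re_sub_le l' t)).2
  have h3 := slope_gap h l.1.2.1 l'.1.2.1
  have hQ := one_le_Q l
  have h4 : ε * (Q + 1) * (4 * (Q : ℝ) ^ 2) ≤ 1 := by
    have h5 := epsBound_mul_pow_le Q (j := 3) (by norm_num)
    have h6 : ε * (Q + 1) ≤ epsBound Q * (Q + 1) := mul_le_mul_of_nonneg_right hε (by positivity)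
    have h7 := epsBound_pos Q
    have h8 : (Q : ℝ) ^ 2 ≤ (Q + 1) ^ 2 := pow_le_pow_left₀ (by positivity) (by linarith) 2
    calc ε * (Q + 1) * (4 * (Q : ℝ) ^ 2) ≤ epsBound Q * (Q + 1) * (4 * (Q + 1) ^ 2) := by gcongr
      _ = 4 * (epsBound Q * (Q + 1) ^ 3) := by ring
      _ ≤ 1 := by linarith
  have h5 : ε * (Q + 1) ≤ 1 / (4 * (Q : ℝ) ^ 2) := by rw [le_div_iff₀ (by positivity)]; exact h4
  have e : 1 / (2 * (Q : ℝ) ^ 2) = 1 / (Q : ℝ) ^ 2 - 2 * (1 / (4 * (Q : ℝ) ^ 2)) := by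
    field_simp; ring
  rw [e]
  linarith

/-- That e and h are different orbits is seen from the linearization: a common orbit would have a
positive eigenvalue of its return map, whereas e^{±2πiθ} with 0 < θ < 1 is never positive. -/
theorem hyperbolic_ne_elliptic (r : Slope X₁ X₂ Q) (k m : ℤ) :
    ¬ ∀ t, (T.orbit (r, Kind.hyp)).z (t + k) = (T.orbit (r, Kind.ell)).z t + m * I := by
  intro h
  obtain ⟨v, c, hc, hv, hv0, hvp⟩ := T.exists_positive_solution r
  obtain ⟨θ, hθ, hθQ, M, hM, hp⟩ := T.elliptic r
  have hw := T.linearized_translate h hv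
  have h1 := T.returnMap_iterate hM hw 1
  have hper : (T.orbit (r, Kind.ell)).period = (T.orbit (r, Kind.hyp)).period := by
    rw [T.period_eq, T.period_eq]
  rw [one_mul, hper] at h1
  have h2 : v (((T.orbit (r, Kind.hyp)).period : ℝ) + k) = c • v (0 + k) := by
    rw [← hvp]; congr 1; ring
  rw [h2] at h1
  have hQ := one_le_Q (r, Kind.ell)
  refine pow_apply_ne_smul hθ one_pos ?_ hp hc (T.linearized_ne_zero hv hv0 (0 + k)) h1.symm
  have : (1 : ℝ) / Q ≤ 1 := by rw [div_le_one (by linarith)]; exact hQ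
  push_cast
  linarith

/-- Different orbits do not meet. -/
theorem strand_ne (hε : ε ≤ epsBound Q) {l l' : Label X₁ X₂ Q} (hne : l ≠ l') (k m : ℤ) (t : ℝ) :
    (T.orbit l).z (t + k) ≠ (T.orbit l').z t + m * I := by
  intro h
  have hre : ((T.orbit l).z (t + k)).re = ((T.orbit l').z t).re := by rw [h]; simp
  have hQ := one_le_Q l
  have hpos : 0 < 1 / (2 * (Q : ℝ) ^ 2) := by positivity
  rcases lt_trichotomy l.1.1 l'.1.1 with h1 | h1 | h1
  · have := T.re_gap hε h1 t (t + k)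
    linarith
  · have hall := T.orbit_eq_of_eq_at h
    obtain ⟨r, i⟩ := l
    obtain ⟨r', i'⟩ := l'
    have hr : r = r' := Subtype.ext h1
    subst hr
    cases i <;> cases i'
    · exact hne rfl
    · refine T.hyperbolic_ne_elliptic r (-k) (-m) fun t => ?_
      have := hall (t + (-k : ℤ))
      push_cast at this ⊢
      rw [neg_add_cancel_right] at this
      rw [this]; ring
    · exact T.hyperbolic_ne_elliptic r k m hall
    · exact hne rfl
  · have := T.re_gap hε h1 (t + k) t
    linarith

/-- The rotation of linearized solutions is less than half a turn. -/
theorem rotation_bounds (hε : ε ≤ epsBound Q) {l : Label X₁ X₂ Q} (τ : Frame (T.orbit l)) {k : ℕ}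
    (hk : k * (T.orbit l).period ≤ Q) {d : ℝ} (hd : d ∈ rotationSet (T.orbit l) τ k) :
    -(1 / 2) < d + k * τ.turns ∧ d + k * τ.turns < 1 / 2 := by
  obtain ⟨v, G, hv, hG, hGv, e⟩ := (mem_rotationSet_iff
    (fun v hv => (T.isAlmostShear_linearized _ hv).continuous) τ k d).1 hd
  have hpi := Real.pi_gt_three
  have hkQ : ((k * (T.orbit l).period : ℕ) : ℝ) ≤ Q := by exact_mod_cast hk
  have h := (T.isAlmostShear_linearized _ hv).angle_bounds T.eps_pos
    (fun t => hGv t ▸ exp_ne_zero _) hG hGv (t := 0) (T := ((k * (T.orbit l).period : ℕ) : ℝ))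
    (Nat.cast_nonneg _) (hkQ.trans_lt (lt_halfTurnTime T.eps_pos hε))
  rw [zero_add, ← e] at h
  have hεQ : ε * ((k * (T.orbit l).period : ℕ) : ℝ) < Real.pi := by
    have h1 := epsBound_mul_pow_le Q (j := 1) (by norm_num)
    have h2 := epsBound_pos Q
    have : ε * ((k * (T.orbit l).period : ℕ) : ℝ) ≤ epsBound Q * Q := by gcongr
    nlinarith
  constructor <;> nlinarith [h.1, h.2]

theorem int_eq_of_mem_rotationSet (hε : ε ≤ epsBound Q) {l : Label X₁ X₂ Q} (τ : Frame (T.orbit l))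
    {k : ℕ} (hk : k * (T.orbit l).period ≤ Q) {n : ℤ}
    (hn : (n : ℝ) ∈ rotationSet (T.orbit l) τ k) : n = -(k * τ.turns) := by
  obtain ⟨h1, h2⟩ := T.rotation_bounds hε τ hk hn
  have a : ((-1 : ℤ) : ℝ) < ((n + k * τ.turns : ℤ) : ℝ) := by push_cast; linarith
  have b : ((n + k * τ.turns : ℤ) : ℝ) < ((1 : ℤ) : ℝ) := by push_cast; linarith
  have a' := Int.cast_lt.1 a
  have b' := Int.cast_lt.1 b
  linarith [(by omega : n + k * τ.turns = 0)]

theorem exp_eq_pos_smul {a b : ℂ} (h : a.im = b.im) : exp a = Real.exp (a.re - b.re) • exp b := by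
  rw [real_smul, ofReal_exp, ← exp_add]
  congr 1
  apply Complex.ext <;> simp [h]

theorem exists_log_linearized {l : Label X₁ X₂ Q} {v : ℝ → ℂ} (hv : (T.orbit l).IsLinearized v)
    (h0 : v 0 ≠ 0) : ∃ G : ℝ → ℂ, Continuous G ∧ ∀ t, exp (G t) = v t := by
  obtain ⟨G, -, hG, hGv, -⟩ := (T.isAlmostShear_linearized _ hv).exists_angle
    (T.linearized_ne_zero hv h0)
  exact ⟨G, hG, hGv⟩

/-- Measured in the coordinates, all rotations exceed -1/2 turn. None is an integer, since only 0
would be possible and the k-th power of the return map has no eigenvector with positive eigenvalue.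
The solution starting at ∂x does not turn positively, so the infimum lies in [-1/2, 0) and has floor
-1. The frame shifts the index by -2k · `τ.turns`. -/
theorem czIndex_elliptic (hε : ε ≤ epsBound Q) (r : Slope X₁ X₂ Q)
    (τ : Frame (T.orbit (r, Kind.ell))) {k : ℕ} (hk0 : 0 < k)
    (hk : k * (T.orbit (r, Kind.ell)).period ≤ Q) :
    czIndex (T.orbit (r, Kind.ell)) τ k = -1 - 2 * (k * τ.turns) := by
  have hcont : ∀ v, (T.orbit (r, Kind.ell)).IsLinearized v → Continuous v :=
    fun v hv => (T.isAlmostShear_linearized _ hv).continuous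
  have hno : ¬ ∃ n : ℤ, (n : ℝ) ∈ rotationSet (T.orbit (r, Kind.ell)) τ k := by
    rintro ⟨n, hn⟩
    obtain ⟨v, G, hv, hG, hGv, e⟩ := (mem_rotationSet_iff hcont τ k _).1 hn
    have hn' := T.int_eq_of_mem_rotationSet hε τ hk hn
    obtain ⟨θ, hθ, hθQ, M, hM, hp⟩ := T.elliptic r
    have h1 := T.returnMap_iterate hM hv k
    have h2 : (G ((k * (T.orbit (r, Kind.ell)).period : ℕ) : ℝ)).im = (G 0).im := by
      have e' : ((-(k * τ.turns) : ℤ) : ℝ) + k * τ.turns = 0 := by push_cast; ring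
      rw [hn', e'] at e
      linarith
    rw [← hGv, ← hGv, exp_eq_pos_smul h2] at h1
    refine pow_apply_ne_smul hθ hk0 ?_ hp (Real.exp_pos _) (exp_ne_zero (G 0)) h1.symm
    have hkQ : k ≤ Q := (Nat.le_mul_of_pos_right k (T.orbit (r, Kind.ell)).period_pos).trans hk
    have hQ := one_le_Q (r, Kind.ell)
    have hk' : (k : ℝ) ≤ Q := by exact_mod_cast hkQ
    have hkp : (0 : ℝ) < k := by exact_mod_cast hk0
    rw [lt_div_iff₀ (by linarith)] at hθQ
    nlinarith
  obtain ⟨θ, hθ, hθQ, M, hM, hp⟩ := T.elliptic r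
  obtain ⟨v, hv, hv0, -⟩ := hM 1
  obtain ⟨G, hG, hGv⟩ := T.exists_log_linearized hv (by rw [hv0]; exact one_ne_zero)
  have hpi := Real.pi_pos
  set d : ℝ := ((G ((k * (T.orbit (r, Kind.ell)).period : ℕ) : ℝ)).im - (G 0).im) / (2 * Real.pi) - k * τ.turns with hd
  have hmem : d ∈ rotationSet (T.orbit (r, Kind.ell)) τ k := (mem_rotationSet_iff hcont τ k _).2
    ⟨v, G, hv, hG, hGv, by rw [hd]; field_simp; ring⟩
  have hε1 : ε < 1 := by
    have := epsBound_mul_pow_le Q (j := 0) (by norm_num)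
    simp at this
    linarith
  have hle : d ≤ -(k * τ.turns) := by
    have h1 := (T.isAlmostShear_linearized _ hv).angle_nonpos hε1
      (fun t => hGv t ▸ exp_ne_zero _) hG hGv hv0 (T := ((k * (T.orbit (r, Kind.ell)).period : ℕ) : ℝ)) (Nat.cast_nonneg _)
    have : ((G ((k * (T.orbit (r, Kind.ell)).period : ℕ) : ℝ)).im - (G 0).im) / (2 * Real.pi) ≤ 0 :=
      div_nonpos_of_nonpos_of_nonneg h1 (by positivity)
    linarith
  have hlt : d < -(k * τ.turns) := by
    refine hle.lt_of_ne fun h => hno ⟨-(k * τ.turns), ?_⟩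
    rw [h] at hmem
    push_cast
    exact hmem
  have hlow : ∀ d' ∈ rotationSet (T.orbit (r, Kind.ell)) τ k, -(1 / 2) - (k * τ.turns : ℝ) ≤ d' := fun d' hd' => by
    have := (T.rotation_bounds hε τ hk hd').1; linarith
  have hinf1 : -(1 / 2) - (k * τ.turns : ℝ) ≤ sInf (rotationSet (T.orbit (r, Kind.ell)) τ k) := le_csInf ⟨d, hmem⟩ hlow
  have hinf2 : sInf (rotationSet (T.orbit (r, Kind.ell)) τ k) < -(k * τ.turns) :=
    (csInf_le ⟨_, hlow⟩ hmem).trans_lt hlt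
  have hfl : ⌊sInf (rotationSet (T.orbit (r, Kind.ell)) τ k)⌋ = -(k * τ.turns) - 1 := by
    rw [Int.floor_eq_iff]
    push_cast
    constructor <;> linarith
  rw [czIndex, dif_neg hno, hfl]
  ring

/-- A solution multiplied by a positive number over each period returns to its direction, so its
rotation in the coordinates is an integer. The bound by half a turn forces this integer to be 0. -/
theorem czIndex_hyperbolic (hε : ε ≤ epsBound Q) (r : Slope X₁ X₂ Q)
    (τ : Frame (T.orbit (r, Kind.hyp))) {k : ℕ}
    (hk : k * (T.orbit (r, Kind.hyp)).period ≤ Q) :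
    czIndex (T.orbit (r, Kind.hyp)) τ k = -2 * (k * τ.turns) := by
  have hcont : ∀ v, (T.orbit (r, Kind.hyp)).IsLinearized v → Continuous v :=
    fun v hv => (T.isAlmostShear_linearized _ hv).continuous
  obtain ⟨v, c, hc, hv, hv0, hvp⟩ := T.exists_positive_solution r
  obtain ⟨G, hG, hGv⟩ := T.exists_log_linearized hv hv0
  have hpow : v ((k * (T.orbit (r, Kind.hyp)).period : ℕ) : ℝ) = (c ^ k : ℝ) • v 0 := by
    clear hk
    induction k with
    | zero => simp
    | succ k ih =>
      rw [show (((k + 1) * (T.orbit (r, Kind.hyp)).period : ℕ) : ℝ) = ((k * (T.orbit (r, Kind.hyp)).period : ℕ) : ℝ) + (T.orbit (r, Kind.hyp)).period by push_cast; ring,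
        hvp, ih, smul_smul, pow_succ']
  obtain ⟨m, hm⟩ : ∃ m : ℤ, (G ((k * (T.orbit (r, Kind.hyp)).period : ℕ) : ℝ)).im - (G 0).im = 2 * Real.pi * m := by
    have h1 : exp (G ((k * (T.orbit (r, Kind.hyp)).period : ℕ) : ℝ)) = exp ((Real.log (c ^ k) : ℝ) + G 0) := by
      rw [hGv, exp_add, hGv, hpow, ← ofReal_exp, Real.exp_log (by positivity), real_smul]
    obtain ⟨m, hm⟩ := exp_eq_exp_iff_exists_int.1 h1
    refine ⟨m, ?_⟩
    rw [hm]
    simp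
    ring
  have hmem : ((m - k * τ.turns : ℤ) : ℝ) ∈ rotationSet (T.orbit (r, Kind.hyp)) τ k := (mem_rotationSet_iff hcont τ k _).2
    ⟨v, G, hv, hG, hGv, by rw [hm]; push_cast; ring⟩
  have hex : ∃ n : ℤ, (n : ℝ) ∈ rotationSet (T.orbit (r, Kind.hyp)) τ k := ⟨_, hmem⟩
  rw [czIndex, dif_pos hex, T.int_eq_of_mem_rotationSet hε τ hk hex.choose_spec]
  ring

end TwistPerturbation

end Index

/-! ### The linking integral of two graphs over the time axis. -/

section LinkKernel

open MeasureTheory Set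

variable {c : Fin 4 → ℝ} {δ : ℝ} {f g : ℝ → ℂ}

/-- The curve `t ↦ (t, f t)`, `0 ≤ t ≤ S`, as a map on the unit interval. -/
def curveMap (f : ℝ → ℂ) (S : ℝ) : (Fin 1 → ℝ) → (Fin 3 → ℝ) := fun u => pt3 (S * u 0) (f (S * u 0))

theorem contDiff_curveMap (hf : ContDiff ℝ ∞ f) (S : ℝ) : ContDiff ℝ ∞ (curveMap f S) :=
  contDiff_pt3 (contDiff_const.mul (contDiff_apply ℝ ℝ 0))
    (hf.comp (contDiff_const.mul (contDiff_apply ℝ ℝ 0)))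

theorem fderiv_curveMap (hf : ContDiff ℝ ∞ f) (S : ℝ) (u : Fin 1 → ℝ) :
    fderiv ℝ (curveMap f S) u (Pi.single 0 1) =
      ![S, S * (deriv f (S * u 0)).re, S * (deriv f (S * u 0)).im] := by
  have h1 : HasDerivAt (fun s : ℝ => curveMap f S (u + s • (Pi.single 0 1 : Fin 1 → ℝ)))
      (fderiv ℝ (curveMap f S) u (Pi.single 0 1)) 0 := by
    have hline : HasDerivAt (fun s : ℝ => u + s • (Pi.single 0 (1 : ℝ) : Fin 1 → ℝ))
        (Pi.single 0 1) 0 := by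
      simpa using ((hasDerivAt_id (0 : ℝ)).smul_const (Pi.single 0 (1 : ℝ) : Fin 1 → ℝ)).const_add u
    have h2 : HasFDerivAt (curveMap f S) (fderiv ℝ (curveMap f S) u)
        (u + (0 : ℝ) • (Pi.single 0 (1 : ℝ) : Fin 1 → ℝ)) := by
      rw [zero_smul, add_zero]
      exact ((contDiff_curveMap hf S).differentiable (by simp) u).hasFDerivAt
    exact h2.comp_hasDerivAt (0 : ℝ) hline
  have h2 : HasDerivAt (fun s : ℝ => S * (u 0 + s)) S 0 := by
    simpa using ((hasDerivAt_id (0 : ℝ)).const_add (u 0)).const_mul S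
  have h3 : HasDerivAt (fun s : ℝ => f (S * (u 0 + s))) (S • deriv f (S * u 0)) 0 := by
    have := HasDerivAt.scomp (h := fun s : ℝ => S * (u 0 + s)) (0 : ℝ)
      (hf.differentiable (by simp) (S * (u 0 + 0))).hasDerivAt h2
    rw [add_zero] at this
    exact this
  refine h1.unique ?_
  rw [hasDerivAt_pi]
  intro j
  fin_cases j
  · simpa [curveMap, pt3] using h2
  · have := Complex.reCLM.hasFDerivAt.comp_hasDerivAt (0 : ℝ) h3
    simpa [curveMap, pt3, Function.comp_def] using this
  · have := Complex.imCLM.hasFDerivAt.comp_hasDerivAt (0 : ℝ) h3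
    simpa [curveMap, pt3, Function.comp_def] using this

/-- The integrand of the linking integral of the curves `(t, f t)` and `(t, g t)`. -/
def linkKernel (c : Fin 4 → ℝ) (δ : ℝ) (f g : ℝ → ℂ) (t₁ t₂ : ℝ) : ℝ :=
  stepFn (c 2) δ (f t₁ - g t₂).re * (deriv (stairFn (c 1) δ) (t₁ - t₂) *
    (deriv (stairFn (c 3) δ) (f t₁ - g t₂).im * ((deriv f t₁).im - (deriv g t₂).im)))

/-- The coordinate x enters undifferentiated. In the 2×2 determinant of the t- and y-columns the
bumps in t and y are common factors, and the difference of the y-velocities remains. -/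
theorem leadInt_curveMap (hδ : 0 < δ) (hδ1 : δ < 1) (hf : ContDiff ℝ ∞ f) (hg : ContDiff ℝ ∞ g)
    (S S' : ℝ) :
    leadInt (n := 2) (stairMap (stairY c δ) ordY (diffLift (p := 1) (q := 1) (curveMap f S) (curveMap g S'))) =
      ∫ y in Icc (0 : Fin 2 → ℝ) 1, S * (S' * linkKernel c δ f g (S * y 0) (S' * y 1)) := by
  have hA := contDiff_curveMap hf S
  have hB := contDiff_curveMap hg S'
  refine setIntegral_congr_fun measurableSet_Icc fun y _ => ?_
  have hM := gradMat_stairMap (stairSys_stairY (c := c) hδ hδ1).smooth (ι := ordY)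
    (contDiff_diffLift (p := 1) (q := 1) hA hB) y
  have hl := fderiv_diffLift_left (p := 1) (q := 1) (hA.differentiable (by simp))
    (hB.differentiable (by simp)) y 0
  have hr := fderiv_diffLift_right (p := 1) (q := 1) (hA.differentiable (by simp))
    (hB.differentiable (by simp)) y 0
  rw [fderiv_curveMap hf] at hl
  rw [fderiv_curveMap hg] at hr
  have hl' : fderiv ℝ (diffLift (p := 1) (q := 1) (curveMap f S) (curveMap g S')) y (Pi.single (0 : Fin 2) 1) =
    ![S, S * (deriv f (S * y 0)).re, S * (deriv f (S * y 0)).im] := hl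
  have hr' : fderiv ℝ (diffLift (p := 1) (q := 1) (curveMap f S) (curveMap g S')) y (Pi.single (1 : Fin 2) 1) =
    -![S', S' * (deriv g (S' * y 1)).re, S' * (deriv g (S' * y 1)).im] := hr
  have hD : diffLift (p := 1) (q := 1) (curveMap f S) (curveMap g S') y =
      pt3 (S * y 0) (f (S * y 0)) - pt3 (S' * y 1) (g (S' * y 1)) := rfl
  rw [hM, Matrix.det_fin_two]
  simp only [Matrix.submatrix_apply, Matrix.of_apply, stairMap, id, hl', hr', hD]
  simp [ordY, stairY, pt3, linkKernel]
  ring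

theorem setIntegral_fin_two {h : ℝ → ℝ → ℝ} (hh : Continuous fun w : ℝ × ℝ => h w.1 w.2) :
    ∫ y in Icc (0 : Fin 2 → ℝ) 1, h (y 0) (y 1) = ∫ s in (0 : ℝ)..1, ∫ t in (0 : ℝ)..1, h s t := by
  have e : (MeasurableEquiv.finTwoArrow (α := ℝ)) ⁻¹' (Icc (0 : ℝ) 1 ×ˢ Icc (0 : ℝ) 1) =
      Icc (0 : Fin 2 → ℝ) 1 := by
    ext y
    simp only [mem_preimage, mem_Icc, Pi.le_def, Fin.forall_fin_two, mem_prod]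
    change ((0 ≤ y 0 ∧ y 0 ≤ 1) ∧ (0 ≤ y 1 ∧ y 1 ≤ 1)) ↔ _
    simp only [Pi.zero_apply, Pi.one_apply]
    tauto
  have h1 := (volume_preserving_finTwoArrow ℝ).setIntegral_preimage_emb
    (MeasurableEquiv.measurableEmbedding _) (fun w : ℝ × ℝ => h w.1 w.2) (Icc (0 : ℝ) 1 ×ˢ Icc (0 : ℝ) 1)
  rw [e] at h1
  refine h1.trans ?_
  rw [Measure.volume_eq_prod, setIntegral_prod _ (by
    rw [← Measure.volume_eq_prod]
    exact hh.continuousOn.integrableOn_compact (isCompact_Icc.prod isCompact_Icc))]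
  rw [intervalIntegral.integral_of_le zero_le_one, integral_Icc_eq_integral_Ioc]
  refine integral_congr_ae (ae_of_all _ fun s => ?_)
  simp only
  rw [intervalIntegral.integral_of_le zero_le_one, integral_Icc_eq_integral_Ioc]

theorem continuous_linkKernel (hδ : 0 < δ) (hδ1 : δ < 1) (hf : ContDiff ℝ ∞ f) (hg : ContDiff ℝ ∞ g) :
    Continuous fun w : ℝ × ℝ => linkKernel c δ f g w.1 w.2 := by
  have h1 : Continuous (deriv f) :=
    (((contDiff_succ_iff_deriv (n := ∞)).1 (by simpa using hf)).2.2).continuous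
  have h2 : Continuous (deriv g) :=
    (((contDiff_succ_iff_deriv (n := ∞)).1 (by simpa using hg)).2.2).continuous
  have h3 : ∀ a, Continuous (deriv (stairFn a δ)) := fun a =>
    (((contDiff_succ_iff_deriv (n := ∞)).1 (by simpa using contDiff_stairFn hδ hδ1)).2.2).continuous
  have h4 := (contDiff_stepFn (c 2) δ).continuous
  have h5 := hf.continuous
  have h6 := hg.continuous
  have h7 := h3 (c 1)
  have h8 := h3 (c 3)
  unfold linkKernel
  fun_prop

theorem leadInt_curveMap_eq (hδ : 0 < δ) (hδ1 : δ < 1) (hf : ContDiff ℝ ∞ f) (hg : ContDiff ℝ ∞ g)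
    (S S' : ℝ) :
    leadInt (n := 2) (stairMap (stairY c δ) ordY (diffLift (p := 1) (q := 1) (curveMap f S) (curveMap g S'))) =
      ∫ s in (0 : ℝ)..S, ∫ t in (0 : ℝ)..S', linkKernel c δ f g s t := by
  have hk := continuous_linkKernel (c := c) hδ hδ1 hf hg
  rw [leadInt_curveMap hδ hδ1 hf hg, setIntegral_fin_two
    (h := fun a b => S * (S' * linkKernel c δ f g (S * a) (S' * b)))
    (by
      have : Continuous fun w : ℝ × ℝ => linkKernel c δ f g (S * w.1) (S' * w.2) :=
        hk.comp (by fun_prop : Continuous fun w : ℝ × ℝ => (S * w.1, S' * w.2))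
      fun_prop)]
  simp only [intervalIntegral.integral_const_mul]
  have inner : ∀ a, S' * ∫ b in (0 : ℝ)..1, linkKernel c δ f g a (S' * b) =
      ∫ t in (0 : ℝ)..S', linkKernel c δ f g a t := fun a => by
    rw [intervalIntegral.mul_integral_comp_mul_left (f := fun b => linkKernel c δ f g a b), mul_zero,
      mul_one]
  rw [← intervalIntegral.integral_const_mul]
  simp only [inner]
  rw [intervalIntegral.mul_integral_comp_mul_left
    (f := fun a => ∫ t in (0 : ℝ)..S', linkKernel c δ f g a t), mul_zero, mul_one]

end LinkKernel

/-! ### Linking integrals of curves of equal slope: a sum of winding numbers of strands. -/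

section Crossing

open MeasureTheory Set Complex

variable {c : Fin 4 → ℝ} {δ ρ : ℝ} {f g : ℝ → ℂ}

theorem HasTurns.comp_mul {S : ℝ} {n : ℤ} (h : HasTurns f S n) :
    HasTurns (fun u => f (S * u)) 1 n := by
  obtain ⟨G, hG, hGf, e⟩ := h
  exact ⟨fun u => G (S * u), hG.comp (contDiff_const.mul contDiff_id), fun u => hGf _, by simpa using e⟩

theorem HasTurns.contDiff {S : ℝ} {n : ℤ} (h : HasTurns f S n) : ContDiff ℝ ∞ f := by
  obtain ⟨G, hG, hGf, -⟩ := h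
  obtain rfl : f = fun t => exp (G t) := funext fun t => (hGf t).symm
  exact contDiff_exp.comp hG

theorem HasTurns.ne_zero {S : ℝ} {n : ℤ} (h : HasTurns f S n) (t : ℝ) : f t ≠ 0 := by
  obtain ⟨G, hG, hGf, -⟩ := h
  exact hGf t ▸ exp_ne_zero _

/-- Nearby closed curves make the same number of turns. -/
theorem HasTurns.of_close {S : ℝ} {n : ℤ} (h : HasTurns f S n) (hg : ContDiff ℝ ∞ g)
    (hf0 : f S = f 0) (hg0 : g S = g 0) (hfg : ∀ t, ‖g t - f t‖ < ‖f t‖) : HasTurns g S n := by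
  have hf := h.contDiff
  have hne := h.ne_zero
  obtain ⟨G, hG, hGf, e⟩ := h
  -- The quotient stays in the open unit disc about 1, where the principal logarithm is smooth;
  -- adding that logarithm to G gives a logarithm of g with the same increment, since the quotient
  -- has equal values at 0 and S.
  have hs : ∀ t, g t / f t ∈ slitPlane := by
    intro t
    refine Or.inl ?_
    have h1 : ‖g t / f t - 1‖ < 1 := by
      rw [div_sub_one (hne t), norm_div, div_lt_one (norm_pos_iff.2 (hne t))]
      exact hfg t
    have h2 := (abs_lt.1 ((abs_re_le_norm _).trans_lt h1)).1
    simp at h2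
    linarith
  have hq : ContDiff ℝ ∞ fun t => g t / f t := by
    simp only [div_eq_mul_inv]
    exact hg.mul (hf.inv hne)
  refine ⟨fun t => G t + log (g t / f t), hG.add ?_, fun t => ?_, ?_⟩
  · rw [contDiff_iff_contDiffAt]
    intro t
    exact ((contDiffAt_log (n := ∞) (hs t)).restrict_scalars ℝ).comp t hq.contDiffAt
  · rw [exp_add, hGf, exp_log (slitPlane_ne_zero (hs t)), mul_div_cancel₀ _ (hne t)]
  · simp only [hf0, hg0, e]; ring

/-- The crossing integral of a closed curve near an integer translate of the origin. -/
theorem integral_crossing (hρ : 0 < ρ) (hρ1 : ρ ≤ 1 / 8) (hc : ∀ j, |c j| ≤ ρ / 2) (hδ : 0 < δ)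
    (hδρ : δ ≤ ρ / 2) {φ : ℝ → ℂ} (hφ : ContDiff ℝ ∞ φ) {w n : ℤ} {S : ℝ}
    (hn : HasTurns (fun t => φ t - w * I) S n) (hfar : ∀ t, 2 * ρ < ‖φ t - w * I‖)
    (him : ∀ t, |(φ t - w * I).im| ≤ 3 / 4) :
    ∫ t in (0 : ℝ)..S, stepFn (c 2) δ (φ t).re *
      (deriv (stairFn (c 3) δ) (φ t).im * (deriv φ t).im) = n := by
  have c2 := abs_le.1 (hc 2)
  have c3 := abs_le.1 (hc 3)
  have hB : IsStep ρ (stepFn (c 2) δ) := isStep_stepFn hδ (by linarith) (by linarith)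
  have hV : IsStep ρ (stepFn (c 3) δ) := isStep_stepFn hδ (by linarith) (by linarith)
  have h1 := leadInt_planeCurve hρ hB hV hn.comp_mul fun t _ => hfar _
  have hs : ContDiff ℝ ∞ fun u : ℝ => φ (S * u) - w * I :=
    (hφ.comp (contDiff_const.mul contDiff_id)).sub contDiff_const
  rw [leadInt_curve (contDiff_planeCurve hB.smooth hV.smooth hs)] at h1
  rw [← h1]
  have h2 : ∀ u, planeCurve (stepFn (c 2) δ) (stepFn (c 3) δ) (fun u => φ (S * u) - w * I) u 0 *
      deriv (fun s => planeCurve (stepFn (c 2) δ) (stepFn (c 3) δ) (fun u => φ (S * u) - w * I) s 1) u =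
      S * (fun t => stepFn (c 2) δ (φ t).re *
      (deriv (stairFn (c 3) δ) (φ t).im * (deriv φ t).im)) (S * u) := by
    intro u
    have h3 : HasDerivAt (fun u : ℝ => (φ (S * u) - w * I).im) (S * (deriv φ (S * u)).im) u := by
      have h4 : HasDerivAt (fun u : ℝ => φ (S * u) - w * I) (S • deriv φ (S * u)) u :=
        (HasDerivAt.scomp (h := fun u : ℝ => S * u) u (hφ.differentiable (by simp) (S * u)).hasDerivAt
          (by simpa using (hasDerivAt_id u).const_mul S)).sub_const _
      have := imCLM.hasFDerivAt.comp_hasDerivAt u h4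
      simpa [Function.comp_def] using this
    have h5 : HasDerivAt (fun s => planeCurve (stepFn (c 2) δ) (stepFn (c 3) δ)
        (fun u => φ (S * u) - w * I) s 1)
        (deriv (stepFn (c 3) δ) (φ (S * u) - w * I).im * (S * (deriv φ (S * u)).im)) u :=
      ((hV.smooth.differentiable (by simp) _).hasDerivAt).comp u h3
    rw [h5.deriv]
    have h6 := abs_le.1 (him (S * u))
    -- After the shift by w the imaginary part is at most 3/4 in absolute value, and the
    -- neighbouring stairs near ±1 are out of reach for ρ ≤ 1/8; only the step near 0 is seen.
    have h7 : deriv (stairFn (c 3) δ) (φ (S * u)).im =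
        deriv (stepFn (c 3) δ) (φ (S * u) - w * I).im := by
      have h8 : (φ (S * u)).im = (φ (S * u) - w * I).im + w := by simp
      rw [h8, deriv_stairFn_add_int, deriv_stairFn_eq hδ (by linarith) 0 (by push_cast; linarith)
        (by push_cast; linarith)]
      simp
    simp only [h7, planeCurve]
    simp
    ring
  simp_rw [h2]
  rw [intervalIntegral.integral_const_mul, intervalIntegral.mul_integral_comp_mul_left
    (f := fun t => stepFn (c 2) δ (φ t).re * (deriv (stairFn (c 3) δ) (φ t).im * (deriv φ t).im)),
    mul_zero, mul_one]

/-- The linking integral of two curves with the same period and the same winding. -/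
theorem integral_linkKernel (hρ : 0 < ρ) (hρ1 : ρ ≤ 1 / 8) (hc : ∀ j, |c j| ≤ ρ / 2) (hδ : 0 < δ)
    (hδρ : δ ≤ ρ / 2) (hf : ContDiff ℝ ∞ f) (hg : ContDiff ℝ ∞ g) {q : ℕ} {p : ℤ}
    (hfq : ∀ t, f (t + q) = f t - p * I) {N : ℕ → ℤ}
    (h : ∀ k < q, ∃ w : ℤ, ∀ s : ℝ, |s - k| ≤ ρ →
      HasTurns (fun t => f (t + s) - g t - w * I) q (N k) ∧
      ∀ t, 2 * ρ < ‖f (t + s) - g t - w * I‖ ∧ |(f (t + s) - g t - w * I).im| ≤ 3 / 4) :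
    ∫ s in (0 : ℝ)..q, ∫ t in (0 : ℝ)..q, linkKernel c δ f g s t =
      ∑ k ∈ Finset.range q, (N k : ℝ) := by
  have hδ1 : δ < 1 := by linarith
  have hk := continuous_linkKernel (c := c) hδ hδ1 hf hg
  have c1 := abs_le.1 (hc 1)
  have hfd : ∀ t, deriv f (t + q) = deriv f t := fun t => by
    rw [← deriv_comp_add_const]
    simp_rw [hfq]
    rw [deriv_sub_const]
  have hper : ∀ t s, linkKernel c δ f g (s + q) t = linkKernel c δ f g s t := by
    intro t s
    have e1 : f (s + q) - g t = (f s - g t) + ((-p : ℤ) : ℂ) * I := by rw [hfq]; push_cast; ring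
    have e2 : (f (s + q) - g t).re = (f s - g t).re := by rw [e1]; simp
    have e3 : (f (s + q) - g t).im = (f s - g t).im + ((-p : ℤ) : ℝ) := by rw [e1]; simp
    have e4 : s + q - t = s - t + ((q : ℤ) : ℝ) := by push_cast; ring
    simp only [linkKernel, e2, e3, e4, deriv_stairFn_add_int, hfd]
  have hswap : ∀ (F : ℝ → ℝ → ℝ), (Continuous fun w : ℝ × ℝ => F w.1 w.2) → ∀ a b a' b' : ℝ,
      ∫ s in a..b, ∫ t in a'..b', F s t = ∫ t in a'..b', ∫ s in a..b, F s t := by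
    intro F hF a b a' b'
    refine intervalIntegral_intervalIntegral_swap ?_
    exact (hF.continuousOn.integrableOn_compact
      (isCompact_uIcc.prod isCompact_uIcc)).mono_set (prod_mono uIoc_subset_uIcc uIoc_subset_uIcc)
  rw [hswap _ hk]
  -- Use the time difference as the variable, over the period [-1/2, q - 1/2], so that the integers
  -- 0, …, q - 1 where the bump in t concentrates lie well inside unit windows.
  have h1 : ∀ t, ∫ s in (0 : ℝ)..q, linkKernel c δ f g s t =
      ∫ s in (-(1 / 2) : ℝ)..(q - 1 / 2), linkKernel c δ f g (t + s) t := by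
    intro t
    have hp : Function.Periodic (fun s => linkKernel c δ f g s t) q := fun s => hper t s
    have e := hp.intervalIntegral_add_eq 0 (t - 1 / 2)
    rw [zero_add] at e
    rw [e, intervalIntegral.integral_comp_add_left (fun s => linkKernel c δ f g s t)]
    congr 1; ring
  simp_rw [h1]
  have hk' : Continuous fun w : ℝ × ℝ => linkKernel c δ f g (w.1 + w.2) w.1 :=
    hk.comp (by fun_prop : Continuous fun w : ℝ × ℝ => (w.1 + w.2, w.1))
  rw [hswap (fun t s => linkKernel c δ f g (t + s) t) hk']
  have hcont : Continuous fun s => ∫ t in (0 : ℝ)..q, linkKernel c δ f g (t + s) t :=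
    intervalIntegral.continuous_parametric_intervalIntegral_of_continuous'
      (f := fun s t => linkKernel c δ f g (t + s) t)
      (hk'.comp continuous_swap) 0 q
  have hsum := intervalIntegral.sum_integral_adjacent_intervals (a := fun k : ℕ => (k : ℝ) - 1 / 2)
    (n := q) fun k _ => hcont.intervalIntegrable (μ := volume) _ _
  simp only [Nat.cast_zero, zero_sub] at hsum
  refine hsum.symm.trans (Finset.sum_congr rfl fun k hkq => ?_)
  obtain ⟨w, hw⟩ := h k (Finset.mem_range.1 hkq)
  -- For a fixed time difference s the bump in t is a constant factor, nonzero only for s near k.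
  -- There the inner integral is the winding number of the difference of the two strands.
  have hinner : ∀ s ∈ uIcc ((k : ℝ) - 1 / 2) (((k + 1 : ℕ) : ℝ) - 1 / 2),
      ∫ t in (0 : ℝ)..q, linkKernel c δ f g (t + s) t = deriv (stairFn (c 1) δ) s * N k := by
    intro s hs
    rw [uIcc_of_le (by push_cast; linarith)] at hs
    push_cast at hs
    have e : ∀ t, linkKernel c δ f g (t + s) t = deriv (stairFn (c 1) δ) s *
        (stepFn (c 2) δ (f (t + s) - g t).re * (deriv (stairFn (c 3) δ) (f (t + s) - g t).im *
          (deriv (fun t => f (t + s) - g t) t).im)) := by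
      intro t
      have h2 : HasDerivAt (fun t => f (t + s) - g t) (deriv f (t + s) - deriv g t) t :=
        ((hf.differentiable (by simp) (t + s)).hasDerivAt.comp_add_const t s).sub
          (hg.differentiable (by simp) t).hasDerivAt
      rw [h2.deriv, linkKernel, add_sub_cancel_left]
      simp only [sub_im]
      ring
    simp_rw [e]
    rw [intervalIntegral.integral_const_mul]
    by_cases hz : deriv (stairFn (c 1) δ) s = 0
    · rw [hz, zero_mul, zero_mul]
    congr 1
    obtain ⟨k', h2, h3⟩ := deriv_stairFn_ne_zero hδ hδ1 hz
    have hkk : k' = k := by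
      have a1 : ((k' : ℤ) : ℝ) < ((k + 1 : ℤ) : ℝ) := by push_cast; linarith [hs.2]
      have a2 : ((k - 1 : ℤ) : ℝ) < ((k' : ℤ) : ℝ) := by push_cast; linarith [hs.1]
      have a1' := Int.cast_lt.1 a1
      have a2' := Int.cast_lt.1 a2
      omega
    subst hkk
    push_cast at h2 h3
    obtain ⟨h4, h5⟩ := hw s (abs_le.2 ⟨by linarith, by linarith⟩)
    exact integral_crossing hρ hρ1 hc hδ hδρ
      ((hf.comp (contDiff_id.add contDiff_const)).sub hg) h4 (fun t => (h5 t).1) fun t => (h5 t).2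
  rw [intervalIntegral.integral_congr hinner, intervalIntegral.integral_mul_const,
    intervalIntegral.integral_deriv_eq_sub
      (fun x _ => (contDiff_stairFn hδ hδ1).differentiable (by simp) x)
      ((((contDiff_succ_iff_deriv (n := ∞)).1
        (by simpa using contDiff_stairFn hδ hδ1)).2.2).continuous.intervalIntegrable _ _)]
  -- The staircase rises by 1 over a window of length 1, so the window at k contributes exactly `N
  -- k`.
  have e : (((k + 1 : ℕ) : ℝ) - 1 / 2) = ((k : ℝ) - 1 / 2) + ((1 : ℤ) : ℝ) := by push_cast; ring
  simp only [e, stairFn_add_int]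
  push_cast
  ring

end Crossing

/-! ### Linking integrals of curves separated in the direction x. -/

section SeparatedCurves

open MeasureTheory Set Complex

variable {c : Fin 4 → ℝ} {δ ρ : ℝ} {f g : ℝ → ℂ}

/-- Shifting G₀ by a changes ∫ G₀ dG₁ by a times the increment of G₁. It is applied to opposite
sides of a square that differ by an integer vector. -/
theorem leadInt_curve_sub {G G' : ℝ → Fin 2 → ℝ} (hG : ContDiff ℝ ∞ G) (hG' : ContDiff ℝ ∞ G')
    {a b : ℝ} (h0 : ∀ t, G' t 0 = G t 0 + a) (h1 : ∀ t, G' t 1 = G t 1 + b) :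
    leadInt (fun y : Fin 1 → ℝ => G' (y 0)) - leadInt (fun y : Fin 1 → ℝ => G (y 0)) =
      a * (G 1 1 - G 0 1) := by
  have hd : ContDiff ℝ ∞ fun s => G s 1 := contDiff_pi.1 hG 1
  have hdc : Continuous (deriv fun s => G s 1) :=
    (((contDiff_succ_iff_deriv (n := ∞)).1 (by simpa using hd)).2.2).continuous
  have h0c : Continuous fun s => G s 0 := (contDiff_pi.1 hG 0).continuous
  rw [leadInt_curve hG, leadInt_curve hG']
  simp_rw [h0, h1, deriv_add_const]
  have i1 : IntervalIntegrable (fun t => (G t 0 + a) * deriv (fun s => G s 1) t) volume 0 1 :=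
    ((h0c.add continuous_const).mul hdc).intervalIntegrable _ _
  have i2 : IntervalIntegrable (fun t => G t 0 * deriv (fun s => G s 1) t) volume 0 1 :=
    (h0c.mul hdc).intervalIntegrable _ _
  rw [← intervalIntegral.integral_sub i1 i2]
  have e : ∀ t, (G t 0 + a) * deriv (fun s => G s 1) t - G t 0 * deriv (fun s => G s 1) t =
      a * deriv (fun s => G s 1) t := fun t => by ring
  simp_rw [e]
  rw [intervalIntegral.integral_const_mul, intervalIntegral.integral_deriv_eq_sub
    (fun x _ => hd.differentiable (by simp) x) (hdc.intervalIntegrable _ _)]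

/-- The linking integral of curves that are separated in the direction `x`. -/
theorem leadInt_curveMap_separated (hδ : 0 < δ) (hδ1 : δ < 1) (hf : ContDiff ℝ ∞ f)
    (hg : ContDiff ℝ ∞ g) {q q' : ℕ} {p p' : ℤ} (hfq : ∀ t, f (t + q) = f t - p * I)
    (hgq : ∀ t, g (t + q') = g t - p' * I) {κ : ℝ}
    (hκ : ∀ s t, stepFn (c 2) δ (f s - g t).re = κ) :
    leadInt (n := 2) (stairMap (stairY c δ) ordY
      (diffLift (p := 1) (q := 1) (curveMap f q) (curveMap g q'))) = κ * (q * p' - q' * p) := by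
  let D : (Fin 2 → ℝ) → (Fin 3 → ℝ) := diffLift (p := 1) (q := 1) (curveMap f q) (curveMap g q')
  have hD : ContDiff ℝ ∞ D := contDiff_diffLift (contDiff_curveMap hf q) (contDiff_curveMap hg q')
  have hY := (stairSys_stairY (c := c) hδ hδ1).smooth
  let U : (Fin 2 → ℝ) → (Fin 2 → ℝ) :=
    stairMap (fun j : Fin 2 => stairY c δ j.succ) (fun j : Fin 2 => ordY j.succ) D
  have hU : ContDiff ℝ ∞ U := contDiff_stairMap (fun j => hY j.succ) hD
  -- With the undifferentiated factor constant, what is left is κ times the degree of a map of tori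
  -- given by the differences in t and y.
  have h1 : leadInt (n := 2) (stairMap (stairY c δ) ordY D) =
      κ * ∫ y in Icc (0 : Fin 2 → ℝ) 1, (gradMat U y).det := by
    rw [leadInt, ← integral_const_mul]
    refine setIntegral_congr_fun measurableSet_Icc fun y _ => ?_
    have e0 : stairMap (stairY c δ) ordY D y 0 = κ := hκ _ _
    have e1 : (gradMat (stairMap (stairY c δ) ordY D) y).submatrix id Fin.succ = gradMat U y := by
      rw [gradMat_stairMap hY hD, gradMat_stairMap (fun j => hY j.succ) hD]
      rfl
    rw [e0, e1]
  change leadInt (n := 2) (stairMap (stairY c δ) ordY D) = _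
  rw [h1, integral_det_gradMat hU, Fin.sum_univ_two]
  let V : ℝ → ℝ → Fin 2 → ℝ := fun a b => ![stairFn (c 1) δ (q * a - q' * b),
    stairFn (c 3) δ ((f (q * a)).im - (g (q' * b)).im)]
  have hUV : ∀ y, U y = V (y 0) (y 1) := by
    intro y
    funext j
    fin_cases j <;> rfl
  have hV0 : ∀ a, ContDiff ℝ ∞ fun b => V a b := by
    intro a
    have : (fun b => V a b) = fun b => U ![a, b] := by
      funext b; rw [hUV]; rfl
    rw [this]
    refine hU.comp (contDiff_pi.2 fun j => ?_)
    fin_cases j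
    exacts [contDiff_const, contDiff_id]
  have hV1 : ∀ b, ContDiff ℝ ∞ fun a => V a b := by
    intro b
    have : (fun a => V a b) = fun a => U ![a, b] := by
      funext a; rw [hUV]; rfl
    rw [this]
    refine hU.comp (contDiff_pi.2 fun j => ?_)
    fin_cases j
    exacts [contDiff_id, contDiff_const]
  have f0 : ∀ e : ℝ, (fun y : Fin 1 → ℝ => U ((0 : Fin 2).insertNth e y)) =
      fun y => V e (y 0) := fun e => funext fun y => by rw [hUV]; rfl
  have f1 : ∀ e : ℝ, (fun y : Fin 1 → ℝ => U ((1 : Fin 2).insertNth e y)) =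
      fun y => V (y 0) e := fun e => funext fun y => by rw [hUV]; rfl
  have hf1 : (f q).im = (f 0).im + ((-p : ℤ) : ℝ) := by
    have := hfq 0; rw [zero_add] at this; rw [this]; simp; ring
  have hg1 : (g q').im = (g 0).im + ((-p' : ℤ) : ℝ) := by
    have := hgq 0; rw [zero_add] at this; rw [this]; simp; ring
  -- The sides of the square differ by (q, -p) in one variable and by (-q', p') in the other; Stokes
  -- gives the determinant q p' - q' p of these vectors.
  have s0 := leadInt_curve_sub (hV0 0) (hV0 1) (a := q) (b := -p) (fun t => by
      have : (q : ℝ) * 1 - q' * t = (q * 0 - q' * t) + ((q : ℤ) : ℝ) := by push_cast; ring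
      simp only [V, Matrix.cons_val_zero]
      rw [this, stairFn_add_int]; push_cast; ring) (fun t => by
      have : (f (q * 1)).im - (g (q' * t)).im = (f (q * 0)).im - (g (q' * t)).im + ((-p : ℤ) : ℝ) := by
        rw [mul_one, mul_zero, hf1]; ring
      simp only [V, Matrix.cons_val_one, Matrix.cons_val_zero]
      rw [this, stairFn_add_int]; push_cast; ring)
  have s1 := leadInt_curve_sub (hV1 0) (hV1 1) (a := -q') (b := p') (fun t => by
      have : (q : ℝ) * t - q' * 1 = (q * t - q' * 0) + ((-q' : ℤ) : ℝ) := by push_cast; ring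
      simp only [V, Matrix.cons_val_zero]
      rw [this, stairFn_add_int]; push_cast; ring) (fun t => by
      have : (f (q * t)).im - (g (q' * 1)).im = (f (q * t)).im - (g (q' * 0)).im + ((p' : ℤ) : ℝ) := by
        rw [mul_one, mul_zero, hg1]; push_cast; ring
      simp only [V, Matrix.cons_val_one, Matrix.cons_val_zero]
      rw [this, stairFn_add_int])
  rw [f0, f0, f1, f1, s0, s1]
  have v0 : V 0 1 1 = V 0 0 1 + p' := by
    have : (f (q * 0)).im - (g (q' * 1)).im = (f (q * 0)).im - (g (q' * 0)).im + ((p' : ℤ) : ℝ) := by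
      rw [mul_one, mul_zero, mul_zero, hg1]; push_cast; ring
    simp only [V, Matrix.cons_val_one, Matrix.cons_val_zero]
    rw [this, stairFn_add_int]
  have v1 : V 1 0 1 = V 0 0 1 - p := by
    have : (f (q * 1)).im - (g (q' * 0)).im = (f (q * 0)).im - (g (q' * 0)).im + ((-p : ℤ) : ℝ) := by
      rw [mul_one, mul_zero, mul_zero, hf1]; ring
    simp only [V, Matrix.cons_val_one, Matrix.cons_val_zero]
    rw [this, stairFn_add_int]; push_cast; ring
  rw [v0, v1]
  simp only [Fin.val_zero, Fin.val_one, pow_zero, pow_one]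
  ring

end SeparatedCurves

/-! ### Stability of the winding of strands. -/

section Strands

open Set Complex

variable {f g : ℝ → ℂ}

theorem exists_pos_le_of_periodic {h : ℝ → ℝ} (hh : Continuous h) {S : ℝ} (hS : S ≠ 0)
    (hp : ∀ t, h (t + S) = h t) (h0 : ∀ t, 0 < h t) : ∃ m > 0, ∀ t, m ≤ h t := by
  have hper : Function.Periodic h S := hp
  obtain ⟨x, ⟨t, rfl⟩, hx⟩ := (hper.compact_of_continuous hS hh).exists_isLeast (range_nonempty h)
  exact ⟨h t, h0 t, fun s => hx ⟨s, rfl⟩⟩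

theorem exists_bound_of_periodic {h : ℝ → ℂ} (hh : Continuous h) {S : ℝ} (hS : S ≠ 0)
    (hp : ∀ t, h (t + S) = h t) : ∃ M > 0, ∀ t, ‖h t‖ ≤ M := by
  have hper : Function.Periodic h S := hp
  obtain ⟨M, hM⟩ := (hper.compact_of_continuous hS hh).isBounded.exists_norm_le
  exact ⟨max M 1, by positivity, fun t => (hM _ ⟨t, rfl⟩).trans (le_max_left _ _)⟩

theorem HasTurns.const_mul {S : ℝ} {n : ℤ} (h : HasTurns f S n) {a : ℂ} (ha : a ≠ 0) :
    HasTurns (fun t => a * f t) S n := by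
  obtain ⟨G, hG, hGf, e⟩ := h
  exact ⟨fun t => log a + G t, contDiff_const.add hG, fun t => by rw [exp_add, exp_log ha, hGf],
    by simp only [e]; ring⟩

/-- Small changes of the time difference of two strands. -/
theorem exists_strand_bound (hf : ContDiff ℝ ∞ f) (hg : ContDiff ℝ ∞ g) {L : ℝ} (hL0 : 0 < L)
    (hL : ∀ s t, ‖f s - f t‖ ≤ L * |s - t|) {q k : ℝ} {w n p : ℤ}
    (hfq : ∀ t, f (t + q) = f t - p * I) (hgq : ∀ t, g (t + q) = g t - p * I)
    (hn : HasTurns (fun t => f (t + k) - g t - w * I) q n) {m : ℝ} (hm : 0 < m)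
    (hm' : ∀ t, m ≤ ‖f (t + k) - g t - w * I‖)
    (him : ∀ t, |(f (t + k) - g t - w * I).im| ≤ 11 / 16) :
    ∃ η > 0, ∀ ρ, 0 < ρ → ρ < η → ∀ s : ℝ, |s - k| ≤ ρ →
      HasTurns (fun t => f (t + s) - g t - w * I) q n ∧
      ∀ t, 2 * ρ < ‖f (t + s) - g t - w * I‖ ∧ |(f (t + s) - g t - w * I).im| ≤ 3 / 4 := by
  -- Changing the time difference by ρ moves the strand by at most Lρ. Since Lρ < m/4, the distance
  -- to 0 stays above 3m/4 > 2ρ and the winding is unchanged; Lρ < 1/16 raises the bound 11/16 to at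
  -- most 3/4.
  refine ⟨min (m / 4) (min (m / (4 * L)) (1 / (16 * L))), by positivity, fun ρ hρ hρη s hs => ?_⟩
  have h1 : ρ < m / 4 := hρη.trans_le (min_le_left _ _)
  have h2 : ρ < m / (4 * L) := hρη.trans_le ((min_le_right _ _).trans (min_le_left _ _))
  have h3 : ρ < 1 / (16 * L) := hρη.trans_le ((min_le_right _ _).trans (min_le_right _ _))
  rw [lt_div_iff₀ (by positivity)] at h2 h3
  have hd : ∀ t, ‖f (t + s) - g t - w * I - (f (t + k) - g t - w * I)‖ ≤ L * ρ := by
    intro t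
    have e : f (t + s) - g t - w * I - (f (t + k) - g t - w * I) = f (t + s) - f (t + k) := by ring
    rw [e]
    refine (hL _ _).trans ?_
    rw [add_sub_add_left_eq_sub]
    gcongr
  have hcl : ∀ s, f (q + s) - g q - w * I = f (0 + s) - g 0 - w * I := by
    intro s
    have := hgq 0
    rw [zero_add] at this
    rw [this, add_comm q s, hfq, zero_add]; ring
  refine ⟨hn.of_close ?_ (hcl k) (hcl s) fun t => ?_, fun t => ⟨?_, ?_⟩⟩
  · exact ((hf.comp (contDiff_id.add contDiff_const)).sub hg).sub contDiff_const
  · have := hd t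
    have := hm' t
    nlinarith
  · have a1 := hd t
    have a2 := hm' t
    have a3 := norm_sub_le (f (t + s) - g t - w * I) (f (t + s) - g t - w * I - (f (t + k) - g t - w * I))
    rw [sub_sub_cancel] at a3
    nlinarith
  · have a1 := abs_le.1 ((abs_im_le_norm _).trans (hd t))
    have a2 := abs_le.1 (him t)
    rw [sub_im] at a1
    exact abs_le.2 ⟨by linarith, by linarith⟩

end Strands

/-! ### Relative position of strands of orbits. -/

section OrbitLinking

open MeasureTheory Set Complex

variable {X₁ X₂ ε : ℝ} {Q : ℕ}

open Classical in
/-- The linking number of the orbit `l` with the push-off of the orbit `l'` along a frame that makes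
`n` turns. -/
def linkNumber (l l' : Label X₁ X₂ Q) (n : ℤ) : ℤ :=
  if l'.1.1 < l.1.1 then l.1.1.den * l'.1.1.num - l'.1.1.den * l.1.1.num
  else if l = l' then n else 0

theorem linkInt_chain (c : Fin 4 → ℝ) (δ : ℝ) (σ σ' : SmoothCube projY 1) :
    linkInt c δ σ.chain σ'.chain = leadPair (p := 1) (q := 1) (stairY c δ) ordY σ σ' := by
  simp [linkInt]

namespace TwistPerturbation

variable (T : TwistPerturbation X₁ X₂ Q ε)

theorem exists_lipschitz (l : Label X₁ X₂ Q) :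
    ∃ L > 0, ∀ s t, ‖(T.orbit l).z s - (T.orbit l).z t‖ ≤ L * |s - t| := by
  have hε := T.eps_pos
  refine ⟨|X₁| + |X₂| + ε, by positivity, fun s t => ?_⟩
  refine convex_univ.norm_image_sub_le_of_norm_hasDerivWithin_le (f := (T.orbit l).z)
    (fun x _ => ((T.orbit l).flow x).hasDerivWithinAt) (fun x _ => ?_) (mem_univ t) (mem_univ s)
  have hm := (T.orbit l).mem x
  have h1 : |((T.orbit l).z x).re| ≤ |X₁| + |X₂| :=
    abs_le.2 ⟨by linarith [hm.1, neg_abs_le X₁, abs_nonneg X₂], by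
      linarith [hm.2, le_abs_self X₂, abs_nonneg X₁]⟩
  refine (norm_add_le _ _).trans (add_le_add ?_ (T.small _ _).1.le)
  rw [norm_mul, norm_neg, Complex.norm_real, norm_I, mul_one]
  exact h1

/-- The speed of y + (p/q)t is |x - p/q| + ε at most, and x stays within ε(Q + 1) of p/q. -/
theorem im_drift (l : Label X₁ X₂ Q) (s : ℝ) {t : ℝ} (ht : 0 ≤ t) :
    |((T.orbit l).z (s + t)).im - ((T.orbit l).z s).im + l.1.1 * t| ≤ ε * (Q + 2) * t := by
  have h := norm_image_sub_le_of_norm_deriv_le_segment' (C := ε * (Q + 2)) (a := s) (b := s + t)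
    (f := fun x => ((T.orbit l).z x).im + l.1.1 * x)
    (fun x _ => ((T.hasDerivAt_im (T.orbit l) x).add
      ((hasDerivAt_id x).const_mul (l.1.1 : ℝ))).hasDerivWithinAt)
    (fun x _ => by
      have h1 := abs_le.1 (T.abs_re_sub_le l x)
      have h2 := abs_le.1 ((abs_im_le_norm _).trans (T.small x ((T.orbit l).z x)).1.le)
      rw [Real.norm_eq_abs, abs_le]
      constructor <;> linarith [h1.1, h1.2, h2.1, h2.2]) (s + t) ⟨by linarith, le_rfl⟩
  rw [Real.norm_eq_abs, add_sub_cancel_left] at h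
  refine le_trans (le_of_eq ?_) h
  congr 1
  ring

theorem leadPair_loop_pushLoop {c : Fin 4 → ℝ} {δ : ℝ} (hδ : 0 < δ) (hδ1 : δ < 1)
    (l l' : Label X₁ X₂ Q) (τ : Frame (T.orbit l')) (r : ℝ) :
    linkInt c δ (T.orbit l).loop.chain ((T.orbit l').pushLoop τ r).chain =
      leadInt (n := 2) (stairMap (stairY c δ) ordY (diffLift (p := 1) (q := 1)
        (curveMap (T.orbit l).z l.1.1.den)
        (curveMap (fun t => (T.orbit l').z t + r * τ.ν t) l'.1.1.den))) := by
  have hA : LiftEq perY (T.orbit l).loop.lift (curveMap (T.orbit l).z (T.orbit l).period) :=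
    SmoothCube.liftEq_ofLift isLatticeProj_projY (contDiff_curveMap (T.orbit l).smooth _)
  have hB : LiftEq perY ((T.orbit l').pushLoop τ r).lift
      (curveMap (fun t => (T.orbit l').z t + r * τ.ν t) (T.orbit l').period) :=
    SmoothCube.liftEq_ofLift isLatticeProj_projY (contDiff_curveMap
      ((T.orbit l').smooth.add (contDiff_const.mul τ.smooth)) _)
  rw [linkInt_chain, leadPair_eq (stairSys_stairY hδ hδ1) not_perY_ordY_zero hA hB, T.period_eq,
    T.period_eq]

theorem frame_periodic (l : Label X₁ X₂ Q) (τ : Frame (T.orbit l)) (t : ℝ) :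
    τ.ν (t + l.1.1.den) = τ.ν t := by
  rw [← T.period_eq l]; exact τ.periodic t

/-- Two strands of orbits with the same slope do not turn around each other. -/
theorem hasTurns_zero (hε : ε ≤ epsBound Q) {l l' : Label X₁ X₂ Q} (hs : l.1.1 = l'.1.1) {k w : ℤ}
    (h0 : ∀ t, (T.orbit l).z (t + k) - (T.orbit l').z t - w * I ≠ 0) :
    HasTurns (fun t => (T.orbit l).z (t + k) - (T.orbit l').z t - w * I) l.1.1.den 0 := by
  have hsm : ContDiff ℝ ∞ fun t => (T.orbit l).z (t + k) - (T.orbit l').z t - w * I :=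
    (((T.orbit l).smooth.comp (contDiff_id.add contDiff_const)).sub (T.orbit l').smooth).sub
      contDiff_const
  have hQ : (l.1.1.den : ℝ) ≤ Q := by exact_mod_cast l.1.2.1
  obtain ⟨n, hn⟩ := exists_hasTurns hsm h0 (T := l.1.1.den) (by
    have h1 := T.winding_eq l k
    have h2 := T.winding_eq l' 0
    rw [← hs, zero_add] at h2
    rw [h2, add_comm ((l.1.1.den : ℕ) : ℝ) (k : ℝ), h1, zero_add]
    ring)
  obtain ⟨G, hG, hGf, e⟩ := hn
  have hb := (T.isAlmostShear_sub (T.orbit l) (T.orbit l') k w).angle_bounds T.eps_pos h0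
    hG.continuous hGf (t := 0) (T := l.1.1.den) (Nat.cast_nonneg _)
    (hQ.trans_lt (lt_halfTurnTime T.eps_pos hε))
  have hpi := Real.pi_gt_three
  have e' : (G (0 + l.1.1.den)).im - (G 0).im = 2 * Real.pi * n := by
    rw [zero_add, e]; simp
  rw [e'] at hb
  have hεQ : ε * (l.1.1.den : ℝ) < 1 := by
    have h1 := epsBound_mul_pow_le Q (j := 1) (by norm_num)
    have h2 := epsBound_pos Q
    have : ε * (l.1.1.den : ℝ) ≤ epsBound Q * Q := by gcongr
    nlinarith
  -- The total angle 2πn lies above -π and is at most εq < 1, which leaves n = 0 only.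
  have hn0 : n = 0 := by
    have a : ((-1 : ℤ) : ℝ) < n := by push_cast; nlinarith [hb.1]
    have b : (n : ℝ) < ((1 : ℤ) : ℝ) := by push_cast; nlinarith [hb.2]
    have a' := Int.cast_lt.1 a
    have b' := Int.cast_lt.1 b
    omega
  subst hn0
  exact ⟨G, hG, hGf, e⟩

/-- Two strands of orbits with the same slope keep their distance in the direction `y`. -/
theorem abs_im_strand_le (hε : ε ≤ epsBound Q) {l l' : Label X₁ X₂ Q} (hs : l.1.1 = l'.1.1) (k : ℤ)
    (t : ℝ) : |((T.orbit l).z (t + k) - (T.orbit l').z t -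
      (round ((T.orbit l).z k - (T.orbit l').z 0).im : ℤ) * I).im| ≤ 5 / 8 := by
  set w := round ((T.orbit l).z k - (T.orbit l').z 0).im with hw
  have hper : Function.Periodic (fun t => ((T.orbit l).z (t + k) - (T.orbit l').z t - w * I).im)
      l.1.1.den := by
    intro t
    have h2 := T.winding_eq l' t
    rw [← hs] at h2
    simp only
    rw [h2, add_right_comm, T.winding_eq l]
    simp
  obtain ⟨s, hs', e⟩ := hper.exists_mem_Ico₀ (by exact_mod_cast l.1.1.pos) t
  rw [e]
  have h0 := abs_sub_round ((T.orbit l).z k - (T.orbit l').z 0).im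
  rw [← hw] at h0
  have h1 := T.im_drift l k hs'.1
  have h2 := T.im_drift l' 0 hs'.1
  rw [← hs, zero_add] at h2
  rw [add_comm (k : ℝ) s] at h1
  -- Rounding leaves at most 1/2 at time 0, and over one period each strand departs by at most 1/50
  -- from motion with the common slope; 1/2 + 2/50 is below 5/8.
  have hb : ε * (Q + 2) * s ≤ 1 / 50 := by
    have hQ : (l.1.1.den : ℝ) ≤ Q := by exact_mod_cast l.1.2.1
    have h3 := epsBound_mul_pow_le Q (j := 2) (by norm_num)
    have h4 := epsBound_pos Q
    have h5 : (0 : ℝ) ≤ Q := Nat.cast_nonneg _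
    have h6 : ε * (Q + 2) * s ≤ epsBound Q * (Q + 2) * Q := by
      have : s ≤ Q := hs'.2.le.trans hQ
      have := hs'.1
      gcongr
    nlinarith
  have h0' := abs_le.1 h0
  have h1' := abs_le.1 (h1.trans hb)
  have h2' := abs_le.1 (h2.trans hb)
  simp only [sub_im, mul_im, intCast_re, intCast_im, I_re, I_im] at h0' ⊢
  exact abs_le.2 ⟨by linarith [h1'.1, h2'.2, h0'.1], by linarith [h1'.2, h2'.1, h0'.2]⟩

end TwistPerturbation

end OrbitLinking

/-! ### Linking numbers of orbits with push-offs. -/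

section OrbitLinking

open MeasureTheory Set Complex

variable {X₁ X₂ ε : ℝ} {Q : ℕ}

namespace TwistPerturbation

variable (T : TwistPerturbation X₁ X₂ Q ε)

theorem exists_frame_bound (l : Label X₁ X₂ Q) (τ : Frame (T.orbit l)) :
    ∃ M > 0, ∀ t, ‖τ.ν t‖ ≤ M :=
  exists_bound_of_periodic τ.smooth.continuous (S := l.1.1.den) (by exact_mod_cast l.1.1.pos.ne')
    (T.frame_periodic l τ)

theorem contDiff_push (l : Label X₁ X₂ Q) (τ : Frame (T.orbit l)) (r : ℝ) :
    ContDiff ℝ ∞ fun t => (T.orbit l).z t + r * τ.ν t :=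
  (T.orbit l).smooth.add (contDiff_const.mul τ.smooth)

theorem push_add_period (l : Label X₁ X₂ Q) (τ : Frame (T.orbit l)) (r t : ℝ) :
    (T.orbit l).z (t + l.1.1.den) + r * τ.ν (t + l.1.1.den) =
      (T.orbit l).z t + r * τ.ν t - (l.1.1.num : ℂ) * I := by
  rw [T.frame_periodic, T.winding_eq]; ring

/-- A meeting of a strand with its own translate by k would make k a period, against irreducibility
of the orbit. -/
theorem self_strand_ne (l : Label X₁ X₂ Q) {k : ℕ} (hk : 0 < k) (hkq : k < l.1.1.den) (w : ℤ)
    (t : ℝ) : (T.orbit l).z (t + k) ≠ (T.orbit l).z t + w * I := by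
  intro h
  have h2 := T.orbit_eq_of_eq_at (γ := T.orbit l) (γ' := T.orbit l) (k := (k : ℤ)) (m := w) (t₀ := t)
    (by exact_mod_cast h) 0
  refine (T.orbit l).irreducible k hk (by rwa [T.period_eq]) ⟨w, ?_⟩
  simpa using h2

/-- The orbits are separated in x by d, the push-off uses up at most d/2, and the step in x takes
place within d/2 of 0. The step is thus constant, 1 if `l` has the larger slope and 0 otherwise. -/
theorem exists_linkInt_eq_of_ne (hε : ε ≤ epsBound Q) {l l' : Label X₁ X₂ Q}
    (hs : l.1.1 ≠ l'.1.1) (τ : Frame (T.orbit l')) :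
    ∃ r₀ > 0, ∀ r, 0 < r → r < r₀ → ∃ η > 0, ∀ ρ, 0 < ρ → ρ < η → ∀ c : Fin 4 → ℝ,
      (∀ j, |c j| ≤ ρ) → ∀ δ, 0 < δ → δ ≤ ρ →
      linkInt c δ (T.orbit l).loop.chain ((T.orbit l').pushLoop τ r).chain =
        linkNumber l l' τ.turns := by
  obtain ⟨M, hM, hν⟩ := T.exists_frame_bound l' τ
  have hQ : (0 : ℝ) < Q := zero_lt_one.trans_le (one_le_Q l)
  set d : ℝ := 1 / (2 * (Q : ℝ) ^ 2) with hd
  have hd0 : 0 < d := by positivity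
  have hd1 : d ≤ 1 / 2 := by
    rw [hd]
    have := one_le_Q l
    gcongr
    nlinarith
  refine ⟨d / (2 * M), by positivity, fun r hr hr0 => ⟨d / 4, by positivity,
    fun ρ hρ hρd c hc δ hδ hδρ => ?_⟩⟩
  have hδ1 : δ < 1 := by linarith
  rw [lt_div_iff₀ (by positivity)] at hr0
  have hre : ∀ t, |((r : ℂ) * τ.ν t).re| ≤ d / 2 := fun t => by
    refine (abs_re_le_norm _).trans ?_
    rw [norm_mul, norm_real, Real.norm_of_nonneg hr.le]
    have := hν t
    nlinarith
  have hc2 := abs_le.1 (hc 2)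
  rw [T.leadPair_loop_pushLoop hδ hδ1]
  rcases hs.lt_or_gt with h | h
  · rw [leadInt_curveMap_separated hδ hδ1 (T.orbit l).smooth (T.contDiff_push l' τ r)
      (T.winding_eq l) (T.push_add_period l' τ r) (κ := 0)]
    · have hll : l ≠ l' := fun e => hs (by rw [e])
      simp [linkNumber, h.not_gt, hll]
    · intro s t
      refine stepFn_of_le hδ ?_
      have h1 := T.re_gap hε h t s
      have h2 := abs_le.1 (hre t)
      rw [sub_re, add_re]
      linarith [h2.1]
  · rw [leadInt_curveMap_separated hδ hδ1 (T.orbit l).smooth (T.contDiff_push l' τ r)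
      (T.winding_eq l) (T.push_add_period l' τ r) (κ := 1)]
    · simp [linkNumber, h]
    · intro s t
      refine stepFn_of_ge hδ ?_
      have h1 := T.re_gap hε h s t
      have h2 := abs_le.1 (hre t)
      rw [sub_re, add_re]
      linarith [h2.2]

-- For `l = l'` and k = 0 the difference of strands is -rν, which turns like the frame. In all other
-- cases the unpushed strands are disjoint and do not wind around each other by `hasTurns_zero`; a
-- push-off smaller than their distance does not change this.
open Classical in
theorem exists_strand (hε : ε ≤ epsBound Q) {l l' : Label X₁ X₂ Q}
    (hs : l.1.1 = l'.1.1) (τ : Frame (T.orbit l')) {k : ℕ} (hk : k < l.1.1.den) :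
    ∃ r₀ > 0, ∀ r : ℝ, 0 < r → r < r₀ → ∃ η > 0, ∀ ρ, 0 < ρ → ρ < η → ∃ w : ℤ,
      ∀ s : ℝ, |s - k| ≤ ρ →
      HasTurns (fun t => (T.orbit l).z (t + s) - ((T.orbit l').z t + r * τ.ν t) - w * I) l.1.1.den
        (if l = l' ∧ k = 0 then τ.turns else 0) ∧
      ∀ t, 2 * ρ < ‖(T.orbit l).z (t + s) - ((T.orbit l').z t + r * τ.ν t) - w * I‖ ∧
        |((T.orbit l).z (t + s) - ((T.orbit l').z t + r * τ.ν t) - w * I).im| ≤ 3 / 4 := by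
  obtain ⟨M, hM, hν⟩ := T.exists_frame_bound l' τ
  obtain ⟨L, hL, hLip⟩ := T.exists_lipschitz l
  have hgq : ∀ r t : ℝ, (T.orbit l').z (t + l.1.1.den) + r * τ.ν (t + l.1.1.den) =
      (T.orbit l').z t + r * τ.ν t - (l.1.1.num : ℂ) * I := by
    rw [hs]; exact T.push_add_period l' τ
  have hden : (l.1.1.den : ℝ) ≠ 0 := by exact_mod_cast l.1.1.pos.ne'
  have hνr : ∀ r : ℝ, 0 < r → ∀ t, ‖(r : ℂ) * τ.ν t‖ ≤ r * M := fun r hr t => by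
    rw [norm_mul, norm_real, Real.norm_of_nonneg hr.le]
    exact mul_le_mul_of_nonneg_left (hν t) hr.le
  by_cases hA : l = l' ∧ k = 0
  · obtain ⟨rfl, rfl⟩ := hA
    obtain ⟨m, hm, hmν⟩ := exists_pos_le_of_periodic τ.smooth.continuous.norm hden
      (fun t => by rw [T.frame_periodic]) (fun t => norm_pos_iff.2 (τ.ne_zero t))
    refine ⟨1 / (2 * M), by positivity, fun r hr hr0 => ?_⟩
    rw [lt_div_iff₀ (by positivity)] at hr0
    have e : ∀ t : ℝ, (T.orbit l).z (t + (0 : ℕ)) - ((T.orbit l).z t + r * τ.ν t) - (0 : ℤ) * I =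
        (-r : ℂ) * τ.ν t := fun t => by simp
    have hturn := τ.hasTurns.const_mul (a := (-r : ℂ)) (by exact_mod_cast (neg_neg_of_pos hr).ne)
    rw [T.period_eq] at hturn
    obtain ⟨η, hη, h⟩ := exists_strand_bound (T.orbit l).smooth (T.contDiff_push l τ r) hL hLip
      (k := (0 : ℕ)) (w := 0) (n := τ.turns) (T.winding_eq l) (hgq r) (by simp_rw [e]; exact hturn)
      (m := r * m) (by positivity) (fun t => by
        rw [e, norm_mul, norm_neg, norm_real, Real.norm_of_nonneg hr.le]
        exact mul_le_mul_of_nonneg_left (hmν t) hr.le)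
      (fun t => by
        rw [e]
        refine (abs_im_le_norm _).trans ?_
        rw [neg_mul, norm_neg]
        linarith [hνr r hr t])
    refine ⟨η, hη, fun ρ hρ hρη => ⟨0, ?_⟩⟩
    simpa using h ρ hρ hρη
  · have hne : ∀ (w : ℤ) (t : ℝ), (T.orbit l).z (t + (k : ℤ)) - (T.orbit l').z t - w * I ≠ 0 := by
      intro w t h
      by_cases hl : l = l'
      · subst hl
        refine T.self_strand_ne l (k := k) (Nat.pos_of_ne_zero fun h0 => hA ⟨rfl, h0⟩) hk w t ?_
        rw [Int.cast_natCast] at h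
        linear_combination h
      · refine T.strand_ne hε hl k w t ?_
        linear_combination h
    obtain ⟨w, hw⟩ : ∃ w : ℤ, ∀ t, |((T.orbit l).z (t + (k : ℤ)) - (T.orbit l').z t - w * I).im| ≤ 5 / 8 :=
      ⟨_, T.abs_im_strand_le hε hs k⟩
    have hsm : ContDiff ℝ ∞ fun t => (T.orbit l).z (t + (k : ℤ)) - (T.orbit l').z t - w * I :=
      (((T.orbit l).smooth.comp (contDiff_id.add contDiff_const)).sub (T.orbit l').smooth).sub
        contDiff_const
    have hper : ∀ t : ℝ, (T.orbit l).z (t + l.1.1.den + (k : ℤ)) - (T.orbit l').z (t + l.1.1.den) - w * I =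
        (T.orbit l).z (t + (k : ℤ)) - (T.orbit l').z t - w * I := fun t => by
      have h2 := T.winding_eq l' t
      rw [← hs] at h2
      rw [h2, add_right_comm, T.winding_eq l]
      ring
    obtain ⟨m, hm, hmf⟩ := exists_pos_le_of_periodic hsm.continuous.norm hden
      (fun t => by rw [hper]) (fun t => norm_pos_iff.2 (hne w t))
    have hturn := T.hasTurns_zero hε hs (hne w)
    -- A push-off of size rM < m/2 leaves a distance of at least m/2, and rM < 1/16 turns the bound
    -- 5/8 on the imaginary part into 11/16.
    refine ⟨min (m / (2 * M)) (1 / (16 * M)), by positivity, fun r hr hr0 => ?_⟩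
    have hr1 := hr0.trans_le (min_le_left _ _)
    have hr2 := hr0.trans_le (min_le_right _ _)
    rw [lt_div_iff₀ (by positivity)] at hr1 hr2
    have e : ∀ t : ℝ, (T.orbit l).z (t + (k : ℕ)) - ((T.orbit l').z t + r * τ.ν t) - w * I =
        (T.orbit l).z (t + (k : ℤ)) - (T.orbit l').z t - w * I - r * τ.ν t := fun t => by
      push_cast; ring
    obtain ⟨η, hη, h⟩ := exists_strand_bound (T.orbit l).smooth (T.contDiff_push l' τ r) hL hLip
      (k := (k : ℕ)) (w := w) (n := 0) (T.winding_eq l) (hgq r) (by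
        simp_rw [e]
        refine hturn.of_close (hsm.sub (contDiff_const.mul τ.smooth)) ?_ ?_ fun t => ?_
        · simpa using hper 0
        · have h1 := hper 0
          have h2 := T.frame_periodic l' τ 0
          rw [← hs] at h2
          rw [zero_add] at h1 h2
          rw [h1, h2]
        · rw [sub_sub_cancel_left, norm_neg]
          have := hνr r hr t
          have := hmf t
          linarith)
      (m := m / 2) (by positivity) (fun t => by
        rw [e]
        have h1 := norm_sub_norm_le ((T.orbit l).z (t + (k : ℤ)) - (T.orbit l').z t - w * I)
          (r * τ.ν t)
        have := hνr r hr t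
        have := hmf t
        linarith)
      (fun t => by
        rw [e, sub_im _ ((r : ℂ) * τ.ν t)]
        have h1 := abs_le.1 ((abs_im_le_norm ((r : ℂ) * τ.ν t)).trans (hνr r hr t))
        have h2 := abs_le.1 (hw t)
        exact abs_le.2 ⟨by linarith, by linarith⟩)
    refine ⟨η, hη, fun ρ hρ hρη => ⟨w, ?_⟩⟩
    simpa [hA] using h ρ hρ hρη

/-- The linking integral of an orbit with a small push-off of an orbit. -/
theorem exists_linkInt_eq (hε : ε ≤ epsBound Q) (l l' : Label X₁ X₂ Q) (τ : Frame (T.orbit l')) :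
    ∃ r₀ > 0, ∀ r, 0 < r → r < r₀ → ∃ η > 0, ∀ ρ, 0 < ρ → ρ < η → ∀ c : Fin 4 → ℝ,
      (∀ j, |c j| ≤ ρ) → ∀ δ, 0 < δ → δ ≤ ρ →
      linkInt c δ (T.orbit l).loop.chain ((T.orbit l').pushLoop τ r).chain =
        linkNumber l l' τ.turns := by
  classical
  by_cases hs : l.1.1 = l'.1.1
  swap
  · exact T.exists_linkInt_eq_of_ne hε hs τ
  obtain ⟨r₀, hr₀, h⟩ := exists_pos_forall_finset (Finset.range l.1.1.den)
    (fun k hk => T.exists_strand hε hs τ (Finset.mem_range.1 hk))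
  refine ⟨r₀, hr₀, fun r hr hr' => ?_⟩
  obtain ⟨η, hη, h⟩ := exists_pos_forall_finset (Finset.range l.1.1.den) (h r hr hr')
  refine ⟨min (η / 2) (1 / 16), by positivity, fun ρ hρ hρη c hc δ hδ hδρ => ?_⟩
  have h1 := hρη.trans_le (min_le_left _ _)
  have h2 := hρη.trans_le (min_le_right _ _)
  have hδ1 : δ < 1 := by linarith
  -- `integral_linkKernel` wants c and δ bounded by half its radius, so it is used with radius 2ρ; ρ
  -- < 1/16 then meets its bound 1/8.
  rw [T.leadPair_loop_pushLoop hδ hδ1, ← hs, leadInt_curveMap_eq hδ hδ1 (T.orbit l).smooth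
    (T.contDiff_push l' τ r), integral_linkKernel (ρ := 2 * ρ) (by linarith) (by linarith)
    (fun j => (hc j).trans (by linarith)) hδ (by linarith) (T.orbit l).smooth
    (T.contDiff_push l' τ r) (T.winding_eq l)
    (fun k hk => h (2 * ρ) (by linarith) (by linarith) k (Finset.mem_range.2 hk))]
  by_cases hl : l = l'
  · subst hl
    have : l.1.1.den ≠ 0 := l.1.1.pos.ne'
    simp [linkNumber, Finset.sum_ite_eq', this]
  · simp [linkNumber, hl, hs]

end TwistPerturbation

end OrbitLinking

/-! ### Chains of families of cubes with multiplicities. -/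

section LabelChains

variable {k n : ℕ} {X : Type} {π : (Fin k → ℝ) → X} {ι : Type*}

/-- The chain of a finite family of cubes with multiplicities. -/
def labelChain (m : ι →₀ ℕ) (σ : ι → SmoothCube π n) : Chain π n :=
  m.sum fun l j => (j : ℤ) • (σ l).chain

theorem Chain.In.zsmul {A : Set X} {c : Chain π n} (h : c.In A) (j : ℤ) : (j • c).In A :=
  fun σ hσ => h σ (Finsupp.support_smul hσ)

theorem Chain.In.sub {A : Set X} {c d : Chain π n} (h : c.In A) (h' : d.In A) : (c - d).In A := by
  rw [sub_eq_add_neg]; exact h.add h'.neg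

theorem Chain.In.sum {A : Set X} {s : Finset ι} {c : ι → Chain π n} (h : ∀ i ∈ s, (c i).In A) :
    (∑ i ∈ s, c i).In A := by
  classical
  induction s using Finset.induction_on with
  | empty => simpa using Chain.In.zero A
  | insert a s ha ih =>
    rw [Finset.sum_insert ha]
    exact (h a (Finset.mem_insert_self _ _)).add (ih fun i hi => h i (Finset.mem_insert_of_mem hi))

theorem SmoothCube.chain_in {A : Set X} {σ : SmoothCube π n} (h : ∀ u, σ.toFun u ∈ A) :
    σ.chain.In A := by
  intro τ hτ u
  rw [Finset.mem_singleton.1 (Finsupp.support_single_subset hτ)]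
  exact h u

theorem labelChain_in {A : Set X} {m : ι →₀ ℕ} {σ : ι → SmoothCube π n}
    (h : ∀ l ∈ m.support, ∀ u, (σ l).toFun u ∈ A) : (labelChain m σ).In A :=
  Chain.In.sum fun l hl => (SmoothCube.chain_in (h l hl)).zsmul _

theorem boundary_single (σ : SmoothCube π (n + 1)) : boundary σ.chain =
    ∑ i : Fin (n + 1), (-1 : ℤ) ^ (i : ℕ) • ((σ.face i 1).chain - (σ.face i 0).chain) := by
  rw [boundary, SmoothCube.chain, Finsupp.liftAddHom_apply_single]
  simp

theorem map_labelChain {G : Type*} [AddCommGroup G] (f : Chain π n →+ G) (m : ι →₀ ℕ)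
    (σ : ι → SmoothCube π n) :
    f (labelChain m σ) = ∑ l ∈ m.support, (m l : ℤ) • f (σ l).chain := by
  rw [labelChain, Finsupp.sum, map_sum]
  exact Finset.sum_congr rfl fun l _ => map_zsmul f _ _

theorem boundary_labelChain (m : ι →₀ ℕ) {σ : ι → SmoothCube π (n + 1)} {σ₁ σ₀ : ι → SmoothCube π n}
    (h : ∀ l, boundary (σ l).chain = (σ₁ l).chain - (σ₀ l).chain) :
    boundary (labelChain m σ) = labelChain m σ₁ - labelChain m σ₀ := by
  rw [map_labelChain, labelChain, labelChain, Finsupp.sum, Finsupp.sum, ← Finset.sum_sub_distrib]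
  exact Finset.sum_congr rfl fun l _ => by rw [h, smul_sub]

theorem boundary_labelChain_eq_zero (m : ι →₀ ℕ) {σ : ι → SmoothCube π (n + 1)}
    (h : ∀ l, boundary (σ l).chain = 0) : boundary (labelChain m σ) = 0 := by
  rw [map_labelChain]
  exact Finset.sum_eq_zero fun l _ => by rw [h, smul_zero]

theorem evalC_labelChain (f : SmoothCube π n → ℝ) (m : ι →₀ ℕ) (σ : ι → SmoothCube π n) :
    evalC f (labelChain m σ) = ∑ l ∈ m.support, (m l : ℝ) * f (σ l) := by
  rw [map_labelChain]
  exact Finset.sum_congr rfl fun l _ => by simp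

end LabelChains

/-! ### Vanishing of linking for disjoint chains. -/

section FarChains

open MeasureTheory Set

variable {c : Fin 4 → ℝ} {δ : ℝ}

/-- If all three bumps were nonzero at a pair of points, their images in Y would be 2r-close; so
some bump vanishes and with it a column of the determinant. -/
theorem detPair_eq_zero_of_far (hδ : 0 < δ) (hδ1 : δ < 1) {r : ℝ} (hc : ∀ j, |c j| ≤ r)
    (hr : δ ≤ r) (σ : SmoothCube projY 1) (σ' : SmoothCube projY 2)
    (h : ∀ u v, 2 * r < dist (σ.toFun u) (σ'.toFun v)) :
    detPair (p := 1) (q := 2) (stairY c δ) ordY σ σ' = 0 := by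
  rw [detPair, setIntegral_congr_fun (g := fun _ => (0 : ℝ)) measurableSet_Icc fun y hy => ?_,
    integral_zero]
  have hu : (fun i : Fin 1 => y (Fin.castAdd 2 i)) ∈ Icc (0 : Fin 1 → ℝ) 1 :=
    ⟨fun i => hy.1 _, fun i => hy.2 _⟩
  have hv : (fun i : Fin 2 => y (Fin.natAdd 1 i)) ∈ Icc (0 : Fin 2 → ℝ) 1 :=
    ⟨fun i => hy.1 _, fun i => hy.2 _⟩
  have hfar := h (toCube _ hu) (toCube _ hv)
  rw [← σ.proj_lift, ← σ'.proj_lift] at hfar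
  have hex : ∃ j, deriv (stairY c δ j) (diffLift (p := 1) (q := 2) σ.lift σ'.lift y (ordY j)) = 0 := by
    by_contra! hne
    refine hfar.not_ge (dist_projY_le hδ hδ1 hc hr fun j => ?_)
    fin_cases j
    · exact hne 1
    · exact hne 0
    · exact hne 2
  obtain ⟨j, hj⟩ := hex
  beta_reduce
  rw [gradMat_stairMap (stairSys_stairY hδ hδ1).smooth
    (contDiff_diffLift (p := 1) (q := 2) σ.lift_smooth σ'.lift_smooth)]
  exact Matrix.det_eq_zero_of_column_eq_zero j fun i => by rw [Matrix.of_apply, hj, zero_mul]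

/-- A cycle does not link the boundary of a chain from which it is disjoint. -/
theorem exists_linkInt_boundary_eq_zero {a : Chain projY 1} (ha : boundary a = 0)
    {W : Chain projY 2} {A B : Set YSpace} (hA : a.In A) (hB : W.In B) (hAB : Disjoint A B) :
    ∃ η > 0, ∀ ρ, 0 < ρ → ρ < η → ∀ c : Fin 4 → ℝ, (∀ j, |c j| ≤ ρ) → ∀ δ, 0 < δ → δ ≤ ρ →
      linkInt c δ a (boundary W) = 0 := by
  obtain ⟨η, hη, h⟩ := exists_pos_forall_finset (a.support ×ˢ W.support)
    (P := fun w ρ => ∀ u v, 2 * ρ < dist (w.1.toFun u) (w.2.toFun v)) (by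
      rintro ⟨σ, σ'⟩ hw
      obtain ⟨h1, h2⟩ := Finset.mem_product.1 hw
      obtain ⟨η, hη, hη'⟩ := exists_pos_le_of_cubes (p := 1) (q := 2)
        (f := fun z => dist (σ.toFun z.1) (σ'.toFun z.2))
        (((σ.continuous_toFun continuous_projY).comp continuous_fst).dist
          ((σ'.continuous_toFun continuous_projY).comp continuous_snd))
        (fun z => dist_pos.2 fun e => disjoint_left.1 hAB (hA σ h1 z.1) (e ▸ hB σ' h2 z.2))
      exact ⟨η / 2, by positivity, fun r hr hrη u v => by
        have := hη' (u, v)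
        simp only at this ⊢
        linarith⟩)
  refine ⟨min η (1 / 2), by positivity, fun ρ hρ hρη c hc δ hδ hδρ => ?_⟩
  have h1 := hρη.trans_le (min_le_left _ _)
  have h2 := hρη.trans_le (min_le_right _ _)
  have hδ1 : δ < 1 := by linarith
  rw [← neg_eq_zero, ← crossInt_eq hδ hδ1 ha]
  exact evalC_eq_zero fun σ hσ => evalC_eq_zero fun σ' hσ' =>
    detPair_eq_zero_of_far hδ hδ1 hc hδρ σ σ' (h ρ hρ h1 (σ, σ') (Finset.mem_product.2 ⟨hσ, hσ'⟩))

end FarChains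

/-! ### Annuli between push-offs of an orbit. -/

section Bands

open Set Complex

variable {X₁ X₂ ε : ℝ} {Q : ℕ} {K : ℝ → ℂ → ℝ}

theorem coe_add_intCast (x : ℝ) (k : ℤ) : ((x + k : ℝ) : UnitAddCircle) = x := by
  rw [← sub_eq_zero, ← AddCircle.coe_sub, add_sub_cancel_left]
  exact (AddCircle.coe_eq_zero_iff 1).2 ⟨k, by simp⟩

theorem projY_eq {t t' : ℝ} {z z' : ℂ} (h : ∃ k : ℤ, t = t' + k) (h' : ∃ w : ℤ, z = z' + w * I) :
    projY (pt3 t z) = projY (pt3 t' z') := by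
  obtain ⟨k, rfl⟩ := h
  obtain ⟨w, rfl⟩ := h'
  refine Prod.ext ?_ (Prod.ext ?_ ?_)
  · change ((t' + k : ℝ) : UnitAddCircle) = (t' : UnitAddCircle)
    exact coe_add_intCast _ _
  · simp [projY, pt3]
  · change (((z' + w * I).im : ℝ) : UnitAddCircle) = (z'.im : UnitAddCircle)
    have : (z' + w * I).im = z'.im + w := by simp
    rw [this, coe_add_intCast]

namespace Orbit

variable (γ : Orbit K X₁ X₂) (τ : Frame γ)

/-- The annulus between two push-offs of an orbit. -/
def band (r r' : ℝ) : SmoothCube projY 2 :=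
  SmoothCube.ofLift projY
    (fun u => pt3 (γ.period * u 1)
      (γ.z (γ.period * u 1) + ((r' + u 0 * (r - r') : ℝ) : ℂ) * τ.ν (γ.period * u 1)))
    (contDiff_pt3 (contDiff_const.mul (contDiff_apply ℝ ℝ 1))
      ((γ.smooth.comp (contDiff_const.mul (contDiff_apply ℝ ℝ 1))).add
        ((Complex.ofRealCLM.contDiff.comp (contDiff_const.add
          ((contDiff_apply ℝ ℝ 0).mul contDiff_const))).mul
          (τ.smooth.comp (contDiff_const.mul (contDiff_apply ℝ ℝ 1))))))

theorem strip_eq (r : ℝ) : γ.strip τ r = γ.band τ r 0 := by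
  refine SmoothCube.ext (funext fun u => ?_)
  simp [strip, band, SmoothCube.ofLift]

theorem pushLoop_zero : γ.pushLoop τ 0 = γ.loop := by
  refine SmoothCube.ext (funext fun u => ?_)
  simp [pushLoop, loop, SmoothCube.ofLift]

theorem projY_push_add (r t : ℝ) :
    projY (pt3 (t + γ.period) (γ.z (t + γ.period) + r * τ.ν (t + γ.period))) =
      projY (pt3 t (γ.z t + r * τ.ν t)) := by
  obtain ⟨w, hw⟩ := γ.closed
  refine projY_eq ⟨γ.period, by simp⟩ ⟨w, ?_⟩
  rw [hw, τ.periodic]; ring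

/-- The sides at the beginning and the end of the period project to the same curve in Y and cancel;
the other two sides are the push-offs. -/
theorem boundary_band (r r' : ℝ) :
    boundary (γ.band τ r r').chain = (γ.pushLoop τ r).chain - (γ.pushLoop τ r').chain := by
  have h0 : (γ.band τ r r').face 0 1 = γ.pushLoop τ r := by
    refine SmoothCube.ext (funext fun u => ?_)
    simp [band, pushLoop, SmoothCube.ofLift, SmoothCube.face]
  have h1 : (γ.band τ r r').face 0 0 = γ.pushLoop τ r' := by
    refine SmoothCube.ext (funext fun u => ?_)
    simp [band, pushLoop, SmoothCube.ofLift, SmoothCube.face]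
  have h2 : (γ.band τ r r').face 1 1 = (γ.band τ r r').face 1 0 := by
    refine SmoothCube.ext (funext fun u => ?_)
    have := γ.projY_push_add τ (r' + u 0 * (r - r')) 0
    have e : ∀ e : unitInterval, (Fin.insertNth 1 e u : Fin 2 → unitInterval) 0 = u 0 := fun _ => rfl
    simpa [band, SmoothCube.ofLift, SmoothCube.face, e] using this
  rw [boundary_single, Fin.sum_univ_two, h0, h1, h2]
  simp

theorem boundary_pushLoop (r : ℝ) : boundary (γ.pushLoop τ r).chain = 0 := by
  have h : (γ.pushLoop τ r).face 0 1 = (γ.pushLoop τ r).face 0 0 := by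
    refine SmoothCube.ext (funext fun u => ?_)
    have := γ.projY_push_add τ r 0
    simpa [pushLoop, SmoothCube.ofLift, SmoothCube.face] using this
  rw [boundary_single, Fin.sum_univ_one, h]
  simp

theorem loop_mem (u : Fin 1 → unitInterval) : γ.loop.toFun u ∈ γ.image := ⟨_, rfl⟩

theorem pushLoop_mem (r : ℝ) (u : Fin 1 → unitInterval) :
    (γ.pushLoop τ r).toFun u ∈ γ.pushImage τ r := ⟨_, rfl⟩

theorem band_mem (r r' : ℝ) (u : Fin 2 → unitInterval) :
    (γ.band τ r r').toFun u ∈ γ.pushImage τ (r' + u 0 * (r - r')) := ⟨_, rfl⟩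

end Orbit

end Bands

/-! ### The linking number of a generator with its push-off. -/

section GeneratorLinking

open Set Complex

variable {X₁ X₂ ε : ℝ} {Q : ℕ} {T : TwistPerturbation X₁ X₂ Q ε} {P : ℤ}

namespace Generator

variable (α : Generator T P) (τ : Trivialization T)

/-- The annuli between two push-offs of a generator. -/
def bands (r r' : ℝ) : Chain projY 2 := labelChain α.mult fun l => (T.orbit l).band (τ l) r r'

theorem cycle_eq : α.cycle = labelChain α.mult fun l => (T.orbit l).loop := rfl

theorem pushCycle_eq (r : ℝ) :
    α.pushCycle τ r = labelChain α.mult fun l => (T.orbit l).pushLoop (τ l) r := rfl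

theorem pushCycle_zero : α.pushCycle τ 0 = α.cycle := by
  rw [pushCycle_eq, cycle_eq]
  simp_rw [Orbit.pushLoop_zero]

theorem strips_eq (r : ℝ) : α.strips τ r = α.bands τ r 0 := by
  rw [bands]
  simp_rw [← Orbit.strip_eq]
  rfl

theorem boundary_bands (r r' : ℝ) :
    boundary (α.bands τ r r') = α.pushCycle τ r - α.pushCycle τ r' :=
  boundary_labelChain _ fun l => (T.orbit l).boundary_band (τ l) r r'

theorem boundary_pushCycle (r : ℝ) : boundary (α.pushCycle τ r) = 0 :=
  boundary_labelChain_eq_zero _ fun l => (T.orbit l).boundary_pushLoop (τ l) r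

theorem boundary_cycle (τ : Trivialization T) : boundary α.cycle = 0 := by
  rw [← α.pushCycle_zero τ, boundary_pushCycle]

theorem cycle_in : α.cycle.In α.image :=
  labelChain_in fun l hl u => mem_biUnion hl ((T.orbit l).loop_mem u)

theorem pushCycle_in (r : ℝ) : (α.pushCycle τ r).In (α.pushImage τ r) :=
  labelChain_in fun l hl u => mem_biUnion hl ((T.orbit l).pushLoop_mem (τ l) r u)

theorem bands_in {r r' : ℝ} {A : Set YSpace} (hr : r' ≤ r)
    (h : ∀ ρ, r' ≤ ρ → ρ ≤ r → α.pushImage τ ρ ⊆ A) : (α.bands τ r r').In A := by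
  refine labelChain_in fun l hl u => ?_
  have h0 := (u 0).2.1
  have h1 := (u 0).2.2
  exact h (r' + u 0 * (r - r')) (by nlinarith) (by nlinarith)
    (mem_biUnion hl ((T.orbit l).band_mem (τ l) r r' u))

/-- The linking number of a generator with its push-off. -/
def linkTotal : ℤ :=
  ∑ l ∈ α.mult.support, ∑ l' ∈ α.mult.support,
    α.mult l * (α.mult l' * linkNumber l l' (τ l').turns)

theorem exists_linkInt_eq_of_small (hε : ε ≤ epsBound Q) :
    ∃ r₀ > 0, ∀ r, 0 < r → r < r₀ → ∃ η > 0, ∀ ρ, 0 < ρ → ρ < η → ∀ c : Fin 4 → ℝ,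
      (∀ j, |c j| ≤ ρ) → ∀ δ, 0 < δ → δ ≤ ρ →
      linkInt c δ α.cycle (α.pushCycle τ r) = α.linkTotal τ := by
  obtain ⟨r₀, hr₀, h⟩ := exists_pos_forall_finset (α.mult.support ×ˢ α.mult.support)
    (fun w _ => T.exists_linkInt_eq hε w.1 w.2 (τ w.2))
  refine ⟨r₀, hr₀, fun r hr hr' => ?_⟩
  obtain ⟨η, hη, h⟩ := exists_pos_forall_finset _ (h r hr hr')
  refine ⟨η, hη, fun ρ hρ hρη c hc δ hδ hδρ => ?_⟩
  rw [linkInt, cycle_eq, evalC_labelChain, linkTotal]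
  push_cast
  refine Finset.sum_congr rfl fun l hl => ?_
  rw [pushCycle_eq, evalC_labelChain, Finset.mul_sum]
  refine Finset.sum_congr rfl fun l' hl' => ?_
  rw [← linkInt_chain, h ρ hρ hρη (l, l') (Finset.mem_product.2 ⟨hl, hl'⟩) c hc δ hδ hδρ]

/-- The linking integral of a generator with its push-off. -/
theorem exists_linkInt_eq (hε : ε ≤ epsBound Q) {r : ℝ} (hr : 0 < r) (hp : α.IsPushable τ r) :
    ∃ η > 0, ∀ ρ, 0 < ρ → ρ < η → ∀ c : Fin 4 → ℝ, (∀ j, |c j| ≤ ρ) → ∀ δ, 0 < δ → δ ≤ ρ →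
      linkInt c δ α.cycle (α.pushCycle τ r) = α.linkTotal τ := by
  obtain ⟨r₀, hr₀, h⟩ := α.exists_linkInt_eq_of_small τ hε
  set r' := min (r₀ / 2) r with hr'
  have h1 : r' ≤ r₀ / 2 := min_le_left _ _
  have h2 : r' ≤ r := min_le_right _ _
  have h3 : 0 < r' := by positivity
  obtain ⟨η, hη, h⟩ := h r' h3 (by linarith)
  obtain ⟨η', hη', h'⟩ := exists_linkInt_boundary_eq_zero (α.boundary_cycle τ) α.cycle_in
    (B := α.imageᶜ) (α.bands_in τ h2 fun ρ hρ hρr =>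
      disjoint_right.1 (hp ρ (h3.trans_le hρ) hρr).2.symm) disjoint_compl_right
  refine ⟨min η η', by positivity, fun ρ hρ hρη c hc δ hδ hδρ => ?_⟩
  have e := h' ρ hρ (hρη.trans_le (min_le_right _ _)) c hc δ hδ hδρ
  rw [boundary_bands, linkInt_sub_right,
    h ρ hρ (hρη.trans_le (min_le_left _ _)) c hc δ hδ hδρ] at e
  linarith

end Generator

end GeneratorLinking

/-! ### The relative Chern number through turns along the boundary. -/

section ChernNumber

open Set Complex

variable {X₁ X₂ ε : ℝ} {Q : ℕ} {K : ℝ → ℂ → ℝ}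

/-- The factor exp(g) has a periodic logarithm and makes no turns, so the section turns as often as
the frame. -/
theorem IsTrivialAlong.hasTurns {ψ : ℝ → ℂ → ℂ} (hψ : IsSection ψ) {γ : Orbit K X₁ X₂} {τ : Frame γ}
    (h : IsTrivialAlong ψ γ τ) : HasTurns (fun t => ψ t (γ.z t)) γ.period τ.turns := by
  obtain ⟨g, hg, hgp, e⟩ := h
  have hsm : ContDiff ℝ ∞ fun t => ψ t (γ.z t) := hψ.1.comp (contDiff_id.prodMk γ.smooth)
  obtain ⟨n, hn⟩ := exists_hasTurns hsm
    (fun t => by rw [e]; exact mul_ne_zero (exp_ne_zero _) (τ.ne_zero t)) (T := γ.period) (by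
      have h1 := hgp 0
      have h2 := τ.periodic 0
      rw [zero_add] at h1 h2
      rw [e, e, h1, h2])
  obtain ⟨G, hG, hGf, hGe⟩ := τ.hasTurns
  have hper : ∀ t : ℝ, ψ (t + γ.period) (γ.z (t + γ.period)) = ψ t (γ.z t) := fun t => by
    rw [e, e, hgp, τ.periodic]
  have key := hn.log_add hper (G := fun t => g t + G t) (hg.add hG.continuous)
    (fun t => by rw [exp_add, hGf, e]) 0
  have h1 := hgp 0
  rw [zero_add] at key h1
  rw [h1, hGe] at key
  have h2 : (2 * Real.pi * I : ℂ) * τ.turns = 2 * Real.pi * I * n := by linear_combination key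
  have h3 := mul_left_cancel₀ two_pi_I_ne_zero h2
  rwa [Int.cast_injective h3]

theorem exists_turnInt_loop {ψ : ℝ → ℂ → ℂ} (hψ : IsSection ψ) {γ : Orbit K X₁ X₂} {τ : Frame γ}
    (h : IsTrivialAlong ψ γ τ) :
    ∃ ρ > 0, ∀ ζ : ℂ, ‖ζ‖ ≤ ρ → ∀ δ, 0 < δ → δ ≤ ρ → turnInt ψ ζ δ γ.loop = τ.turns :=
  exists_turnInt_eq hψ _ (h.hasTurns hψ).comp_mul fun _ => rfl

variable {T : TwistPerturbation X₁ X₂ Q ε} {P : ℤ}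

/-- The total number of turns of the trivialization along a generator. -/
def Generator.turnTotal (α : Generator T P) (τ : Trivialization T) : ℤ :=
  ∑ l ∈ α.mult.support, α.mult l * (τ l).turns

theorem Generator.exists_turnInt_cycle (α : Generator T P) (τ : Trivialization T) {ψ : ℝ → ℂ → ℂ}
    (hψ : IsSection ψ) (h : ∀ l, α.mult l ≠ 0 → IsTrivialAlong ψ (T.orbit l) (τ l)) :
    ∃ ρ > 0, ∀ r, 0 < r → r < ρ → ∀ ζ : ℂ, ‖ζ‖ ≤ r → ∀ δ, 0 < δ → δ ≤ r →
      evalC (turnInt ψ ζ δ) α.cycle = α.turnTotal τ := by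
  obtain ⟨ρ, hρ, h⟩ := exists_pos_forall_finset α.mult.support
    (P := fun l r => ∀ ζ : ℂ, ‖ζ‖ ≤ r → ∀ δ, 0 < δ → δ ≤ r →
      turnInt ψ ζ δ (T.orbit l).loop = (τ l).turns) fun l hl => by
    obtain ⟨ρ, hρ, h⟩ := exists_turnInt_loop hψ (h l (Finsupp.mem_support_iff.1 hl))
    exact ⟨ρ, hρ, fun r hr hrρ ζ hζ δ hδ hδr => h ζ (hζ.trans hrρ.le) δ hδ (hδr.trans hrρ.le)⟩
  refine ⟨ρ, hρ, fun r hr hrρ ζ hζ δ hδ hδr => ?_⟩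
  rw [α.cycle_eq, evalC_labelChain, turnTotal]
  push_cast
  exact Finset.sum_congr rfl fun l hl => by rw [h r hr hrρ l hl ζ hζ δ hδ hδr]

theorem Represents.boundary {α β : Generator T P} {W : Chain projY 2} {Z : H2 α β}
    (h : Represents W Z) : boundary W - (α.cycle - β.cycle) ∈ degenerate projY 1 := by
  obtain ⟨W', rfl, -⟩ := h
  exact W'.2.2

theorem hasZeroNumber_iff_of_trivial {α β : Generator T P} (τ : Trivialization T)
    {W : Chain projY 2} {Z : H2 α β} (hW : Represents W Z) {ψ : ℝ → ℂ → ℂ} (hψ : IsSection ψ)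
    (h : ∀ l, α.mult l ≠ 0 ∨ β.mult l ≠ 0 → IsTrivialAlong ψ (T.orbit l) (τ l)) (n : ℤ) :
    HasZeroNumber ψ W n ↔ n = α.turnTotal τ - β.turnTotal τ := by
  refine hasZeroNumber_iff hψ hW.boundary ?_ n
  obtain ⟨ρ, hρ, h1⟩ := α.exists_turnInt_cycle τ hψ fun l hl => h l (Or.inl hl)
  obtain ⟨ρ', hρ', h2⟩ := β.exists_turnInt_cycle τ hψ fun l hl => h l (Or.inr hl)
  have a1 := min_le_left ρ ρ'
  have a2 := min_le_right ρ ρ'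
  have a3 : 0 < min ρ ρ' := lt_min hρ hρ'
  refine ⟨min ρ ρ' / 2, by positivity, fun ζ hζ δ hδ hδr => ?_⟩
  rw [map_sub, h1 _ (by positivity) (by linarith) ζ hζ δ hδ hδr,
    h2 _ (by positivity) (by linarith) ζ hζ δ hδ hδr]
  push_cast
  rfl

end ChernNumber

/-! ### Existence of sections that are trivial along prescribed orbits. -/

section Sections

open Set Complex

variable {X₁ X₂ ε : ℝ} {Q : ℕ}

/-- The exponential sections of the vertical tangent bundle. -/
def expSection (a b : ℤ) (t : ℝ) (z : ℂ) : ℂ := exp (2 * Real.pi * I * (a * t + b * z.im : ℝ))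

theorem isSection_expSection (a b : ℤ) : IsSection (expSection a b) := by
  refine ⟨?_, fun t z => ?_, fun t z => ?_⟩
  · refine contDiff_exp.comp (contDiff_const.mul (ofRealCLM.contDiff.comp ?_))
    exact (contDiff_const.mul contDiff_fst).add
      (contDiff_const.mul (imCLM.contDiff.comp contDiff_snd))
  · rw [expSection, expSection, exp_eq_exp_iff_exists_int]
    exact ⟨a, by push_cast; ring⟩
  · rw [expSection, expSection, exp_eq_exp_iff_exists_int]
    exact ⟨b, by simp only [add_im, I_im]; push_cast; ring⟩

/-- A nonnegative function on `ℝ × S¹` that vanishes at one point. -/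
def pointFn (z : ℂ) : ℝ := Real.sin (Real.pi * z.im) ^ 2 + z.re ^ 2

theorem pointFn_add_int (z : ℂ) (w : ℤ) : pointFn (z + w * I) = pointFn z := by
  have h : Real.sin (Real.pi * (z.im + w)) ^ 2 = Real.sin (Real.pi * z.im) ^ 2 := by
    rw [mul_add, mul_comm Real.pi (w : ℝ), Real.sin_add_int_mul_pi, mul_pow, ← zpow_natCast,
      ← zpow_mul, mul_comm w, zpow_mul]
    simp
  simp [pointFn, h]

theorem pointFn_nonneg (z : ℂ) : 0 ≤ pointFn z := by unfold pointFn; positivity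

theorem eq_of_pointFn_eq_zero {z : ℂ} (h : pointFn z = 0) : ∃ w : ℤ, z = w * I := by
  unfold pointFn at h
  have h1 : Real.sin (Real.pi * z.im) = 0 := by nlinarith [sq_nonneg z.re]
  have h2 : z.re = 0 := by nlinarith [sq_nonneg (Real.sin (Real.pi * z.im))]
  obtain ⟨n, hn⟩ := Real.sin_eq_zero_iff.1 h1
  refine ⟨n, Complex.ext (by simp [h2]) ?_⟩
  have : (n : ℝ) = z.im := mul_right_cancel₀ Real.pi_ne_zero (by linarith)
  simp [this]

theorem contDiff_pointFn : ContDiff ℝ ∞ pointFn :=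
  ((Real.contDiff_sin.comp (contDiff_const.mul imCLM.contDiff)).pow 2).add (reCLM.contDiff.pow 2)

namespace TwistPerturbation

variable (T : TwistPerturbation X₁ X₂ Q ε)

/-- A nonnegative function on `S¹ × ℝ × S¹` that vanishes exactly on an orbit. -/
def orbitFn (l : Label X₁ X₂ Q) (t : ℝ) (z : ℂ) : ℝ :=
  ∏ k ∈ Finset.range l.1.1.den, pointFn (z - (T.orbit l).z (t + k))

theorem contDiff_orbitFn (l : Label X₁ X₂ Q) :
    ContDiff ℝ ∞ fun w : ℝ × ℂ => T.orbitFn l w.1 w.2 :=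
  contDiff_prod fun _ _ => contDiff_pointFn.comp
    (contDiff_snd.sub ((T.orbit l).smooth.comp (contDiff_fst.add contDiff_const)))

/-- A unit of time permutes the q strands cyclically; the last one returns to the first up to an
integer translation in y, which `pointFn` does not see. -/
theorem orbitFn_add_t (l : Label X₁ X₂ Q) (t : ℝ) (z : ℂ) : T.orbitFn l (t + 1) z = T.orbitFn l t z := by
  have hq := l.1.1.pos
  obtain ⟨q, hq'⟩ := Nat.exists_eq_succ_of_ne_zero hq.ne'
  have h0 : pointFn (z - (T.orbit l).z (t + l.1.1.den)) = pointFn (z - (T.orbit l).z t) := by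
    rw [T.winding_eq, ← pointFn_add_int (z - (T.orbit l).z t) l.1.1.num]
    congr 1; ring
  rw [orbitFn, orbitFn]
  rw [hq'] at h0 ⊢
  rw [Finset.prod_range_succ, Finset.prod_range_succ']
  push_cast at h0 ⊢
  rw [add_assoc t 1, add_comm 1 (q : ℝ), h0, add_zero]
  congr 1
  refine Finset.prod_congr rfl fun k _ => ?_
  rw [add_assoc, add_comm 1 (k : ℝ)]

theorem orbitFn_add_y (l : Label X₁ X₂ Q) (t : ℝ) (z : ℂ) : T.orbitFn l t (z + I) = T.orbitFn l t z := by
  refine Finset.prod_congr rfl fun k _ => ?_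
  rw [← pointFn_add_int (z - (T.orbit l).z (t + k)) 1]
  congr 1; push_cast; ring

theorem orbitFn_add (l : Label X₁ X₂ Q) (t : ℝ) (z : ℂ) (k : ℕ) (w : ℤ) :
    T.orbitFn l (t + k) (z + w * I) = T.orbitFn l t z := by
  have h1 : T.orbitFn l (t + k) z = T.orbitFn l t z := by
    induction k with
    | zero => simp
    | succ k ih => rw [Nat.cast_succ, ← add_assoc, T.orbitFn_add_t, ih]
  rw [← h1]
  refine Finset.prod_congr rfl fun k _ => ?_
  rw [add_sub_right_comm, pointFn_add_int]

theorem orbitFn_self (l : Label X₁ X₂ Q) (t : ℝ) : T.orbitFn l t ((T.orbit l).z t) = 0 := by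
  refine Finset.prod_eq_zero (Finset.mem_range.2 l.1.1.pos) ?_
  simp [pointFn]

theorem orbitFn_pos (hε : ε ≤ epsBound Q) {l l' : Label X₁ X₂ Q} (h : l ≠ l') (t : ℝ) :
    0 < T.orbitFn l' t ((T.orbit l).z t) := by
  refine Finset.prod_pos fun k _ => (pointFn_nonneg _).lt_of_ne' fun h0 => ?_
  obtain ⟨w, hw⟩ := eq_of_pointFn_eq_zero h0
  refine T.strand_ne hε h.symm k (-w) t ?_
  push_cast
  linear_combination -hw

open Classical in
/-- There is a section of `V` that is trivial along finitely many orbits. -/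
theorem exists_section (hε : ε ≤ epsBound Q) (τ : Trivialization T) (F : Finset (Label X₁ X₂ Q)) :
    ∃ ψ, IsSection ψ ∧ ∀ l ∈ F, IsTrivialAlong ψ (T.orbit l) (τ l) := by
  -- Over a period t grows by q and y by -p, so `expSection a b` turns aq - bp times; as p and q are
  -- coprime, every integer occurs.
  have hab : ∀ l : Label X₁ X₂ Q, ∃ a b : ℤ, a * l.1.1.den - b * l.1.1.num = (τ l).turns := by
    intro l
    have hc : IsCoprime (l.1.1.num : ℤ) (l.1.1.den : ℤ) :=
      Int.isCoprime_iff_gcd_eq_one.2 (by simpa [Int.gcd] using l.1.1.reduced)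
    obtain ⟨u, v, huv⟩ := hc
    exact ⟨(τ l).turns * v, -((τ l).turns * u), by linear_combination (τ l).turns * huv⟩
  choose a b hab using hab
  -- Interpolation in the manner of Lagrange: each summand vanishes along all the other orbits and
  -- is a positive multiple of the right exponential along its own.
  refine ⟨fun t z => ∑ l ∈ F, expSection (a l) (b l) t z *
    ((∏ l' ∈ F.erase l, T.orbitFn l' t z : ℝ) : ℂ), ⟨?_, fun t z => ?_, fun t z => ?_⟩, ?_⟩
  · refine ContDiff.sum fun l _ => (isSection_expSection _ _).1.mul ?_
    exact ofRealCLM.contDiff.comp (contDiff_prod fun l' _ => T.contDiff_orbitFn l')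
  · simp only [(isSection_expSection _ _).2.1, T.orbitFn_add_t]
  · simp only [(isSection_expSection _ _).2.2, T.orbitFn_add_y]
  · intro l hl
    set D : ℝ → ℝ := fun t => ∏ l' ∈ F.erase l, T.orbitFn l' t ((T.orbit l).z t) with hD
    have hD0 : ∀ t, 0 < D t := fun t => Finset.prod_pos fun l' hl' =>
      T.orbitFn_pos hε (Finset.ne_of_mem_erase hl').symm t
    have hDl : ∀ l', Continuous fun t => T.orbitFn l' t ((T.orbit l).z t) := fun l' =>
      (T.contDiff_orbitFn l').continuous.comp
        (g := fun w : ℝ × ℂ => T.orbitFn l' w.1 w.2) (f := fun t => (t, (T.orbit l).z t))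
        (continuous_id.prodMk (T.orbit l).smooth.continuous)
    have hDc : Continuous D := continuous_finsetProd _ fun l' _ => hDl l'
    have hval : ∀ t, ∑ l' ∈ F, expSection (a l') (b l') t ((T.orbit l).z t) *
        ((∏ l'' ∈ F.erase l', T.orbitFn l'' t ((T.orbit l).z t) : ℝ) : ℂ) =
        expSection (a l) (b l) t ((T.orbit l).z t) * (D t : ℂ) := by
      intro t
      refine Finset.sum_eq_single_of_mem l hl fun l' hl' hne => ?_
      rw [Finset.prod_eq_zero (Finset.mem_erase.2 ⟨hne.symm, hl⟩) (T.orbitFn_self l t)]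
      simp
    have hDp : ∀ t : ℝ, D (t + (T.orbit l).period) = D t := by
      intro t
      refine Finset.prod_congr rfl fun l' _ => ?_
      have h := T.orbitFn_add l' t ((T.orbit l).z t) (T.orbit l).period (-l.1.1.num)
      have e : (T.orbit l).z t + ((-l.1.1.num : ℤ) : ℂ) * I =
          (T.orbit l).z (t + (T.orbit l).period) := by
        rw [T.orbit_add_period]; push_cast; ring
      rw [← e]
      exact h
    obtain ⟨G, hG, hGf, hGe⟩ := (τ l).hasTurns
    refine ⟨fun t => 2 * Real.pi * I * (a l * t + b l * ((T.orbit l).z t).im : ℝ) +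
      (Real.log (D t) : ℝ) - G t, ?_, fun t => ?_, fun t => ?_⟩
    · have hz := (T.orbit l).smooth.continuous
      have hlog : Continuous fun t => Real.log (D t) := hDc.log fun t => (hD0 t).ne'
      have hGc := hG.continuous
      fun_prop
    · have e1 := (τ l).hasTurns.log_add (τ l).periodic hG.continuous hGf t
      have e2 : ((T.orbit l).z (t + (T.orbit l).period)).im = ((T.orbit l).z t).im - l.1.1.num := by
        rw [T.orbit_add_period]; simp
      have e3 : ((a l : ℂ) * l.1.1.den - b l * l.1.1.num) = (τ l).turns := by exact_mod_cast hab l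
      beta_reduce
      rw [e1, e2, hDp, T.period_eq]
      push_cast
      linear_combination 2 * Real.pi * I * e3
    · beta_reduce
      rw [hval, exp_sub, exp_add, hGf, div_mul_cancel₀ _ ((τ l).ne_zero t), expSection, ← ofReal_exp,
        Real.exp_log (hD0 t)]

end TwistPerturbation

variable {T : TwistPerturbation X₁ X₂ Q ε} {P : ℤ}

/-- The argument principle makes the number independent of chain and section; `exists_section` shows
that there is a section to count with. -/
theorem hasChernNumber_iff (hε : ε ≤ epsBound Q) (τ : Trivialization T) {α β : Generator T P}
    (Z : H2 α β) (n : ℤ) : HasChernNumber τ Z n ↔ n = α.turnTotal τ - β.turnTotal τ := by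
  classical
  constructor
  · rintro ⟨W, ψ, hW, hψ, h, hn⟩
    exact (hasZeroNumber_iff_of_trivial τ hW hψ h n).1 hn
  · intro hn
    obtain ⟨ψ, hψ, h⟩ := T.exists_section hε τ (α.mult.support ∪ β.mult.support)
    obtain ⟨W, rfl⟩ := Quotient.exists_rep Z
    have h' : ∀ l, α.mult l ≠ 0 ∨ β.mult l ≠ 0 → IsTrivialAlong ψ (T.orbit l) (τ l) :=
      fun l hl => h l (by simpa [Finset.mem_union, Finsupp.mem_support_iff] using hl)
    have hW : Represents W.1 (Quotient.mk _ W) := ⟨W, rfl, rfl⟩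
    exact ⟨W.1, ψ, hW, hψ, h', (hasZeroNumber_iff_of_trivial τ hW hψ h' n).2 hn⟩

end Sections

/-! ### The homology class of a generator: total period and total winding. -/

section Winding

open Set Complex

/-- The change of a coordinate along a 1-cube. -/
def coordChange (j : Fin 3) (σ : SmoothCube projY 1) : ℝ := σ.lift 1 j - σ.lift 0 j

theorem coordChange_eq (j : Fin 3) {σ : SmoothCube projY 1} {A : (Fin 1 → ℝ) → (Fin 3 → ℝ)}
    (h : LiftEq perY σ.lift A) : coordChange j σ = A 1 j - A 0 j := by
  obtain ⟨m, -, hm⟩ := h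
  rw [coordChange, hm 1 ⟨zero_le_one, le_rfl⟩, hm 0 ⟨le_rfl, zero_le_one⟩]
  ring

theorem coordChange_ofLift (j : Fin 3) {A : (Fin 1 → ℝ) → (Fin 3 → ℝ)} (hA : ContDiff ℝ ∞ A) :
    coordChange j (SmoothCube.ofLift projY A hA) = A 1 j - A 0 j :=
  coordChange_eq j (SmoothCube.liftEq_ofLift isLatticeProj_projY hA)

theorem coordChange_degenerate (j : Fin 3) {σ : SmoothCube projY 1} (hσ : σ.IsDegenerate) :
    coordChange j σ = 0 := by
  obtain ⟨i, hi⟩ := hσ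
  rw [coordChange_eq (A := fun _ => σ.lift 0) j
    (SmoothCube.liftEq isLatticeProj_projY σ continuous_const fun u => ?_), sub_self]
  rw [hi u 0 fun j hj => absurd (Subsingleton.elim j i) hj, σ.lift_spec]
  rfl

/-- One lift of the square serves all four sides, so the coordinate changes around the boundary
telescope to 0. -/
theorem evalC_coordChange_boundary (j : Fin 3) (W : Chain projY 2) :
    evalC (coordChange j) (boundary W) = 0 := by
  rw [evalC_boundary]
  refine evalC_eq_zero fun σ _ => ?_
  have h : ∀ (i : Fin 2) (e : unitInterval), coordChange j (σ.face i e) =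
      σ.lift (i.insertNth (e : ℝ) (1 : Fin 1 → ℝ)) j - σ.lift (i.insertNth (e : ℝ) (0 : Fin 1 → ℝ)) j :=
    fun i e => coordChange_eq j (SmoothCube.liftEq_face isLatticeProj_projY σ i e)
  have h0 : ∀ a b : ℝ, (Fin.insertNth 0 a (fun _ : Fin 1 => b) : Fin 2 → ℝ) = ![a, b] := fun a b => by
    ext i; fin_cases i <;> rfl
  have h1 : ∀ a b : ℝ, (Fin.insertNth 1 a (fun _ : Fin 1 => b) : Fin 2 → ℝ) = ![b, a] := fun a b => by
    ext i; fin_cases i <;> rfl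
  have e0 : (0 : Fin 1 → ℝ) = fun _ => 0 := rfl
  have e1 : (1 : Fin 1 → ℝ) = fun _ => 1 := rfl
  rw [Fin.sum_univ_two]
  simp only [h, Icc.coe_one, Icc.coe_zero, e0, e1, h0, h1, Fin.val_zero, Fin.val_one, pow_zero,
    pow_one]
  ring

theorem Homologous.evalC_coordChange {A : Set YSpace} {a b : Chain projY 1} (h : Homologous A a b)
    (j : Fin 3) : evalC (coordChange j) a = evalC (coordChange j) b := by
  obtain ⟨W, -, hW⟩ := h
  have := evalC_eq_of_sub_mem (fun _ hσ => coordChange_degenerate j hσ) hW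
  rwa [evalC_coordChange_boundary, map_sub, sub_eq_zero] at this

variable {X₁ X₂ ε : ℝ} {Q : ℕ} {T : TwistPerturbation X₁ X₂ Q ε} {P : ℤ}

theorem TwistPerturbation.coordChange_loop_t (T : TwistPerturbation X₁ X₂ Q ε) (l : Label X₁ X₂ Q) :
    coordChange 0 (T.orbit l).loop = l.1.1.den := by
  rw [Orbit.loop, coordChange_ofLift, ← T.period_eq l]
  simp [pt3]

theorem TwistPerturbation.coordChange_loop_y (T : TwistPerturbation X₁ X₂ Q ε) (l : Label X₁ X₂ Q) :
    coordChange 2 (T.orbit l).loop = -l.1.1.num := by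
  have h := T.orbit_add_period l 0
  rw [zero_add] at h
  rw [Orbit.loop, coordChange_ofLift]
  simp [pt3, h]

theorem coordChange_circleT_t (x : ℝ) : coordChange 0 (circleT x) = 1 := by
  rw [circleT, coordChange_ofLift]; simp [pt3]

theorem coordChange_circleT_y (x : ℝ) : coordChange 2 (circleT x) = 0 := by
  rw [circleT, coordChange_ofLift]; simp [pt3]

theorem coordChange_circleY_t (x : ℝ) : coordChange 0 (circleY x) = 0 := by
  rw [circleY, coordChange_ofLift]; simp [pt3]

theorem coordChange_circleY_y (x : ℝ) : coordChange 2 (circleY x) = 1 := by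
  rw [circleY, coordChange_ofLift]; simp [pt3]

namespace Generator

variable (α : Generator T P)

/-- The homology class is read off from the change of t along the cycle, and in `sum_num` from the
change of y, which is -p along an orbit of slope p/q. -/
theorem sum_den : ∑ l ∈ α.mult.support, (α.mult l : ℝ) * l.1.1.den = Q := by
  have h := α.sector.evalC_coordChange 0
  rw [show T.cycle α.mult = labelChain α.mult fun l => (T.orbit l).loop from rfl, evalC_labelChain] at h
  simpa [T.coordChange_loop_t, coordChange_circleT_t, coordChange_circleY_t] using h

theorem sum_num : ∑ l ∈ α.mult.support, (α.mult l : ℝ) * l.1.1.num = P := by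
  have h := α.sector.evalC_coordChange 2
  rw [show T.cycle α.mult = labelChain α.mult fun l => (T.orbit l).loop from rfl, evalC_labelChain] at h
  simpa [T.coordChange_loop_y, coordChange_circleT_y, coordChange_circleY_y] using h

/-- All iterates occurring in the index have total period at most Q, the range in which rotations
are under control. -/
theorem mul_period_le {l : Label X₁ X₂ Q} {k : ℕ} (hk : k ≤ α.mult l) :
    k * (T.orbit l).period ≤ Q := by
  by_cases hl : l ∈ α.mult.support
  · have h := α.sum_den
    have h1 := Finset.single_le_sum (f := fun l => (α.mult l : ℝ) * l.1.1.den)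
      (fun l _ => by positivity) hl
    rw [h] at h1
    rw [T.period_eq]
    have h2 : α.mult l * l.1.1.den ≤ Q := by exact_mod_cast h1
    exact (Nat.mul_le_mul_right _ hk).trans h2
  · have : k = 0 := by
      have := Finsupp.notMem_support_iff.1 hl
      omega
    simp [this]

end Generator

end Winding

/-! ### The integral of p dq along a polygonal path. -/

section PolygonalPaths

/-- `∫ p dq` along the path with the given edges that starts at `v`. -/
def pathSum (v : ℝ × ℝ) (L : List (ℝ × ℝ)) : ℝ :=
  (((L.scanl (· + ·) v).zip (L.scanl (· + ·) v).tail).map fun e => segmentIntegral e.1 e.2).sum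

theorem segmentIntegral_eq (v w : ℝ × ℝ) :
    segmentIntegral v w = (v.1 + (w.1 - v.1) / 2) * (w.2 - v.2) := by
  have e : ∀ u : ℝ, (v.1 + u * (w.1 - v.1)) * (w.2 - v.2) =
      v.1 * (w.2 - v.2) + u * ((w.1 - v.1) * (w.2 - v.2)) := fun u => by ring
  rw [segmentIntegral]
  simp_rw [e]
  rw [intervalIntegral.integral_add (by simp) (by
    exact Continuous.intervalIntegrable (by fun_prop) _ _), intervalIntegral.integral_const,
    intervalIntegral.integral_mul_const, integral_id]
  simp only [smul_eq_mul]
  ring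

theorem pathSum_cons (v e : ℝ × ℝ) (L : List (ℝ × ℝ)) :
    pathSum v (e :: L) = (v.1 + e.1 / 2) * e.2 + pathSum (v + e) L := by
  have h : (e :: L).scanl (· + ·) v = v :: (L.scanl (· + ·) (v + e)) := by simp
  obtain ⟨L', hL'⟩ : ∃ L', L.scanl (· + ·) (v + e) = (v + e) :: L' := by
    cases L <;> simp
  rw [pathSum, pathSum, h, List.tail_cons, hL']
  simp [segmentIntegral_eq]

/-- Moving the path by v adds v.1 to p throughout, hence v.1 times the total change of q to the
integral. -/
theorem pathSum_eq_add (v : ℝ × ℝ) (L : List (ℝ × ℝ)) :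
    pathSum v L = v.1 * (L.map Prod.snd).sum + pathSum 0 L := by
  induction L generalizing v with
  | nil => simp [pathSum]
  | cons e L ih =>
    rw [pathSum_cons, pathSum_cons, ih, ih (0 + e)]
    simp
    ring

/-- Twice the area of the parallelogram with edges `(num r, den r)` and `(num s, den s)`, if it is
traversed in the positive sense. -/
def crossTerm (r s : ℚ) : ℝ := if s < r then r.num * s.den - s.num * r.den else 0

theorem crossTerm_of_le {r s : ℚ} (h : s ≤ r) : crossTerm r s = r.num * s.den - s.num * r.den := by
  rcases h.eq_or_lt with rfl | h
  · simp [crossTerm]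
  · simp [crossTerm, h]

theorem sum_map_cross (r : ℚ) (L : List ℚ) :
    (L.map fun s : ℚ => (r.num * s.den - s.num * r.den : ℝ)).sum =
      r.num * (L.map fun s => (s.den : ℝ)).sum - (L.map fun s => (s.num : ℝ)).sum * r.den := by
  induction L with
  | nil => simp
  | cons s L ih => simp only [List.map_cons, List.sum_cons, ih]; ring

/-- An edge j contributes (Σ_{i<j} p_i + p_j/2) q_j. Twice the sum is (Σ p)(Σ q) plus the
antisymmetric part Σ_{i<j} (p_i q_j - p_j q_i). In decreasing order the pairs i < j with unequal
slopes are those counted by `crossTerm`, and equal slopes contribute 0. -/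
theorem two_mul_pathSum {L : List ℚ} (hL : L.Pairwise (· ≥ ·)) :
    2 * pathSum 0 (L.map fun r : ℚ => ((r.num : ℝ), (r.den : ℝ))) =
      (L.map fun r => (r.num : ℝ)).sum * (L.map fun r => (r.den : ℝ)).sum +
        (L.map fun r => (L.map fun s => crossTerm r s).sum).sum := by
  induction L with
  | nil => simp [pathSum]
  | cons r L ih =>
    obtain ⟨h1, h2⟩ := List.pairwise_cons.1 hL
    have a1 : L.map (fun s => crossTerm r s) = L.map fun s : ℚ => (r.num * s.den - s.num * r.den : ℝ) :=
      List.map_congr_left fun s hs => crossTerm_of_le (h1 s hs)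
    have a2 : L.map (fun s => crossTerm s r + (L.map fun s' => crossTerm s s').sum) =
        L.map fun s => (L.map fun s' => crossTerm s s').sum :=
      List.map_congr_left fun s hs => by simp [crossTerm, (h1 s hs).not_gt]
    have a3 : crossTerm r r = 0 := by simp [crossTerm]
    have a4 := sum_map_cross r L
    have a5 : List.map (Prod.snd ∘ fun r : ℚ => ((r.num : ℝ), (r.den : ℝ))) L =
        L.map fun s => (s.den : ℝ) := rfl
    have := ih h2
    simp only [List.map_cons, List.sum_cons, pathSum_cons, a1, a2, a3, a4]
    rw [pathSum_eq_add]
    simp only [List.map_map, a5, Prod.fst_add, Prod.fst_zero]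
    linear_combination this

variable {X₁ X₂ ε : ℝ} {Q : ℕ} {T : TwistPerturbation X₁ X₂ Q ε} {P : ℤ}

namespace Generator

variable (α : Generator T P)

theorem sum_slopes (f : ℚ → ℝ) :
    (α.slopes.map f).sum = ∑ l ∈ α.mult.support, (α.mult l : ℝ) * f l.1.1 := by
  rw [slopes, Finsupp.sum]
  have h := map_sum ((Multiset.sumAddMonoidHom (M := ℝ)).comp (Multiset.mapAddMonoidHom f))
    (fun l => Multiset.replicate (α.mult l) (l.1.1 : ℚ)) α.mult.support
  refine h.trans (Finset.sum_congr rfl fun l _ => ?_)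
  simp

theorem two_mul_pathIntegral : 2 * α.pathIntegral = P * Q +
    ∑ l ∈ α.mult.support, ∑ l' ∈ α.mult.support,
      (α.mult l : ℝ) * (α.mult l' * crossTerm l.1.1 l'.1.1) := by
  have hs : ∀ f : ℚ → ℝ, ((α.slopes.sort (· ≥ ·)).map f).sum = (α.slopes.map f).sum := fun f => by
    rw [← Multiset.sum_coe, ← Multiset.map_coe, Multiset.sort_eq]
  have h := two_mul_pathSum (L := α.slopes.sort (· ≥ ·)) (Multiset.pairwise_sort _ _)
  rw [hs, hs, hs] at h
  simp_rw [hs, α.sum_slopes] at h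
  rw [α.sum_num, α.sum_den] at h
  simp_rw [Finset.mul_sum] at h
  exact h

end Generator

end PolygonalPaths

/-! ### Construction of fillings in [0,1] × Y. -/

section Fillings

open Set Complex

variable {X₁ X₂ : ℝ}

/-- The cylinder over a 1-cube of `Y`, from height `s₀` to height `s₁`. -/
def cubeCyl (s₀ s₁ : ℝ) (σ : SmoothCube projY 1) : SmoothCube projM 2 where
  toFun u := (s₀ + u 0 * (s₁ - s₀), σ.toFun fun _ => u 1)
  smooth := by
    obtain ⟨F, hF, h⟩ := σ.smooth
    refine ⟨fun u => Fin.cons (s₀ + u 0 * (s₁ - s₀)) (F fun _ => u 1), contDiff_pi.2 fun i => ?_,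
      fun u => ?_⟩
    · refine Fin.cases ?_ (fun j => ?_) i
      · simpa using contDiff_const.add ((contDiff_apply ℝ ℝ 0).mul contDiff_const)
      · simpa [Function.comp_def] using (contDiff_pi.1 hF j).comp (contDiff_pi.2 fun _ => contDiff_apply ℝ ℝ 1)
    · rw [h]; rfl

/-- The 1-cube is a closed curve, so the two vertical sides of its cylinder coincide and cancel. -/
theorem boundary_cubeCyl (s₀ s₁ : ℝ) {σ : SmoothCube projY 1} (h : σ.face 0 1 = σ.face 0 0) :
    boundary (cubeCyl s₀ s₁ σ).chain = (cubeIncl s₁ σ).chain - (cubeIncl s₀ σ).chain := by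
  have e0 : ∀ e : unitInterval, (cubeCyl s₀ s₁ σ).face 0 e = cubeIncl (s₀ + e * (s₁ - s₀)) σ := fun e => by
    refine SmoothCube.ext (funext fun u => Prod.ext rfl ?_)
    change σ.toFun _ = σ.toFun u
    congr 1
    funext i
    rw [Subsingleton.elim i 0]
    rfl
  have hv : ∀ (e : unitInterval), σ.toFun (fun _ => e) = (σ.face 0 e).toFun (fun i => i.elim0) := fun e => by
    change σ.toFun _ = σ.toFun _
    congr 1
    funext i
    rw [Subsingleton.elim i 0]
    rfl
  have e1 : (cubeCyl s₀ s₁ σ).face 1 1 = (cubeCyl s₀ s₁ σ).face 1 0 := by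
    refine SmoothCube.ext (funext fun u => Prod.ext rfl ?_)
    change σ.toFun (fun _ => 1) = σ.toFun (fun _ => 0)
    rw [hv, hv, h]
  rw [boundary_single, Fin.sum_univ_two, e0, e0, e1]
  simp

theorem chainIncl_labelChain {ι : Type*} (s : ℝ) (m : ι →₀ ℕ) {n : ℕ} (σ : ι → SmoothCube projY n) :
    chainIncl s (labelChain m σ) = labelChain m fun l => cubeIncl s (σ l) := by
  have h := map_labelChain (Finsupp.mapDomain.addMonoidHom (cubeIncl s) :
    Chain projY n →+ Chain projM n) m σ
  refine h.trans (Finset.sum_congr rfl fun l _ => ?_)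
  simp [SmoothCube.chain]

theorem chainProj_labelChain {ι : Type*} (m : ι →₀ ℕ) {n : ℕ} (σ : ι → SmoothCube projM n) :
    chainProj (labelChain m σ) = labelChain m fun l => cubeProj (σ l) := by
  have h := map_labelChain (Finsupp.mapDomain.addMonoidHom cubeProj :
    Chain projM n →+ Chain projY n) m σ
  refine h.trans (Finset.sum_congr rfl fun l _ => ?_)
  simp [SmoothCube.chain]

theorem labelChain_mem_degenerate {k n : ℕ} {X : Type} {π : (Fin k → ℝ) → X} {ι : Type*} (m : ι →₀ ℕ)
    {σ : ι → SmoothCube π n} (h : ∀ l, (σ l).IsDegenerate) : labelChain m σ ∈ degenerate π n :=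
  AddSubgroup.sum_mem _ fun l _ => by
    have : (σ l).chain ∈ degenerate π n := AddSubgroup.subset_closure ⟨σ l, h l, rfl⟩
    exact AddSubgroup.zsmul_mem _ this _

theorem boundary_chainIncl (s : ℝ) (W : Chain projY 2) :
    boundary (chainIncl s W) = chainIncl s (boundary W) := by
  have hf : ∀ (σ : SmoothCube projY 2) (i : Fin 2) (e : unitInterval),
      (cubeIncl s σ).face i e = cubeIncl s (σ.face i e) := fun _ _ _ => rfl
  have h : (boundary (π := projM) (n := 1)).comp (Finsupp.mapDomain.addMonoidHom (cubeIncl s)) =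
      (Finsupp.mapDomain.addMonoidHom (cubeIncl s)).comp (boundary (π := projY) (n := 1)) := by
    refine Finsupp.addHom_ext' fun σ => AddMonoidHom.ext_int ?_
    simp only [AddMonoidHom.comp_apply, Finsupp.singleAddHom_apply,
      Finsupp.mapDomain.addMonoidHom_apply, Finsupp.mapDomain_single]
    have e1 := boundary_single (cubeIncl s σ)
    have e2 := boundary_single σ
    rw [SmoothCube.chain] at e1 e2
    rw [e1, e2, ← Finsupp.mapDomain.addMonoidHom_apply, map_sum]
    refine Finset.sum_congr rfl fun i _ => ?_
    rw [map_zsmul, map_sub, hf, hf]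
    simp [SmoothCube.chain]
  exact DFunLike.congr_fun h W

theorem chainIncl_degenerate (s : ℝ) {n : ℕ} {c : Chain projY n} (h : c ∈ degenerate projY n) :
    chainIncl s c ∈ degenerate projM n := by
  have hle : degenerate projY n ≤ (degenerate projM n).comap
      (Finsupp.mapDomain.addMonoidHom (cubeIncl s)) := by
    refine (AddSubgroup.closure_le _).2 ?_
    rintro _ ⟨σ, ⟨i, hi⟩, rfl⟩
    refine AddSubgroup.subset_closure ⟨cubeIncl s σ, ⟨i, fun u v huv => ?_⟩, ?_⟩
    · exact Prod.ext rfl (hi u v huv)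
    · simp [SmoothCube.chain]
  exact hle h

theorem chainIncl_in {n : ℕ} {s : ℝ} {c : Chain projY n} {A : Set YSpace} {C : Set MSpace}
    (h : c.In A) (hC : ∀ w ∈ A, (s, w) ∈ C) : (chainIncl s c).In C := by
  classical
  intro σ hσ u
  obtain ⟨σ', hσ', rfl⟩ := Finset.mem_image.1 (Finsupp.mapDomain_support hσ)
  exact hC _ (h σ' hσ' u)

/-- A relative 2-chain in `Y` between cycles that consist of closed curves lifts to a filling. -/
theorem exists_filling {ι : Type*} {ma mb : ι →₀ ℕ} {σa σb : ι → SmoothCube projY 1}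
    (ha : ∀ l, (σa l).face 0 1 = (σa l).face 0 0) (hb : ∀ l, (σb l).face 0 1 = (σb l).face 0 0)
    {A B : Set YSpace} (hA : ∀ l ∈ ma.support, ∀ u, (σa l).toFun u ∈ A)
    (hB : ∀ l ∈ mb.support, ∀ u, (σb l).toFun u ∈ B) (hAY : A ⊆ torusY X₁ X₂)
    (hBY : B ⊆ torusY X₁ X₂) {W : Chain projY 2} (hW : W.In (torusY X₁ X₂))
    (hbd : boundary W - (labelChain ma σa - labelChain mb σb) ∈ degenerate projY 1) :
    ∃ S, IsFilling X₁ X₂ (labelChain ma σa) (labelChain mb σb) A B S ∧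
      Homologous (torusY X₁ X₂) (chainProj S) W := by
  -- The filling consists of `W` at height 1/2, cylinders over the first cycle up to height 1 and
  -- cylinders over the second from height 0. The cylinders project to degenerate cubes, so the
  -- projection is `W`.
  set Ca := labelChain ma fun l => cubeCyl (1 / 2) 1 (σa l) with hCa
  set Cb := labelChain mb fun l => cubeCyl 0 (1 / 2) (σb l) with hCb
  have hsub : ∀ {n : ℕ} (s : ℝ) (c d : Chain projY n),
      chainIncl s (c - d) = chainIncl s c - chainIncl s d := fun s c d =>
    map_sub (Finsupp.mapDomain.addMonoidHom (cubeIncl s)) c d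
  have hin : ∀ C : Set MSpace, (∀ s : ℝ, 1 / 2 ≤ s → s ≤ 1 → ∀ w ∈ A, (s, w) ∈ C) →
      (∀ s : ℝ, 0 ≤ s → s ≤ 1 / 2 → ∀ w ∈ B, (s, w) ∈ C) →
      (∀ w ∈ torusY X₁ X₂, ((1 / 2 : ℝ), w) ∈ C) → (Ca + chainIncl (1 / 2) W + Cb).In C := by
    intro C h1 h2 h3
    refine (Chain.In.add ?_ (chainIncl_in hW h3)).add ?_
    · refine labelChain_in fun l hl u => h1 _ ?_ ?_ _ (hA l hl _)
      · linarith [(u 0).2.1]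
      · linarith [(u 0).2.2]
    · refine labelChain_in fun l hl u => h2 _ ?_ ?_ _ (hB l hl _)
      · linarith [(u 0).2.1]
      · linarith [(u 0).2.2]
  refine ⟨Ca + chainIncl (1 / 2) W + Cb, ⟨?_, ?_, ?_⟩, 0, Chain.In.zero _, ?_⟩
  · exact hin _ (fun s h1 h2 w hw => ⟨⟨by linarith, h2⟩, hAY hw⟩)
      (fun s h1 h2 w hw => ⟨⟨h1, by linarith⟩, hBY hw⟩) (fun w hw => ⟨by norm_num, hw⟩)
  · have h1 : boundary Ca = chainIncl 1 (labelChain ma σa) - chainIncl (1 / 2) (labelChain ma σa) := by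
      rw [chainIncl_labelChain, chainIncl_labelChain]
      exact boundary_labelChain _ fun l => boundary_cubeCyl _ _ (ha l)
    have h2 : boundary Cb = chainIncl (1 / 2) (labelChain mb σb) - chainIncl 0 (labelChain mb σb) := by
      rw [chainIncl_labelChain, chainIncl_labelChain]
      exact boundary_labelChain _ fun l => boundary_cubeCyl _ _ (hb l)
    have h3 := chainIncl_degenerate (1 / 2) hbd
    rw [hsub, hsub] at h3
    rw [map_add, map_add, h1, h2, boundary_chainIncl]
    convert h3 using 1
    abel
  · exact hin {w | (w.1 = 1 → w.2 ∈ A) ∧ (w.1 = 0 → w.2 ∈ B)}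
      (fun s h1 h2 w hw => ⟨fun _ => hw, fun h => by simp only at h; linarith⟩)
      (fun s h1 h2 w hw => ⟨fun h => by simp only at h; linarith, fun _ => hw⟩)
      (fun w hw => ⟨fun h => by norm_num at h, fun h => by norm_num at h⟩)
  · have hadd : ∀ c d : Chain projM 2, chainProj (c + d) = chainProj c + chainProj d := fun c d =>
      map_add (Finsupp.mapDomain.addMonoidHom cubeProj) c d
    have hdeg : ∀ s₀ s₁ (σ : SmoothCube projY 1), (cubeProj (cubeCyl s₀ s₁ σ)).IsDegenerate := by
      refine fun s₀ s₁ σ => ⟨0, fun u v huv => ?_⟩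
      change σ.toFun (fun _ => u 1) = σ.toFun (fun _ => v 1)
      rw [huv 1 (by simp)]
    rw [hadd, hadd, chainProj_chainIncl, map_zero, hCa, hCb, chainProj_labelChain,
      chainProj_labelChain]
    have := add_mem (labelChain_mem_degenerate ma fun l => hdeg (1 / 2) 1 (σa l))
      (labelChain_mem_degenerate mb fun l => hdeg 0 (1 / 2) (σb l))
    convert this using 1
    abel

end Fillings

/-! ### Small push-offs stay in Y and avoid the orbits. -/

section Pushable

open Set Complex Filter Topology

variable {X₁ X₂ ε : ℝ} {Q : ℕ}

namespace TwistPerturbation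

variable (T : TwistPerturbation X₁ X₂ Q ε)

theorem continuous_push_pair (l : Label X₁ X₂ Q) (τ : Frame (T.orbit l)) :
    Continuous fun w : ℝ × ℝ => (T.orbit l).z w.2 + w.1 * τ.ν w.2 :=
  ((T.orbit l).smooth.continuous.comp continuous_snd).add
    ((continuous_ofReal.comp continuous_fst).mul (τ.smooth.continuous.comp continuous_snd))

/-- An open condition that holds along one compact period persists for all small push-offs,
uniformly in t. -/
theorem eventually_push {l : Label X₁ X₂ Q} {τ : Frame (T.orbit l)} {p : ℝ → ℂ → Prop}
    (hp : IsOpen {w : ℝ × ℂ | p w.1 w.2}) (h : ∀ t, p t ((T.orbit l).z t)) :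
    ∀ᶠ r : ℝ in 𝓝 (0 : ℝ), ∀ t ∈ Icc (0 : ℝ) (T.orbit l).period, p t ((T.orbit l).z t + r * τ.ν t) := by
  refine isCompact_Icc.eventually_forall_of_forall_eventually fun t _ => ?_
  have hc : Continuous fun w : ℝ × ℝ => (w.2, (T.orbit l).z w.2 + w.1 * τ.ν w.2) :=
    continuous_snd.prodMk (T.continuous_push_pair l τ)
  have := (hp.preimage hc).mem_nhds (x := ((0 : ℝ), t)) (by
    simp only [mem_preimage, mem_ofPred_eq, ofReal_zero, zero_mul, add_zero]; exact h t)
  exact this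

theorem exists_of_mem_pushImage {l : Label X₁ X₂ Q} {τ : Frame (T.orbit l)} {r : ℝ} {w : YSpace}
    (hw : w ∈ (T.orbit l).pushImage τ r) :
    ∃ t ∈ Icc (0 : ℝ) (T.orbit l).period, w = projY (pt3 t ((T.orbit l).z t + r * τ.ν t)) := by
  obtain ⟨t, rfl⟩ := hw
  have hper : Function.Periodic (fun t => projY (pt3 t ((T.orbit l).z t + r * τ.ν t)))
      (T.orbit l).period := (T.orbit l).projY_push_add τ r
  obtain ⟨s, hs, e⟩ := hper.exists_mem_Ico₀ (by exact_mod_cast (T.orbit l).period_pos) t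
  exact ⟨s, ⟨hs.1, hs.2.le⟩, e⟩

theorem eventually_pushImage_subset (hX : ∀ r : ℚ, r.den ≤ Q → (r : ℝ) ≠ X₁ ∧ (r : ℝ) ≠ X₂)
    (l : Label X₁ X₂ Q) (τ : Frame (T.orbit l)) :
    ∀ᶠ r : ℝ in 𝓝 (0 : ℝ), (T.orbit l).pushImage τ r ⊆ torusY X₁ X₂ := by
  have h := T.eventually_push (l := l) (τ := τ) (p := fun _ z => z.re ∈ Ioo X₁ X₂)
    (isOpen_Ioo.preimage (continuous_re.comp continuous_snd)) (T.re_mem_Ioo hX l)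
  filter_upwards [h] with r hr w hw
  obtain ⟨t, ht, rfl⟩ := T.exists_of_mem_pushImage hw
  exact Ioo_subset_Icc_self (hr t ht)

/-- In the slice of time t the orbit consists of q strands. The remainder of the integer time shift
modulo q selects the strand, and the quotient gives a multiple of the winding. -/
theorem mem_image_iff {l : Label X₁ X₂ Q} {t : ℝ} {z : ℂ}
    (h : projY (pt3 t z) ∈ (T.orbit l).image) :
    ∃ k < l.1.1.den, ∃ w : ℤ, z = (T.orbit l).z (t + k) + w * I := by
  obtain ⟨s, hs⟩ := h
  obtain ⟨m, -, hm⟩ := (isLatticeProj_projY _ _).1 hs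
  have h0 : s = t + m 0 := hm 0
  have h1 : ((T.orbit l).z s).re = z.re + m 1 := hm 1
  have h2 : ((T.orbit l).z s).im = z.im + m 2 := hm 2
  have hm1 : m 1 = 0 := by
    obtain ⟨m', h', hm'⟩ := (isLatticeProj_projY _ _).1 hs
    have : ((T.orbit l).z s).re = z.re + m' 1 := hm' 1
    have h'1 := h' 1 (by simp [perY])
    rw [h'1] at this
    have h3 : (m 1 : ℝ) = 0 := by push_cast at this; linarith
    exact_mod_cast h3
  set q := l.1.1.den with hq
  have hq0 : 0 < q := l.1.1.pos
  have hshift : ∀ (x : ℝ) (j : ℤ), (T.orbit l).z (x + j * q) = (T.orbit l).z x - (j * l.1.1.num : ℤ) * I := by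
    intro x j
    have hper : Function.Periodic (fun x : ℝ => (T.orbit l).z x + (l.1.1 : ℝ) * x * I) q := by
      intro x
      have hn : ((l.1.1 : ℝ) : ℂ) * q = l.1.1.num := by
        have : (l.1.1 : ℚ) * q = l.1.1.num := Rat.mul_den_eq_num _
        exact_mod_cast this
      beta_reduce
      rw [T.winding_eq]
      push_cast at hn ⊢
      linear_combination I * hn
    have h := hper.int_mul j x
    have hn : ((l.1.1 : ℝ) : ℂ) * q = l.1.1.num := by
      have : (l.1.1 : ℚ) * q = l.1.1.num := Rat.mul_den_eq_num _
      exact_mod_cast this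
    beta_reduce at h
    push_cast at h hn ⊢
    linear_combination h - j * I * hn
  obtain ⟨k, hk⟩ : ∃ k : ℕ, (k : ℤ) = m 0 % q := ⟨(m 0 % q).toNat, Int.toNat_of_nonneg
    (Int.emod_nonneg _ (by omega))⟩
  refine ⟨k, ?_, -(m 0 / q * l.1.1.num) - m 2, ?_⟩
  · have := Int.emod_lt_of_pos (m 0) (b := q) (by omega)
    omega
  · have e : s = t + k + (m 0 / q : ℤ) * q := by
      have h3 : (k : ℤ) + m 0 / q * q = m 0 := by
        rw [hk, mul_comm]; exact Int.emod_add_mul_ediv _ _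
      have h4 : (k : ℝ) + (m 0 / q : ℤ) * q = m 0 := by exact_mod_cast h3
      linarith
    have h5 := hshift (t + k) (m 0 / q)
    rw [← e] at h5
    have h6 : (T.orbit l).z s = z + m 2 * I := by
      refine Complex.ext ?_ ?_
      · rw [h1, hm1]; simp
      · rw [h2]; simp
    rw [h6] at h5
    push_cast at h5 ⊢
    linear_combination h5

/-- Strands other than the orbit's own are at positive distance, which survives small r by
compactness. The own strand differs by rν, which is nonzero and shorter than 1, hence not an integer
translation in y. -/
theorem eventually_disjoint (hε : ε ≤ epsBound Q) (l l' : Label X₁ X₂ Q) (τ : Frame (T.orbit l)) :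
    ∀ᶠ r : ℝ in 𝓝[>] (0 : ℝ), Disjoint ((T.orbit l).pushImage τ r) (T.orbit l').image := by
  have hpt : ∀ k ∈ Finset.range l'.1.1.den, ¬ (l = l' ∧ k = 0) → ∀ᶠ r : ℝ in 𝓝[>] (0 : ℝ),
      ∀ t ∈ Icc (0 : ℝ) (T.orbit l).period,
        0 < pointFn ((T.orbit l).z t + r * τ.ν t - (T.orbit l').z (t + k)) := by
    intro k hk hlk
    refine (T.eventually_push (p := fun t z => 0 < pointFn (z - (T.orbit l').z (t + k)))
      ?_ fun t => ?_).filter_mono nhdsWithin_le_nhds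
    · refine isOpen_lt continuous_const (contDiff_pointFn.continuous.comp (continuous_snd.sub ?_))
      exact (T.orbit l').smooth.continuous.comp (continuous_fst.add continuous_const)
    · refine (pointFn_nonneg _).lt_of_ne' fun h0 => ?_
      obtain ⟨w, hw⟩ := eq_of_pointFn_eq_zero h0
      have e : (T.orbit l').z (t + k) = (T.orbit l).z t + ((-w : ℤ) : ℂ) * I := by
        push_cast; linear_combination -hw
      by_cases hl : l = l'
      · subst hl
        exact T.self_strand_ne l (Nat.pos_of_ne_zero fun h => hlk ⟨rfl, h⟩) (Finset.mem_range.1 hk) _ _ e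
      · exact T.strand_ne hε (Ne.symm hl) k (-w) t (by exact_mod_cast e)
  have hall : ∀ᶠ r : ℝ in 𝓝[>] (0 : ℝ), ∀ k ∈ Finset.range l'.1.1.den, ¬ (l = l' ∧ k = 0) →
      ∀ t ∈ Icc (0 : ℝ) (T.orbit l).period,
        0 < pointFn ((T.orbit l).z t + r * τ.ν t - (T.orbit l').z (t + k)) := by
    rw [Filter.eventually_all_finset]
    intro k hk
    rw [Filter.eventually_imp_distrib_left]
    exact hpt k hk
  obtain ⟨M, hM, hν⟩ := T.exists_frame_bound l τ
  have hsmall : ∀ᶠ r : ℝ in 𝓝[>] (0 : ℝ), 0 < r ∧ r < 1 / M :=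
    Ioo_mem_nhdsGT (by positivity : (0 : ℝ) < 1 / M)
  filter_upwards [hall, hsmall] with r hr hrs
  rw [disjoint_left]
  intro w hw hw'
  obtain ⟨t, ht, rfl⟩ := T.exists_of_mem_pushImage hw
  obtain ⟨k, hk, w, e⟩ := T.mem_image_iff hw'
  by_cases hlk : l = l' ∧ k = 0
  · obtain ⟨rfl, rfl⟩ := hlk
    have e' : (r : ℂ) * τ.ν t = w * I := by
      rw [Nat.cast_zero, add_zero] at e
      linear_combination e
    have hn : ‖(r : ℂ) * τ.ν t‖ = |(w : ℝ)| := by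
      rw [e', norm_mul, norm_I, mul_one, ← ofReal_intCast, norm_real, Real.norm_eq_abs]
    have h1 : ‖(r : ℂ) * τ.ν t‖ < 1 := by
      rw [norm_mul, norm_real, Real.norm_of_nonneg hrs.1.le]
      have h2 := hν t
      have h3 := hrs.2
      rw [lt_div_iff₀ hM] at h3
      nlinarith [hrs.1]
    have h2 : 0 < ‖(r : ℂ) * τ.ν t‖ := norm_pos_iff.2
      (mul_ne_zero (by exact_mod_cast hrs.1.ne') (τ.ne_zero t))
    rw [hn] at h1 h2
    have h3 : |w| < 1 := by exact_mod_cast h1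
    have h4 : 0 < |w| := by exact_mod_cast h2
    omega
  · have h0 := hr k (Finset.mem_range.2 hk) hlk t ht
    rw [e, add_sub_cancel_left] at h0
    have h1 := pointFn_add_int 0 w
    rw [zero_add] at h1
    rw [h1] at h0
    simp [pointFn] at h0

end TwistPerturbation

variable {T : TwistPerturbation X₁ X₂ Q ε} {P : ℤ}

theorem Generator.eventually_isPushable (hε : ε ≤ epsBound Q)
    (hX : ∀ r : ℚ, r.den ≤ Q → (r : ℝ) ≠ X₁ ∧ (r : ℝ) ≠ X₂) (α : Generator T P)
    (τ : Trivialization T) : ∀ᶠ r : ℝ in 𝓝[>] (0 : ℝ), α.IsPushable τ r := by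
  have h1 : ∀ᶠ r : ℝ in 𝓝[>] (0 : ℝ), ∀ l ∈ α.mult.support,
      (T.orbit l).pushImage (τ l) r ⊆ torusY X₁ X₂ := by
    rw [Filter.eventually_all_finset]
    exact fun l _ => (T.eventually_pushImage_subset hX l (τ l)).filter_mono nhdsWithin_le_nhds
  have h2 : ∀ᶠ r : ℝ in 𝓝[>] (0 : ℝ), ∀ l ∈ α.mult.support, ∀ l' ∈ α.mult.support,
      Disjoint ((T.orbit l).pushImage (τ l) r) (T.orbit l').image := by
    rw [Filter.eventually_all_finset]
    intro l _
    rw [Filter.eventually_all_finset]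
    exact fun l' _ => T.eventually_disjoint hε l l' (τ l)
  -- Pushability asks for all sizes up to r, so a whole interval to the right of 0 is extracted
  -- first.
  obtain ⟨r₀, hr₀, h⟩ := mem_nhdsGT_iff_exists_Ioc_subset.1 (h1.and h2)
  filter_upwards [Ioc_mem_nhdsGT hr₀] with r hr ρ hρ hρr
  obtain ⟨h1, h2⟩ := h ⟨hρ, hρr.trans hr.2⟩
  refine ⟨iUnion₂_subset h1, ?_⟩
  simp only [Generator.pushImage, Generator.image, disjoint_iUnion_left, disjoint_iUnion_right]
  exact fun l hl l' hl' => h2 l' hl' l hl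

end Pushable

/-! ### Assembly of the index formula. -/

section IndexFormula

open Set Complex Filter Topology

variable {X₁ X₂ ε : ℝ} {Q : ℕ} {T : TwistPerturbation X₁ X₂ Q ε} {P : ℤ}

theorem Orbit.face_pushLoop {K : ℝ → ℂ → ℝ} (γ : Orbit K X₁ X₂) (τ : Frame γ) (r : ℝ) :
    (γ.pushLoop τ r).face 0 1 = (γ.pushLoop τ r).face 0 0 := by
  refine SmoothCube.ext (funext fun u => ?_)
  have := γ.projY_push_add τ r 0
  simpa [pushLoop, SmoothCube.ofLift, SmoothCube.face] using this

theorem Generator.image_subset (α : Generator T P) : α.image ⊆ torusY X₁ X₂ := by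
  refine iUnion₂_subset fun l _ => ?_
  rintro _ ⟨t, rfl⟩
  exact (T.orbit l).mem t

theorem Generator.pushImage_zero (α : Generator T P) (τ : Trivialization T) :
    α.pushImage τ 0 = α.image := by
  simp [Generator.pushImage, Generator.image, Orbit.pushImage, Orbit.image]

theorem Generator.strips_in (α : Generator T P) (τ : Trivialization T) {r : ℝ} (hr : 0 < r)
    (h : α.IsPushable τ r) : (α.strips τ r).In (torusY X₁ X₂) := by
  rw [α.strips_eq]
  refine α.bands_in τ hr.le fun ρ hρ hρr => ?_
  rcases hρ.eq_or_lt with rfl | h0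
  · rw [α.pushImage_zero]; exact α.image_subset
  · exact (h ρ h0 hρr).1

theorem Generator.boundary_strips (α : Generator T P) (τ : Trivialization T) (r : ℝ) :
    boundary (α.strips τ r) = α.pushCycle τ r - α.cycle := by
  rw [α.strips_eq, α.boundary_bands, α.pushCycle_zero]

/-- Both cycles are homologous to the same standard cycle; the difference of the two connecting
chains joins them. -/
theorem nonempty_H2 (α β : Generator T P) : Nonempty (H2 α β) := by
  obtain ⟨V, hV, h⟩ := α.sector
  obtain ⟨V', hV', h'⟩ := β.sector
  refine ⟨Quotient.mk _ ⟨V - V', hV.sub hV', ?_⟩⟩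
  have := sub_mem h' h
  rw [map_sub]
  convert this using 1
  simp only [Generator.cycle]
  abel

theorem hasIntersectionNumber_iff_of_filling (hε : ε ≤ epsBound Q) {α β : Generator T P}
    (τ : Trivialization T) {r : ℝ} (hr : 0 < r) (hα : α.IsPushable τ r) (hβ : β.IsPushable τ r)
    {S S' : Chain projM 2} (hS : IsFilling X₁ X₂ α.cycle β.cycle α.image β.image S)
    (hS' : IsFilling X₁ X₂ (α.pushCycle τ r) (β.pushCycle τ r) (α.pushImage τ r) (β.pushImage τ r) S')
    (n : ℤ) : HasIntersectionNumber S S' n ↔ n = α.linkTotal τ - β.linkTotal τ := by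
  refine hasIntersectionNumber_iff hS hS' α.cycle_in β.cycle_in (α.pushCycle_in τ r)
    (β.pushCycle_in τ r) (hα r hr le_rfl).2.symm (hβ r hr le_rfl).2.symm (α.boundary_cycle τ)
    (β.boundary_pushCycle τ r) _ ?_ n
  obtain ⟨η, hη, h⟩ := α.exists_linkInt_eq τ hε hr hα
  obtain ⟨η', hη', h'⟩ := β.exists_linkInt_eq τ hε hr hβ
  have a1 := min_le_left η η'
  have a2 := min_le_right η η'
  have a3 : 0 < min η η' := lt_min hη hη'
  refine ⟨min η η' / 2, by positivity, fun c hc δ hδ hδr => ?_⟩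
  rw [h _ (by positivity) (by linarith) c hc δ hδ hδr,
    h' _ (by positivity) (by linarith) c hc δ hδ hδr]
  push_cast
  rfl

/-- The intersection number of any two admissible fillings depends only on their boundaries, which
gives uniqueness. For existence, a small pushable r is chosen and `exists_filling` is applied to `W`
and to `W` corrected by the strips. -/
theorem hasSelfIntersection_iff (hε : ε ≤ epsBound Q)
    (hX : ∀ r : ℚ, r.den ≤ Q → (r : ℝ) ≠ X₁ ∧ (r : ℝ) ≠ X₂) {α β : Generator T P}
    (τ : Trivialization T) (Z : H2 α β) (n : ℤ) :
    HasSelfIntersection τ Z n ↔ n = α.linkTotal τ - β.linkTotal τ := by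
  constructor
  · rintro ⟨r, W, S, S', hr, hα, hβ, -, hS, -, hS', -, hn⟩
    exact (hasIntersectionNumber_iff_of_filling hε τ hr hα hβ hS hS' n).1 hn
  · intro hn
    obtain ⟨r, ⟨hα, hβ⟩, hr⟩ := (((α.eventually_isPushable hε hX τ).and
      (β.eventually_isPushable hε hX τ)).and (self_mem_nhdsWithin (s := Ioi (0 : ℝ)))).exists
    have hr : 0 < r := hr
    obtain ⟨⟨W, hW, hbd⟩, rfl⟩ := Quotient.exists_rep Z
    have hface : ∀ l, (T.orbit l).loop.face 0 1 = (T.orbit l).loop.face 0 0 := fun l => by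
      rw [← (T.orbit l).pushLoop_zero (τ l), Orbit.face_pushLoop]
    obtain ⟨S, hS, hSW⟩ := exists_filling (ma := α.mult) (mb := β.mult) hface hface
      (A := α.image) (B := β.image) (fun l hl u => mem_biUnion hl ((T.orbit l).loop_mem u))
      (fun l hl u => mem_biUnion hl ((T.orbit l).loop_mem u)) α.image_subset β.image_subset hW hbd
    have hW' : (W + α.strips τ r - β.strips τ r).In (torusY X₁ X₂) :=
      (hW.add (α.strips_in τ hr hα)).sub (β.strips_in τ hr hβ)
    obtain ⟨S', hS', hSW'⟩ := exists_filling (ma := α.mult) (mb := β.mult)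
      (fun l => (T.orbit l).face_pushLoop (τ l) r) (fun l => (T.orbit l).face_pushLoop (τ l) r)
      (A := α.pushImage τ r) (B := β.pushImage τ r)
      (fun l hl u => mem_biUnion hl ((T.orbit l).pushLoop_mem (τ l) r u))
      (fun l hl u => mem_biUnion hl ((T.orbit l).pushLoop_mem (τ l) r u))
      (hα r hr le_rfl).1 (hβ r hr le_rfl).1 hW' (by
        rw [map_sub, map_add, α.boundary_strips, β.boundary_strips]
        convert hbd using 1
        rw [← α.pushCycle_eq, ← β.pushCycle_eq]
        abel)
    exact ⟨r, W, S, S', hr, hα, hβ, ⟨_, rfl, rfl⟩, hS, hSW, hS', hSW',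
      (hasIntersectionNumber_iff_of_filling hε τ hr hα hβ hS hS' n).2 hn⟩

-- Summing -2kn over k = 1, …, j gives -j(j + 1)n, and each elliptic iterate adds -1. The bound on j
-- keeps every period within Q.
open Classical in
theorem sum_Icc_czIndex (hε : ε ≤ epsBound Q) (α : Generator T P) (τ : Trivialization T)
    (l : Label X₁ X₂ Q) : ∀ j ≤ α.mult l, ∑ k ∈ Finset.Icc 1 j, czIndex (T.orbit l) (τ l) k =
      (if l.2 = Kind.ell then -(j : ℤ) else 0) - j * (j + 1) * (τ l).turns := by
  intro j
  induction j with
  | zero => simp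
  | succ j ih =>
    intro hj
    rw [Finset.sum_Icc_succ_top (by omega), ih (by omega)]
    obtain ⟨r, i⟩ := l
    have hk := α.mul_period_le hj
    cases i with
    | ell =>
      rw [T.czIndex_elliptic hε r (τ (r, Kind.ell)) j.succ_pos hk]
      simp only [if_true]
      push_cast
      ring
    | hyp =>
      rw [T.czIndex_hyperbolic hε r (τ (r, Kind.hyp)) hk]
      simp only [reduceCtorEq, if_false]
      push_cast
      ring

theorem Generator.czSum_eq (hε : ε ≤ epsBound Q) (α : Generator T P) (τ : Trivialization T) :
    α.czSum τ = -(α.ellipticFactors : ℤ) -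
      ∑ l ∈ α.mult.support, α.mult l * (α.mult l + 1) * (τ l).turns := by
  classical
  rw [Generator.czSum, Generator.ellipticFactors, Finsupp.sum, Finsupp.sum, Nat.cast_sum,
    ← Finset.sum_neg_distrib, ← Finset.sum_sub_distrib]
  refine Finset.sum_congr rfl fun l _ => ?_
  rw [sum_Icc_czIndex hε α τ l _ le_rfl]
  split_ifs <;> simp

/-- Off the diagonal `linkNumber` is minus `crossTerm`, whose weighted sum is 2∫p dq - PQ; the
diagonal contributes the turns of the frames with weight m². -/
theorem Generator.linkTotal_eq (α : Generator T P) (τ : Trivialization T) :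
    (α.linkTotal τ : ℝ) = P * Q - 2 * α.pathIntegral +
      ∑ l ∈ α.mult.support, (α.mult l : ℝ) ^ 2 * (τ l).turns := by
  classical
  have h : ∀ l ∈ α.mult.support, (∑ l' ∈ α.mult.support, (α.mult l : ℝ) *
      (α.mult l' * (linkNumber l l' (τ l').turns : ℤ))) =
      (α.mult l : ℝ) ^ 2 * (τ l).turns - ∑ l' ∈ α.mult.support,
        (α.mult l : ℝ) * (α.mult l' * crossTerm l.1.1 l'.1.1) := by
    intro l hl
    have h1 : ((α.mult l : ℝ) ^ 2 * (τ l).turns) = ∑ l' ∈ α.mult.support,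
        if l = l' then (α.mult l : ℝ) * (α.mult l' * (τ l').turns) else 0 := by
      rw [Finset.sum_ite_eq, if_pos hl]; ring
    rw [h1, ← Finset.sum_sub_distrib]
    refine Finset.sum_congr rfl fun l' _ => ?_
    unfold linkNumber crossTerm
    by_cases hlt : l'.1.1 < l.1.1
    · have hne : l ≠ l' := fun e => hlt.ne' (by rw [e])
      simp only [hlt, hne, if_true, if_false]
      push_cast
      ring
    · by_cases hll : l = l'
      · subst hll; simp
      · simp [hlt, hll]
  rw [α.two_mul_pathIntegral, linkTotal]
  push_cast
  rw [Finset.sum_congr rfl h, Finset.sum_sub_distrib]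
  ring

/-- The turns enter with weights m, m² and -m(m + 1) from the Chern number, the linking number and
the Conley–Zehnder sum, so the frame drops out. -/
theorem Generator.index_eq (hε : ε ≤ epsBound Q) (α : Generator T P) (τ : Trivialization T) :
    ((α.turnTotal τ + α.linkTotal τ + α.czSum τ : ℤ) : ℝ) =
      P * Q - 2 * α.pathIntegral - α.ellipticFactors := by
  have h : ∑ l ∈ α.mult.support, (α.mult l : ℝ) * (τ l).turns +
      ∑ l ∈ α.mult.support, (α.mult l : ℝ) ^ 2 * (τ l).turns =
      ∑ l ∈ α.mult.support, (α.mult l : ℝ) * (α.mult l + 1) * (τ l).turns := by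
    rw [← Finset.sum_add_distrib]
    exact Finset.sum_congr rfl fun l _ => by ring
  rw [Int.cast_add, Int.cast_add, α.linkTotal_eq, α.czSum_eq hε, turnTotal]
  push_cast
  linear_combination h

end IndexFormula

end PFH

end

theorem proposition3p2 (Q : ℕ) (hQ : 0 < Q) :
    ∃ ε : ℝ, 0 < ε ∧
      ∀ (P : ℤ) (X₁ X₂ : ℝ), X₁ ≤ X₂ →
        (∀ r : ℚ, r.den ≤ Q → (r : ℝ) ≠ X₁ ∧ (r : ℝ) ≠ X₂) →
      ∀ (T : PFH.TwistPerturbation X₁ X₂ Q ε) (α β : PFH.Generator T P),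
        Nonempty (PFH.H2 α β) ∧
        ∀ (Z : PFH.H2 α β) (τ : PFH.Trivialization T) (n : ℤ),
          PFH.HasRelativeIndex τ Z n ↔
            (n : ℝ) = (β.ellipticFactors : ℝ) - (α.ellipticFactors : ℝ)
              + 2 * (β.pathIntegral - α.pathIntegral) := by
  refine ⟨PFH.epsBound Q, PFH.epsBound_pos Q, fun P X₁ X₂ _ hX T α β =>
    ⟨PFH.nonempty_H2 α β, fun Z τ n => ?_⟩⟩
  have hα := α.index_eq le_rfl τ
  have hβ := β.index_eq le_rfl τ
  -- The Chern and self-intersection numbers exist and are unique. The equivalence thus contains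
  -- both that the index is defined and that it has only one value.
  have key : PFH.HasRelativeIndex τ Z n ↔ n = (α.turnTotal τ - β.turnTotal τ) +
      (α.linkTotal τ - β.linkTotal τ) + (α.czSum τ - β.czSum τ) := by
    constructor
    · rintro ⟨c, q, hc, hq, rfl⟩
      rw [(PFH.hasChernNumber_iff le_rfl τ Z c).1 hc,
        (PFH.hasSelfIntersection_iff le_rfl hX τ Z q).1 hq]
    · intro h
      exact ⟨_, _, (PFH.hasChernNumber_iff le_rfl τ Z _).2 rfl,
        (PFH.hasSelfIntersection_iff le_rfl hX τ Z _).2 rfl, h⟩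
  rw [key, ← Int.cast_inj (α := ℝ)]
  push_cast at hα hβ ⊢
  -- The term PQ depends only on the homology class and cancels between α and β.
  constructor <;> intro h <;> linarith
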